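/- Let $S$ be an arrangement of eight distinct planes in $\mathbb P^3=\mathbb P^3_{\mathbb C}$ such that no six of them meet in a point and no four of them contain a common line. A double (triple) line of $S$ is a line contained in exactly two (three) planes of $S$; a fourfold (fivefold) point is a point lying on exactly four (five) planes of $S$. Let $X$ be the double octic Calabi–Yau threefold of $S$, constructed as follows: blow up $\mathbb P^3$ at the fivefold points of $S$, then along the strict transforms of the triple lines, then at the remaining fourfold points (those lying on no triple line); take the double covering $Y$ of the resulting threefold branched along the strict transforms of the planes and the exceptional divisors over the fivefold points and triple lines (that is, the normalization of this threefold in the function field $\mathbb C(\mathbb P^3)(\sqrt{f})$ of the double covering $u^2=f$, where $f$ is the product of the equations of the eight planes); finally let $X\to Y$ be the blow-up of the reduced union of the double curves of the branch divisor, i.e. of the singular locus of $Y$. Let $p\colon X\to\mathbb P^3$ be the resulting morphism. Let $\phi$ be an automorphism of $\mathbb P^3$ of order two which maps $S$ to itself, such that (i) no double line and no triple line of $S$ is pointwise fixed by $\phi$; (ii) for no fourfold point of $S$ are all four planes of $S$ through it $\phi$-invariant; (iii) every pointwise fixed line of $\phi$ that is not contained in a plane of $S$ meets $S$ with odd multiplicity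 in at most two points. Let $\widetilde\phi\colon X\to X$ be an involution induced by $\phi$, i.e. $\widetilde\phi^2=\mathrm{id}$ and $p\circ\widetilde\phi=\phi\circ p$. Then the fixed locus of $\widetilde\phi$ contains no curve of positive geometric genus. -/

import Mathlib

open CategoryTheory AlgebraicGeometry TopologicalSpace MvPolynomial
open scoped MatrixGroups

noncomputable section

namespace DoubleOctic

/-! ### Projective space and its automorphisms -/

/-- The standard grading of `ℂ[x₀, x₁, x₂, x₃]`. -/
abbrev grading : ℕ → Submodule ℂ (MvPolynomial (Fin 4) ℂ) :=
  homogeneousSubmodule (Fin 4) ℂ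

instance gradedAlgebra : GradedAlgebra grading := MvPolynomial.gradedAlgebra

/-- The projective space `ℙ³` over `ℂ`, as a scheme. -/
abbrev P3 : Scheme.{0} := Proj grading

/-- The base `Spec ℂ`. -/
abbrev SpecC : Scheme.{0} := Spec (CommRingCat.of ℂ)

/-- The structure morphism of `ℙ³`. -/
def P3.toSpecC : P3 ⟶ SpecC :=
  Proj.toSpecZero grading ≫ Spec.map (CommRingCat.ofHom (algebraMap ℂ (grading 0)))

/-- The linear form `a₀ x₀ + a₁ x₁ + a₂ x₂ + a₃ x₃`. -/
def linearForm (a : Fin 4 → ℂ) : MvPolynomial (Fin 4) ℂ := ∑ j, C (a j) * X j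

lemma linearForm_mem (a : Fin 4 → ℂ) : linearForm a ∈ grading 1 :=
  Submodule.sum_mem _ fun j _ ↦ by
    simpa using (isHomogeneous_C (Fin 4) (a j)).mul (isHomogeneous_X ℂ j)

/-- The substitution `x ↦ A x`, i.e. `xᵢ ↦ ∑ⱼ Aᵢⱼ xⱼ`, as a graded ring homomorphism. -/
def substHom (A : Matrix (Fin 4) (Fin 4) ℂ) : grading →+*ᵍ grading where
  toRingHom := (aeval (R := ℂ) fun i ↦ linearForm (A i)).toRingHom
  map_mem {n p} hp := by
    have h := IsHomogeneous.aeval (n := 1) hp (fun i ↦ linearForm (A i))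
      (fun i ↦ linearForm_mem (A i))
    simpa using h

lemma substHom_linearForm (A : Matrix (Fin 4) (Fin 4) ℂ) (a : Fin 4 → ℂ) :
    substHom A (linearForm a) = linearForm (Matrix.vecMul a A) := by
  change aeval (R := ℂ) (fun i ↦ linearForm (A i)) (linearForm a) = _
  simp only [linearForm, map_sum, map_mul, aeval_X, algHom_C, Matrix.vecMul, dotProduct,
    Finset.mul_sum, Finset.sum_mul, algebraMap_eq]
  rw [Finset.sum_comm]
  simp [mul_assoc]

lemma linearForm_single (j : Fin 4) : linearForm (Pi.single j 1) = X j := by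
  simp [linearForm, Pi.single_apply]

lemma irrelevant_le_map (A : GL (Fin 4) ℂ) :
    HomogeneousIdeal.irrelevant grading ≤
      (HomogeneousIdeal.irrelevant grading).map (substHom A.val) := by
  have hX (j : Fin 4) :
      X j ∈ ((HomogeneousIdeal.irrelevant grading).map (substHom A.val)).toIdeal := by
    have h : substHom A.val (linearForm ((A⁻¹).val j)) = X j := by
      rw [substHom_linearForm, ← linearForm_single]
      congr 1
      have h1 : (A⁻¹).val * A.val = 1 := by simp
      ext k
      have h2 := congrFun (congrFun h1 j) k
      simpa [Matrix.mul_apply, Matrix.vecMul, dotProduct, Matrix.one_apply, Pi.single_apply,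
        eq_comm] using h2
    rw [← h]
    refine Ideal.mem_map_of_mem _ ?_
    exact HomogeneousIdeal.mem_irrelevant_of_mem grading one_pos (linearForm_mem _)
  intro p hp
  have hp0 : coeff 0 p = 0 := by
    have h := (HomogeneousIdeal.mem_irrelevant_iff grading p).mp hp
    rw [GradedRing.proj_apply] at h
    have h3 : homogeneousComponent 0 p = 0 :=
      (decomposition.decompose'_apply p 0).symm.trans h
    simpa [homogeneousComponent_zero] using h3
  have hspan : p ∈ Ideal.span (X '' (Set.univ : Set (Fin 4)) :
      Set (MvPolynomial (Fin 4) ℂ)) := by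
    rw [mem_ideal_span_X_image]
    intro m hm
    by_contra! hcon
    have hm0 : m = 0 := by
      ext i
      simpa using hcon i (Set.mem_univ i)
    rw [hm0, mem_support_iff] at hm
    exact hm hp0
  refine (Ideal.span_le.mpr ?_ : Ideal.span (X '' (Set.univ : Set (Fin 4))) ≤ _) hspan
  rintro _ ⟨j, -, rfl⟩
  exact hX j

/-- The automorphism `[v] ↦ [A v]` of `ℙ³` given by an invertible matrix `A`. -/
def projMap (A : GL (Fin 4) ℂ) : P3 ⟶ P3 :=
  Proj.map (substHom A.val) (irrelevant_le_map A)

/-- `[v] ↦ [A v]` has order two in `PGL₄(ℂ)`: `A²` is a scalar matrix and `A` is not. -/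
def IsOrderTwo (A : GL (Fin 4) ℂ) : Prop :=
  (∃ c : ℂ, A.val * A.val = c • 1) ∧ ¬ ∃ c : ℂ, A.val = c • 1

/-- Every point of the linear subspace `W` is fixed by `[v] ↦ [A v]`. -/
def IsFixedPointwise (A : GL (Fin 4) ℂ) (W : Submodule ℂ (Fin 4 → ℂ)) : Prop :=
  ∀ v ∈ W, ∃ c : ℂ, A.val.mulVec v = c • v

/-- The closed subset of the scheme `ℙ³` which is the projectivization of `W ⊆ ℂ⁴`: the common
zeros of all linear forms that vanish on `W`. -/
def linearLocus (W : Submodule ℂ (Fin 4 → ℂ)) : Closeds P3 :=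
  ⟨ProjectiveSpectrum.zeroLocus grading
      {g | ∃ a : Fin 4 → ℂ, (∀ v ∈ W, a ⬝ᵥ v = 0) ∧ g = linearForm a},
    ProjectiveSpectrum.isClosed_zeroLocus _ _⟩

/-! ### Arrangements of eight planes

Points, lines and planes of `ℙ³` are linear subspaces of `ℂ⁴` of dimension 1, 2, 3. -/

/-- The plane with the equation `a₀ x₀ + a₁ x₁ + a₂ x₂ + a₃ x₃ = 0`. -/
def plane (a : Fin 4 → ℂ) : Submodule ℂ (Fin 4 → ℂ) :=
  LinearMap.ker (∑ j, a j • LinearMap.proj (R := ℂ) (φ := fun _ : Fin 4 ↦ ℂ) j)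

/-- An arrangement of eight distinct planes of `ℙ³`, given by their equations, such that no six
of them meet in a point and no four of them contain a common line. -/
structure Arrangement where
  /-- The coefficients of the equations of the eight planes. -/
  form : Fin 8 → Fin 4 → ℂ
  form_ne_zero : ∀ i, form i ≠ 0
  distinct : ∀ i j, i ≠ j → plane (form i) ≠ plane (form j)
  no_six : ∀ p : Submodule ℂ (Fin 4 → ℂ), Module.finrank ℂ p = 1 →
    {i | p ≤ plane (form i)}.ncard < 6
  no_four : ∀ l : Submodule ℂ (Fin 4 → ℂ), Module.finrank ℂ l = 2 →
    {i | l ≤ plane (form i)}.ncard < 4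

namespace Arrangement

variable (S : Arrangement)

/-- The number of planes of the arrangement that contain the linear subspace `W`. -/
def mult (W : Submodule ℂ (Fin 4 → ℂ)) : ℕ := {i | W ≤ plane (S.form i)}.ncard

/-- `p` is a point that lies on exactly five planes. -/
def IsFivefoldPoint (p : Submodule ℂ (Fin 4 → ℂ)) : Prop :=
  Module.finrank ℂ p = 1 ∧ S.mult p = 5

/-- `p` is a point that lies on exactly four planes. -/
def IsFourfoldPoint (p : Submodule ℂ (Fin 4 → ℂ)) : Prop :=
  Module.finrank ℂ p = 1 ∧ S.mult p = 4

/-- `l` is a line that lies on exactly three planes. -/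
def IsTripleLine (l : Submodule ℂ (Fin 4 → ℂ)) : Prop :=
  Module.finrank ℂ l = 2 ∧ S.mult l = 3

/-- `l` is a line that lies on exactly two planes. -/
def IsDoubleLine (l : Submodule ℂ (Fin 4 → ℂ)) : Prop :=
  Module.finrank ℂ l = 2 ∧ S.mult l = 2

/-- The octic form that defines the union of the eight planes. -/
def octic : MvPolynomial (Fin 4) ℂ := ∏ i, linearForm (S.form i)

lemma octic_mem : S.octic ∈ grading (8 • 1) := by
  have h := IsHomogeneous.prod (Finset.univ : Finset (Fin 8)) (fun i ↦ linearForm (S.form i))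
    (fun _ ↦ 1) (fun i _ ↦ linearForm_mem (S.form i))
  simpa [octic] using h

/-- The regular function `f / x₀⁸` on the chart `x₀ ≠ 0` of `ℙ³`, where `f` is the octic form. -/
def dehomogenizedOctic : Γ(P3, Proj.basicOpen grading (X 0)) :=
  Proj.awayToSection grading (X 0)
    (HomogeneousLocalization.Away.mk grading (isHomogeneous_X ℂ 0) 8 S.octic S.octic_mem)

end Arrangement

/-! ### Varieties, blow-ups, double covers -/

/-- `s : X ⟶ Spec ℂ` is a complex variety: integral, separated and of finite type. -/
class IsVariety {X : Scheme.{0}} (s : X ⟶ SpecC) : Prop where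
  isIntegral : IsIntegral X
  isSeparated : IsSeparated s
  locallyOfFinitePresentation : LocallyOfFinitePresentation s
  quasiCompact : QuasiCompact s

/-- An ideal sheaf is invertible if it is locally generated by a nonzerodivisor. -/
def IsInvertibleIdeal {X : Scheme.{0}} (I : X.IdealSheafData) : Prop :=
  ∀ x : X, ∃ U : X.affineOpens, x ∈ U.1 ∧
    ∃ a ∈ nonZeroDivisors Γ(X, U.1), I.ideal U = Ideal.span {a}

/-- `π : X' ⟶ X` is the blow-up of the ideal sheaf `I`: the inverse image ideal sheaf of `I` is
invertible on `X'`, and `π` is universal with this property. -/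
structure IsBlowup {X' X : Scheme.{0}} (π : X' ⟶ X) (I : X.IdealSheafData) : Prop where
  isInvertibleIdeal : IsInvertibleIdeal (I.comap π)
  existsUnique_lift : ∀ {T : Scheme.{0}} (g : T ⟶ X), IsInvertibleIdeal (I.comap g) →
    ∃! h : T ⟶ X', h ≫ π = g

/-- `π : X' ⟶ X` is the blow-up of the closed subset `Z` with its reduced structure. -/
def IsBlowupAlong {X' X : Scheme.{0}} (π : X' ⟶ X) (Z : Closeds X) : Prop :=
  IsBlowup π (Scheme.IdealSheafData.vanishingIdeal Z)

/-- The singular locus of `s : X ⟶ Spec ℂ`: the points where `X` is not smooth over `ℂ`. -/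
def singularLocus {X : Scheme.{0}} (s : X ⟶ SpecC) [LocallyOfFinitePresentation s] : Closeds X :=
  s.smoothLocus.compl

/-- Let `π : P ⟶ ℙ³` be birational. Then `ρ : Y ⟶ P` is the normal double cover of `P` defined
by the arrangement: `Y` is normal and finite over `P`, dominates `ℙ³`, and its function field is
`ℂ(ℙ³)(w)` with `w² = f / x₀⁸`. It is branched along those prime divisors of `P` along
which the octic form `f` vanishes to an odd order. For `P = ℙ³` it is the double octic
`u² = f` with branch divisor `f = 0`. -/
structure IsDoubleCover (S : Arrangement) {P Y : Scheme.{0}} [IsIntegral Y] (π : P ⟶ P3)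
    (ρ : Y ⟶ P) : Prop where
  isFinite : IsFinite ρ
  isIntegrallyClosed : ∀ y : Y, IsIntegrallyClosed (Y.presheaf.stalk y)
  isDominant : IsDominant (ρ ≫ π)
  function_field : ∃ (h : genericPoint Y ∈ (ρ ≫ π) ⁻¹ᵁ Proj.basicOpen grading (X 0))
    (w : Y.functionField),
    w ^ 2 = Y.presheaf.germ _ (genericPoint Y) h
      ((ρ ≫ π).app (Proj.basicOpen grading (X 0)) S.dehomogenizedOctic) ∧
    ∀ z : Y.functionField, ∃ a b : P3.presheaf.stalk ((ρ ≫ π) (genericPoint Y)),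
      z = (ρ ≫ π).stalkMap (genericPoint Y) a + (ρ ≫ π).stalkMap (genericPoint Y) b * w

/-! ### The double octic -/

/-- The union of the fivefold points. -/
def Arrangement.fivefoldLocus (S : Arrangement) : Closeds P3 :=
  ⨆ p : {p // S.IsFivefoldPoint p}, linearLocus p.1

/-- The union of the triple lines. -/
def Arrangement.tripleLocus (S : Arrangement) : Closeds P3 :=
  ⨆ l : {l // S.IsTripleLine l}, linearLocus l.1

/-- The union of the fourfold points that lie on no triple line. These are the fourfold points of
the branch divisor that are left after the blow-ups of the fivefold points and triple lines. -/
def Arrangement.fourfoldLocus (S : Arrangement) : Closeds P3 :=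
  ⨆ p : {p // S.IsFourfoldPoint p ∧ ∀ l, S.IsTripleLine l → ¬ p ≤ l}, linearLocus p.1

/-- The strict transform under `π` of a closed set `T` when `Z` is blown up. -/
def strictTransform {X' X : Scheme.{0}} (π : X' ⟶ X) (Z T : Closeds X) : Closeds X' :=
  Closeds.closure (π ⁻¹' (T \ Z : Set X))

/-- The resolution `X` of the double covering of `ℙ³` branched along an arrangement `S` of eight
planes. One blows up the fivefold points, then the strict transforms of the triple lines, then the
remaining fourfold points, takes the double covering of the result (it is branched along the
strict transforms of the planes and the exceptional divisors over the fivefold points and the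
triple lines, which are the prime divisors where `f` has odd order), and finally blows up the
(reduced) union of the double curves, which is the singular locus of this double covering. -/
structure Resolution (S : Arrangement) where
  /-- Blow-up of `ℙ³` at the fivefold points. -/
  P₁ : Scheme.{0}
  /-- Blow-up of `P₁` along the triple lines. -/
  P₂ : Scheme.{0}
  /-- Blow-up of `P₂` at the remaining fourfold points. -/
  P₃ : Scheme.{0}
  /-- The double covering of `P₃`. -/
  Y : Scheme.{0}
  /-- The double octic: the blow-up of the singular locus of `Y`. -/
  X : Scheme.{0}
  π₁ : P₁ ⟶ P3
  π₂ : P₂ ⟶ P₁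
  π₃ : P₃ ⟶ P₂
  ρ : Y ⟶ P₃
  σ : X ⟶ Y
  [variety_P₁ : IsVariety (π₁ ≫ P3.toSpecC)]
  [variety_P₂ : IsVariety (π₂ ≫ π₁ ≫ P3.toSpecC)]
  [variety_P₃ : IsVariety (π₃ ≫ π₂ ≫ π₁ ≫ P3.toSpecC)]
  [variety_Y : IsVariety (ρ ≫ π₃ ≫ π₂ ≫ π₁ ≫ P3.toSpecC)]
  [variety_X : IsVariety (σ ≫ ρ ≫ π₃ ≫ π₂ ≫ π₁ ≫ P3.toSpecC)]
  blowup₁ : IsBlowupAlong π₁ S.fivefoldLocus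
  blowup₂ : IsBlowupAlong π₂ (strictTransform π₁ S.fivefoldLocus S.tripleLocus)
  blowup₃ : IsBlowupAlong π₃ (S.fourfoldLocus.preimage (π₂ ≫ π₁).continuous)
  cover : haveI := variety_Y.isIntegral
    IsDoubleCover S (π₃ ≫ π₂ ≫ π₁) ρ
  blowup₄ : haveI := variety_Y.locallyOfFinitePresentation
    IsBlowupAlong σ (singularLocus (ρ ≫ π₃ ≫ π₂ ≫ π₁ ≫ P3.toSpecC))

/-- The morphism from the double octic to `ℙ³`. -/
def Resolution.toP3 {S : Arrangement} (D : Resolution S) : D.X ⟶ P3 :=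
  D.σ ≫ D.ρ ≫ D.π₃ ≫ D.π₂ ≫ D.π₁

/-! ### The genus of a curve -/

/-- The everywhere regular differentials of a field extension `F / k`: those `ω ∈ Ω_{F/k}`
that lie in the image of `Ω_{V/k}` for every valuation ring `V` of `F` that contains `k`. (The
image of `Ω_{V/k}` is spanned by the `a • db` with `a, b ∈ V`.) For the function field of a curve
these are the global regular differentials of the smooth projective model. -/
def regularDifferentials (k F : Type) [Field k] [Field F] [Algebra k F] : Submodule k (Ω[F⁄k]) :=
  ⨅ (V : ValuationSubring F) (_ : ∀ c : k, algebraMap k F c ∈ V),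
    Submodule.span k {ω | ∃ a ∈ V, ∃ b ∈ V, ω = a • KaehlerDifferential.D k F b}

/-- The inclusion of the constants into the function field of an integral scheme over `ℂ`. -/
def constants {C : Scheme.{0}} [IsIntegral C] (s : C ⟶ SpecC) : ℂ →+* C.functionField :=
  (C.presheaf.germ ⊤ (genericPoint C) trivial).hom.comp
    (s.appTop.hom.comp (Scheme.ΓSpecIso (CommRingCat.of ℂ)).inv.hom)

/-- The dimension of a variety over `ℂ`: the transcendence degree of its function field. -/
def dimension {C : Scheme.{0}} [IsIntegral C] (s : C ⟶ SpecC) : Cardinal :=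
  letI := (constants s).toAlgebra
  Algebra.trdeg ℂ C.functionField

/-- The geometric genus of a curve `C` over `ℂ`, i.e. the genus of its smooth projective model. -/
def geometricGenus {C : Scheme.{0}} [IsIntegral C] (s : C ⟶ SpecC) : Cardinal :=
  letI := (constants s).toAlgebra
  Module.rank ℂ (regularDifferentials ℂ C.functionField)

end DoubleOctic

end

open DoubleOctic

/-!
# Fixed curves of involutions of double octics have geometric genus zero

Let `η` be the generic point of a curve `C` that is fixed pointwise by the lift of the involution
`[v] ↦ [A v]`, and `κ` its residue field, the function field of `C`. The proof shows that `κ` is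
generated by a single element over `ℂ`, and that such a field has no regular differentials. It only
uses the local rings at the images of `η` in the double octic, in the double cover `Y`, in the three
blow-ups and in `ℙ³`. These data are collected in the structure `LocalTower`.

**The arrangement.** Points and lines are replaced by the spaces of linear forms that vanish on them,
and the automorphism by its action `B` on linear forms, scaled such that `B² = 1`; the properties of
the arrangement that are needed are those of the structure `IsSymmetric`. If an eigenspace of `B` had
dimension one, the automorphism would fix a plane pointwise, every plane of the arrangement would be
invariant because no double or triple line is fixed pointwise, and seven planes would meet in the
isolated fixed point. So the fixed locus in `ℙ³` consists of two skew lines, each on at most one plane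
of the arrangement (`IsSymmetric.finrank_eigenspace`, `IsSymmetric.formMult_eigenspace`). The lift of
the automorphism acts trivially on `κ`. Hence the odd forms vanish at the image of `η` if `h` is an
even form that does not, and this image is the generic point of a fixed line or a closed point of it.
Likewise, a quotient of forms of different parity which is regular at `η` has residue zero
(`LocalTower.odd`). This determines the position of `η` on the exceptional divisors.

**The resolution.** The local rings of a blow-up are localizations of the usual affine charts by the
universal property (`IsBlowup.isLocalBlowup`), so the blow-up of a coordinate subspace again has
local coordinates (`IsCoord.blowup`). On the third blow-up coordinates are found in which the planes
are given by monomials. Then the local ring of the normal double cover is a localization of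
`R[√F]` with a square-free monomial `F` times a unit, its singular locus is found with the Jacobian
criterion, and its blow-up is computed (`exists_forall_mem_adjoin`). Over a closed point,
every curve in the resolution is rational: over a point where two branch divisors meet it is a conic,
and over a point where three of them meet it is a line in one of the exceptional divisors.

**The curves.** The remaining curves map onto a curve of the third blow-up that is fixed pointwise by
the involution.
* For a fixed line of `ℙ³` on no plane of the arrangement, the double cover is branched at the at most
  two points that lie on an odd number of planes. So it is given by an equation `ω² = c p q` with `p`
  and `q` linear, or it is trivial (`LocalTower.exists_generator_line`). A fixed line on a plane is in
  the branch locus.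
* For a fixed line of the exceptional plane over a point, either the line is in the branch locus, or
  the planes through the point come in pairs of planes that meet the line in the same point, so that
  the double cover of the line is trivial (`LocalTower.exists_generator_of_exceptional`).
* Over a triple line there is no such curve: at a closed point of the line, the fixed points of the
  fibre of the exceptional divisor are isolated (`LocalTower.exists_generator_of_triple_line`).

Together these cases give `LocalTower.exists_generator`. Finally, a differential of `ℂ(τ)` which is
regular at all the finite places is `p(τ) dτ` with a polynomial `p`, and it has a pole at infinity
(`regularDifferentials_eq_bot`).
-/

noncomputable section

namespace DoubleOctic

/-! ### Ideal sheaves on local rings -/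

/-- The largest affine open subset of an affine scheme. -/
abbrev topAffine (X : Scheme.{0}) [IsAffine X] : X.affineOpens := ⟨⊤, isAffineOpen_top X⟩

/-- The ideal of `R` that corresponds to an ideal sheaf on `Spec R`. -/
def specIdeal {R : CommRingCat.{0}} (I : (Spec R).IdealSheafData) : Ideal R :=
  (I.ideal (topAffine _)).comap (Scheme.ΓSpecIso R).inv.hom

lemma mem_specIdeal {R : CommRingCat.{0}} {I : (Spec R).IdealSheafData} {r : R} :
    r ∈ specIdeal I ↔ (Scheme.ΓSpecIso R).inv.hom r ∈ I.ideal (topAffine _) :=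
  Ideal.mem_comap

lemma specIdeal_le_iff {R : CommRingCat.{0}} {I J : (Spec R).IdealSheafData} :
    specIdeal I ≤ specIdeal J ↔ I ≤ J := by
  constructor
  · intro h
    refine Scheme.IdealSheafData.le_of_isAffine ?_
    exact (Ideal.comap_le_comap_iff_of_surjective _
      (ConcreteCategory.bijective_of_isIso (Scheme.ΓSpecIso R).inv).2 _ _).1 h
  · exact fun h ↦ Ideal.comap_mono (h _)

lemma specIdeal_surjective {R : CommRingCat.{0}} (J : Ideal R) :
    ∃ I : (Spec R).IdealSheafData, specIdeal I = J := by
  refine ⟨.ofIdealTop (J.comap (Scheme.ΓSpecIso R).hom.hom), ?_⟩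
  have h : (Scheme.IdealSheafData.ofIdealTop (J.comap (Scheme.ΓSpecIso R).hom.hom)).ideal
      (topAffine _) = J.comap (Scheme.ΓSpecIso R).hom.hom :=
    Scheme.IdealSheafData.equivOfIsAffine.right_inv _
  ext r
  rw [mem_specIdeal, h]
  refine Ideal.mem_comap.trans ?_
  simp

lemma specIdeal_map {R S : CommRingCat.{0}} (φ : R ⟶ S) (J : (Spec S).IdealSheafData) :
    specIdeal (J.map (Spec.map φ)) = (specIdeal J).comap φ.hom := by
  have h := Scheme.ΓSpecIso_inv_naturality φ
  ext r
  rw [mem_specIdeal, Ideal.mem_comap, mem_specIdeal,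
    Scheme.IdealSheafData.ideal_map_of_isAffineHom]
  refine Ideal.mem_comap.trans ?_
  change (Spec.map φ).appTop.hom ((Scheme.ΓSpecIso R).inv.hom r) ∈
    Scheme.IdealSheafData.ideal _ (topAffine _) ↔ _
  rw [← RingHom.comp_apply, ← CommRingCat.hom_comp, ← h]
  rfl

/-- The inverse image of ideal sheaves under a morphism of affine schemes is the extension of
ideals, since both are left adjoint to the direct image. -/
lemma specIdeal_comap {R S : CommRingCat.{0}} (φ : R ⟶ S) (I : (Spec R).IdealSheafData) :
    specIdeal (I.comap (Spec.map φ)) = (specIdeal I).map φ.hom := by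
  apply le_antisymm
  · obtain ⟨J, hJ⟩ := specIdeal_surjective ((specIdeal I).map φ.hom)
    rw [← hJ, specIdeal_le_iff, ← Scheme.IdealSheafData.le_map_iff_comap_le, ← specIdeal_le_iff,
      specIdeal_map, hJ]
    exact Ideal.le_comap_map
  · rw [Ideal.map_le_iff_le_comap, ← specIdeal_map, specIdeal_le_iff]
    exact Scheme.IdealSheafData.le_map_comap _ _

/-- The stalk at `x` of an ideal sheaf, as an ideal of the local ring of `x`. -/
def stalkIdeal {X : Scheme.{0}} (I : X.IdealSheafData) (x : X) : Ideal (X.presheaf.stalk x) :=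
  specIdeal (I.comap (X.fromSpecStalk x))

lemma stalkIdeal_comap {X Y : Scheme.{0}} (f : X ⟶ Y) (I : Y.IdealSheafData) (x : X) :
    stalkIdeal (I.comap f) x = (stalkIdeal I (f x)).map (f.stalkMap x).hom := by
  rw [stalkIdeal, stalkIdeal, ← specIdeal_comap, ← Scheme.IdealSheafData.comap_comp,
    ← Scheme.IdealSheafData.comap_comp, Scheme.SpecMap_stalkMap_fromSpecStalk]

/-- The sections of an ideal sheaf over an affine open subset `U` are its pullback to `Spec Γ(X,
U)`. -/
lemma specIdeal_comap_fromSpec {X : Scheme.{0}} (I : X.IdealSheafData) (U : X.affineOpens) :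
    specIdeal (I.comap U.2.fromSpec) = I.ideal U := by
  have := U.2.isOpenImmersion_fromSpec
  have key : ∀ (V : X.affineOpens) (e : V = U) (ψ : Γ(X, U) ⟶ Γ(X, V)),
      ψ = X.presheaf.map (homOfLE (le_of_eq (congrArg Subtype.val e))).op →
      Ideal.comap ψ.hom (I.ideal V) = I.ideal U := by
    rintro V rfl ψ rfl
    simp [Ideal.comap_id]
  have hV : U.2.fromSpec ''ᵁ ⊤ = U.1 := by
    rw [Scheme.Hom.image_top_eq_opensRange]
    exact U.2.opensRange_fromSpec
  rw [specIdeal, Scheme.IdealSheafData.ideal_comap_of_isOpenImmersion I U.2.fromSpec (topAffine _)]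
  refine key ⟨U.2.fromSpec ''ᵁ ⊤, (isAffineOpen_top _).image_of_isOpenImmersion _⟩ (Subtype.ext hV)
    ((Scheme.ΓSpecIso _).inv ≫ (U.2.fromSpec.appIso ⊤).inv) ?_
  rw [← cancel_mono (U.2.fromSpec.appIso ⊤).hom, Category.assoc, Iso.inv_hom_id, Category.comp_id,
    Scheme.Hom.appIso_hom', Scheme.Hom.map_appLE, Scheme.Hom.appLE, U.2.fromSpec_app_self]
  simp [← Functor.map_comp]

lemma stalkIdeal_eq_map_germ {X : Scheme.{0}} (I : X.IdealSheafData) (U : X.affineOpens) (x : X)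
    (hx : x ∈ U.1) : stalkIdeal I x = (I.ideal U).map (X.presheaf.germ U.1 x hx).hom := by
  rw [stalkIdeal, ← specIdeal_comap_fromSpec I U, ← specIdeal_comap,
    ← Scheme.IdealSheafData.comap_comp, ← U.2.fromSpecStalk_eq_fromSpecStalk hx]
  rfl

/-! ### The local rings of a blow-up -/

/-- The restriction of a vanishing ideal to a local ring is a radical ideal. -/
lemma stalkIdeal_vanishingIdeal_isRadical {X : Scheme.{0}} (Z : Closeds X) (x : X) :
    (stalkIdeal (Scheme.IdealSheafData.vanishingIdeal Z) x).IsRadical := by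
  obtain ⟨_, ⟨U, hU, rfl⟩, hxU, -⟩ :=
    X.isBasis_affineOpens.exists_subset_of_mem_open (Set.mem_univ x) isOpen_univ
  rw [stalkIdeal_eq_map_germ _ ⟨U, hU⟩ x hxU]
  let : Algebra Γ(X, U) (X.presheaf.stalk x) := (X.presheaf.germ U x hxU).hom.toAlgebra
  have := hU.isLocalization_stalk ⟨x, hxU⟩
  have h := IsLocalization.map_radical (hU.primeIdealOf ⟨x, hxU⟩).asIdeal.primeCompl
    (X.presheaf.stalk x) ((Scheme.IdealSheafData.vanishingIdeal Z).ideal ⟨U, hU⟩)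
  rw [Scheme.IdealSheafData.vanishingIdeal_ideal,
    (PrimeSpectrum.isRadical_vanishingIdeal _).radical] at h
  rw [Scheme.IdealSheafData.vanishingIdeal_ideal]
  change (Ideal.map (algebraMap Γ(X, U) (X.presheaf.stalk x)) _).IsRadical
  rw [h]
  exact Ideal.radical_isRadical _

/-- The primes of a local ring that contain the stalk of a vanishing ideal are those that
correspond to points of the closed set. -/
lemma stalkIdeal_vanishingIdeal_le_iff {X : Scheme.{0}} (Z : Closeds X) (x : X)
    (P : PrimeSpectrum (X.presheaf.stalk x)) :
    stalkIdeal (Scheme.IdealSheafData.vanishingIdeal Z) x ≤ P.asIdeal ↔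
      X.fromSpecStalk x P ∈ Z := by
  obtain ⟨_, ⟨U, hU, rfl⟩, hxU, -⟩ :=
    X.isBasis_affineOpens.exists_subset_of_mem_open (Set.mem_univ x) isOpen_univ
  have hf : X.fromSpecStalk x = Spec.map (X.presheaf.germ U x hxU) ≫ hU.fromSpec :=
    (hU.fromSpecStalk_eq_fromSpecStalk hxU).symm
  rw [stalkIdeal_eq_map_germ _ ⟨U, hU⟩ x hxU, Ideal.map_le_iff_le_comap,
    Scheme.IdealSheafData.vanishingIdeal_ideal, hf]
  have h : IsClosed (hU.fromSpec ⁻¹' Z) := Z.isClosed.preimage hU.fromSpec.continuous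
  let Q : PrimeSpectrum Γ(X, U) := Spec.map (X.presheaf.germ U x hxU) P
  have h1 : PrimeSpectrum.zeroLocus
      (PrimeSpectrum.vanishingIdeal (hU.fromSpec ⁻¹' Z) : Set Γ(X, U)) = hU.fromSpec ⁻¹' Z := by
    rw [PrimeSpectrum.zeroLocus_vanishingIdeal_eq_closure]
    exact h.closure_eq
  change (PrimeSpectrum.vanishingIdeal (hU.fromSpec ⁻¹' Z) : Set Γ(X, U)) ⊆ Q.asIdeal ↔
    Q ∈ hU.fromSpec ⁻¹' Z
  rw [← h1]
  exact (PrimeSpectrum.mem_zeroLocus Q _).symm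

/-- The ring homomorphism `φ : R → R'` between local rings looks like the local ring of a point of
the blow-up of `I`: the ideal `I R'` is generated by the nonzerodivisor `φ a`, where `a ∈ I`, and
`R'` is a localization of the affine chart `R[I / a]`. -/
def IsLocalBlowup {R R' : Type*} [CommRing R] [CommRing R'] (φ : R →+* R') (I : Ideal R) : Prop :=
  ∃ a ∈ I, φ a ∈ nonZeroDivisors R' ∧ I.map φ = Ideal.span {φ a} ∧
    ∀ z : R', ∃ n : ℕ, ∃ r ∈ I ^ n, ∃ s ∈ I ^ n, ∃ u : R', IsUnit u ∧ φ s = u * φ a ^ n ∧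
      z * φ s = φ r

/-- The elements of `R'` which are quotients of elements of the same power of `I`. -/
def blowupSubring {R R' : Type*} [CommRing R] [CommRing R'] (φ : R →+* R') (I : Ideal R) (a : R) :
    Subring R' where
  carrier := {z | ∃ n : ℕ, ∃ r ∈ I ^ n, ∃ s ∈ I ^ n, ∃ u : R', IsUnit u ∧ φ s = u * φ a ^ n ∧
      z * φ s = φ r}
  one_mem' := ⟨0, 1, by simp, 1, by simp, 1, isUnit_one, by simp, by simp⟩
  zero_mem' := ⟨0, 0, by simp, 1, by simp, 1, isUnit_one, by simp, by simp⟩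
  mul_mem' := by
    rintro z z' ⟨n, r, hr, s, hs, u, hu, h1, h2⟩ ⟨n', r', hr', s', hs', u', hu', h1', h2'⟩
    refine ⟨n + n', r * r', pow_add I n n' ▸ Ideal.mul_mem_mul hr hr', s * s',
      pow_add I n n' ▸ Ideal.mul_mem_mul hs hs', u * u', hu.mul hu', ?_, ?_⟩
    · rw [map_mul, h1, h1']; ring
    · rw [map_mul, map_mul, ← h2, ← h2']; ring
  add_mem' := by
    rintro z z' ⟨n, r, hr, s, hs, u, hu, h1, h2⟩ ⟨n', r', hr', s', hs', u', hu', h1', h2'⟩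
    refine ⟨n + n', r * s' + s * r', ?_, s * s',
      pow_add I n n' ▸ Ideal.mul_mem_mul hs hs', u * u', hu.mul hu', ?_, ?_⟩
    · exact pow_add I n n' ▸ add_mem (Ideal.mul_mem_mul hr hs') (Ideal.mul_mem_mul hs hr')
    · rw [map_mul, h1, h1']; ring
    · simp only [map_mul, map_add, ← h2, ← h2']; ring
  neg_mem' := by
    rintro z ⟨n, r, hr, s, hs, u, hu, h1, h2⟩
    exact ⟨n, -r, neg_mem hr, s, hs, u, hu, h1, by rw [map_neg, ← h2]; ring⟩

variable {R R' : Type*} [CommRing R] [CommRing R'] (φ : R →+* R') (I : Ideal R) (a : R)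

lemma map_mem_blowupSubring (r : R) : φ r ∈ blowupSubring φ I a :=
  ⟨0, r, by simp, 1, by simp, 1, isUnit_one, by simp, by simp⟩

/-- A quotient of two elements of `I` is in the blow-up chart. -/
lemma mem_blowupSubring_of_mul_eq (ha : a ∈ I) {z : R'} {r : R} (hr : r ∈ I) (hz : z * φ a = φ r) :
    z ∈ blowupSubring φ I a :=
  ⟨1, r, by simpa, a, by simpa, 1, isUnit_one, by simp, hz⟩

lemma inv_mem_blowupSubring {z w : R'} (hzw : z * w = 1)
    (hz : z ∈ blowupSubring φ I a) : w ∈ blowupSubring φ I a := by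
  obtain ⟨n, r, hr, s, hs, u, hu, h1, h2⟩ := hz
  refine ⟨n, s, hs, r, hr, z * u, (IsUnit.of_mul_eq_one w hzw).mul hu, ?_, ?_⟩
  · rw [← h2, h1]; ring
  · rw [← h2, ← mul_assoc, mul_comm w, hzw, one_mul]

/-- The ring `blowupSubring φ I a` is local, since it contains the inverses of its elements that are
units of `R'`. -/
lemma isLocalRing_blowupSubring [IsLocalRing R'] :
    IsLocalRing (blowupSubring φ I a) ∧ IsLocalHom (blowupSubring φ I a).subtype := by
  have h : IsLocalHom (blowupSubring φ I a).subtype := by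
    constructor
    rintro ⟨z, hz⟩ hu
    obtain ⟨w, hw⟩ := hu.exists_right_inv
    have hw' : z * w = 1 := hw
    exact IsUnit.of_mul_eq_one ⟨w, inv_mem_blowupSubring φ I a hw' hz⟩ (Subtype.ext hw')
  exact ⟨RingHom.domain_isLocalRing (blowupSubring φ I a).subtype, h⟩

/-- Two morphisms from the spectrum of a local ring to `X` that only differ by a local
homomorphism and meet at the same local ring of `X`: a morphism `h : Spec B ⟶ X` whose pullback to
the spectrum of the local ring of `x` is the canonical morphism yields a section of
`B → 𝒪_{X, x}`. -/
lemma surjective_of_fromSpecStalk_factors {X : Scheme.{0}} {x : X} {B : CommRingCat.{0}}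
    [IsLocalRing B] (j : B ⟶ X.presheaf.stalk x) [IsLocalHom j.hom] (h : Spec B ⟶ X)
    (e : Spec.map j ≫ h = X.fromSpecStalk x) :
    ∃ γ : X.presheaf.stalk x ⟶ B, γ ≫ j = 𝟙 _ ∧ Spec.map γ ≫ X.fromSpecStalk x = h := by
  have hx : h (IsLocalRing.closedPoint B) = x := by
    have h1 : X.fromSpecStalk x (IsLocalRing.closedPoint (X.presheaf.stalk x)) = x :=
      Scheme.fromSpecStalk_closedPoint
    rw [← e] at h1
    rw [← Spec_closedPoint (f := j)]
    exact h1
  have key : ∀ x' : X, h (IsLocalRing.closedPoint B) = x' →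
      ∃ γ : X.presheaf.stalk x' ⟶ B, Spec.map γ ≫ X.fromSpecStalk x' = h := by
    rintro x' rfl
    exact ⟨_, Scheme.Spec_stalkClosedPointTo_fromSpecStalk h⟩
  obtain ⟨γ, hγ⟩ := key x hx
  refine ⟨γ, ?_, hγ⟩
  apply Spec.map_injective
  rw [← cancel_mono (X.fromSpecStalk x), Spec.map_comp, Category.assoc, hγ, e, Spec.map_id,
    Category.id_comp]

lemma isInvertibleIdeal_comap_of_span {X : Scheme.{0}} (I : X.IdealSheafData) (x : X)
    {B : CommRingCat.{0}} (β : X.presheaf.stalk x ⟶ B) {b : B} (hb : b ∈ nonZeroDivisors B)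
    (h : (stalkIdeal I x).map β.hom = Ideal.span {b}) :
    IsInvertibleIdeal (I.comap (Spec.map β ≫ X.fromSpecStalk x)) := by
  intro y
  refine ⟨topAffine _, trivial, (Scheme.ΓSpecIso B).inv.hom b, ?_, ?_⟩
  · refine mem_nonZeroDivisors_of_injective (f := (Scheme.ΓSpecIso B).hom.hom)
      (ConcreteCategory.bijective_of_isIso (Scheme.ΓSpecIso B).hom).1 ?_
    rwa [← RingHom.comp_apply, ← CommRingCat.hom_comp, Iso.inv_hom_id]
  · have h1 : specIdeal (I.comap (Spec.map β ≫ X.fromSpecStalk x)) = Ideal.span {b} := by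
      rw [Scheme.IdealSheafData.comap_comp, specIdeal_comap]
      exact h
    rw [specIdeal] at h1
    have h2 := congrArg (Ideal.map (Scheme.ΓSpecIso B).inv.hom) h1
    rw [Ideal.map_comap_of_surjective _
      (ConcreteCategory.bijective_of_isIso (Scheme.ΓSpecIso B).inv).2, Ideal.map_span,
      Set.image_singleton] at h2
    exact h2

lemma IsInvertibleIdeal.exists_stalk {X : Scheme.{0}} [IsIntegral X] {I : X.IdealSheafData}
    (h : IsInvertibleIdeal I) (x : X) : ∃ a, a ≠ 0 ∧ stalkIdeal I x = Ideal.span {a} := by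
  obtain ⟨U, hxU, a, ha, hI⟩ := h x
  refine ⟨X.presheaf.germ U.1 x hxU a, ?_, ?_⟩
  · have : Nonempty U.1 := ⟨⟨x, hxU⟩⟩
    rw [map_ne_zero_iff _ (AlgebraicGeometry.germ_injective_of_isIntegral X x hxU)]
    exact nonZeroDivisors.ne_zero ha
  · rw [stalkIdeal_eq_map_germ I U x hxU, hI, Ideal.map_span, Set.image_singleton]

/-- If the extension of an ideal to a local ring is principal, it is generated by the image of an
element of the ideal. -/
lemma exists_mem_span_eq_of_map_eq_span [IsLocalRing R'] {b : R'} (hb : b ∈ nonZeroDivisors R')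
    (h : I.map φ = Ideal.span {b}) : ∃ a ∈ I, ∃ u : R', IsUnit u ∧ φ a = u * b := by
  by_contra! hcon
  have h1 : I.map φ ≤ IsLocalRing.maximalIdeal R' * Ideal.span {b} := by
    rw [Ideal.map_le_iff_le_comap]
    intro r hr
    have hr' : φ r ∈ Ideal.span {b} := h ▸ Ideal.mem_map_of_mem φ hr
    obtain ⟨u, hu⟩ := Ideal.mem_span_singleton'.mp hr'
    have h3 : ¬ IsUnit u := fun hu' ↦ hcon r hr u hu' hu.symm
    rw [Ideal.mem_comap, ← hu]
    exact Ideal.mul_mem_mul ((IsLocalRing.mem_maximalIdeal u).mpr h3)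
      (Ideal.mem_span_singleton_self b)
  have h2 : b ∈ IsLocalRing.maximalIdeal R' * Ideal.span {b} :=
    h1 (h ▸ Ideal.mem_span_singleton_self b)
  obtain ⟨m, hm, hmb⟩ := Ideal.mem_mul_span_singleton.mp h2
  have h3 : (1 - m) * b = 0 := by rw [sub_mul, hmb, one_mul, sub_self]
  have h4 : 1 - m = 0 := (mem_nonZeroDivisors_iff.mp hb).2 _ h3
  exact hm (by rw [← sub_eq_zero.mp h4]; exact isUnit_one)

/-- The universal property of the blow-up forces its local rings to be localizations of the affine
charts: the subring `B` of the local ring of `x` formed by the quotients of elements of equal powers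
of `I` already makes `I` principal, so the universal property yields a morphism from `Spec B` to the
blow-up, and its uniqueness shows that `B` is the whole local ring. -/
lemma IsBlowup.isLocalBlowup {X' X : Scheme.{0}} [IsIntegral X'] {π : X' ⟶ X}
    {I : X.IdealSheafData} (h : IsBlowup π I) (x : X') :
    IsLocalBlowup (π.stalkMap x).hom (stalkIdeal I (π x)) := by
  obtain ⟨b, hb0, hb⟩ := h.isInvertibleIdeal.exists_stalk x
  rw [stalkIdeal_comap] at hb
  obtain ⟨a, ha, u, hu, hau⟩ := exists_mem_span_eq_of_map_eq_span _ _
    (mem_nonZeroDivisors_of_ne_zero hb0) hb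
  have ha0 : (π.stalkMap x).hom a ∈ nonZeroDivisors (X'.presheaf.stalk x) :=
    mem_nonZeroDivisors_of_ne_zero (by rw [hau]; exact mul_ne_zero hu.ne_zero hb0)
  have hspan : (stalkIdeal I (π x)).map (π.stalkMap x).hom = Ideal.span {(π.stalkMap x).hom a} := by
    rw [hb, hau, Ideal.span_singleton_mul_left_unit hu]
  refine ⟨a, ha, ha0, hspan, fun z ↦ ?_⟩
  let B := blowupSubring (π.stalkMap x).hom (stalkIdeal I (π x)) a
  obtain ⟨hloc, hlochom⟩ := isLocalRing_blowupSubring (π.stalkMap x).hom (stalkIdeal I (π x)) a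
  let β : X.presheaf.stalk (π x) ⟶ CommRingCat.of B :=
    CommRingCat.ofHom ((π.stalkMap x).hom.codRestrict B (map_mem_blowupSubring _ _ _))
  let j : CommRingCat.of B ⟶ X'.presheaf.stalk x := CommRingCat.ofHom B.subtype
  have hj : IsLocalHom j.hom := hlochom
  have hβj : β ≫ j = π.stalkMap x := rfl
  have hinv : IsInvertibleIdeal (I.comap (Spec.map β ≫ X.fromSpecStalk (π x))) := by
    refine isInvertibleIdeal_comap_of_span I (π x) β (b := β.hom a) ?_ (le_antisymm ?_ ?_)
    · refine mem_nonZeroDivisors_of_injective (f := B.subtype) Subtype.val_injective ha0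
    · rw [Ideal.map_le_iff_le_comap]
      intro r hr
      have h1 : (π.stalkMap x).hom r ∈ Ideal.span {(π.stalkMap x).hom a} :=
        hspan ▸ Ideal.mem_map_of_mem _ hr
      obtain ⟨c, hc⟩ := Ideal.mem_span_singleton'.mp h1
      rw [Ideal.mem_comap, Ideal.mem_span_singleton']
      exact ⟨⟨c, mem_blowupSubring_of_mul_eq _ _ _ ha hr hc⟩, Subtype.ext hc⟩
    · rw [Ideal.span_singleton_le_iff_mem]
      exact Ideal.mem_map_of_mem _ ha
  obtain ⟨k, hk, -⟩ := h.existsUnique_lift _ hinv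
  have hinv' : IsInvertibleIdeal (I.comap (Spec.map (π.stalkMap x) ≫ X.fromSpecStalk (π x))) :=
    isInvertibleIdeal_comap_of_span I (π x) _ ha0 hspan
  obtain ⟨k', -, hk'⟩ := h.existsUnique_lift _ hinv'
  have e : Spec.map j ≫ k = X'.fromSpecStalk x := by
    rw [hk' (X'.fromSpecStalk x) (by simp), hk' (Spec.map j ≫ k)]
    dsimp only
    rw [← hβj, Spec.map_comp, Category.assoc, Category.assoc, hk]
  obtain ⟨γ, hγ, -⟩ := surjective_of_fromSpecStalk_factors j k e
  have h1 : j.hom (γ.hom z) = z := by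
    rw [← RingHom.comp_apply, ← CommRingCat.hom_comp, hγ]; rfl
  have h2 : z ∈ B := h1 ▸ (γ.hom z).2
  exact h2

/-- A blow-up is an isomorphism near the points outside of the centre. -/
lemma IsBlowup.bijective_stalkMap {X' X : Scheme.{0}} [IsIntegral X'] {π : X' ⟶ X}
    {I : X.IdealSheafData} (h : IsBlowup π I) (x : X') (hx : stalkIdeal I (π x) = ⊤) :
    Function.Bijective (π.stalkMap x).hom := by
  have hinv : IsInvertibleIdeal (I.comap (Spec.map (𝟙 _) ≫ X.fromSpecStalk (π x))) :=
    isInvertibleIdeal_comap_of_span I (π x) (𝟙 _) (b := 1) (one_mem _) (by simp [hx])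
  have hinv' : IsInvertibleIdeal (I.comap (Spec.map (π.stalkMap x) ≫ X.fromSpecStalk (π x))) :=
    isInvertibleIdeal_comap_of_span I (π x) _ (b := 1) (one_mem _) (by simp [hx, Ideal.map_top])
  obtain ⟨k, hk, -⟩ := h.existsUnique_lift _ hinv
  obtain ⟨k', -, hk'⟩ := h.existsUnique_lift _ hinv'
  have e : Spec.map (π.stalkMap x) ≫ k = X'.fromSpecStalk x := by
    rw [hk' (X'.fromSpecStalk x) (by simp), hk' (Spec.map (π.stalkMap x) ≫ k)]
    simp [hk]
  obtain ⟨γ, hγ, hγ2⟩ := surjective_of_fromSpecStalk_factors _ k e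
  have h3 : π.stalkMap x ≫ γ = 𝟙 _ := by
    apply Spec.map_injective
    rw [← cancel_mono (X.fromSpecStalk (π x)), Spec.map_comp, Category.assoc,
      Scheme.SpecMap_stalkMap_fromSpecStalk, reassoc_of% hγ2, hk]
  have : IsIso (π.stalkMap x) := ⟨γ, h3, hγ⟩
  exact ConcreteCategory.bijective_of_isIso (π.stalkMap x)

/-! ### The Jacobian criterion for a hypersurface -/

section Jacobian
open TensorProduct KaehlerDifferential IsLocalRing

variable {P L : Type} [CommRing P] [CommRing L] [IsLocalRing L] [Algebra ℂ P] [Algebra ℂ L]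
  [Algebra P L] [IsScalarTower ℂ P L] [Algebra.FormallySmooth ℂ P] [Module.Free P Ω[P⁄ℂ]]
  [Module.Finite P Ω[P⁄ℂ]]

/-- The derivation given by the second component of a homomorphism to the dual numbers. -/
def dualNumberDerivation {K : Type} [Field K] [Algebra ℂ K] [Algebra P K] [IsScalarTower ℂ P K]
    (g : P →ₐ[ℂ] DualNumber K) (hg : ∀ p, (g p).fst = algebraMap P K p) : Derivation ℂ P K where
  toFun p := (g p).snd
  map_add' := by simp
  map_smul' := by simp
  map_one_eq_zero' := by simp
  leibniz' a b := by
    simp [TrivSqZeroExt.snd_mul, hg, Algebra.smul_def, mul_comm]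

/-- The Jacobian criterion for a hypersurface: it is smooth where some derivative of its equation
does not vanish. -/
lemma formallySmooth_of_dualNumber (hsurj : Function.Surjective (algebraMap P L)) {G : P}
    (hker : RingHom.ker (algebraMap P L) = Ideal.span {G})
    (g : P →ₐ[ℂ] DualNumber (ResidueField L))
    (hg : ∀ p, (g p).fst = algebraMap P (ResidueField L) p) (hG : (g G).snd ≠ 0) :
    Algebra.FormallySmooth ℂ L := by
  rw [Algebra.FormallySmooth.iff_injective_cotangentComplexBaseChange_residueField P hsurj
    (hker ▸ ⟨{G}, by simp⟩), injective_iff_map_eq_zero]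
  intro x hx
  have hGker : G ∈ RingHom.ker (algebraMap P L) := hker ▸ Ideal.mem_span_singleton_self G
  have key : ∀ x : ResidueField L ⊗[P] RingHom.ker (algebraMap P L),
      ∃ k : ResidueField L, x = k ⊗ₜ[P] (⟨G, hGker⟩ : RingHom.ker (algebraMap P L)) := by
    intro x
    induction x with
    | zero => exact ⟨0, by simp⟩
    | add x y h1 h2 =>
      obtain ⟨k, rfl⟩ := h1
      obtain ⟨k', rfl⟩ := h2
      exact ⟨k + k', (TensorProduct.add_tmul _ _ _).symm⟩
    | tmul k y =>
      obtain ⟨y, hy⟩ := y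
      obtain ⟨p, hp⟩ := Ideal.mem_span_singleton'.mp (hker ▸ hy)
      refine ⟨p • k, ?_⟩
      rw [TensorProduct.smul_tmul]
      congr 1
      exact Subtype.ext hp.symm
  obtain ⟨k, rfl⟩ := key x
  rw [cotangentComplexBaseChange_tmul] at hx
  have h := congrArg ((dualNumberDerivation g hg).liftKaehlerDifferential.liftBaseChange
    (ResidueField L)) hx
  rw [map_smul, map_zero, kerToTensor_apply, LinearMap.liftBaseChange_tmul,
    Derivation.liftKaehlerDifferential_comp_D, one_smul, smul_eq_zero] at h
  rw [h.resolve_right hG, TensorProduct.zero_tmul]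

/-- The Jacobian criterion for a hypersurface: it is singular where all the derivatives of its
equation vanish. -/
lemma not_formallySmooth_of_tmul_D_eq_zero [IsDomain P]
    (hsurj : Function.Surjective (algebraMap P L)) {G : P}
    (hker : RingHom.ker (algebraMap P L) = Ideal.span {G}) (hG : G ≠ 0)
    (h : (1 : ResidueField L) ⊗ₜ[P] KaehlerDifferential.D ℂ P G = 0) :
    ¬ Algebra.FormallySmooth ℂ L := by
  rw [Algebra.FormallySmooth.iff_injective_cotangentComplexBaseChange_residueField P hsurj
    (hker ▸ ⟨{G}, by simp⟩), injective_iff_map_eq_zero]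
  intro hinj
  have hGker : G ∈ RingHom.ker (algebraMap P L) := hker ▸ Ideal.mem_span_singleton_self G
  have h1 := hinj ((1 : ResidueField L) ⊗ₜ[P] (⟨G, hGker⟩ : RingHom.ker (algebraMap P L))) (by
    rw [cotangentComplexBaseChange_tmul, kerToTensor_apply, h, smul_zero])
  let e : P ≃ₗ[P] Submodule.span P {G} := LinearEquiv.toSpanNonzeroSingleton P P G hG
  let ψ : RingHom.ker (algebraMap P L) →ₗ[P] ResidueField L :=
    Algebra.linearMap P (ResidueField L) ∘ₗ e.symm.toLinearMap ∘ₗ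
      Submodule.inclusion (le_of_eq hker)
  have h2 := congrArg (ψ.liftBaseChange (ResidueField L)) h1
  have h3 : e.symm ⟨G, Submodule.mem_span_singleton_self G⟩ = 1 := by
    rw [LinearEquiv.symm_apply_eq]
    exact (LinearEquiv.toSpanNonzeroSingleton_one P P G hG).symm
  have h4 : ψ ⟨G, hGker⟩ = 1 := by
    change algebraMap P (ResidueField L) (e.symm ⟨G, Submodule.mem_span_singleton_self G⟩) = 1
    rw [h3, map_one]
  rw [map_zero, LinearMap.liftBaseChange_tmul, h4, one_smul] at h2
  exact one_ne_zero h2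

end Jacobian

/-! ### Local coordinates -/

section Coordinates

variable {R : Type} [CommRing R] [Algebra ℂ R]

/-- The elements `c₀, c₁, c₂` of `R` are local coordinates of the affine space: they are
algebraically independent and `R` is a localization of `ℂ[c₀, c₁, c₂]`. -/
structure IsCoord (c : Fin 3 → R) : Prop where
  injective : Function.Injective (aeval c : MvPolynomial (Fin 3) ℂ →ₐ[ℂ] R)
  frac : ∀ z : R, ∃ p q : MvPolynomial (Fin 3) ℂ, IsUnit (aeval c q) ∧
    z * aeval c q = aeval c p

/-- The polynomials which are units in `R`. -/
def unitSubmonoid (c : Fin 3 → R) : Submonoid (MvPolynomial (Fin 3) ℂ) :=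
  (IsUnit.submonoid R).comap (aeval c : MvPolynomial (Fin 3) ℂ →ₐ[ℂ] R)

variable {c : Fin 3 → R}

lemma IsCoord.isLocalization (h : IsCoord c) :
    let := (aeval c : MvPolynomial (Fin 3) ℂ →ₐ[ℂ] R).toRingHom.toAlgebra
    IsLocalization (unitSubmonoid c) R := by
  let := (aeval c : MvPolynomial (Fin 3) ℂ →ₐ[ℂ] R).toRingHom.toAlgebra
  refine ⟨⟨fun y ↦ y.2, fun z ↦ ?_, fun {x y} hxy ↦ ⟨1, by rw [h.injective hxy]⟩⟩⟩
  obtain ⟨p, q, hq, hz⟩ := h.frac z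
  exact ⟨(p, ⟨q, hq⟩), hz⟩

lemma IsCoord.isIntegrallyClosed [IsDomain R] (h : IsCoord c) : IsIntegrallyClosed R := by
  let := (aeval c : MvPolynomial (Fin 3) ℂ →ₐ[ℂ] R).toRingHom.toAlgebra
  have := h.isLocalization
  have hM : unitSubmonoid c ≤ nonZeroDivisors (MvPolynomial (Fin 3) ℂ) :=
    le_nonZeroDivisors_of_noZeroDivisors fun h0 ↦ by
      have h1 : IsUnit (aeval c (0 : MvPolynomial (Fin 3) ℂ)) := h0
      rw [map_zero] at h1
      exact not_isUnit_zero h1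
  exact isIntegrallyClosed_of_isLocalization R (unitSubmonoid c) hM

lemma IsCoord.formallySmooth (h : IsCoord c) :
    Algebra.FormallySmooth ℂ R ∧ Algebra.EssFiniteType ℂ R := by
  let := (aeval c : MvPolynomial (Fin 3) ℂ →ₐ[ℂ] R).toRingHom.toAlgebra
  have := h.isLocalization
  have : IsScalarTower ℂ (MvPolynomial (Fin 3) ℂ) R :=
    .of_algebraMap_eq' (aeval c : MvPolynomial (Fin 3) ℂ →ₐ[ℂ] R).comp_algebraMap.symm
  have : Algebra.FormallySmooth (MvPolynomial (Fin 3) ℂ) R :=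
    Algebra.FormallySmooth.of_isLocalization (unitSubmonoid c)
  have : Algebra.EssFiniteType (MvPolynomial (Fin 3) ℂ) R :=
    Algebra.EssFiniteType.of_isLocalization _ (unitSubmonoid c)
  exact ⟨Algebra.FormallySmooth.comp ℂ (MvPolynomial (Fin 3) ℂ) R,
    Algebra.EssFiniteType.comp ℂ (MvPolynomial (Fin 3) ℂ) R⟩

/-- A homomorphism on a coordinate ring can be prescribed on the coordinates, provided that it
makes units out of units. -/
lemma IsCoord.exists_lift (h : IsCoord c) {Q : Type} [CommRing Q] [Algebra ℂ Q] (v : Fin 3 → Q)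
    (hv : ∀ q : MvPolynomial (Fin 3) ℂ, IsUnit (aeval c q) → IsUnit (aeval v q)) :
    ∃ g : R →ₐ[ℂ] Q, ∀ p : MvPolynomial (Fin 3) ℂ, g (aeval c p) = aeval v p := by
  let := (aeval c : MvPolynomial (Fin 3) ℂ →ₐ[ℂ] R).toRingHom.toAlgebra
  have := h.isLocalization
  have : IsScalarTower ℂ (MvPolynomial (Fin 3) ℂ) R :=
    .of_algebraMap_eq' (aeval c : MvPolynomial (Fin 3) ℂ →ₐ[ℂ] R).comp_algebraMap.symm
  refine ⟨IsLocalization.liftAlgHom (M := unitSubmonoid c) (f := aeval v) fun y ↦ hv _ y.2,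
    fun p ↦ ?_⟩
  exact IsLocalization.lift_eq _ p

lemma isPrime_span_X_image (T : Set (Fin 3)) :
    (Ideal.span (X '' T : Set (MvPolynomial (Fin 3) ℂ))).IsPrime := by
  classical
  let ev : MvPolynomial (Fin 3) ℂ →ₐ[ℂ] MvPolynomial (Fin 3) ℂ :=
    aeval fun i ↦ if i ∈ T then 0 else X i
  have h1 : ∀ p, p - ev p ∈ Ideal.span (X '' T : Set (MvPolynomial (Fin 3) ℂ)) := by
    intro p
    induction p using MvPolynomial.induction_on with
    | C a => simp [ev]
    | add p q hp hq => rw [map_add, add_sub_add_comm]; exact add_mem hp hq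
    | mul_X p i hp =>
      have : p * X i - ev (p * X i) = (p - ev p) * X i + ev p * (X i - ev (X i)) := by
        rw [map_mul]; ring
      rw [this]
      refine add_mem (Ideal.mul_mem_right _ _ hp) (Ideal.mul_mem_left _ _ ?_)
      by_cases hi : i ∈ T
      · simpa [ev, hi] using Ideal.subset_span (Set.mem_image_of_mem X hi)
      · simp [ev, hi]
  have h2 : Ideal.span (X '' T : Set (MvPolynomial (Fin 3) ℂ)) = RingHom.ker ev := by
    apply le_antisymm
    · rw [Ideal.span_le]
      rintro _ ⟨i, hi, rfl⟩
      simp [ev, hi]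
    · intro p hp
      have := h1 p
      rwa [RingHom.mem_ker.mp hp, sub_zero] at this
  rw [h2]
  exact RingHom.ker_isPrime _

/-- The coordinate subspaces through the point are irreducible. -/
lemma IsCoord.isPrime_span [IsLocalRing R] (h : IsCoord c) (T : Set (Fin 3))
    (hT : ∀ i ∈ T, ¬ IsUnit (c i)) : (Ideal.span (c '' T)).IsPrime := by
  let := (aeval c : MvPolynomial (Fin 3) ℂ →ₐ[ℂ] R).toRingHom.toAlgebra
  have := h.isLocalization
  have hmap : (Ideal.span (X '' T : Set (MvPolynomial (Fin 3) ℂ))).map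
      (algebraMap (MvPolynomial (Fin 3) ℂ) R) = Ideal.span (c '' T) := by
    rw [Ideal.map_span, Set.image_image]
    congr 1
    refine Set.image_congr fun i _ ↦ aeval_X c i
  rw [← hmap]
  refine IsLocalization.isPrime_of_isPrime_disjoint (unitSubmonoid c) R _
    (isPrime_span_X_image T) ?_
  rw [Set.disjoint_left]
  intro q hq hq'
  have h1 : algebraMap (MvPolynomial (Fin 3) ℂ) R q ∈ Ideal.span (c '' T) :=
    hmap ▸ Ideal.mem_map_of_mem _ hq'
  have h2 : Ideal.span (c '' T) ≤ IsLocalRing.maximalIdeal R := by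
    rw [Ideal.span_le]
    rintro _ ⟨i, hi, rfl⟩
    exact (IsLocalRing.mem_maximalIdeal _).mpr (hT i hi)
  exact (IsLocalRing.mem_maximalIdeal _).mp (h2 h1) hq

lemma IsCoord.notMem_span [IsLocalRing R] (h : IsCoord c) (T : Set (Fin 3))
    (hT : ∀ i ∈ T, ¬ IsUnit (c i)) {j : Fin 3} (hj : j ∉ T) : c j ∉ Ideal.span (c '' T) := by
  classical
  intro hmem
  let := (aeval c : MvPolynomial (Fin 3) ℂ →ₐ[ℂ] R).toRingHom.toAlgebra
  have := h.isLocalization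
  have hmap : (Ideal.span (X '' T : Set (MvPolynomial (Fin 3) ℂ))).map
      (algebraMap (MvPolynomial (Fin 3) ℂ) R) = Ideal.span (c '' T) := by
    rw [Ideal.map_span, Set.image_image]
    congr 1
    refine Set.image_congr fun i _ ↦ aeval_X c i
  have h0 : (algebraMap (MvPolynomial (Fin 3) ℂ) R) (X j) = c j := aeval_X c j
  rw [← hmap, ← h0, IsLocalization.algebraMap_mem_map_algebraMap_iff (unitSubmonoid c)] at hmem
  obtain ⟨q, hq, hqX⟩ := hmem
  rcases (isPrime_span_X_image T).mem_or_mem hqX with h1 | h1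
  · have h3 : algebraMap (MvPolynomial (Fin 3) ℂ) R q ∈ Ideal.span (c '' T) :=
      hmap ▸ Ideal.mem_map_of_mem _ h1
    exact (h.isPrime_span T hT).ne_top (Ideal.eq_top_of_isUnit_mem _ h3 hq)
  · rw [mem_ideal_span_X_image] at h1
    obtain ⟨i, hi, h4⟩ := h1 (Finsupp.single j 1) (by simp [X])
    rw [Finsupp.single_apply_ne_zero] at h4
    exact hj (h4.1 ▸ hi)

end Coordinates

/-! ### The local rings of a double cover -/

section DoubleCover
open TensorProduct KaehlerDifferential IsLocalRing

variable {R S : Type} [CommRing R] [IsDomain R] [CommRing S] [IsDomain S] [Algebra R S]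

/-- Every element of `S` is a quotient of elements of `R[w]`. -/
def IsGeneratedBy (R : Type) {S : Type} [CommRing R] [CommRing S] [Algebra R S] (w : S) : Prop :=
  ∀ z : S, ∃ a b a' b' : R, IsUnit (algebraMap R S a' + algebraMap R S b' * w) ∧
    z * (algebraMap R S a' + algebraMap R S b' * w) = algebraMap R S a + algebraMap R S b * w

/-- `w` does not lie in the field of fractions of `R`. -/
def IsNonsplit (R : Type) {S : Type} [CommRing R] [CommRing S] [Algebra R S] (w : S) : Prop :=
  ∀ a b : R, algebraMap R S a + algebraMap R S b * w = 0 → b = 0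

/-- If `w ∈ Frac R` is integral over the normal domain `R`, then `w ∈ R`. -/
lemma exists_eq_algebraMap_of_not_isNonsplit [IsIntegrallyClosed R]
    (hinj : Function.Injective (algebraMap R S)) {w : S} {F : R} (hw : w ^ 2 = algebraMap R S F)
    (h : ¬ IsNonsplit R w) : ∃ r, w = algebraMap R S r := by
  rw [IsNonsplit] at h
  push Not at h
  obtain ⟨a, b, hab, hb⟩ := h
  have h1 : a ^ 2 = b ^ 2 * F := by
    apply hinj
    rw [map_mul, map_pow, map_pow, ← hw]
    linear_combination (algebraMap R S a - algebraMap R S b * w) * hab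
  obtain ⟨r, hr⟩ := (IsIntegrallyClosed.pow_dvd_pow_iff two_ne_zero).mp (Dvd.intro F h1.symm)
  refine ⟨-r, ?_⟩
  have hb' : algebraMap R S b ≠ 0 := (map_ne_zero_iff _ hinj).mpr hb
  apply mul_left_cancel₀ hb'
  rw [hr, map_mul] at hab
  rw [map_neg]
  linear_combination hab

/-- If `R` is normal and `F` is square-free, the elements of `Frac R + Frac R · √F` which are
integral over `R` are those of `R + R √F`. -/
lemma exists_eq_add_mul_of_isIntegral [IsIntegrallyClosed R] {t : R} (ht : 2 * t = 1)
    (hinj : Function.Injective (algebraMap R S)) {w : S} {F : R} (hw : w ^ 2 = algebraMap R S F)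
    (hF0 : F ≠ 0) (hF : ∀ d, F ∣ d ^ 2 → F ∣ d) {z : S} (hz : IsIntegral R z) {α β γ : R}
    (hγ : γ ≠ 0) (h : z * algebraMap R S γ = algebraMap R S α + algebraMap R S β * w) :
    ∃ a b : R, z = algebraMap R S a + algebraMap R S b * w := by
  let K := FractionRing R
  let L := FractionRing S
  have hinj' : Function.Injective (algebraMap R L) := by
    rw [IsScalarTower.algebraMap_eq R S L]
    exact (IsFractionRing.injective S L).comp hinj
  have : FaithfulSMul R L := (faithfulSMul_iff_algebraMap_injective R L).mpr hinj'
  let : Algebra K L := FractionRing.liftAlgebra R L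
  have : IsScalarTower R K L := FractionRing.isScalarTower_liftAlgebra R L
  have hS : Function.Injective (algebraMap S L) := IsFractionRing.injective S L
  have hK : Function.Injective (algebraMap R K) := IsFractionRing.injective R K
  have hKL : Function.Injective (algebraMap K L) := (algebraMap K L).injective
  have hSL (r : R) : algebraMap S L (algebraMap R S r) = algebraMap K L (algebraMap R K r) := by
    rw [← IsScalarTower.algebraMap_apply R S L, ← IsScalarTower.algebraMap_apply R K L]
  set zL := algebraMap S L z with hzL
  set wL := algebraMap S L w with hwL
  have hzint : IsIntegral R zL := hz.map (IsScalarTower.toAlgHom R S L)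
  have hγ' : algebraMap R K γ ≠ 0 := (map_ne_zero_iff _ hK).mpr hγ
  set a : K := algebraMap R K α / algebraMap R K γ with ha
  set b : K := algebraMap R K β / algebraMap R K γ with hb
  have hzab : zL = algebraMap K L a + algebraMap K L b * wL := by
    have hγL : algebraMap K L (algebraMap R K γ) ≠ 0 := (map_ne_zero_iff _ hKL).mpr hγ'
    have h1 := congrArg (algebraMap S L) h
    simp only [map_mul, map_add, hSL] at h1
    rw [ha, hb, map_div₀, map_div₀, div_mul_eq_mul_div, ← add_div, eq_div_iff hγL]
    exact h1
  have hwF : wL ^ 2 = algebraMap K L (algebraMap R K F) := by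
    rw [hwL, ← map_pow, hw, hSL]
  -- an integral element of `K` belongs to `R`
  have hfrac (y : K) (hy : zL = algebraMap K L y) : ∃ r, z = algebraMap R S r := by
    have h1 : IsIntegral R y := by
      rw [hy] at hzint
      exact (isIntegral_algebraMap_iff hKL).mp hzint
    obtain ⟨r, hr⟩ := IsIntegrallyClosed.isIntegral_iff.mp h1
    exact ⟨r, hS (by rw [hSL, hr, ← hy])⟩
  by_cases hzK : zL ∈ (algebraMap K L).range
  · obtain ⟨y, hy⟩ := hzK
    obtain ⟨r, hr⟩ := hfrac y hy.symm
    exact ⟨r, 0, by simp [hr]⟩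
  -- otherwise `X² - 2 a X + a² - b² F` is the minimal polynomial of `z`
  obtain ⟨a₁, ha₁⟩ : ∃ a₁ : K, a₁ = -(a + a) := ⟨_, rfl⟩
  obtain ⟨a₀, ha₀⟩ : ∃ a₀ : K, a₀ = a * a - b * b * algebraMap R K F := ⟨_, rfl⟩
  let p : Polynomial K := Polynomial.X ^ 2 + Polynomial.C a₁ * Polynomial.X + Polynomial.C a₀
  have hpdeg : p.natDegree = 2 := by simp only [p]; compute_degree!
  have hpmon : p.Monic := by simp only [p]; monicity!
  have hpz : Polynomial.aeval zL p = 0 := by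
    simp only [p, map_add, map_mul, map_pow, Polynomial.aeval_X, Polynomial.aeval_C]
    rw [ha₁, ha₀, map_neg, map_add, map_sub, map_mul (algebraMap K L) a a,
      map_mul (algebraMap K L) (b * b), map_mul (algebraMap K L) b b, ← hwF, hzab]
    ring
  have hintK : IsIntegral K zL := hzint.tower_top
  have hmin : p = minpoly K zL := by
    refine Polynomial.eq_of_monic_of_dvd_of_natDegree_le (minpoly.monic hintK) hpmon
      (minpoly.dvd K zL hpz) ?_
    rw [hpdeg]
    exact (minpoly.two_le_natDegree_iff hintK).mpr hzK
  rw [minpoly.isIntegrallyClosed_eq_field_fractions' K hzint] at hmin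
  have h1 := congrArg (fun q ↦ Polynomial.coeff q 1) hmin
  have h0 := congrArg (fun q ↦ Polynomial.coeff q 0) hmin
  simp only [Polynomial.coeff_map] at h1 h0
  have hp1 : p.coeff 1 = -2 * a := by
    rw [show -2 * a = a₁ by rw [ha₁]; ring]
    simp [p]
  have hp0 : p.coeff 0 = a ^ 2 - b ^ 2 * algebraMap R K F := by
    rw [show a ^ 2 - b ^ 2 * algebraMap R K F = a₀ by rw [ha₀]; ring]
    simp [p]
  rw [hp1] at h1
  rw [hp0] at h0
  set m := minpoly R zL
  have ha' : a = algebraMap R K (-t * m.coeff 1) := by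
    have : (2 : K) * algebraMap R K t = 1 := by rw [← map_ofNat (algebraMap R K) 2, ← map_mul, ht, map_one]
    rw [map_mul, ← h1, map_neg]
    linear_combination -a * this
  set n : R := (-t * m.coeff 1) ^ 2 - m.coeff 0 with hn
  have hbF : b ^ 2 * algebraMap R K F = algebraMap R K n := by
    rw [hn, map_sub, map_pow, ← ha', ← h0]; ring
  have hd : IsIntegral R (b * algebraMap R K F) := by
    refine IsIntegral.of_pow (n := 2) two_pos ?_
    rw [show (b * algebraMap R K F) ^ 2 = algebraMap R K (n * F) by rw [map_mul, ← hbF]; ring]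
    exact isIntegral_algebraMap
  obtain ⟨d, hd⟩ := IsIntegrallyClosed.isIntegral_iff.mp hd
  obtain ⟨e, he⟩ := hF d ⟨n, hK (by rw [map_pow, hd, map_mul, ← hbF]; ring)⟩
  have hbe : b = algebraMap R K e := by
    apply mul_right_cancel₀ ((map_ne_zero_iff _ hK).mpr hF0)
    rw [← hd, he, map_mul, mul_comm]
  refine ⟨-t * m.coeff 1, e, hS ?_⟩
  rw [ha', hbe, ← hSL, ← hSL, hwL, ← map_mul (algebraMap S L), ← map_add (algebraMap S L)] at hzab
  exact hzab

/-- If the double cover is normal and finite over `R`, up to localization, and `F` is square-free,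
its local ring is a localization of `R[√F]`. -/
lemma isGeneratedBy_of_forall_isIntegral [IsIntegrallyClosed R] {t : R} (ht : 2 * t = 1)
    (hinj : Function.Injective (algebraMap R S)) {w : S} {F : R} (hw : w ^ 2 = algebraMap R S F)
    (hF0 : F ≠ 0) (hF : ∀ d, F ∣ d ^ 2 → F ∣ d)
    (hfrac : ∀ z : S, ∃ α β γ : R, γ ≠ 0 ∧
      z * algebraMap R S γ = algebraMap R S α + algebraMap R S β * w)
    (hint : ∀ z : S, ∃ b s : S, IsIntegral R b ∧ IsIntegral R s ∧ IsUnit s ∧ z * s = b) :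
    IsGeneratedBy R w := by
  intro z
  obtain ⟨b, s, hb, hs, hsu, hz⟩ := hint z
  obtain ⟨α, β, γ, hγ, h⟩ := hfrac b
  obtain ⟨α', β', γ', hγ', h'⟩ := hfrac s
  obtain ⟨a, b', rfl⟩ := exists_eq_add_mul_of_isIntegral ht hinj hw hF0 hF hb hγ h
  obtain ⟨a', b'', rfl⟩ := exists_eq_add_mul_of_isIntegral ht hinj hw hF0 hF hs hγ' h'
  exact ⟨a, b', a', b'', hsu, hz⟩

end DoubleCover

/-! ### Smoothness of double covers -/

section CoverSmooth
open TensorProduct KaehlerDifferential IsLocalRing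

lemma IsCoord.algHom_ext {R : Type} [CommRing R] [Algebra ℂ R] {c : Fin 3 → R} (h : IsCoord c)
    {Q : Type} [CommRing Q] [Algebra ℂ Q] {f g : R →ₐ[ℂ] Q} (hfg : ∀ i, f (c i) = g (c i)) :
    f = g := by
  ext z
  obtain ⟨p, q, hq, hz⟩ := h.frac z
  have key (p : MvPolynomial (Fin 3) ℂ) : f (aeval c p) = g (aeval c p) := by
    have : f.comp (aeval c) = g.comp (aeval c) := MvPolynomial.algHom_ext fun i ↦ by simpa using hfg i
    exact DFunLike.congr_fun this p
  have h1 := congrArg f hz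
  have h2 := congrArg g hz
  rw [map_mul, key, key, ← h2, map_mul] at h1
  exact (hq.map g).mul_right_cancel h1

variable {R S P L : Type} [CommRing R] [CommRing S] [Algebra R S] [CommRing P] [CommRing L]
  [Algebra (Polynomial R) P] [Algebra S L] [Algebra P L]

/-- The local ring `L` of the double cover at `𝔭` is a quotient of the local ring `P` of the affine
line over `R`, at the image of `𝔭`. -/
lemma surjective_of_isGeneratedBy {w : S} (hw : IsGeneratedBy R w) (𝔭 : Ideal S) [𝔭.IsPrime]
    [IsLocalization.AtPrime P (𝔭.comap (Polynomial.aeval (R := R) w))]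
    [IsLocalization.AtPrime L 𝔭]
    (hPL : ∀ p, algebraMap P L (algebraMap (Polynomial R) P p) =
      algebraMap S L (Polynomial.aeval w p)) : Function.Surjective (algebraMap P L) := by
  have key (z : S) : ∃ p q : Polynomial R, IsUnit (Polynomial.aeval w q) ∧
      z * Polynomial.aeval w q = Polynomial.aeval w p := by
    obtain ⟨a, b, a', b', hu, h⟩ := hw z
    exact ⟨.C a + .C b * .X, .C a' + .C b' * .X, by simpa using hu, by simpa using h⟩
  intro x
  obtain ⟨⟨z, s⟩, hx⟩ := IsLocalization.surj 𝔭.primeCompl x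
  obtain ⟨p, q, hq, hz⟩ := key z
  obtain ⟨p', q', hq', hs⟩ := key s
  have hsu : IsUnit (algebraMap S L s) := IsLocalization.map_units L s
  have hden : q * p' ∈ (𝔭.comap (Polynomial.aeval (R := R) w)).primeCompl := by
    change ¬ Polynomial.aeval w (q * p') ∈ 𝔭
    rw [map_mul, ← hs]
    intro hcon
    rcases ‹𝔭.IsPrime›.mem_or_mem hcon with h | h
    · exact ‹𝔭.IsPrime›.ne_top (𝔭.eq_top_of_isUnit_mem h hq)
    · rcases ‹𝔭.IsPrime›.mem_or_mem h with h | h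
      · exact s.2 h
      · exact ‹𝔭.IsPrime›.ne_top (𝔭.eq_top_of_isUnit_mem h hq')
  have hu : IsUnit (algebraMap P L (algebraMap (Polynomial R) P (q * p'))) :=
    (IsLocalization.map_units P ⟨_, hden⟩).map _
  refine ⟨IsLocalization.mk' P (p * q') (⟨q * p', hden⟩ :
    (𝔭.comap (Polynomial.aeval (R := R) w)).primeCompl), ?_⟩
  apply hu.mul_right_cancel
  rw [← map_mul, IsLocalization.mk'_spec, hPL, hPL]
  have hx' : x * algebraMap S L s = algebraMap S L z := hx
  rw [map_mul (Polynomial.aeval w), map_mul (Polynomial.aeval w), ← hz, ← hs]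
  simp only [map_mul, ← hx']
  ring

/-- As a quotient of the local ring `P` of the affine line over `R`, the local ring `L` of the
double cover is given by the single equation `X² = F`. -/
lemma ker_of_isNonsplit [IsDomain R] [IsDomain S] {w : S} {F : R} (hinj : Function.Injective (algebraMap R S))
    (hwF : w ^ 2 = algebraMap R S F) (hw : IsNonsplit R w) (𝔭 : Ideal S) [𝔭.IsPrime]
    [IsLocalization.AtPrime P (𝔭.comap (Polynomial.aeval (R := R) w))]
    [IsLocalization.AtPrime L 𝔭]
    (hPL : ∀ p, algebraMap P L (algebraMap (Polynomial R) P p) =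
      algebraMap S L (Polynomial.aeval w p)) :
    RingHom.ker (algebraMap P L) =
      Ideal.span {algebraMap (Polynomial R) P (.X ^ 2 - .C F)} := by
  have hSL : Function.Injective (algebraMap S L) :=
    IsLocalization.injective L 𝔭.primeCompl_le_nonZeroDivisors
  have key (p : Polynomial R) (hp : Polynomial.aeval w p = 0) :
      (.X ^ 2 - .C F : Polynomial R) ∣ p := by
    have hm : (.X ^ 2 - .C F : Polynomial R).Monic := Polynomial.monic_X_pow_sub_C F two_ne_zero
    have h1 := Polynomial.modByMonic_add_div p (.X ^ 2 - .C F : Polynomial R)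
    set r := p %ₘ (.X ^ 2 - .C F : Polynomial R)
    have hr : r.degree < 2 := (Polynomial.degree_modByMonic_lt p hm).trans_le
      (by rw [Polynomial.degree_X_pow_sub_C two_pos F]; rfl)
    have hr' : r.natDegree ≤ 1 := Polynomial.natDegree_le_of_degree_le (Order.lt_succ_iff.mp hr)
    rw [Polynomial.eq_X_add_C_of_natDegree_le_one hr'] at h1
    have h2 := congrArg (Polynomial.aeval w) h1
    simp only [map_add, map_mul, map_sub, map_pow, Polynomial.aeval_C, Polynomial.aeval_X, hp,
      hwF, sub_self, zero_mul, add_zero] at h2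
    have hb := hw _ _ (by rw [add_comm]; exact h2)
    rw [hb, map_zero, zero_mul, zero_add] at h2
    have ha := (map_eq_zero_iff _ hinj).mp h2
    rw [hb, ha, map_zero, zero_mul, zero_add, zero_add] at h1
    exact ⟨_, h1.symm⟩
  apply le_antisymm
  · intro x hx
    obtain ⟨⟨p, q⟩, hpq⟩ := IsLocalization.surj
      (𝔭.comap (Polynomial.aeval (R := R) w)).primeCompl x
    have h1 := congrArg (algebraMap P L) hpq
    rw [map_mul, (RingHom.mem_ker).mp hx, zero_mul, hPL] at h1
    obtain ⟨k, hk⟩ := key p ((map_eq_zero_iff _ hSL).mp h1.symm)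
    rw [Ideal.mem_span_singleton]
    have h2 : algebraMap (Polynomial R) P (.X ^ 2 - .C F) ∣ x * algebraMap (Polynomial R) P q := by
      rw [hpq]
      exact map_dvd _ ⟨k, hk⟩
    exact (IsLocalization.map_units P q).dvd_mul_right.mp h2
  · rw [Ideal.span_le, Set.singleton_subset_iff, SetLike.mem_coe, RingHom.mem_ker, hPL]
    simp [hwF]

variable {c : Fin 3 → R} [Algebra ℂ R] [Algebra ℂ S] [IsScalarTower ℂ R S]

/-- The double cover is singular over the common zeros of two factors of the branch divisor: there
the differential of `X² - a b` vanishes. -/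
lemma not_formallySmooth_of_mul [IsDomain R] [IsDomain S] {w : S} {F a b : R} (hc : IsCoord c)
    (hinj : Function.Injective (algebraMap R S)) (hwF : w ^ 2 = algebraMap R S F)
    (hw : IsNonsplit R w) (hgen : IsGeneratedBy R w) (𝔭 : Ideal S) [𝔭.IsPrime]
    (hF : F = a * b) (ha : algebraMap R S a ∈ 𝔭) (hb : algebraMap R S b ∈ 𝔭) :
    ¬ Algebra.FormallySmooth ℂ (Localization.AtPrime 𝔭) := by
  let 𝔮 := 𝔭.comap (Polynomial.aeval (R := R) w)
  let P := Localization.AtPrime 𝔮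
  let L := Localization.AtPrime 𝔭
  let f : P →+* L := Localization.localRingHom 𝔮 𝔭 (Polynomial.aeval (R := R) w).toRingHom rfl
  let : Algebra P L := f.toAlgebra
  have hPL : ∀ p, algebraMap P L (algebraMap (Polynomial R) P p) =
      algebraMap S L (Polynomial.aeval w p) :=
    fun p ↦ Localization.localRingHom_to_map 𝔮 𝔭 _ rfl p
  have : IsScalarTower ℂ P L := .of_algebraMap_eq fun z ↦ by
    rw [IsScalarTower.algebraMap_apply ℂ (Polynomial R) P, hPL,
      IsScalarTower.algebraMap_apply ℂ R (Polynomial R), Polynomial.algebraMap_eq,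
      Polynomial.aeval_C, ← IsScalarTower.algebraMap_apply ℂ R S,
      ← IsScalarTower.algebraMap_apply ℂ S L]
  obtain ⟨_, _⟩ := hc.formallySmooth
  have : Algebra.FormallySmooth ℂ (Polynomial R) := Algebra.FormallySmooth.comp ℂ R _
  have : Algebra.FormallySmooth (Polynomial R) P :=
    Algebra.FormallySmooth.of_isLocalization 𝔮.primeCompl
  have : Algebra.FormallySmooth ℂ P := Algebra.FormallySmooth.comp ℂ (Polynomial R) P
  have : Algebra.EssFiniteType ℂ (Polynomial R) := Algebra.EssFiniteType.comp ℂ R _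
  have : Algebra.EssFiniteType (Polynomial R) P :=
    Algebra.EssFiniteType.of_isLocalization _ 𝔮.primeCompl
  have : Algebra.EssFiniteType ℂ P := Algebra.EssFiniteType.comp ℂ (Polynomial R) P
  have : Module.Free P Ω[P⁄ℂ] := Module.free_of_flat_of_isLocalRing
  have hRP : Function.Injective (algebraMap (Polynomial R) P) :=
    IsLocalization.injective P 𝔮.primeCompl_le_nonZeroDivisors
  refine not_formallySmooth_of_tmul_D_eq_zero (P := P)
    (surjective_of_isGeneratedBy hgen 𝔭 hPL) (ker_of_isNonsplit hinj hwF hw 𝔭 hPL) ?_ ?_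
  · rw [Ne, map_eq_zero_iff _ hRP]
    exact (Polynomial.monic_X_pow_sub_C F two_ne_zero).ne_zero
  have hres (p : Polynomial R) (hp : Polynomial.aeval w p ∈ 𝔭) :
      algebraMap P (ResidueField L) (algebraMap (Polynomial R) P p) = 0 := by
    rw [IsScalarTower.algebraMap_apply P L (ResidueField L), hPL]
    exact (residue_eq_zero_iff _).mpr
      ((IsLocalization.AtPrime.to_map_mem_maximal_iff L 𝔭 _).mpr hp)
  -- the differential of a product vanishes where both factors do
  have hD (p q : Polynomial R) (hp : Polynomial.aeval w p ∈ 𝔭) (hq : Polynomial.aeval w q ∈ 𝔭) :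
      (1 : ResidueField L) ⊗ₜ[P] KaehlerDifferential.D ℂ P
        (algebraMap (Polynomial R) P (p * q)) = 0 := by
    rw [map_mul, Derivation.leibniz, TensorProduct.tmul_add, ← TensorProduct.smul_tmul,
      ← TensorProduct.smul_tmul, Algebra.smul_def, Algebra.smul_def, hres p hp, hres q hq]
    simp
  have hwp : w ∈ 𝔭 := ‹𝔭.IsPrime›.mem_of_pow_mem 2 (by
    rw [hwF, hF, map_mul]; exact 𝔭.mul_mem_right _ ha)
  have h1 := hD .X .X (by simpa using hwp) (by simpa using hwp)
  have h2 := hD (.C a) (.C b) (by simpa using ha) (by simpa using hb)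
  rw [show (.X ^ 2 - .C F : Polynomial R) = .X * .X - .C a * .C b by rw [hF, map_mul]; ring,
    map_sub, map_sub, TensorProduct.tmul_sub, h1, h2, sub_zero]

/-- The double cover is smooth outside the branch divisor, where `∂/∂X` does not annihilate `X² -
F`, and over the points where `F` is a coordinate `cⱼ` times a unit, where `∂/∂cⱼ` does not. -/
lemma formallySmooth_of_mul [IsDomain R] [IsDomain S] {w : S} {F : R} (hc : IsCoord c)
    (hinj : Function.Injective (algebraMap R S)) (hwF : w ^ 2 = algebraMap R S F)
    (hw : IsNonsplit R w) (hgen : IsGeneratedBy R w) (𝔭 : Ideal S) [𝔭.IsPrime]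
    (hF : algebraMap R S F ∉ 𝔭 ∨ ∃ j b, F = c j * b ∧ algebraMap R S (c j) ∈ 𝔭 ∧
      algebraMap R S b ∉ 𝔭) :
    Algebra.FormallySmooth ℂ (Localization.AtPrime 𝔭) := by
  let 𝔮 := 𝔭.comap (Polynomial.aeval (R := R) w)
  let P := Localization.AtPrime 𝔮
  let L := Localization.AtPrime 𝔭
  let f : P →+* L := Localization.localRingHom 𝔮 𝔭 (Polynomial.aeval (R := R) w).toRingHom rfl
  let : Algebra P L := f.toAlgebra
  have hPL : ∀ p, algebraMap P L (algebraMap (Polynomial R) P p) =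
      algebraMap S L (Polynomial.aeval w p) :=
    fun p ↦ Localization.localRingHom_to_map 𝔮 𝔭 _ rfl p
  have : IsScalarTower ℂ P L := .of_algebraMap_eq fun z ↦ by
    rw [IsScalarTower.algebraMap_apply ℂ (Polynomial R) P, hPL,
      IsScalarTower.algebraMap_apply ℂ R (Polynomial R), Polynomial.algebraMap_eq,
      Polynomial.aeval_C, ← IsScalarTower.algebraMap_apply ℂ R S,
      ← IsScalarTower.algebraMap_apply ℂ S L]
  obtain ⟨_, _⟩ := hc.formallySmooth
  have : Algebra.FormallySmooth ℂ (Polynomial R) := Algebra.FormallySmooth.comp ℂ R _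
  have : Algebra.FormallySmooth (Polynomial R) P :=
    Algebra.FormallySmooth.of_isLocalization 𝔮.primeCompl
  have : Algebra.FormallySmooth ℂ P := Algebra.FormallySmooth.comp ℂ (Polynomial R) P
  have : Algebra.EssFiniteType ℂ (Polynomial R) := Algebra.EssFiniteType.comp ℂ R _
  have : Algebra.EssFiniteType (Polynomial R) P :=
    Algebra.EssFiniteType.of_isLocalization _ 𝔮.primeCompl
  have : Algebra.EssFiniteType ℂ P := Algebra.EssFiniteType.comp ℂ (Polynomial R) P
  have : Module.Free P Ω[P⁄ℂ] := Module.free_of_flat_of_isLocalRing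
  let K := ResidueField L
  let res : S →ₐ[ℂ] K := IsScalarTower.toAlgHom ℂ S K
  have hres (z : S) : res z = 0 ↔ z ∈ 𝔭 := by
    change algebraMap S K z = 0 ↔ _
    rw [IsScalarTower.algebraMap_apply S L K]
    exact (residue_eq_zero_iff _).trans (IsLocalization.AtPrime.to_map_mem_maximal_iff L 𝔭 z)
  have hPK (p : Polynomial R) : algebraMap P K (algebraMap (Polynomial R) P p) =
      res (Polynomial.aeval w p) := by
    rw [IsScalarTower.algebraMap_apply P L K, hPL]
    exact (IsScalarTower.algebraMap_apply S L K _).symm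
  let resR : R →ₐ[ℂ] K := res.comp (IsScalarTower.toAlgHom ℂ R S)
  have hresR (r : R) : resR r = res (algebraMap R S r) := rfl
  -- an infinitesimal motion of the point in the space with the coordinates `c` and `X`
  have key (v : Fin 3 → K) (e : K) : ∃ (g₀ : R →ₐ[ℂ] DualNumber K) (g : P →ₐ[ℂ] DualNumber K),
      (∀ r, (g₀ r).fst = resR r) ∧ (∀ i, (g₀ (c i)).snd = v i) ∧
      (∀ p, (g p).fst = algebraMap P K p) ∧
      (∀ r, g (algebraMap (Polynomial R) P (.C r)) = g₀ r) ∧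
      (g (algebraMap (Polynomial R) P .X)).snd = e := by
    let V : Fin 3 → DualNumber K := fun i ↦ TrivSqZeroExt.inl (resR (c i)) + TrivSqZeroExt.inr (v i)
    have hV (q : MvPolynomial (Fin 3) ℂ) : (aeval V q).fst = resR (aeval c q) := by
      have : (TrivSqZeroExt.fstHom ℂ K K).comp (aeval V) = resR.comp (aeval c) :=
        MvPolynomial.algHom_ext fun i ↦ by simp [V]
      exact DFunLike.congr_fun this q
    obtain ⟨g₀, hg₀⟩ := hc.exists_lift V fun q hq ↦ by
      rw [TrivSqZeroExt.isUnit_iff_isUnit_fst, hV]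
      exact hq.map resR
    have hg₀c (i : Fin 3) : g₀ (c i) = V i := by simpa using hg₀ (X i)
    have hg₀' (r : R) : (g₀ r).fst = resR r := by
      have : (TrivSqZeroExt.fstHom ℂ K K).comp g₀ = resR :=
        hc.algHom_ext fun i ↦ by simp [hg₀c, V]
      exact DFunLike.congr_fun this r
    let g₁ : Polynomial R →ₐ[ℂ] DualNumber K :=
      { Polynomial.eval₂RingHom g₀.toRingHom
          (TrivSqZeroExt.inl (res w) + TrivSqZeroExt.inr e) with
        commutes' := fun z ↦ by
          rw [IsScalarTower.algebraMap_apply ℂ R (Polynomial R)]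
          simp }
    have hg₁C (r : R) : g₁ (.C r) = g₀ r := by simp [g₁]
    have hg₁X : g₁ .X = TrivSqZeroExt.inl (res w) + TrivSqZeroExt.inr e := by simp [g₁]
    have hg₁ (p : Polynomial R) : (g₁ p).fst = res (Polynomial.aeval w p) := by
      have : ((TrivSqZeroExt.fstHom ℂ K K).comp g₁).toRingHom =
          res.toRingHom.comp (Polynomial.aeval (R := R) w).toRingHom := by
        refine Polynomial.ringHom_ext (fun r ↦ ?_) ?_
        · change (g₁ (.C r)).fst = res (Polynomial.aeval w (.C r))
          rw [hg₁C, hg₀', hresR, Polynomial.aeval_C]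
        · change (g₁ .X).fst = res (Polynomial.aeval w .X)
          rw [hg₁X, Polynomial.aeval_X]
          simp
      exact DFunLike.congr_fun this p
    have hunit (y : 𝔮.primeCompl) : IsUnit (g₁ y) := by
      rw [TrivSqZeroExt.isUnit_iff_isUnit_fst, hg₁, isUnit_iff_ne_zero, Ne, hres]
      exact y.2
    let g : P →ₐ[ℂ] DualNumber K := IsLocalization.liftAlgHom (M := 𝔮.primeCompl) hunit
    have hg (p : Polynomial R) : g (algebraMap (Polynomial R) P p) = g₁ p :=
      IsLocalization.lift_eq _ p
    refine ⟨g₀, g, hg₀', fun i ↦ by simp [hg₀c, V], fun p ↦ ?_, fun r ↦ by rw [hg, hg₁C], ?_⟩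
    · have : (TrivSqZeroExt.fstHom ℂ K K).toRingHom.comp g.toRingHom = algebraMap P K := by
        refine IsLocalization.ringHom_ext 𝔮.primeCompl (RingHom.ext fun p ↦ ?_)
        change (g (algebraMap (Polynomial R) P p)).fst = algebraMap P K (algebraMap _ P p)
        rw [hg, hg₁, hPK]
      exact DFunLike.congr_fun this p
    · rw [hg, hg₁X]
      simp
  have hwres : res w ^ 2 = resR F := by rw [← map_pow, hwF, hresR]
  rcases hF with hF | ⟨j, b, hFb, hj, hb⟩
  · obtain ⟨g₀, g, h1, h2, h3, h4, h5⟩ := key 0 1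
    have hz : g₀ F = TrivSqZeroExt.inl (resR F) := by
      have : g₀ = (TrivSqZeroExt.inlAlgHom ℂ K K).comp resR := by
        refine hc.algHom_ext fun i ↦ TrivSqZeroExt.ext ?_ ?_
        · rw [h1]; rfl
        · rw [h2]; rfl
      rw [this]; rfl
    refine formallySmooth_of_dualNumber (P := P)
      (surjective_of_isGeneratedBy hgen 𝔭 hPL) (ker_of_isNonsplit hinj hwF hw 𝔭 hPL) g h3 ?_
    have hX : (g (algebraMap (Polynomial R) P .X)).fst = res w := by
      rw [h3, hPK, Polynomial.aeval_X]
    rw [map_sub, map_pow, map_sub, map_pow, h4, hz]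
    simp only [TrivSqZeroExt.snd_sub, TrivSqZeroExt.snd_inl, sub_zero, TrivSqZeroExt.snd_pow,
      h5, hX]
    have h0 : res w ≠ 0 := by
      intro h0
      rw [h0, zero_pow two_ne_zero] at hwres
      exact hF ((hres _).mp hwres.symm)
    have h2 : (2 : K) ≠ 0 := by
      rw [← map_ofNat (algebraMap ℂ K) 2]
      exact (map_ne_zero _).mpr two_ne_zero
    simpa using ⟨h2, h0⟩
  · obtain ⟨g₀, g, h1, h2, h3, h4, h5⟩ := key (fun _ ↦ 1) 0
    refine formallySmooth_of_dualNumber (P := P)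
      (surjective_of_isGeneratedBy hgen 𝔭 hPL) (ker_of_isNonsplit hinj hwF hw 𝔭 hPL) g h3 ?_
    rw [map_sub, map_pow, map_sub, map_pow, h4, hFb, map_mul]
    have h0 : (g₀ (c j)).fst = 0 := by rw [h1, hresR, hres]; exact hj
    have h0' : (g₀ b).fst ≠ 0 := by rw [h1, hresR, Ne, hres]; exact hb
    simp only [TrivSqZeroExt.snd_sub, TrivSqZeroExt.snd_pow, h5, TrivSqZeroExt.snd_mul, h0, h2]
    simpa using h0'

/-- If `w` lies in `R`, the double cover is trivial. -/
lemma formallySmooth_of_mem_range [IsLocalHom (algebraMap R S)] {r : R} (hc : IsCoord c)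
    (hinj : Function.Injective (algebraMap R S)) (hgen : IsGeneratedBy R (algebraMap R S r))
    (𝔭 : Ideal S) [𝔭.IsPrime] :
    Algebra.FormallySmooth ℂ (Localization.AtPrime 𝔭) := by
  have hsurj : Function.Surjective (algebraMap R S) := by
    intro z
    obtain ⟨a, b, a', b', hu, h⟩ := hgen z
    rw [← map_mul, ← map_add] at hu
    obtain ⟨u, hu'⟩ := (isUnit_of_map_unit (algebraMap R S) _ hu).exists_right_inv
    refine ⟨(a + b * r) * u, ?_⟩
    rw [map_mul, map_add, map_mul, ← h, ← map_mul, ← map_add, mul_assoc, ← map_mul, hu', map_one,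
      mul_one]
  have := hc.formallySmooth.1
  have : Algebra.FormallySmooth ℂ S := Algebra.FormallySmooth.of_equiv
    (AlgEquiv.ofBijective (IsScalarTower.toAlgHom ℂ R S) ⟨hinj, hsurj⟩)
  have : Algebra.FormallySmooth S (Localization.AtPrime 𝔭) :=
    Algebra.FormallySmooth.of_isLocalization 𝔭.primeCompl
  exact Algebra.FormallySmooth.comp ℂ S _

end CoverSmooth

/-! ### The singular locus of a double cover -/

section SingularIdeal
set_option linter.unusedSectionVars false
open IsLocalRing

variable {R S : Type} [CommRing R] [IsDomain R] [IsLocalRing R] [Algebra ℂ R] {c : Fin 3 → R}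

lemma IsCoord.prime (hc : IsCoord c) {i : Fin 3} (hi : ¬ IsUnit (c i)) : Prime (c i) := by
  have h0 : c i ≠ 0 := by
    intro h0
    refine X_ne_zero (R := ℂ) i (hc.injective ?_)
    rw [aeval_X, h0, map_zero]
  rw [← Ideal.span_singleton_prime h0]
  simpa using hc.isPrime_span {i} (by simpa using hi)

lemma IsCoord.not_dvd (hc : IsCoord c) {i j : Fin 3} (hi : ¬ IsUnit (c i)) (hij : j ≠ i) :
    ¬ c i ∣ c j := by
  have := hc.notMem_span {i} (by simpa using hi) (j := j) (by simpa using hij)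
  rwa [Set.image_singleton, Ideal.mem_span_singleton] at this

lemma IsCoord.not_dvd_prod (hc : IsCoord c) {T : Finset (Fin 3)} {g : R} (hg : IsUnit g)
    {i : Fin 3} (hi : ¬ IsUnit (c i)) (hiT : i ∉ T) : ¬ c i ∣ g * ∏ j ∈ T, c j := by
  intro h
  rw [hg.dvd_mul_left, (hc.prime hi).dvd_finsetProd_iff] at h
  obtain ⟨j, hj, hd⟩ := h
  exact hc.not_dvd hi (fun e ↦ hiT (e ▸ hj)) hd

lemma IsCoord.prod_ne_zero (hc : IsCoord c) (T : Finset (Fin 3)) {g : R} (hg : IsUnit g) :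
    g * ∏ j ∈ T, c j ≠ 0 := by
  refine mul_ne_zero hg.ne_zero (Finset.prod_ne_zero_iff.mpr fun j _ h0 ↦ ?_)
  refine X_ne_zero (R := ℂ) j (hc.injective ?_)
  rw [aeval_X, h0, map_zero]

/-- A product of distinct coordinates is square-free. -/
lemma IsCoord.prod_dvd_of_dvd_sq (hc : IsCoord c) (T : Finset (Fin 3))
    (hT : ∀ i ∈ T, ¬ IsUnit (c i)) {g : R} (hg : IsUnit g) (d : R)
    (h : g * ∏ j ∈ T, c j ∣ d ^ 2) : g * ∏ j ∈ T, c j ∣ d := by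
  rw [hg.mul_left_dvd] at h ⊢
  induction T using Finset.induction_on with
  | empty => simp
  | insert i T hi ih =>
    rw [Finset.prod_insert hi] at h ⊢
    obtain ⟨e, rfl⟩ := ih (fun j hj ↦ hT j (Finset.mem_insert_of_mem hj))
      ((dvd_mul_left _ _).trans h)
    have hp := hc.prime (hT i (Finset.mem_insert_self i T))
    rw [mul_comm (c i)]
    refine mul_dvd_mul_left _ ?_
    refine (hp.dvd_or_dvd (hp.dvd_of_dvd_pow ((dvd_mul_right _ _).trans h))).resolve_left ?_
    intro h1
    exact hc.not_dvd_prod isUnit_one (hT i (Finset.mem_insert_self i T)) hi (by simpa using h1)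

variable [CommRing S] [IsDomain S] [Algebra R S]

/-- A nonempty product of distinct coordinates which vanish at the point, times a unit, has no
square root in the field of fractions. -/
lemma IsCoord.isNonsplit (hc : IsCoord c) {T : Finset (Fin 3)} (hT : ∀ i ∈ T, ¬ IsUnit (c i))
    (hTn : T.Nonempty) {g : R} (hg : IsUnit g) (hinj : Function.Injective (algebraMap R S)) {w : S}
    (hw : w ^ 2 = algebraMap R S (g * ∏ j ∈ T, c j)) : IsNonsplit R w := by
  by_contra hcon
  have := hc.isIntegrallyClosed
  obtain ⟨r, rfl⟩ := exists_eq_algebraMap_of_not_isNonsplit hinj hw hcon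
  rw [← map_pow] at hw
  have h1 := hinj hw
  obtain ⟨i, hi⟩ := hTn
  have hp := hc.prime (hT i hi)
  rw [← Finset.mul_prod_erase T c hi] at h1
  have h2 : c i ∣ r := hp.dvd_of_dvd_pow (n := 2)
    ⟨g * ∏ j ∈ T.erase i, c j, by rw [h1]; ring⟩
  obtain ⟨s, rfl⟩ := h2
  refine hc.not_dvd_prod hg (hT i hi) (Finset.notMem_erase i T) ⟨s ^ 2, ?_⟩
  apply mul_left_cancel₀ hp.ne_zero
  linear_combination -h1

variable [Algebra ℂ S] [IsScalarTower ℂ R S] [IsLocalRing S] [IsLocalHom (algebraMap R S)]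

/-- The double cover is singular exactly where two branch divisors meet. -/
lemma IsCoord.not_formallySmooth_iff (hc : IsCoord c) {T : Finset (Fin 3)}
    (hT : ∀ i ∈ T, ¬ IsUnit (c i)) {g : R} (hg : IsUnit g)
    (hinj : Function.Injective (algebraMap R S)) {w : S}
    (hw : w ^ 2 = algebraMap R S (g * ∏ j ∈ T, c j)) (hgen : IsGeneratedBy R w)
    (𝔭 : Ideal S) [h𝔭 : 𝔭.IsPrime] :
    ¬ Algebra.FormallySmooth ℂ (Localization.AtPrime 𝔭) ↔
      ∃ i ∈ T, ∃ j ∈ T, i ≠ j ∧ algebraMap R S (c i) ∈ 𝔭 ∧ algebraMap R S (c j) ∈ 𝔭 := by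
  have := hc.isIntegrallyClosed
  by_cases hns : IsNonsplit R w
  · constructor
    · intro hsm
      by_contra! hcon
      refine hsm (formallySmooth_of_mul hc hinj hw hns hgen 𝔭 ?_)
      have hgp : algebraMap R S g ∉ 𝔭 := fun h ↦
        h𝔭.ne_top (𝔭.eq_top_of_isUnit_mem h (hg.map _))
      by_cases hj : ∃ j ∈ T, algebraMap R S (c j) ∈ 𝔭
      · obtain ⟨j, hjT, hj⟩ := hj
        refine Or.inr ⟨j, g * ∏ i ∈ T.erase j, c i, ?_, hj, ?_⟩
        · rw [← Finset.mul_prod_erase T c hjT]; ring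
        · rw [map_mul, map_prod]
          intro h
          obtain ⟨i, hi, h⟩ := h𝔭.prod_mem_iff.mp ((h𝔭.mem_or_mem h).resolve_left hgp)
          rw [Finset.mem_erase] at hi
          exact hcon j hjT i hi.2 hi.1.symm hj h
      · left
        rw [map_mul, map_prod]
        intro h
        obtain ⟨i, hi, h⟩ := h𝔭.prod_mem_iff.mp ((h𝔭.mem_or_mem h).resolve_left hgp)
        exact hj ⟨i, hi, h⟩
    · rintro ⟨i, hi, j, hj, hij, h1, h2⟩
      refine not_formallySmooth_of_mul hc hinj hw hns hgen 𝔭 (a := c i)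
        (b := c j * (g * ∏ k ∈ (T.erase i).erase j, c k)) ?_ h1
        (by rw [map_mul]; exact 𝔭.mul_mem_right _ h2)
      rw [← Finset.mul_prod_erase T c hi, ← Finset.mul_prod_erase (T.erase i) c
        (Finset.mem_erase.mpr ⟨hij.symm, hj⟩)]
      ring
  · have hTe : T = ∅ := by
      by_contra hTe
      exact hns (hc.isNonsplit hT (Finset.nonempty_iff_ne_empty.mpr hTe) hg hinj hw)
    obtain ⟨r, rfl⟩ := exists_eq_algebraMap_of_not_isNonsplit hinj hw hns
    simp [hTe, formallySmooth_of_mem_range hc hinj hgen 𝔭]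

/-- The ideal of the preimage of the locus `c i = c j = 0`. -/
def pairIdeal (c : Fin 3 → R) (w : S) (i j : Fin 3) : Ideal S :=
  Ideal.span {algebraMap R S (c i), algebraMap R S (c j), w}

/-- Since `F` is in the ideal `(cᵢ, cⱼ)` of `R`, the ideal `pairIdeal c w i j` meets `R[w]` in `(cᵢ,
cⱼ) + R w`. -/
lemma add_mul_mem_pairIdeal_iff {w : S} {F : R} (hinj : Function.Injective (algebraMap R S))
    (hw : w ^ 2 = algebraMap R S F) (hns : IsNonsplit R w) (hgen : IsGeneratedBy R w)
    (hwu : ¬ IsUnit w) {i j : Fin 3} (hF : F ∈ Ideal.span {c i, c j}) (a b : R) :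
    algebraMap R S a + algebraMap R S b * w ∈ pairIdeal c w i j ↔ a ∈ Ideal.span {c i, c j} := by
  have hwmem : w ∈ pairIdeal c w i j := Ideal.subset_span (by simp)
  constructor
  · intro h
    have key : ∀ z ∈ pairIdeal c w i j, ∃ a b a' b' : R, a ∈ Ideal.span {c i, c j} ∧
        IsUnit (algebraMap R S a' + algebraMap R S b' * w) ∧
        z * (algebraMap R S a' + algebraMap R S b' * w) =
          algebraMap R S a + algebraMap R S b * w := by
      intro z hz
      induction hz using Submodule.span_induction with
      | zero => exact ⟨0, 0, 1, 0, zero_mem _, by simp, by simp⟩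
      | mem z hz =>
        rcases hz with rfl | rfl | rfl
        · exact ⟨c i, 0, 1, 0, Ideal.subset_span (by simp), by simp, by simp⟩
        · exact ⟨c j, 0, 1, 0, Ideal.subset_span (by simp), by simp, by simp⟩
        · exact ⟨0, 1, 1, 0, zero_mem _, by simp, by simp⟩
      | add x y _ _ hx hy =>
        obtain ⟨a, b, a', b', ha, hu, h⟩ := hx
        obtain ⟨p, q, p', q', hp, hu', h'⟩ := hy
        refine ⟨a * p' + b * q' * F + (p * a' + q * b' * F), a * q' + b * p' + (p * b' + q * a'),
          a' * p' + b' * q' * F, a' * q' + b' * p', ?_, ?_, ?_⟩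
        · exact add_mem (add_mem (Ideal.mul_mem_right _ _ ha) (Ideal.mul_mem_left _ _ hF))
            (add_mem (Ideal.mul_mem_right _ _ hp) (Ideal.mul_mem_left _ _ hF))
        · convert hu.mul hu' using 1
          simp only [map_add, map_mul, ← hw]
          ring
        · simp only [map_add, map_mul, ← hw]
          linear_combination (algebraMap R S p' + algebraMap R S q' * w) * h +
            (algebraMap R S a' + algebraMap R S b' * w) * h'
      | smul r x _ hx =>
        obtain ⟨a, b, a', b', ha, hu, h⟩ := hx
        obtain ⟨p, q, p', q', hu', h'⟩ := hgen r
        refine ⟨a * p + b * q * F, a * q + b * p,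
          a' * p' + b' * q' * F, a' * q' + b' * p', ?_, ?_, ?_⟩
        · exact add_mem (Ideal.mul_mem_right _ _ ha) (Ideal.mul_mem_left _ _ hF)
        · convert hu.mul hu' using 1
          simp only [map_add, map_mul, ← hw]
          ring
        · simp only [map_add, map_mul, ← hw, smul_eq_mul]
          linear_combination r * (algebraMap R S p' + algebraMap R S q' * w) * h +
            (algebraMap R S a + algebraMap R S b * w) * h'
    obtain ⟨p, q, p', q', hp, hu, h'⟩ := key _ h
    have h1 : algebraMap R S (a * p' + b * q' * F - p) +
        algebraMap R S (a * q' + b * p' - q) * w = 0 := by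
      simp only [map_add, map_sub, map_mul, ← hw]
      linear_combination h'
    have h2 := hns _ _ h1
    rw [h2, map_zero, zero_mul, add_zero, map_eq_zero_iff _ hinj] at h1
    have h3 : a * p' ∈ Ideal.span {c i, c j} := by
      rw [show a * p' = p - b * q' * F by linear_combination h1]
      exact sub_mem hp (Ideal.mul_mem_left _ _ hF)
    have h4 : IsUnit p' := by
      refine isUnit_of_map_unit (algebraMap R S) _ ?_
      have h5 : algebraMap R S q' * w ∈ maximalIdeal S :=
        Ideal.mul_mem_left _ _ ((mem_maximalIdeal w).mpr hwu)
      by_contra h6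
      exact (mem_maximalIdeal _).mp (add_mem ((mem_maximalIdeal _).mpr h6) h5) hu
    exact (Ideal.mul_unit_mem_iff_mem _ h4).mp h3
  · intro h
    refine add_mem ?_ (Ideal.mul_mem_left _ _ hwmem)
    obtain ⟨x, y, rfl⟩ := Ideal.mem_span_pair.mp h
    rw [map_add, map_mul, map_mul]
    exact add_mem (Ideal.mul_mem_left _ _ (Ideal.subset_span (by simp)))
      (Ideal.mul_mem_left _ _ (Ideal.subset_span (by simp)))

lemma isPrime_pairIdeal {w : S} {F : R} (hc : IsCoord c)
    (hinj : Function.Injective (algebraMap R S))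
    (hw : w ^ 2 = algebraMap R S F) (hns : IsNonsplit R w) (hgen : IsGeneratedBy R w)
    (hwu : ¬ IsUnit w) {i j : Fin 3} (hi : ¬ IsUnit (c i)) (hj : ¬ IsUnit (c j))
    (hF : F ∈ Ideal.span {c i, c j}) : (pairIdeal c w i j).IsPrime := by
  have hP : (Ideal.span {c i, c j}).IsPrime := by
    simpa [Set.image_pair] using hc.isPrime_span {i, j} (by
      rintro k (rfl | rfl)
      exacts [hi, hj])
  have hwmem : w ∈ pairIdeal c w i j := Ideal.subset_span (by simp)
  have hiff := add_mul_mem_pairIdeal_iff (c := c) hinj hw hns hgen hwu hF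
  refine ⟨fun h ↦ ?_, fun {x y} hxy ↦ ?_⟩
  · have h1 := (hiff 1 0).mp (h ▸ Submodule.mem_top)
    exact hP.ne_top ((Ideal.eq_top_iff_one _).mpr h1)
  · obtain ⟨a, b, a', b', hu, h⟩ := hgen x
    obtain ⟨p, q, p', q', hu', h'⟩ := hgen y
    rw [← Ideal.mul_unit_mem_iff_mem _ hu, ← Ideal.mul_unit_mem_iff_mem (x := y) _ hu', h, h',
      hiff, hiff]
    apply hP.mem_or_mem
    have h1 : algebraMap R S (a * p + b * q * F) + algebraMap R S (a * q + b * p) * w ∈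
        pairIdeal c w i j := by
      rw [show algebraMap R S (a * p + b * q * F) + algebraMap R S (a * q + b * p) * w =
        (algebraMap R S a + algebraMap R S b * w) * (algebraMap R S p + algebraMap R S q * w) by
          simp only [map_add, map_mul, ← hw]; ring, ← h, ← h',
        show x * (algebraMap R S a' + algebraMap R S b' * w) *
          (y * (algebraMap R S p' + algebraMap R S q' * w)) =
          x * y * ((algebraMap R S a' + algebraMap R S b' * w) *
          (algebraMap R S p' + algebraMap R S q' * w)) by ring]
      exact Ideal.mul_mem_right _ _ hxy
    rw [hiff] at h1
    exact (Submodule.add_mem_iff_left _ (Ideal.mul_mem_left _ _ hF)).mp h1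

/-- A radical ideal is determined by the primes which contain it. -/
lemma eq_of_forall_isPrime_le_iff {J : Ideal S} (hJ : J.IsRadical) {I : Ideal S} (hI : I.IsRadical)
    (h : ∀ 𝔭 : Ideal S, 𝔭.IsPrime → (J ≤ 𝔭 ↔ I ≤ 𝔭)) : J = I := by
  rw [← hJ.radical, ← hI.radical, Ideal.radical_eq_sInf, Ideal.radical_eq_sInf]
  congr 1
  ext 𝔭
  exact ⟨fun h1 ↦ ⟨(h 𝔭 h1.2).mp h1.1, h1.2⟩, fun h1 ↦ ⟨(h 𝔭 h1.2).mpr h1.1, h1.2⟩⟩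

lemma pairIdeal_le_iff {w : S} {F : R}
    (hw : w ^ 2 = algebraMap R S F) {i j : Fin 3} (hF : F ∈ Ideal.span {c i, c j})
    (𝔭 : Ideal S) (h𝔭 : 𝔭.IsPrime) : pairIdeal c w i j ≤ 𝔭 ↔
      algebraMap R S (c i) ∈ 𝔭 ∧ algebraMap R S (c j) ∈ 𝔭 := by
  rw [pairIdeal, Ideal.span_le]
  constructor
  · intro h
    exact ⟨h (by simp), h (by simp)⟩
  · rintro ⟨h1, h2⟩ z (rfl | rfl | rfl)
    · exact h1
    · exact h2
    · obtain ⟨x, y, rfl⟩ := Ideal.mem_span_pair.mp hF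
      refine h𝔭.mem_of_pow_mem 2 ?_
      rw [hw, map_add, map_mul, map_mul]
      exact add_mem (Ideal.mul_mem_left _ _ h1) (Ideal.mul_mem_left _ _ h2)

/-- The ideal of the singular locus of the double cover, when two branch divisors meet. -/
lemma eq_pairIdeal (hc : IsCoord c) {i j : Fin 3} (hij : i ≠ j)
    (hi : ¬ IsUnit (c i)) (hj : ¬ IsUnit (c j)) {g : R} (hg : IsUnit g)
    (hinj : Function.Injective (algebraMap R S)) {w : S}
    (hw : w ^ 2 = algebraMap R S (g * (c i * c j))) (hgen : IsGeneratedBy R w)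
    {J : Ideal S} (hJ : J.IsRadical) (hJp : ∀ 𝔭 : Ideal S, ∀ _ : 𝔭.IsPrime,
      (J ≤ 𝔭 ↔ ¬ Algebra.FormallySmooth ℂ (Localization.AtPrime 𝔭))) :
    J = pairIdeal c w i j := by
  have hT : ∀ k ∈ ({i, j} : Finset (Fin 3)), ¬ IsUnit (c k) := by
    simp only [Finset.mem_insert, Finset.mem_singleton]
    rintro k (rfl | rfl)
    exacts [hi, hj]
  have hw' : w ^ 2 = algebraMap R S (g * ∏ k ∈ ({i, j} : Finset (Fin 3)), c k) := by
    rw [hw, Finset.prod_pair hij]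
  have hns := hc.isNonsplit hT ⟨i, by simp⟩ hg hinj hw'
  have hF : g * (c i * c j) ∈ Ideal.span {c i, c j} := Ideal.mul_mem_left _ _
    (Ideal.mul_mem_right _ _ (Ideal.subset_span (by simp)))
  have hwu : ¬ IsUnit w := by
    intro h
    have h1 := isUnit_of_map_unit (algebraMap R S) _ (hw ▸ h.pow 2)
    exact hi (isUnit_of_mul_isUnit_left (isUnit_of_mul_isUnit_right h1))
  refine eq_of_forall_isPrime_le_iff hJ (isPrime_pairIdeal hc hinj hw hns hgen hwu hi hj hF).isRadical ?_
  intro 𝔭 h𝔭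
  rw [hJp 𝔭 h𝔭, hc.not_formallySmooth_iff hT hg hinj hw' hgen, pairIdeal_le_iff hw hF 𝔭 h𝔭]
  constructor
  · rintro ⟨k, hk, l, hl, hkl, h1, h2⟩
    simp only [Finset.mem_insert, Finset.mem_singleton] at hk hl
    rcases hk with rfl | rfl <;> rcases hl with rfl | rfl
    exacts [(hkl rfl).elim, ⟨h1, h2⟩, ⟨h2, h1⟩, (hkl rfl).elim]
  · rintro ⟨h1, h2⟩
    exact ⟨i, by simp, j, by simp, hij, h1, h2⟩

/-- The ideal of the singular locus of the double cover, when three branch divisors meet. -/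
lemma eq_tripleIdeal (hc : IsCoord c) (hu : ∀ i, ¬ IsUnit (c i)) {g : R} (hg : IsUnit g)
    (hinj : Function.Injective (algebraMap R S)) {w : S}
    (hw : w ^ 2 = algebraMap R S (g * (c 0 * c 1 * c 2))) (hgen : IsGeneratedBy R w)
    {J : Ideal S} (hJ : J.IsRadical) (hJp : ∀ 𝔭 : Ideal S, ∀ _ : 𝔭.IsPrime,
      (J ≤ 𝔭 ↔ ¬ Algebra.FormallySmooth ℂ (Localization.AtPrime 𝔭))) :
    J = Ideal.span {w, algebraMap R S (c 0 * c 1), algebraMap R S (c 1 * c 2),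
      algebraMap R S (c 0 * c 2)} := by
  have hw' : w ^ 2 = algebraMap R S (g * ∏ k ∈ (Finset.univ : Finset (Fin 3)), c k) := by
    rw [hw, Fin.prod_univ_three]
  have hns := hc.isNonsplit (fun k _ ↦ hu k) ⟨0, by simp⟩ hg hinj hw'
  have hF (i j : Fin 3) : g * (c 0 * c 1 * c 2) ∈ Ideal.span {c i, c j} := by
    refine Ideal.mul_mem_left _ _ ?_
    have hi : c i ∈ Ideal.span {c i, c j} := Ideal.subset_span (by simp)
    fin_cases i
    · exact Ideal.mul_mem_right _ _ (Ideal.mul_mem_right _ _ hi)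
    · exact Ideal.mul_mem_right _ _ (Ideal.mul_mem_left _ _ hi)
    · exact Ideal.mul_mem_left _ _ hi
  have hwu : ¬ IsUnit w := by
    intro h
    have h1 := isUnit_of_map_unit (algebraMap R S) _ (hw ▸ h.pow 2)
    exact hu 2 (isUnit_of_mul_isUnit_right (isUnit_of_mul_isUnit_right h1))
  have hprime (i j : Fin 3) := isPrime_pairIdeal hc hinj hw hns hgen hwu (hu i) (hu j) (hF i j)
  have hJ' : J = pairIdeal c w 0 1 ⊓ pairIdeal c w 1 2 ⊓ pairIdeal c w 0 2 := by
    refine eq_of_forall_isPrime_le_iff hJ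
      (((hprime 0 1).isRadical.inf (hprime 1 2).isRadical).inf (hprime 0 2).isRadical) ?_
    intro 𝔭 h𝔭
    rw [hJp 𝔭 h𝔭, hc.not_formallySmooth_iff (fun k _ ↦ hu k) hg hinj hw' hgen, h𝔭.inf_le,
      h𝔭.inf_le, pairIdeal_le_iff hw (hF 0 1) 𝔭 h𝔭, pairIdeal_le_iff hw (hF 1 2) 𝔭 h𝔭,
      pairIdeal_le_iff hw (hF 0 2) 𝔭 h𝔭]
    constructor
    · rintro ⟨k, -, l, -, hkl, h1, h2⟩
      fin_cases k <;> fin_cases l <;> simp_all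
    · rintro ((⟨h1, h2⟩ | ⟨h1, h2⟩) | ⟨h1, h2⟩)
      exacts [⟨0, by simp, 1, by simp, by simp, h1, h2⟩, ⟨1, by simp, 2, by simp, by simp, h1, h2⟩,
        ⟨0, by simp, 2, by simp, by simp, h1, h2⟩]
  have hP (i j : Fin 3) : (Ideal.span {c i, c j}).IsPrime := by
    simpa [Set.image_pair] using hc.isPrime_span {i, j} (by
      rintro k (rfl | rfl)
      exacts [hu _, hu _])
  have hnot (i j k : Fin 3) (hi : k ≠ i) (hj : k ≠ j) : c k ∉ Ideal.span {c i, c j} := by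
    simpa [Set.image_pair] using hc.notMem_span {i, j} (by
      rintro k (rfl | rfl)
      exacts [hu _, hu _]) (j := k) (by simp [hi, hj])
  rw [hJ']
  apply le_antisymm
  · rintro z ⟨⟨h1, h2⟩, h3⟩
    obtain ⟨a, b, a', b', hu', h⟩ := hgen z
    have h1 := (Ideal.mul_unit_mem_iff_mem _ hu').mpr h1
    have h2 := (Ideal.mul_unit_mem_iff_mem _ hu').mpr h2
    have h3 := (Ideal.mul_unit_mem_iff_mem _ hu').mpr h3
    rw [h, add_mul_mem_pairIdeal_iff hinj hw hns hgen hwu (hF _ _)] at h1 h2 h3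
    rw [← Ideal.mul_unit_mem_iff_mem _ hu', h]
    obtain ⟨x, y, rfl⟩ := Ideal.mem_span_pair.mp h1
    have h4 : x ∈ Ideal.span {c 1, c 2} := by
      have h5 := (Submodule.add_mem_iff_left _ (Ideal.mul_mem_left _ y
        (Ideal.subset_span (by simp)))).mp h2
      exact ((hP 1 2).mem_or_mem h5).resolve_right (hnot 1 2 0 (by simp) (by simp))
    have h5 : y ∈ Ideal.span {c 0, c 2} := by
      have h5 := (Submodule.add_mem_iff_right _ (Ideal.mul_mem_left _ x
        (Ideal.subset_span (by simp)))).mp h3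
      exact ((hP 0 2).mem_or_mem h5).resolve_right (hnot 0 2 1 (by simp) (by simp))
    obtain ⟨p, q, rfl⟩ := Ideal.mem_span_pair.mp h4
    obtain ⟨p', q', rfl⟩ := Ideal.mem_span_pair.mp h5
    rw [show (p * c 1 + q * c 2) * c 0 + (p' * c 0 + q' * c 2) * c 1 =
      (p + p') * (c 0 * c 1) + q' * (c 1 * c 2) + q * (c 0 * c 2) by ring]
    rw [map_add, map_add, map_mul _ (p + p'), map_mul _ q', map_mul _ q (c 0 * c 2)]
    refine add_mem (add_mem (add_mem ?_ ?_) ?_) ?_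
    all_goals
      refine Ideal.mul_mem_left _ _ (Ideal.subset_span ?_)
      simp
  · rw [Ideal.span_le]
    have hmem (i j k : Fin 3) (hk : k = i ∨ k = j) : algebraMap R S (c k) ∈ pairIdeal c w i j := by
      rcases hk with rfl | rfl <;> exact Ideal.subset_span (by simp)
    rintro z (rfl | rfl | rfl | rfl)
    · exact ⟨⟨Ideal.subset_span (by simp), Ideal.subset_span (by simp)⟩,
        Ideal.subset_span (by simp)⟩
    · rw [map_mul]
      exact ⟨⟨Ideal.mul_mem_right _ _ (hmem _ _ _ (by simp)),
        Ideal.mul_mem_left _ _ (hmem _ _ _ (by simp))⟩,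
        Ideal.mul_mem_right _ _ (hmem _ _ _ (by simp))⟩
    · rw [map_mul]
      exact ⟨⟨Ideal.mul_mem_right _ _ (hmem _ _ _ (by simp)),
        Ideal.mul_mem_left _ _ (hmem _ _ _ (by simp))⟩,
        Ideal.mul_mem_left _ _ (hmem _ _ _ (by simp))⟩
    · rw [map_mul]
      exact ⟨⟨Ideal.mul_mem_right _ _ (hmem _ _ _ (by simp)),
        Ideal.mul_mem_left _ _ (hmem _ _ _ (by simp))⟩,
        Ideal.mul_mem_left _ _ (hmem _ _ _ (by simp))⟩

end SingularIdeal

/-! ### Residue fields on the resolution of a double cover -/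

section ResidueField
open IsLocalRing IntermediateField
set_option linter.unusedSectionVars false

section Blowup

variable {R R' : Type} [CommRing R] [CommRing R'] [IsDomain R'] {φ : R →+* R'} {G : Set R}

/-- On a local chart of a blow-up, one of the given generators of the ideal divides the others. -/
lemma IsLocalBlowup.exists_generator [IsLocalRing R'] (h : IsLocalBlowup φ (Ideal.span G)) :
    ∃ γ₀ ∈ G, φ γ₀ ≠ 0 ∧ (Ideal.span G).map φ = Ideal.span {φ γ₀} := by
  obtain ⟨a, ha, ha0, hspan, -⟩ := h
  have ha0' : φ a ≠ 0 := nonZeroDivisors.ne_zero ha0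
  obtain ⟨γ₀, hγ₀, u, hu, hau⟩ : ∃ γ₀ ∈ G, ∃ u : R', IsUnit u ∧ φ γ₀ = u * φ a := by
    by_contra! hcon
    have h1 : Ideal.span (φ '' G) ≤ maximalIdeal R' * Ideal.span {φ a} := by
      rw [Ideal.span_le]
      rintro _ ⟨γ, hγ, rfl⟩
      obtain ⟨y, hy⟩ := Ideal.mem_span_singleton'.mp
        (hspan ▸ Ideal.mem_map_of_mem φ (Ideal.subset_span hγ))
      rw [← hy]
      refine Ideal.mul_mem_mul ?_ (Ideal.mem_span_singleton_self _)
      rw [mem_maximalIdeal]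
      exact fun hu ↦ hcon γ hγ y hu hy.symm
    rw [← Ideal.map_span, hspan, Ideal.span_le, Set.singleton_subset_iff, SetLike.mem_coe,
      Ideal.mem_mul_span_singleton] at h1
    obtain ⟨y, hy, hy'⟩ := h1
    have h2 : y = 1 := mul_right_cancel₀ ha0' (by rw [hy', one_mul])
    rw [h2, mem_maximalIdeal] at hy
    exact hy isUnit_one
  refine ⟨γ₀, hγ₀, by rw [hau]; exact mul_ne_zero hu.ne_zero ha0', ?_⟩
  rw [hspan, hau, Ideal.span_singleton_mul_left_unit hu]

/-- The ring of a chart of a blow-up is generated, up to inverting units, by the functions on the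
base and the quotients of the generators of the ideal. -/
lemma IsLocalBlowup.mem_subring (h : IsLocalBlowup φ (Ideal.span G)) {γ₀ : R} (hne : φ γ₀ ≠ 0)
    (hspan₀ : (Ideal.span G).map φ = Ideal.span {φ γ₀}) (A : Subring R') (hA : ∀ s, φ s ∈ A)
    (hG : ∀ γ ∈ G, ∀ y, φ γ = y * φ γ₀ → y ∈ A) (hinv : ∀ t t', t * t' = 1 → t ∈ A → t' ∈ A)
    (z : R') : z ∈ A := by
  obtain ⟨a, -, -, hspan, hz⟩ := h
  have hdiv (γ : R) (hγ : γ ∈ Ideal.span G) : ∃ y, φ γ = y * φ γ₀ := by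
    obtain ⟨y, hy⟩ := Ideal.mem_span_singleton'.mp (hspan₀ ▸ Ideal.mem_map_of_mem φ hγ)
    exact ⟨y, hy.symm⟩
  obtain ⟨u, hu⟩ : Associated (φ γ₀) (φ a) := by
    rw [← Ideal.span_singleton_eq_span_singleton, ← hspan₀, hspan]
  have hone (γ : R) (hγ : γ ∈ Ideal.span G) : ∃ t, φ γ = t * φ γ₀ ∧ t ∈ A := by
    induction hγ using Submodule.span_induction with
    | zero => exact ⟨0, by simp, zero_mem _⟩
    | mem γ hγ =>
      obtain ⟨y, hy⟩ := hdiv γ (Ideal.subset_span hγ)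
      exact ⟨y, hy, hG γ hγ y hy⟩
    | add x y _ _ hx hy =>
      obtain ⟨t, h1, h2⟩ := hx
      obtain ⟨t', h1', h2'⟩ := hy
      exact ⟨t + t', by rw [map_add, h1, h1', add_mul], add_mem h2 h2'⟩
    | smul r x _ hx =>
      obtain ⟨t, h1, h2⟩ := hx
      exact ⟨φ r * t, by rw [smul_eq_mul, map_mul, h1, mul_assoc], mul_mem (hA r) h2⟩
  have hpow (n : ℕ) : ∀ γ ∈ Ideal.span G ^ n, ∃ t, φ γ = t * φ γ₀ ^ n ∧ t ∈ A := by
    induction n with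
    | zero => exact fun γ _ ↦ ⟨φ γ, by simp, hA γ⟩
    | succ n ih =>
      intro γ hγ
      rw [pow_succ] at hγ
      induction hγ using Submodule.mul_induction_on' with
      | mem_mul_mem x hx y hy =>
        obtain ⟨t, h1, h2⟩ := ih x hx
        obtain ⟨t', h1', h2'⟩ := hone y hy
        exact ⟨t * t', by rw [map_mul, h1, h1']; ring, mul_mem h2 h2'⟩
      | add x _ y _ hx hy =>
        obtain ⟨t, h1, h2⟩ := hx
        obtain ⟨t', h1', h2'⟩ := hy
        exact ⟨t + t', by rw [map_add, h1, h1', add_mul], add_mem h2 h2'⟩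
  obtain ⟨n, r, hr, s, hs, v, hv, hsv, hzs⟩ := hz z
  obtain ⟨t, ht, htA⟩ := hpow n r hr
  obtain ⟨t', ht', htA'⟩ := hpow n s hs
  have h0 : φ γ₀ ^ n ≠ 0 := pow_ne_zero n hne
  have h1 : z * t' = t := by
    apply mul_right_cancel₀ h0
    rw [mul_assoc, ← ht', ← ht, hzs]
  have h3 : t' = v * (u : R') ^ n := by
    apply mul_right_cancel₀ h0
    rw [← ht', hsv, ← hu]
    ring
  obtain ⟨b, hb⟩ := (h3 ▸ hv.mul (u.isUnit.pow n) : IsUnit t').exists_right_inv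
  have h4 : z = t * b := by rw [← h1, mul_assoc, hb, mul_one]
  rw [h4]
  exact mul_mem htA (hinv t' b hb htA')

/-- The residue field of a local ring of a blow-up is generated by the residues of the functions
on the base and of the quotients of the generators of the ideal. -/
lemma IsLocalBlowup.exists_quotients [IsLocalRing R'] {κ : Type} [Field κ]
    (h : IsLocalBlowup φ (Ideal.span G)) :
    ∃ γ₀ ∈ G, φ γ₀ ≠ 0 ∧ ∃ y : R → R', (∀ γ ∈ Ideal.span G, φ γ = y γ * φ γ₀) ∧
      ∀ (θ : R' →+* κ) (K : Subfield κ), (∀ s, θ (φ s) ∈ K) → (∀ γ ∈ G, θ (y γ) ∈ K) →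
        ∀ z, θ z ∈ K := by
  obtain ⟨γ₀, hγ₀, hne, hspan⟩ := h.exists_generator
  have hdiv (γ : R) : ∃ y, γ ∈ Ideal.span G → φ γ = y * φ γ₀ := by
    by_cases hγ : γ ∈ Ideal.span G
    · obtain ⟨y, hy⟩ := Ideal.mem_span_singleton'.mp (hspan ▸ Ideal.mem_map_of_mem φ hγ)
      exact ⟨y, fun _ ↦ hy.symm⟩
    · exact ⟨0, fun h ↦ (hγ h).elim⟩
  choose y hy using hdiv
  refine ⟨γ₀, hγ₀, hne, y, hy, fun θ K hK hKG ↦ ?_⟩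
  refine h.mem_subring hne hspan (K.toSubring.comap θ) hK (fun γ hγ y' hy' ↦ ?_)
    (fun t t' htt' ht ↦ ?_)
  · rw [hy γ (Ideal.subset_span hγ)] at hy'
    rw [← mul_right_cancel₀ hne hy']
    exact hKG γ hγ
  · have h1 : θ t * θ t' = 1 := by rw [← map_mul, htt', map_one]
    change θ t' ∈ K
    rw [← inv_eq_of_mul_eq_one_right h1]
    exact inv_mem ht

end Blowup

/-- The blow-up of an empty centre changes nothing. -/
lemma IsLocalBlowup.surjective_of_eq_top {R R' : Type} [CommRing R] [CommRing R'] {φ : R →+* R'}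
    [IsLocalHom φ] {I : Ideal R} (h : IsLocalBlowup φ I) (hI : I = ⊤) : Function.Surjective φ := by
  obtain ⟨a, -, ha0, hspan, hz⟩ := h
  have ha : IsUnit (φ a) := by
    rw [hI, Ideal.map_top] at hspan
    exact Ideal.span_singleton_eq_top.mp hspan.symm
  intro z
  obtain ⟨n, r, -, s, -, u, hu, hs, hzs⟩ := hz z
  have h1 : IsUnit s := isUnit_of_map_unit φ s (by rw [hs]; exact hu.mul (ha.pow n))
  obtain ⟨t, ht⟩ := h1.exists_right_inv
  refine ⟨r * t, ?_⟩
  rw [map_mul, ← hzs, mul_assoc, ← map_mul, ht, map_one, mul_one]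

variable {R κ : Type} [CommRing R] [Algebra ℂ R] [Field κ] [Algebra ℂ κ]

lemma IsCoord.map_mem {c : Fin 3 → R} (hc : IsCoord c) (ρ : R →ₐ[ℂ] κ) (K : IntermediateField ℂ κ)
    (h : ∀ i, ρ (c i) ∈ K) (z : R) : ρ z ∈ K := by
  have key (p : MvPolynomial (Fin 3) ℂ) : ρ (aeval c p) ∈ K := by
    induction p using MvPolynomial.induction_on with
    | C a => rw [algHom_C, AlgHom.commutes]; exact K.algebraMap_mem a
    | add p q hp hq => rw [map_add, map_add]; exact add_mem hp hq
    | mul_X p i hp => rw [map_mul, map_mul, aeval_X]; exact mul_mem hp (h i)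
  obtain ⟨p, q, hq, hz⟩ := hc.frac z
  have h1 := congrArg ρ hz
  rw [map_mul] at h1
  rw [eq_div_of_mul_eq (hq.map ρ).ne_zero h1]
  exact div_mem (key p) (key q)

variable {S O : Type} [CommRing S] [CommRing O] [IsDomain R] [IsDomain S] [IsDomain O]
  [IsLocalRing R] [IsLocalRing S] [IsLocalRing O] [Algebra ℂ S] [Algebra ℂ O]
  [Algebra R S] [Algebra S O] [IsScalarTower ℂ R S] [IsScalarTower ℂ S O]
  [IsLocalHom (algebraMap R S)] [IsLocalHom (algebraMap S O)]

lemma isUnit_of_map_ne_zero {θ : O →ₐ[ℂ] κ} (hθ : Function.Surjective θ) {z : O} (h : θ z ≠ 0) :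
    IsUnit z := by
  by_contra hz
  have h1 : RingHom.ker θ.toRingHom = maximalIdeal O :=
    eq_maximalIdeal (RingHom.ker_isMaximal_of_surjective θ.toRingHom hθ)
  exact h ((RingHom.mem_ker (f := θ.toRingHom)).mp (h1 ▸ (mem_maximalIdeal z).mpr hz))

/-- The residue field of a point of the resolution of a double cover: if the branch divisor is the
zero set of a monomial in local coordinates, the residue field is generated by one element as soon
as the image of the point is closed, or at most one coordinate occurs to an odd power and, if none
does, the square root of the unit `g` lies in a rational extension. Here `R`, `S` and `O` are the
local rings of the base, of the normal double cover and of the blow-up of its singular locus `J`.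
Let `T` be the set of coordinates with an odd exponent. For `|T| ≤ 1` the double cover is smooth.
For `|T| = 2` the exceptional curve over a closed point of the double curve is a conic. For `|T| =
3`, consider the quotients of the generators `w`, `c₀ c₁`, `c₁ c₂`, `c₀ c₂` of `J` by that one which
generates the extension of `J`: at most one of the other three has a nonzero residue. -/
theorem exists_forall_mem_adjoin [IsIntegrallyClosed S] (θ : O →ₐ[ℂ] κ)
    (hθ : Function.Surjective θ) (hinj : Function.Injective (algebraMap R S)) {w₀ : S}
    (hfrac : ∀ z : S, ∃ α β γ : R, γ ≠ 0 ∧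
      z * algebraMap R S γ = algebraMap R S α + algebraMap R S β * w₀)
    (hint : ∀ z : S, ∃ b s : S, IsIntegral R b ∧ IsIntegral R s ∧ IsUnit s ∧ z * s = b)
    {J : Ideal S} (hJ : J.IsRadical) (hJp : ∀ 𝔭 : Ideal S, ∀ _ : 𝔭.IsPrime,
      (J ≤ 𝔭 ↔ ¬ Algebra.FormallySmooth ℂ (Localization.AtPrime 𝔭)))
    (hbl : IsLocalBlowup (algebraMap S O) J)
    {c : Fin 3 → R} (hc : IsCoord c) {m : Fin 3 → ℕ} {g : R} (hg : IsUnit g)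
    (hw₀ : w₀ ^ 2 = algebraMap R S (g * ∏ j, c j ^ m j)) (ρ : R →ₐ[ℂ] κ)
    (hρ : ∀ r, ρ r = θ (algebraMap S O (algebraMap R S r)))
    (hm : ∀ j, m j ≠ 0 → ρ (c j) = 0)
    (hend : (∀ j, ρ (c j) = 0) ∨ ∃ τ : κ, (∀ j, ρ (c j) ∈ ℂ⟮τ⟯) ∧
      (∀ i j, Odd (m i) → Odd (m j) → i = j) ∧
      ((∀ j, Even (m j)) → ∀ ω, ω ^ 2 = ρ g → ∃ τ' : κ, τ ∈ ℂ⟮τ'⟯ ∧ ω ∈ ℂ⟮τ'⟯)) :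
    ∃ τ : κ, ∀ z, z ∈ ℂ⟮τ⟯ := by
  have := hc.isIntegrallyClosed
  obtain ⟨T, hT⟩ : ∃ T : Finset (Fin 3), T = Finset.univ.filter fun j ↦ Odd (m j) := ⟨_, rfl⟩
  have hTm (j : Fin 3) : j ∈ T ↔ Odd (m j) := by simp [hT]
  have hcu (j : Fin 3) (hj : ρ (c j) = 0) : ¬ IsUnit (c j) := fun h ↦ (h.map ρ).ne_zero hj
  have hTρ (j : Fin 3) (hj : j ∈ T) : ρ (c j) = 0 := by
    rw [hTm] at hj
    exact hm j fun h0 ↦ by simp [h0] at hj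
  have hTu (j : Fin 3) (hj : j ∈ T) : ¬ IsUnit (c j) := hcu j (hTρ j hj)
  -- divide `w₀` by the square part of the monomial
  obtain ⟨e, he⟩ : ∃ e : R, e = ∏ j, c j ^ (m j / 2) := ⟨_, rfl⟩
  have hprod : g * ∏ j, c j ^ m j = e ^ 2 * (g * ∏ j ∈ T, c j) := by
    have h1 : ∏ j ∈ T, c j = ∏ j, c j ^ (m j % 2) := by
      rw [hT, Finset.prod_filter]
      refine Finset.prod_congr rfl fun j _ ↦ ?_
      split_ifs with h
      · rw [Nat.odd_iff.mp h, pow_one]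
      · rw [Nat.even_iff.mp (Nat.not_odd_iff_even.mp h), pow_zero]
    rw [h1, he, ← Finset.prod_pow, mul_left_comm, ← Finset.prod_mul_distrib]
    congr 1
    refine Finset.prod_congr rfl fun j _ ↦ ?_
    rw [← pow_mul, ← pow_add]
    congr 1
    omega
  have he0 : e ≠ 0 := by
    rw [he]
    refine Finset.prod_ne_zero_iff.mpr fun j _ ↦ pow_ne_zero _ fun h0 ↦ ?_
    refine X_ne_zero (R := ℂ) j (hc.injective ?_)
    rw [aeval_X, h0, map_zero]
  have heS : algebraMap R S e ≠ 0 := (map_ne_zero_iff _ hinj).mpr he0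
  obtain ⟨w, rfl⟩ : algebraMap R S e ∣ w₀ := by
    rw [← IsIntegrallyClosed.pow_dvd_pow_iff two_ne_zero, hw₀, hprod, map_mul, map_pow]
    exact dvd_mul_right _ _
  have hw : w ^ 2 = algebraMap R S (g * ∏ j ∈ T, c j) := by
    rw [hprod, map_mul (algebraMap R S) (e ^ 2), map_pow, mul_pow] at hw₀
    exact mul_left_cancel₀ (pow_ne_zero 2 heS) hw₀
  have ht : 2 * algebraMap ℂ R (1 / 2) = 1 := by
    rw [← map_ofNat (algebraMap ℂ R) 2, ← map_mul]
    norm_num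
  have hgen : IsGeneratedBy R w := by
    refine isGeneratedBy_of_forall_isIntegral ht hinj hw (hc.prod_ne_zero T hg)
      (hc.prod_dvd_of_dvd_sq T hTu hg) (fun z ↦ ?_) hint
    obtain ⟨α, β, γ, hγ, h⟩ := hfrac z
    exact ⟨α, β * e, γ, hγ, by rw [h, map_mul]; ring⟩
  have hsing := hc.not_formallySmooth_iff hTu hg hinj hw hgen
  let θS : S →+* κ := θ.toRingHom.comp (algebraMap S O)
  have hθS (z : S) : θS z = θ (algebraMap S O z) := rfl
  have hθSR (r : R) : θS (algebraMap R S r) = ρ r := (hρ r).symm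
  have hwρ : θS w ^ 2 = ρ g * ∏ j ∈ T, ρ (c j) := by
    rw [← map_pow, hw, hθSR, map_mul, map_prod]
  have hgρ : ρ g ≠ 0 := (hg.map ρ).ne_zero
  have hmemS (K : IntermediateField ℂ κ) (h1 : ∀ j, ρ (c j) ∈ K) (h2 : θS w ∈ K) (z : S) :
      θS z ∈ K := by
    obtain ⟨a, b, a', b', hu, hz⟩ := hgen z
    have h3 := congrArg θS hz
    have h4 := (hu.map θS).ne_zero
    simp only [map_mul, map_add, hθSR] at h3 h4
    rw [eq_div_of_mul_eq h4 h3]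
    have hK := hc.map_mem ρ K h1
    exact div_mem (add_mem (hK a) (mul_mem (hK b) h2)) (add_mem (hK a') (mul_mem (hK b') h2))
  by_cases hT1 : T.card ≤ 1
  · have hJtop : J = ⊤ := by
      by_contra hne
      obtain ⟨𝔭, h𝔭, hle⟩ := Ideal.exists_le_maximal J hne
      obtain ⟨i, hi, j, hj, hij, -⟩ := (hsing 𝔭).mp ((hJp 𝔭 h𝔭.isPrime).mp hle)
      exact hij (Finset.card_le_one.mp hT1 i hi j hj)
    have hsurj : Function.Surjective θS := hθ.comp (hbl.surjective_of_eq_top hJtop)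
    suffices ∃ τ : κ, (∀ j, ρ (c j) ∈ ℂ⟮τ⟯) ∧ θS w ∈ ℂ⟮τ⟯ by
      obtain ⟨τ, h1, h2⟩ := this
      refine ⟨τ, fun z ↦ ?_⟩
      obtain ⟨z, rfl⟩ := hsurj z
      exact hmemS _ h1 h2 z
    rcases hend with hcl | ⟨τ, hτ, -, hev⟩
    · exact ⟨θS w, fun j ↦ by rw [hcl j]; exact zero_mem _, mem_adjoin_simple_self ℂ _⟩
    · rcases T.eq_empty_or_nonempty with rfl | ⟨j, hj⟩
      · obtain ⟨τ', h1, h2⟩ := hev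
          (fun j ↦ Nat.not_odd_iff_even.mp fun h ↦ by simpa using (hTm j).mpr h) (θS w)
          (by simpa using hwρ)
        refine ⟨τ', fun j ↦ ?_, h2⟩
        exact (adjoin_simple_le_iff.mpr h1 : ℂ⟮τ⟯ ≤ ℂ⟮τ'⟯) (hτ j)
      · refine ⟨τ, hτ, ?_⟩
        rw [Finset.prod_eq_zero hj (hTρ j hj), mul_zero, sq_eq_zero_iff] at hwρ
        rw [hwρ]
        exact zero_mem _
  have hcl : ∀ j, ρ (c j) = 0 := by
    rcases hend with hcl | ⟨τ, -, hodd, -⟩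
    · exact hcl
    · refine (hT1 (Finset.card_le_one.mpr fun i hi j hj ↦ ?_)).elim
      exact hodd i j ((hTm i).mp hi) ((hTm j).mp hj)
  have hw0 : θS w = 0 := by
    obtain ⟨j, hj⟩ := Finset.card_pos.mp (by omega : 0 < T.card)
    rwa [Finset.prod_eq_zero hj (hTρ j hj), mul_zero, sq_eq_zero_iff] at hwρ
  have hmem0 (τ : κ) (z : S) : θ.toRingHom (algebraMap S O z) ∈ (ℂ⟮τ⟯).toSubfield :=
    hmemS ℂ⟮τ⟯ (fun j ↦ by rw [hcl j]; exact zero_mem _) (by rw [hw0]; exact zero_mem _) z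
  -- an element which is the quotient of a generator by itself
  have hself {y x : O} (hx : x ≠ 0) (h : x = y * x) : y = 1 :=
    mul_right_cancel₀ hx (by rw [one_mul]; exact h.symm)
  obtain ⟨gO, hgO⟩ : ∃ gO : O, gO = algebraMap S O (algebraMap R S g) := ⟨_, rfl⟩
  have hgθ : θ gO = ρ g := by rw [hgO, hρ]
  by_cases hT2 : T.card = 2
  · obtain ⟨i, j, hij, rfl⟩ := Finset.card_eq_two.mp hT2
    rw [Finset.prod_pair hij] at hw
    rw [eq_pairIdeal hc hij (hTu i (by simp)) (hTu j (by simp)) hg hinj hw hgen hJ hJp] at hbl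
    obtain ⟨γ₀, hγ₀, hne, y, hy, hK⟩ := hbl.exists_quotients (κ := κ)
    have hyi := hy _ (Ideal.subset_span (by simp) : algebraMap R S (c i) ∈ _)
    have hyj := hy _ (Ideal.subset_span (by simp) : algebraMap R S (c j) ∈ _)
    have hyw := hy _ (Ideal.subset_span (by simp) : w ∈ _)
    have hwO := congrArg (algebraMap S O) hw
    simp only [map_mul, map_pow, ← hgO] at hwO
    set yi := y (algebraMap R S (c i))
    set yj := y (algebraMap R S (c j))
    set yw := y w
    -- the equation of the exceptional conic
    have hrel : θ yw ^ 2 = ρ g * (θ yi * θ yj) := by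
      rw [← hgθ, ← map_mul, ← map_mul, ← map_pow]
      congr 1
      apply mul_right_cancel₀ (pow_ne_zero 2 hne)
      rw [hyw, hyi, hyj] at hwO
      linear_combination hwO
    have hfin (τ : κ) (h1 : θ yi ∈ ℂ⟮τ⟯) (h2 : θ yj ∈ ℂ⟮τ⟯) (h3 : θ yw ∈ ℂ⟮τ⟯) :
        ∃ τ : κ, ∀ z, z ∈ ℂ⟮τ⟯ := by
      refine ⟨τ, fun z ↦ ?_⟩
      obtain ⟨z, rfl⟩ := hθ z
      refine hK θ.toRingHom (ℂ⟮τ⟯).toSubfield (hmem0 τ) ?_ z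
      rintro γ (rfl | rfl | rfl)
      exacts [h1, h2, h3]
    have hgmem (τ : κ) : ρ g ∈ ℂ⟮τ⟯ := by
      rw [← hθSR]; exact hmem0 τ _
    have hone (τ : κ) {y : O} (hy : y = 1) : θ y ∈ ℂ⟮τ⟯ := by
      rw [hy, map_one]; exact one_mem _
    have hτ (τ : κ) : τ ∈ ℂ⟮τ⟯ := mem_adjoin_simple_self ℂ τ
    rcases hγ₀ with rfl | rfl | rfl
    · have h1 := hself hne hyi
      refine hfin (θ yw) (hone _ h1) ?_ (hτ _)
      rw [h1, map_one, one_mul] at hrel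
      rw [eq_div_of_mul_eq hgρ (by rw [hrel, mul_comm] : θ yj * ρ g = θ yw ^ 2)]
      exact div_mem (pow_mem (hτ _) 2) (hgmem _)
    · have h1 := hself hne hyj
      refine hfin (θ yw) ?_ (hone _ h1) (hτ _)
      rw [h1, map_one, mul_one] at hrel
      rw [eq_div_of_mul_eq hgρ (by rw [hrel, mul_comm] : θ yi * ρ g = θ yw ^ 2)]
      exact div_mem (pow_mem (hτ _) 2) (hgmem _)
    · have h1 := hself hne hyw
      refine hfin (θ yi) (hτ _) ?_ (hone _ h1)
      rw [h1, map_one, one_pow] at hrel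
      have h2 : ρ g * θ yi ≠ 0 := by
        intro h0
        rw [← mul_assoc, h0, zero_mul] at hrel
        exact one_ne_zero hrel
      rw [eq_div_of_mul_eq h2 (by rw [hrel]; ring : θ yj * (ρ g * θ yi) = 1)]
      exact div_mem (one_mem _) (mul_mem (hgmem _) (hτ _))
  · have hT3 : T = Finset.univ := by
      apply Finset.eq_univ_of_card
      have := T.card_le_univ
      simp only [Fintype.card_fin] at this ⊢
      omega
    subst hT3
    rw [Fin.prod_univ_three] at hw
    rw [eq_tripleIdeal hc (fun j ↦ hTu j (by simp)) hg hinj hw hgen hJ hJp] at hbl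
    obtain ⟨γ₀, hγ₀, hne, y, hy, hK⟩ := hbl.exists_quotients (κ := κ)
    have hyw := hy _ (Ideal.subset_span (by simp) : w ∈ _)
    have hy01 := hy _ (Ideal.subset_span (by simp) : algebraMap R S (c 0 * c 1) ∈ _)
    have hy12 := hy _ (Ideal.subset_span (by simp) : algebraMap R S (c 1 * c 2) ∈ _)
    have hy02 := hy _ (Ideal.subset_span (by simp) : algebraMap R S (c 0 * c 2) ∈ _)
    have hwO := congrArg (algebraMap S O) hw
    simp only [map_mul, map_pow, ← hgO] at hwO hy01 hy12 hy02
    simp only [map_mul] at hne hy hK hγ₀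
    set yw := y w
    set y01 := y (algebraMap R S (c 0) * algebraMap R S (c 1))
    set y12 := y (algebraMap R S (c 1) * algebraMap R S (c 2))
    set y02 := y (algebraMap R S (c 0) * algebraMap R S (c 2))
    obtain ⟨C0, hC0⟩ : ∃ C0 : O, C0 = algebraMap S O (algebraMap R S (c 0)) := ⟨_, rfl⟩
    obtain ⟨C1, hC1⟩ : ∃ C1 : O, C1 = algebraMap S O (algebraMap R S (c 1)) := ⟨_, rfl⟩
    obtain ⟨C2, hC2⟩ : ∃ C2 : O, C2 = algebraMap S O (algebraMap R S (c 2)) := ⟨_, rfl⟩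
    have hC0θ : θ C0 = 0 := by rw [hC0, ← hρ, hcl]
    have hC1θ : θ C1 = 0 := by rw [hC1, ← hρ, hcl]
    have hC2θ : θ C2 = 0 := by rw [hC2, ← hρ, hcl]
    rw [← hC0, ← hC1, ← hC2] at hwO
    rw [← hC0, ← hC1] at hy01
    rw [← hC1, ← hC2] at hy12
    rw [← hC0, ← hC2] at hy02
    have hfin (τ : κ) (h1 : θ yw ∈ ℂ⟮τ⟯) (h2 : θ y01 ∈ ℂ⟮τ⟯) (h3 : θ y12 ∈ ℂ⟮τ⟯)
        (h4 : θ y02 ∈ ℂ⟮τ⟯) : ∃ τ : κ, ∀ z, z ∈ ℂ⟮τ⟯ := by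
      refine ⟨τ, fun z ↦ ?_⟩
      obtain ⟨z, rfl⟩ := hθ z
      refine hK θ.toRingHom (ℂ⟮τ⟯).toSubfield (hmem0 τ) ?_ z
      rintro γ (rfl | rfl | rfl | rfl)
      exacts [h1, h2, h3, h4]
    have hone (τ : κ) {y : O} (hy : y = 1) : θ y ∈ ℂ⟮τ⟯ := by
      rw [hy, map_one]; exact one_mem _
    have hzero (τ : κ) {y : O} (hy : θ y = 0) : θ y ∈ ℂ⟮τ⟯ := by
      rw [hy]; exact zero_mem _
    have hτ (τ : κ) : τ ∈ ℂ⟮τ⟯ := mem_adjoin_simple_self ℂ τ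
    -- the relation `w² = g c₀ c₁ c₂` makes the residues of all but one of the quotients vanish
    have hred {A B C W v y : O} (hAB : A * B ≠ 0) (h1 : W = v * (A * B)) (h2 : B * C = y * (A * B))
        (h3 : W ^ 2 = gO * (A * B * C)) (hB : θ B = 0) : θ y = 0 := by
      have h4 : v ^ 2 * B = gO * y := by
        apply mul_left_cancel₀ (pow_ne_zero 2 (left_ne_zero_of_mul hAB))
        apply mul_right_cancel₀ (right_ne_zero_of_mul hAB)
        rw [h1] at h3
        linear_combination h3 + gO * A * h2
      have h5 := congrArg θ h4
      rw [map_mul, map_mul, hB, mul_zero, hgθ] at h5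
      exact (mul_eq_zero.mp h5.symm).resolve_left hgρ
    have hred' {A B C W y y' : O} (hW : W ≠ 0) (h1 : A * B = y * W) (h2 : B * C = y' * W)
        (h3 : W ^ 2 = gO * (A * B * C)) (hB : θ B = 0) : θ y = 0 ∨ θ y' = 0 := by
      have h4 : gO * (y * y') = B := by
        apply mul_right_cancel₀ (pow_ne_zero 2 hW)
        linear_combination -B * h3 - gO * B * C * h1 - gO * y * W * h2
      have h5 := congrArg θ h4
      rw [map_mul, map_mul, hB, hgθ] at h5
      exact mul_eq_zero.mp ((mul_eq_zero.mp h5).resolve_left hgρ)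
    rcases hγ₀ with rfl | rfl | rfl | rfl
    · have h1 : yw = 1 := hself hne hyw
      have h01 := hred' hne hy01 hy12 (by rw [hwO]) hC1θ
      have h12 := hred' hne (y := y12) (y' := y02) (A := C1) (B := C2) (C := C0) hy12
        (by rw [← hy02]; ring) (by rw [hwO]; ring) hC2θ
      have h02 := hred' hne (y := y01) (y' := y02) (A := C1) (B := C0) (C := C2)
        (by rw [← hy01]; ring) hy02 (by rw [hwO]; ring) hC0θ
      by_cases h3 : θ y01 = 0
      · rcases h12 with h4 | h4
        · exact hfin (θ y02) (hone _ h1) (hzero _ h3) (hzero _ h4) (hτ _)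
        · exact hfin (θ y12) (hone _ h1) (hzero _ h3) (hτ _) (hzero _ h4)
      · exact hfin (θ y01) (hone _ h1) (hτ _) (hzero _ (h01.resolve_left h3))
          (hzero _ (h02.resolve_left h3))
    · simp only [map_mul, ← hC0, ← hC1] at hne hyw hy01 hy12 hy02
      refine hfin (θ yw) (hτ _) (hone _ (hself hne hy01)) (hzero _ ?_) (hzero _ ?_)
      · exact hred hne hyw hy12 hwO hC1θ
      · exact hred (W := algebraMap S O w) (v := yw) (A := C1) (B := C0) (C := C2) (by rwa [mul_comm]) (by rw [hyw]; ring)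
          (by rw [hy02]; ring) (by rw [hwO]; ring) hC0θ
    · simp only [map_mul, ← hC1, ← hC2] at hne hyw hy01 hy12 hy02
      refine hfin (θ yw) (hτ _) (hzero _ ?_) (hone _ (hself hne hy12)) (hzero _ ?_)
      · exact hred (W := algebraMap S O w) (v := yw) (A := C2) (B := C1) (C := C0) (by rwa [mul_comm]) (by rw [hyw]; ring)
          (by rw [mul_comm, hy01]; ring) (by rw [hwO]; ring) hC1θ
      · exact hred (A := C1) (B := C2) (C := C0) hne hyw
          (by rw [mul_comm, hy02]) (by rw [hwO]; ring) hC2θ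
    · simp only [map_mul, ← hC0, ← hC2] at hne hyw hy01 hy12 hy02
      refine hfin (θ yw) (hτ _) (hzero _ ?_) (hzero _ ?_) (hone _ (hself hne hy02))
      · exact hred (W := algebraMap S O w) (v := yw) (A := C2) (B := C0) (C := C1) (by rwa [mul_comm]) (by rw [hyw]; ring)
          (by rw [hy01]; ring) (by rw [hwO]; ring) hC0θ
      · exact hred (A := C0) (B := C2) (C := C1) hne hyw
          (by rw [mul_comm, hy12]) (by rw [hwO]; ring) hC2θ

end ResidueField

/-! ### Coordinates on a blow-up -/

section BlowupCoordinates
open IsLocalRing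

variable {R R' : Type} [CommRing R] [CommRing R'] [Algebra ℂ R] [Algebra ℂ R']

lemma IsCoord.map_bijective {c : Fin 3 → R} (hc : IsCoord c) (φ : R →ₐ[ℂ] R')
    (hφ : Function.Bijective φ) : IsCoord (φ ∘ c) := by
  have h (p : MvPolynomial (Fin 3) ℂ) : aeval (φ ∘ c) p = φ (aeval c p) := by
    rw [← AlgHom.comp_apply, comp_aeval]; rfl
  refine ⟨fun p q hpq ↦ hc.injective (hφ.1 ?_), fun z ↦ ?_⟩
  · rw [← h, ← h]; exact hpq
  · obtain ⟨z, rfl⟩ := hφ.2 z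
    obtain ⟨p, q, hq, hz⟩ := hc.frac z
    exact ⟨p, q, by rw [h]; exact hq.map φ, by rw [h, h, ← map_mul, hz]⟩

/-- The elements of `R'` which are quotients of polynomials in `c`. -/
def fracSubring (c : Fin 3 → R') : Subring R' where
  carrier := {z | ∃ p q : MvPolynomial (Fin 3) ℂ, IsUnit (aeval c q) ∧ z * aeval c q = aeval c p}
  one_mem' := ⟨1, 1, by simp, by simp⟩
  zero_mem' := ⟨0, 1, by simp, by simp⟩
  mul_mem' := by
    rintro x y ⟨p, q, hq, h⟩ ⟨p', q', hq', h'⟩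
    exact ⟨p * p', q * q', by rw [map_mul]; exact hq.mul hq', by
      rw [map_mul, map_mul, ← h, ← h']; ring⟩
  add_mem' := by
    rintro x y ⟨p, q, hq, h⟩ ⟨p', q', hq', h'⟩
    exact ⟨p * q' + p' * q, q * q', by rw [map_mul]; exact hq.mul hq', by
      rw [map_mul, map_add, map_mul, map_mul, ← h, ← h']; ring⟩
  neg_mem' := by
    rintro x ⟨p, q, hq, h⟩
    exact ⟨-p, q, hq, by rw [map_neg, ← h]; ring⟩

/-- Local coordinates on the blow-up of a coordinate subspace. -/
lemma IsCoord.blowup [IsDomain R'] {c : Fin 3 → R} (hc : IsCoord c) (φ : R →ₐ[ℂ] R')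
    (hφ : Function.Injective φ) {I₀ : Set (Fin 3)}
    (h : IsLocalBlowup φ.toRingHom (Ideal.span (c '' I₀))) {k : Fin 3}
    (hspan : (Ideal.span (c '' I₀)).map φ.toRingHom = Ideal.span {φ (c k)}) :
    ∃ c' : Fin 3 → R', IsCoord c' ∧ c' k = φ (c k) ∧
      (∀ i ∈ I₀, i ≠ k → φ (c i) = c' i * φ (c k)) ∧ ∀ i ∉ I₀, c' i = φ (c i) := by
  classical
  have hne : φ (c k) ≠ 0 := by
    rw [Ne, map_eq_zero_iff _ hφ]
    intro h0
    refine X_ne_zero (R := ℂ) k (hc.injective ?_)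
    rw [aeval_X, h0, map_zero]
  have hdiv (i : Fin 3) : ∃ y, (i ∈ I₀ ∧ i ≠ k → φ (c i) = y * φ (c k)) ∧
      (¬ (i ∈ I₀ ∧ i ≠ k) → y = φ (c i)) := by
    by_cases hi : i ∈ I₀ ∧ i ≠ k
    · obtain ⟨y, hy⟩ := Ideal.mem_span_singleton'.mp (hspan ▸ Ideal.mem_map_of_mem φ.toRingHom
        (Ideal.subset_span ⟨i, hi.1, rfl⟩ : c i ∈ Ideal.span (c '' I₀)))
      exact ⟨y, fun _ ↦ hy.symm, fun h ↦ (h hi).elim⟩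
    · exact ⟨φ (c i), fun h ↦ (hi h).elim, fun _ ↦ rfl⟩
  choose c' hc1 hc2 using hdiv
  have hk : c' k = φ (c k) := hc2 k fun h ↦ h.2 rfl
  refine ⟨c', ⟨?_, ?_⟩, hk, fun i hi hik ↦ hc1 i ⟨hi, hik⟩, fun i hi ↦ hc2 i fun h ↦ hi h.1⟩
  · -- the substitution which describes the blow-up in coordinates
    let ψ : MvPolynomial (Fin 3) ℂ →ₐ[ℂ] MvPolynomial (Fin 3) ℂ :=
      aeval fun i ↦ if i ∈ I₀ ∧ i ≠ k then X i * X k else X i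
    have hψ (i : Fin 3) : ψ (X i) = if i ∈ I₀ ∧ i ≠ k then X i * X k else X i := by
      simp only [ψ, aeval_X]
    have hψk : ψ (X k) = X k := by rw [hψ, if_neg fun h ↦ h.2 rfl]
    have hcomp (q : MvPolynomial (Fin 3) ℂ) : aeval c' (ψ q) = φ (aeval c q) := by
      have : (aeval c').comp ψ = φ.comp (aeval c) := by
        refine MvPolynomial.algHom_ext fun i ↦ ?_
        rw [AlgHom.comp_apply, AlgHom.comp_apply, hψ]
        split_ifs with hi
        · rw [map_mul, aeval_X, aeval_X, aeval_X, hk, hc1 i hi]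
        · rw [aeval_X, aeval_X, hc2 i hi]
      exact DFunLike.congr_fun this q
    have key (p : MvPolynomial (Fin 3) ℂ) : ∃ (n : ℕ) (q : MvPolynomial (Fin 3) ℂ),
        X k ^ n * p = ψ q := by
      induction p using MvPolynomial.induction_on with
      | C a => exact ⟨0, C a, by rw [algHom_C]; simp⟩
      | add p p' h h' =>
        obtain ⟨n, q, h⟩ := h
        obtain ⟨n', q', h'⟩ := h'
        refine ⟨n + n', X k ^ n' * q + X k ^ n * q', ?_⟩
        rw [map_add, map_mul, map_mul, map_pow, map_pow, hψk, ← h, ← h']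
        ring
      | mul_X p i h =>
        obtain ⟨n, q, h⟩ := h
        by_cases hi : i ∈ I₀ ∧ i ≠ k
        · refine ⟨n + 1, q * X i, ?_⟩
          rw [map_mul, hψ, if_pos hi, ← h]
          ring
        · refine ⟨n, q * X i, ?_⟩
          rw [map_mul, hψ, if_neg hi, ← h]
          ring
    rw [injective_iff_map_eq_zero]
    intro p hp
    obtain ⟨n, q, hq⟩ := key p
    have h1 : φ (aeval c q) = 0 := by rw [← hcomp, ← hq, map_mul, hp, mul_zero]
    rw [map_eq_zero_iff _ hφ, ← map_zero (aeval c : MvPolynomial (Fin 3) ℂ →ₐ[ℂ] R)] at h1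
    rw [hc.injective h1, map_zero] at hq
    exact (mul_eq_zero.mp hq).resolve_left (pow_ne_zero n (X_ne_zero k))
  · have hmemc (i : Fin 3) : c' i ∈ fracSubring c' := ⟨X i, 1, by simp, by simp⟩
    have hcoord (i : Fin 3) : ∃ q : MvPolynomial (Fin 3) ℂ, φ (c i) = aeval c' q := by
      by_cases hi : i ∈ I₀ ∧ i ≠ k
      · exact ⟨X i * X k, by rw [map_mul, aeval_X, aeval_X, hk, hc1 i hi]⟩
      · exact ⟨X i, by rw [aeval_X, hc2 i hi]⟩
    have hpoly (p : MvPolynomial (Fin 3) ℂ) : ∃ q : MvPolynomial (Fin 3) ℂ,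
        φ (aeval c p) = aeval c' q := by
      induction p using MvPolynomial.induction_on with
      | C a => exact ⟨C a, by rw [algHom_C, algHom_C]; exact φ.commutes a⟩
      | add p p' h h' =>
        obtain ⟨q, h⟩ := h
        obtain ⟨q', h'⟩ := h'
        exact ⟨q + q', by rw [map_add, map_add, map_add, h, h']⟩
      | mul_X p i h =>
        obtain ⟨q, h⟩ := h
        obtain ⟨q', h'⟩ := hcoord i
        exact ⟨q * q', by rw [map_mul, map_mul, map_mul, h, aeval_X, h']⟩
    refine fun z ↦ h.mem_subring (γ₀ := c k) hne hspan (fracSubring c') (fun r ↦ ?_) ?_ ?_ z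
    · obtain ⟨p, q, hq, hr⟩ := hc.frac r
      obtain ⟨p', hp'⟩ := hpoly p
      obtain ⟨q', hq'⟩ := hpoly q
      refine ⟨p', q', by rw [← hq']; exact hq.map φ, ?_⟩
      rw [← hp', ← hq', ← hr, map_mul]
      rfl
    · rintro _ ⟨i, hi, rfl⟩ y hy
      by_cases hik : i = k
      · subst hik
        have h1 : y = 1 := by
          refine mul_right_cancel₀ hne ?_
          rw [one_mul]
          exact hy.symm
        rw [h1]
        exact one_mem _
      · have h1 : y = c' i := by
          refine mul_right_cancel₀ hne ?_
          rw [← hc1 i ⟨hi, hik⟩]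
          exact hy.symm
        rw [h1]
        exact hmemc i
    · rintro t t' htt' ⟨p, q, hq, hr⟩
      refine ⟨q, p, ?_, ?_⟩
      · rw [← hr]
        exact (IsUnit.of_mul_eq_one t' htt').mul hq
      · rw [← hr]
        linear_combination aeval c' q * htt'

end BlowupCoordinates

/-! ### An involution of an arrangement, in terms of linear forms -/

section Forms
set_option linter.unusedSectionVars false
open Module Module.End

variable {V : Type} [AddCommGroup V] [Module ℂ V] [FiniteDimensional ℂ V]

/-- The number of the forms `f i` that lie in the space `N` of forms. -/
def formMult (f : Fin 8 → V) (N : Submodule ℂ V) : ℕ := {i | f i ∈ N}.ncard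

/-- The linear forms `f` of an arrangement of eight planes, with an involution `B` of the space of
linear forms that permutes the planes. Points and lines of `ℙ³` are given by the spaces of forms
which vanish there, of dimensions three and two. The common zeros of an eigenspace of `B` are a
component of the fixed locus. In `odd_points` only the eigenvalue `-1` occurs, since the sign of `B`
is chosen such that the component in question is the one where the odd forms vanish. -/
structure IsSymmetric (f : Fin 8 → V) (B : End ℂ V) : Prop where
  finrank_eq : finrank ℂ V = 4
  sq : ∀ a, B (B a) = a
  ne_zero : ∀ i, f i ≠ 0
  not_proportional : ∀ i j, i ≠ j → ∀ c : ℂ, f i ≠ c • f j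
  no_six : ∀ N : Submodule ℂ V, finrank ℂ N = 3 → formMult f N < 6
  no_four : ∀ N : Submodule ℂ V, finrank ℂ N = 2 → formMult f N < 4
  perm : ∀ i, ∃ j, ∃ c : ℂ, B (f i) = c • f j
  no_fixed_line : ∀ ε : ℂ, ε = 1 ∨ ε = -1 → ∀ N : Submodule ℂ V, finrank ℂ N = 2 →
    eigenspace B ε ≤ N → formMult f N ≠ 2 ∧ formMult f N ≠ 3
  odd_points : finrank ℂ (eigenspace B (-1)) = 2 → (∀ i, f i ∉ eigenspace B (-1)) →
    {N : Submodule ℂ V | finrank ℂ N = 3 ∧ eigenspace B (-1) ≤ N ∧ Odd (formMult f N)}.encard ≤ 2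

variable {f : Fin 8 → V} {B : End ℂ V}

lemma formMult_mono {N N' : Submodule ℂ V} (h : N ≤ N') : formMult f N ≤ formMult f N' :=
  Set.ncard_le_ncard (fun _ hi ↦ h hi) (Set.toFinite _)

lemma two_le_formMult {N : Submodule ℂ V} {i j : Fin 8} (hij : i ≠ j) (hi : f i ∈ N)
    (hj : f j ∈ N) : 2 ≤ formMult f N := by
  rw [← Set.ncard_pair hij]
  refine Set.ncard_le_ncard ?_ (Set.toFinite _)
  rintro k (rfl | rfl)
  exacts [hi, hj]

lemma eq_of_formMult_le_one {N : Submodule ℂ V} (h : formMult f N ≤ 1) {i j : Fin 8} (hi : f i ∈ N)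
    (hj : f j ∈ N) : i = j := by
  by_contra hij
  have := two_le_formMult hij hi hj
  omega

namespace IsSymmetric

variable (h : IsSymmetric f B)
include h

lemma finrank_span_pair {i j : Fin 8} (hij : i ≠ j) :
    finrank ℂ (Submodule.span ℂ {f i, f j}) = 2 := by
  have hli : LinearIndependent ℂ ![f i, f j] := by
    rw [LinearIndependent.pair_iff' (h.ne_zero i)]
    exact fun c hc ↦ h.not_proportional j i hij.symm c hc.symm
  have := finrank_span_eq_card hli
  rwa [Matrix.range_cons_cons_empty] at this

lemma formMult_le_one {N : Submodule ℂ V} (hN : finrank ℂ N ≤ 1) : formMult f N ≤ 1 := by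
  by_contra hcon
  obtain ⟨i, j, hi, hj, hij⟩ := (Set.one_lt_ncard_iff (Set.toFinite _)).mp (not_le.mp hcon)
  have h1 : Submodule.span ℂ {f i, f j} ≤ N := by
    rw [Submodule.span_le]
    rintro _ (rfl | rfl)
    exacts [hi, hj]
  have h2 := Submodule.finrank_mono h1
  rw [h.finrank_span_pair hij] at h2
  omega

lemma add_smul_mem (ε : ℂ) (hε : ε = 1 ∨ ε = -1) (a : V) : B a + ε • a ∈ eigenspace B ε := by
  rw [mem_eigenspace_iff, map_add, h.sq, map_smul, smul_add, smul_smul]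
  have : ε * ε = 1 := by rcases hε with rfl | rfl <;> norm_num
  rw [this, one_smul, add_comm]

lemma inf_eigenspace : eigenspace B 1 ⊓ eigenspace B (-1) = ⊥ := by
  rw [Submodule.eq_bot_iff]
  rintro a ⟨h1, h2⟩
  rw [SetLike.mem_coe, mem_eigenspace_iff] at h1 h2
  rw [h1, one_smul, neg_one_smul] at h2
  have h3 : (2 : ℂ) • a = 0 := by rw [two_smul]; nth_rw 1 [h2]; simp
  exact (smul_eq_zero.mp h3).resolve_left two_ne_zero

lemma exists_add (N : Submodule ℂ V) (hN : ∀ a ∈ N, B a ∈ N) (a : V) (ha : a ∈ N) :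
    ∃ b ∈ eigenspace B 1, ∃ c ∈ eigenspace B (-1), b ∈ N ∧ c ∈ N ∧ a = b + c := by
  refine ⟨(1 / 2 : ℂ) • (B a + (1 : ℂ) • a), Submodule.smul_mem _ _ (h.add_smul_mem 1 (.inl rfl) a),
    (-1 / 2 : ℂ) • (B a + (-1 : ℂ) • a), Submodule.smul_mem _ _ (h.add_smul_mem (-1) (.inr rfl) a),
    ?_, ?_, ?_⟩
  · exact N.smul_mem _ (N.add_mem (hN a ha) (N.smul_mem _ ha))
  · exact N.smul_mem _ (N.add_mem (hN a ha) (N.smul_mem _ ha))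
  · module

lemma finrank_add : finrank ℂ (eigenspace B 1) + finrank ℂ (eigenspace B (-1)) = 4 := by
  rw [← Submodule.finrank_sup_add_finrank_inf_eq, h.inf_eigenspace, finrank_bot, add_zero,
    ← h.finrank_eq, ← finrank_top ℂ V]
  have htop : eigenspace B 1 ⊔ eigenspace B (-1) = ⊤ := by
    rw [eq_top_iff]
    intro a _
    obtain ⟨b, hb, c, hc, -, -, rfl⟩ := h.exists_add ⊤ (fun _ _ ↦ trivial) a trivial
    exact Submodule.add_mem_sup hb hc
  rw [htop]

/-- If an eigenspace had dimension at most one, `B` would fix a plane and a point, or every point.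
The intersection of two planes which are exchanged by `B` lies in the fixed plane, so by the
condition on fixed lines every plane is invariant; but at most one of them is the fixed plane, and
the other seven would meet in the fixed point. -/
lemma two_le_finrank (ε : ℂ) (hε : ε = 1 ∨ ε = -1) : 2 ≤ finrank ℂ (eigenspace B ε) := by
  by_contra hcon
  have hle : finrank ℂ (eigenspace B ε) ≤ 1 := by omega
  have hne (i j : Fin 8) (hij : i ≠ j) :
      ¬ eigenspace B ε ≤ Submodule.span ℂ {f i, f j} := by
    intro hsub
    have h1 := h.no_fixed_line ε hε _ (h.finrank_span_pair hij) hsub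
    have h2 := h.no_four _ (h.finrank_span_pair hij)
    have h3 := two_le_formMult (f := f) (N := Submodule.span ℂ {f i, f j}) hij
      (Submodule.subset_span (by simp)) (Submodule.subset_span (by simp))
    omega
  -- all planes are invariant
  have hall (i : Fin 8) : f i ∈ eigenspace B ε ∨ f i ∈ eigenspace B (-ε) := by
    by_contra! hi
    obtain ⟨j, c, hj⟩ := h.perm i
    have hij : i ≠ j := by
      rintro rfl
      have h1 : (c * c) • f i = f i := by rw [← smul_smul, ← hj, ← map_smul, ← hj, h.sq]
      have h2 : c * c = 1 := by
        have h3 : (c * c - 1) • f i = 0 := by rw [sub_smul, h1, one_smul, sub_self]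
        exact sub_eq_zero.mp ((smul_eq_zero.mp h3).resolve_right (h.ne_zero i))
      have h4 : c = ε ∨ c = -ε := by
        rcases hε with rfl | rfl <;> rcases mul_self_eq_one_iff.mp h2 with rfl | rfl <;> simp
      rcases h4 with rfl | rfl
      · exact hi.1 (mem_eigenspace_iff.mpr hj)
      · exact hi.2 (mem_eigenspace_iff.mpr hj)
    refine hne i j hij ?_
    have h0 : B (f i) + ε • f i ≠ 0 := by
      intro h0
      refine hi.2 (mem_eigenspace_iff.mpr ?_)
      rw [neg_smul]
      exact eq_neg_of_add_eq_zero_left h0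
    have h1 : eigenspace B ε = ℂ ∙ (B (f i) + ε • f i) := by
      symm
      refine Submodule.eq_of_le_of_finrank_le
        ((Submodule.span_singleton_le_iff_mem _ _).mpr (h.add_smul_mem ε hε _)) ?_
      rw [finrank_span_singleton h0]
      exact hle
    rw [h1, Submodule.span_singleton_le_iff_mem, hj]
    exact Submodule.add_mem _ (Submodule.smul_mem _ _ (Submodule.subset_span (by simp)))
      (Submodule.smul_mem _ _ (Submodule.subset_span (by simp)))
  have hcount : 8 ≤ formMult f (eigenspace B ε) + formMult f (eigenspace B (-ε)) := by
    have h1 : (Set.univ : Set (Fin 8)) ⊆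
      {i | f i ∈ eigenspace B ε} ∪ {i | f i ∈ eigenspace B (-ε)} := fun i _ ↦ hall i
    have h2 := (Set.ncard_le_ncard h1 (Set.toFinite _)).trans (Set.ncard_union_le _ _)
    rw [Set.ncard_univ, Nat.card_eq_fintype_card, Fintype.card_fin] at h2
    exact h2
  have h1 := h.formMult_le_one hle
  have hsum : finrank ℂ (eigenspace B ε) + finrank ℂ (eigenspace B (-ε)) = 4 := by
    rcases hε with rfl | rfl
    · exact h.finrank_add
    · rw [neg_neg, add_comm]; exact h.finrank_add
  have h3 : finrank ℂ (eigenspace B (-ε)) ≠ 3 := by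
    intro h3
    have := h.no_six _ h3
    omega
  have h4 : eigenspace B ε = ⊥ := by
    rw [← Submodule.finrank_eq_zero (R := ℂ)]
    omega
  exact hne 0 1 (by simp) (by rw [h4]; exact bot_le)

lemma finrank_eigenspace (ε : ℂ) (hε : ε = 1 ∨ ε = -1) : finrank ℂ (eigenspace B ε) = 2 := by
  have h1 := h.finrank_add
  have h2 := h.two_le_finrank 1 (.inl rfl)
  have h3 := h.two_le_finrank (-1) (.inr rfl)
  rcases hε with rfl | rfl <;> omega

lemma formMult_eigenspace (ε : ℂ) (hε : ε = 1 ∨ ε = -1) : formMult f (eigenspace B ε) ≤ 1 := by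
  have h1 := h.finrank_eigenspace ε hε
  have h2 := h.no_fixed_line ε hε _ h1 le_rfl
  have h3 := h.no_four _ h1
  omega

/-- `B` induces a permutation of the planes. -/
lemma exists_perm : ∃ σ : Fin 8 → Fin 8, (∀ i, ∃ c : ℂ, B (f i) = c • f (σ i)) ∧
    ∀ i, σ (σ i) = i := by
  choose σ c hσ using h.perm
  refine ⟨σ, fun i ↦ ⟨c i, hσ i⟩, fun i ↦ ?_⟩
  by_contra hne
  refine h.not_proportional i (σ (σ i)) (fun e ↦ hne e.symm) (c i * c (σ i)) ?_
  rw [← smul_smul, ← hσ, ← map_smul, ← hσ, h.sq]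

lemma mem_of_perm {σ : Fin 8 → Fin 8} (hσ : ∀ i, ∃ c : ℂ, B (f i) = c • f (σ i))
    {N : Submodule ℂ V} (hN : ∀ a ∈ N, B a ∈ N) {i : Fin 8} (hi : f i ∈ N) : f (σ i) ∈ N := by
  obtain ⟨c, hc⟩ := hσ i
  have h1 := hN _ hi
  rw [hc] at h1
  have hc0 : c ≠ 0 := by
    rintro rfl
    rw [zero_smul] at hc
    have := h.sq (f i)
    rw [hc, map_zero] at this
    exact h.ne_zero i this.symm
  exact (N.smul_mem_iff hc0).mp h1

lemma perm_ne {σ : Fin 8 → Fin 8} (hσ : ∀ i, ∃ c : ℂ, B (f i) = c • f (σ i)) {i : Fin 8}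
    (h1 : f i ∉ eigenspace B 1) (h2 : f i ∉ eigenspace B (-1)) : σ i ≠ i := by
  intro hi
  obtain ⟨c, hc⟩ := hσ i
  rw [hi] at hc
  have h3 : (c * c) • f i = f i := by rw [← smul_smul, ← hc, ← map_smul, ← hc, h.sq]
  have h4 : c * c = 1 := by
    have h3 : (c * c - 1) • f i = 0 := by rw [sub_smul, h3, one_smul, sub_self]
    exact sub_eq_zero.mp ((smul_eq_zero.mp h3).resolve_right (h.ne_zero i))
  rcases mul_self_eq_one_iff.mp h4 with rfl | rfl
  · exact h1 (mem_eigenspace_iff.mpr hc)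
  · exact h2 (mem_eigenspace_iff.mpr hc)

lemma stable_eigenspace (ε : ℂ) : ∀ a ∈ eigenspace B ε, B a ∈ eigenspace B ε := by
  intro a ha
  rw [mem_eigenspace_iff] at ha
  rw [ha]
  exact Submodule.smul_mem _ _ (mem_eigenspace_iff.mpr ha)

/-- The planes of an invariant linear system which are not invariant come in pairs. -/
lemma exists_even (N : Submodule ℂ V) (hN : ∀ a ∈ N, B a ∈ N) :
    ∃ k, Even k ∧ formMult f N =
      k + formMult f (N ⊓ eigenspace B 1) + formMult f (N ⊓ eigenspace B (-1)) := by
  classical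
  obtain ⟨σ, hσ, hσσ⟩ := h.exists_perm
  let s : Finset (Fin 8) := Finset.univ.filter fun i ↦
    f i ∈ N ∧ f i ∉ eigenspace B 1 ∧ f i ∉ eigenspace B (-1)
  have hmem (i : Fin 8) : i ∈ s ↔ f i ∈ N ∧ f i ∉ eigenspace B 1 ∧ f i ∉ eigenspace B (-1) := by
    simp [s]
  refine ⟨s.card, ?_, ?_⟩
  · have h1 : ∑ i ∈ s, (1 : ZMod 2) = 0 := by
      refine Finset.sum_involution (fun i _ ↦ σ i) (fun _ _ ↦ rfl) (fun i hi _ ↦ ?_)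
        (fun i hi ↦ ?_) (fun i _ ↦ hσσ i)
      · rw [hmem] at hi
        exact h.perm_ne hσ hi.2.1 hi.2.2
      · rw [hmem] at hi ⊢
        refine ⟨h.mem_of_perm hσ hN hi.1, fun h1 ↦ hi.2.1 ?_, fun h1 ↦ hi.2.2 ?_⟩
        · rw [← hσσ i]; exact h.mem_of_perm hσ (h.stable_eigenspace 1) h1
        · rw [← hσσ i]; exact h.mem_of_perm hσ (h.stable_eigenspace (-1)) h1
    rw [Finset.sum_const, nsmul_one, ZMod.natCast_eq_zero_iff] at h1
    exact even_iff_two_dvd.mpr h1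
  · have hdisj (i : Fin 8) (h1 : f i ∈ eigenspace B 1) (h2 : f i ∈ eigenspace B (-1)) : False := by
      have h3 : f i ∈ eigenspace B 1 ⊓ eigenspace B (-1) := ⟨h1, h2⟩
      rw [h.inf_eigenspace] at h3
      exact h.ne_zero i h3
    rw [formMult, formMult, formMult, ← Set.ncard_coe_finset, ← Set.ncard_union_eq,
      ← Set.ncard_union_eq]
    · congr 1
      ext i
      simp only [Set.mem_union, Finset.mem_coe, hmem, Set.mem_ofPred_eq, Submodule.mem_inf]
      tauto
    · rw [Set.disjoint_left]
      rintro i (h1 | h1) h2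
      · rw [Finset.mem_coe, hmem] at h1
        exact h1.2.2 h2.2
      · exact hdisj i h1.2 h2.2
    · rw [Set.disjoint_left]
      intro i h1 h2
      rw [Finset.mem_coe, hmem] at h1
      exact h1.2.1 h2.2

/-- Either one plane belongs to each eigenspace, or none does. -/
lemma formMult_eigenspace_eq :
    formMult f (eigenspace B 1) = formMult f (eigenspace B (-1)) := by
  obtain ⟨k, hk, h1⟩ := h.exists_even ⊤ fun _ _ ↦ trivial
  rw [top_inf_eq, top_inf_eq] at h1
  have h2 := h.formMult_eigenspace 1 (.inl rfl)
  have h3 := h.formMult_eigenspace (-1) (.inr rfl)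
  have h4 : formMult f (⊤ : Submodule ℂ V) = 8 := by
    simp [formMult, Set.ncard_univ]
  obtain ⟨r, rfl⟩ := hk
  omega

/-- An invariant triple line is spanned by eigenvectors with both signs. -/
lemma exists_eigenvectors {N : Submodule ℂ V} (hN : ∀ a ∈ N, B a ∈ N)
    (h3 : formMult f N = 3) : ∃ s ∈ N, s ∈ eigenspace B 1 ∧ s ≠ 0 ∧
      ∃ v ∈ N, v ∈ eigenspace B (-1) ∧ v ≠ 0 := by
  have key (ε : ℂ) (hε : ε = 1 ∨ ε = -1) : ∃ a ∈ N, a ∈ eigenspace B ε ∧ a ≠ 0 := by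
    by_contra! hcon
    have h4 : N ≤ eigenspace B (-ε) := by
      intro a ha
      rw [mem_eigenspace_iff, neg_smul]
      exact eq_neg_of_add_eq_zero_left (hcon _ (N.add_mem (hN a ha) (N.smul_mem _ ha))
        (h.add_smul_mem ε hε a))
    have h5 := formMult_mono (f := f) h4
    have h6 := h.formMult_eigenspace (-ε) (by rcases hε with rfl | rfl <;> simp)
    omega
  obtain ⟨s, h1, h4, h5⟩ := key 1 (.inl rfl)
  exact ⟨s, h1, h4, h5, key (-1) (.inr rfl)⟩

/-- A point on at most four planes lies on at most one triple line. -/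
lemma triple_unique {N₀ N N' : Submodule ℂ V} (hm : formMult f N₀ ≤ 4) (hN : N ≤ N₀)
    (hN' : N' ≤ N₀) (h2 : finrank ℂ N = 2) (h2' : finrank ℂ N' = 2) (h3 : 3 ≤ formMult f N)
    (h3' : 3 ≤ formMult f N') : N' = N := by
  by_contra hne
  have h5 : finrank ℂ (N' ⊓ N : Submodule ℂ V) ≤ 1 := by
    by_contra h6
    have h7 : N' ⊓ N = N := Submodule.eq_of_le_of_finrank_le inf_le_right (by omega)
    have h8 : N' ⊓ N = N' := Submodule.eq_of_le_of_finrank_le inf_le_left (by omega)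
    exact hne (h8.symm.trans h7)
  have h6 := h.formMult_le_one h5
  have h7 := Set.ncard_union_add_ncard_inter {i | f i ∈ N'} {i | f i ∈ N} (Set.toFinite _)
    (Set.toFinite _)
  have h8 : ({i | f i ∈ N'} ∪ {i | f i ∈ N}).ncard ≤ formMult f N₀ := by
    refine Set.ncard_le_ncard ?_ (Set.toFinite _)
    rintro i (hi | hi)
    · exact hN' hi
    · exact hN hi
  have h9 : ({i | f i ∈ N'} ∩ {i | f i ∈ N}).ncard = formMult f (N' ⊓ N) := rfl
  rw [h9] at h7
  have h10 : ({i | f i ∈ N'}).ncard = formMult f N' := rfl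
  have h11 : ({i | f i ∈ N}).ncard = formMult f N := rfl
  omega

/-- A triple line through a point on at most four planes is invariant if the point is. -/
lemma triple_stable {N₀ N : Submodule ℂ V} (hN₀ : ∀ a ∈ N₀, B a ∈ N₀) (hm : formMult f N₀ ≤ 4)
    (hN : N ≤ N₀) (h2 : finrank ℂ N = 2) (h3 : formMult f N = 3) : ∀ a ∈ N, B a ∈ N := by
  obtain ⟨σ, hσ, hσσ⟩ := h.exists_perm
  have hinj : Function.Injective B := fun a b hab ↦ by rw [← h.sq a, ← h.sq b, hab]
  let N' := N.map B
  have h2' : finrank ℂ N' = 2 := by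
    rw [← h2]
    exact (Submodule.equivMapOfInjective B hinj N).finrank_eq.symm
  have h3' : 3 ≤ formMult f N' := by
    rw [← h3]
    refine Set.ncard_le_ncard_of_injOn σ (fun i hi ↦ ?_) (fun i _ j _ hij ↦ ?_) (Set.toFinite _)
    · obtain ⟨c, hc⟩ := hσ i
      have h1 : B (f i) ∈ N' := Submodule.mem_map_of_mem hi
      rw [hc] at h1
      refine (N'.smul_mem_iff ?_).mp h1
      rintro rfl
      rw [zero_smul, ← map_zero B] at hc
      exact h.ne_zero i (hinj hc)
    · rw [← hσσ i, ← hσσ j, hij]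
  have hN' : N' ≤ N₀ := by
    rintro _ ⟨a, ha, rfl⟩
    exact hN₀ a (hN ha)
  intro a ha
  rw [← h.triple_unique hm hN hN' h2 h2' h3.ge h3']
  exact Submodule.mem_map_of_mem ha

/-- At most three planes which contain no triple line have independent equations. -/
lemma exists_adapted_basis {N : Submodule ℂ V} (hm : formMult f N ≤ 3)
    (hN : ∀ N' ≤ N, finrank ℂ N' = 2 → formMult f N' ≠ 3) {d : ℕ} (hd : finrank ℂ N = d) :
    ∃ b : Basis (Fin d) ℂ N, ∀ i, f i ∈ N → ∃ k, f i = b k := by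
  classical
  let s : Set (Fin 8) := {i | f i ∈ N}
  let g : s → N := fun i ↦ ⟨f i, i.2⟩
  have hli : LinearIndependent ℂ g := by
    have h1 : LinearIndependent ℂ (fun i : s ↦ f i) := by
      rw [linearIndependent_iff_card_le_finrank_span]
      let W := Submodule.span ℂ (Set.range fun i : s ↦ f i)
      change Fintype.card s ≤ finrank ℂ W
      have hcard : Fintype.card s = formMult f N := (Set.fintypeCard_eq_ncard s)
      have hfW (i : Fin 8) (hi : f i ∈ N) : f i ∈ W := Submodule.subset_span ⟨⟨i, hi⟩, rfl⟩
      have hWN : W ≤ N := by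
        rw [Submodule.span_le]
        rintro _ ⟨i, rfl⟩
        exact i.2
      have hWm : formMult f W = formMult f N :=
        le_antisymm (formMult_mono hWN) (Set.ncard_le_ncard (fun i hi ↦ hfW i hi) (Set.toFinite _))
      rw [hcard, ← hWm]
      by_contra hlt
      have h1 := hN W hWN
      rcases Nat.lt_or_ge (finrank ℂ W) 2 with h2 | h2
      · have h3 := h.formMult_le_one (N := W) (by omega)
        have h4 : formMult f W = 1 := by omega
        have h5 : finrank ℂ W = 0 := by omega
        obtain ⟨i, hi⟩ := Set.ncard_eq_one.mp h4
        have h6 : f i ∈ W := by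
          have : i ∈ {i | f i ∈ W} := by rw [hi]; rfl
          exact this
        rw [Submodule.finrank_eq_zero.mp h5] at h6
        exact h.ne_zero i h6
      · have h3 : formMult f W = 3 := by omega
        exact h1 (by omega) h3
    exact LinearIndependent.of_comp N.subtype h1
  let b := Basis.sumExtend hli
  have : Fintype (s ⊕ Basis.sumExtendIndex hli) := FiniteDimensional.fintypeBasisIndex b
  have hc : Fintype.card (s ⊕ Basis.sumExtendIndex hli) = d := by
    rw [← hd, finrank_eq_card_basis b]
  let e := Fintype.equivFinOfCardEq hc
  refine ⟨b.reindex e, fun i hi ↦ ⟨e (.inl ⟨i, hi⟩), ?_⟩⟩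
  rw [Basis.reindex_apply, Equiv.symm_apply_apply]
  have : b (.inl ⟨i, hi⟩) = g ⟨i, hi⟩ := by
    simp only [b, Basis.sumExtend, Basis.reindex_apply, Basis.extend_apply_self]
    rfl
  rw [this]

end IsSymmetric
end Forms

/-! ### Products of linear functions and conics -/

section Conic
open IntermediateField

variable {κ : Type} [Field κ] [Algebra ℂ κ]

/-- A product is determined, up to a constant and a square, by the classes of proportional factors
with an odd number of members. -/
lemma exists_prod_eq {ι : Type} [DecidableEq ι] (K : IntermediateField ℂ κ) (x : ι → κ)
    (s : Finset ι) (hx : ∀ i ∈ s, x i ≠ 0) (hK : ∀ i ∈ s, x i ∈ K) :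
    ∃ T ⊆ s, (∀ i ∈ T, ∀ j ∈ T, i ≠ j → ∀ c : ℂ, x j ≠ c • x i) ∧
      (∀ i ∈ T, Odd {j | j ∈ s ∧ ∃ c : ℂ, x j = c • x i}.ncard) ∧
      (∃ k, s.card = T.card + 2 * k) ∧
      ∃ c : ℂ, ∃ q ∈ K, ∏ i ∈ s, x i = c • (q ^ 2 * ∏ i ∈ T, x i) := by
  induction hn : s.card using Nat.strong_induction_on generalizing s with
  | _ n ih =>
  by_cases h : ∃ i ∈ s, ∃ j ∈ s, i ≠ j ∧ ∃ c : ℂ, x j = c • x i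
  · obtain ⟨i, hi, j, hj, hij, c, hc⟩ := h
    have hj' : j ∈ s.erase i := Finset.mem_erase.mpr ⟨hij.symm, hj⟩
    have hsub : (s.erase i).erase j ⊆ s :=
      (Finset.erase_subset _ _).trans (Finset.erase_subset _ _)
    have hcard1 := Finset.card_erase_add_one hi
    have hcard2 := Finset.card_erase_add_one hj'
    obtain ⟨T, hTs, hT1, hT2, ⟨k, hk⟩, d, q, hq, hprod⟩ := ih ((s.erase i).erase j).card
      (by omega) _ (fun l hl ↦ hx l (hsub hl)) (fun l hl ↦ hK l (hsub hl)) rfl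
    refine ⟨T, hTs.trans hsub, hT1, fun l hl ↦ ?_, ⟨k + 1, by omega⟩, c * d, x i * q,
      mul_mem (hK i hi) hq, ?_⟩
    · have hc0 : c ≠ 0 := by
        rintro rfl
        exact hx j hj (by rw [hc, zero_smul])
      have h1 := hT2 l hl
      by_cases hil : ∃ c : ℂ, x i = c • x l
      · have h2 : {j | j ∈ s ∧ ∃ c : ℂ, x j = c • x l} =
            insert i (insert j {k | k ∈ (s.erase i).erase j ∧ ∃ c : ℂ, x k = c • x l}) := by
          ext k
          simp only [Set.mem_ofPred_eq, Set.mem_insert_iff, Finset.mem_erase]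
          constructor
          · rintro ⟨h3, h4⟩
            by_cases hki : k = i
            · exact .inl hki
            · by_cases hkj : k = j
              · exact .inr (.inl hkj)
              · exact .inr (.inr ⟨⟨hkj, hki, h3⟩, h4⟩)
          · rintro (rfl | rfl | ⟨⟨-, -, h3⟩, h4⟩)
            · exact ⟨hi, hil⟩
            · obtain ⟨e, he⟩ := hil
              exact ⟨hj, c * e, by rw [hc, he, smul_smul]⟩
            · exact ⟨h3, h4⟩
        have hfin : {k | k ∈ (s.erase i).erase j ∧ ∃ c : ℂ, x k = c • x l}.Finite :=
          ((s.erase i).erase j).finite_toSet.subset fun k hk ↦ hk.1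
        rw [h2, Set.ncard_insert_of_notMem _ (hfin.insert j), Set.ncard_insert_of_notMem _ hfin]
        · rw [add_assoc, Nat.odd_add]
          simpa using h1
        · simp
        · simp [hij]
      · have h2 : {j | j ∈ s ∧ ∃ c : ℂ, x j = c • x l} =
            {k | k ∈ (s.erase i).erase j ∧ ∃ c : ℂ, x k = c • x l} := by
          ext k
          simp only [Set.mem_ofPred_eq, Finset.mem_erase]
          constructor
          · rintro ⟨h3, e, h4⟩
            refine ⟨⟨?_, ?_, h3⟩, e, h4⟩
            · rintro rfl
              exact hil ⟨c⁻¹ * e, by rw [← smul_smul, ← h4, hc, inv_smul_smul₀ hc0]⟩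
            · rintro rfl
              exact hil ⟨e, h4⟩
          · rintro ⟨⟨-, -, h3⟩, h4⟩
            exact ⟨h3, h4⟩
        rw [h2]
        exact h1
    · rw [← Finset.mul_prod_erase s x hi, ← Finset.mul_prod_erase _ x hj', hprod, hc]
      simp only [Algebra.smul_def, map_mul]
      ring
  · push Not at h
    refine ⟨s, subset_rfl, h, fun i hi ↦ ?_, ⟨0, by omega⟩, 1, 1, one_mem _, by simp⟩
    have : {j | j ∈ s ∧ ∃ c : ℂ, x j = c • x i} = {i} := by
      ext j
      simp only [Set.mem_ofPred_eq, Set.mem_singleton_iff]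
      constructor
      · rintro ⟨h1, c, h2⟩
        by_contra h3
        exact h i hi j h1 (fun e ↦ h3 e.symm) c h2
      · rintro rfl
        exact ⟨hi, 1, by simp⟩
    rw [this, Set.ncard_singleton]
    exact odd_one

/-- The conic `ω² = c p q` with `p`, `q` linear in `τ` is rational. -/
lemma exists_conic_parameter {τ p q q₀ ω : κ} {c x y x' y' : ℂ}
    (hp : p = algebraMap ℂ κ x + algebraMap ℂ κ y * τ)
    (hq : q = algebraMap ℂ κ x' + algebraMap ℂ κ y' * τ) (hp0 : p ≠ 0)
    (hpq : ∀ d : ℂ, q ≠ d • p) (hq₀ : q₀ ∈ ℂ⟮τ⟯) (hω : ω ^ 2 = c • (q₀ ^ 2 * (p * q))) :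
    ∃ τ' : κ, τ ∈ ℂ⟮τ'⟯ ∧ ω ∈ ℂ⟮τ'⟯ := by
  by_cases hc : c = 0
  · rw [hc, zero_smul, sq_eq_zero_iff] at hω
    exact ⟨τ, mem_adjoin_simple_self ℂ τ, by rw [hω]; exact zero_mem _⟩
  by_cases hq0 : q₀ = 0
  · rw [hq0, zero_pow two_ne_zero, zero_mul, smul_zero, sq_eq_zero_iff] at hω
    exact ⟨τ, mem_adjoin_simple_self ℂ τ, by rw [hω]; exact zero_mem _⟩
  have hc' : algebraMap ℂ κ c ≠ 0 := (map_ne_zero _).mpr hc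
  rw [Algebra.smul_def] at hω
  obtain ⟨τ', hτ'⟩ : ∃ τ', ω = τ' * p * q₀ := ⟨ω / (p * q₀), by field_simp⟩
  have h1 : τ' ^ 2 * p = algebraMap ℂ κ c * q := by
    apply mul_right_cancel₀ hp0
    apply mul_right_cancel₀ (pow_ne_zero 2 hq0)
    rw [hτ'] at hω
    linear_combination hω
  have hτ'' : τ' ∈ ℂ⟮τ'⟯ := mem_adjoin_simple_self ℂ τ'
  have hconst (d : ℂ) : algebraMap ℂ κ d ∈ ℂ⟮τ'⟯ := IntermediateField.algebraMap_mem _ d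
  have hnsq (d : ℂ) : τ' ^ 2 ≠ algebraMap ℂ κ d := by
    intro h2
    refine hpq (c⁻¹ * d) ?_
    rw [h2] at h1
    apply mul_left_cancel₀ hc'
    rw [← h1, Algebra.smul_def, map_mul, map_inv₀]
    field_simp
  have h2 : (τ' ^ 2 * algebraMap ℂ κ y - algebraMap ℂ κ (c * y')) * τ =
      algebraMap ℂ κ (c * x') - τ' ^ 2 * algebraMap ℂ κ x := by
    rw [hp, hq] at h1
    rw [map_mul, map_mul]
    linear_combination h1
  have hsolve {a b : ℂ} (ha : a ≠ 0) (h : τ' ^ 2 * algebraMap ℂ κ a = algebraMap ℂ κ b) : False := by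
    refine hnsq (b / a) ?_
    rw [map_div₀, ← h]
    have : algebraMap ℂ κ a ≠ 0 := (map_ne_zero _).mpr ha
    field_simp
  have hτ : τ ∈ ℂ⟮τ'⟯ := by
    by_cases h3 : τ' ^ 2 * algebraMap ℂ κ y - algebraMap ℂ κ (c * y') = 0
    · exfalso
      rw [h3, zero_mul] at h2
      by_cases hy : y = 0
      · refine hsolve (a := x) ?_ (sub_eq_zero.mp h2.symm).symm
        rintro rfl
        rw [hy] at hp
        exact hp0 (by simpa using hp)
      · exact hsolve hy (sub_eq_zero.mp h3)
    · have h4 : τ = (algebraMap ℂ κ (c * x') - τ' ^ 2 * algebraMap ℂ κ x) /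
          (τ' ^ 2 * algebraMap ℂ κ y - algebraMap ℂ κ (c * y')) := by
        rw [eq_div_iff h3, mul_comm]
        exact h2
      rw [h4]
      exact div_mem (sub_mem (hconst _) (mul_mem (pow_mem hτ'' 2) (hconst _)))
        (sub_mem (mul_mem (pow_mem hτ'' 2) (hconst _)) (hconst _))
  refine ⟨τ', hτ, ?_⟩
  rw [hτ', hp]
  exact mul_mem (mul_mem hτ'' (add_mem (hconst _) (mul_mem (hconst _) hτ)))
    ((adjoin_simple_le_iff.mpr hτ : ℂ⟮τ⟯ ≤ ℂ⟮τ'⟯) hq₀)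

end Conic

/-! ### Charts of the blow-ups of points and lines -/

section Charts
set_option linter.unusedSectionVars false
open Module Module.End

/-- `z` is a monomial in the coordinates `c`, up to a unit. -/
def IsMonomial {R : Type} [CommRing R] (c : Fin 3 → R) (z : R) : Prop :=
  ∃ (g : R) (n : Fin 3 → ℕ), IsUnit g ∧ z = g * ∏ j, c j ^ n j

section Monomial
variable {R : Type} [CommRing R] {c : Fin 3 → R}

lemma IsMonomial.of_isUnit {z : R} (hz : IsUnit z) : IsMonomial c z := ⟨z, 0, hz, by simp⟩

lemma IsMonomial.coord (j : Fin 3) : IsMonomial c (c j) :=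
  ⟨1, Pi.single j 1, isUnit_one, by simp [Pi.single_apply, pow_ite]⟩

lemma IsMonomial.mul {z z' : R} (hz : IsMonomial c z) (hz' : IsMonomial c z') :
    IsMonomial c (z * z') := by
  obtain ⟨g, n, hg, rfl⟩ := hz
  obtain ⟨g', n', hg', rfl⟩ := hz'
  refine ⟨g * g', n + n', hg.mul hg', ?_⟩
  simp only [Pi.add_apply, pow_add, Finset.prod_mul_distrib]
  ring

lemma IsMonomial.smul [Algebra ℂ R] {z : R} (hz : IsMonomial c z) {a : ℂ} (ha : a ≠ 0) :
    IsMonomial c (a • z) := by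
  rw [Algebra.smul_def]
  exact (IsMonomial.of_isUnit ((isUnit_iff_ne_zero.mpr ha).map _)).mul hz

end Monomial

variable {V : Type} [AddCommGroup V] [Module ℂ V] [FiniteDimensional ℂ V] {f : Fin 8 → V}
  {B : End ℂ V}
variable {R R' κ : Type} [CommRing R] [CommRing R'] [IsDomain R] [IsDomain R'] [IsLocalRing R']
  [Algebra ℂ R] [Algebra ℂ R'] [Field κ] [Algebra ℂ κ]

lemma span_image_eq (Λ : V →ₗ[ℂ] R) {N : Submodule ℂ V} {n : ℕ} (b : Basis (Fin n) ℂ N) :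
    Ideal.span (Λ '' N) = Ideal.span ((fun i ↦ Λ (b i)) '' Set.univ) := by
  apply le_antisymm
  · rw [Ideal.span_le]
    rintro _ ⟨a, ha, rfl⟩
    have h1 : Λ a = ∑ i, b.repr ⟨a, ha⟩ i • Λ (b i) := by
      have h2 := congrArg (fun x : N ↦ Λ x) (b.sum_repr ⟨a, ha⟩)
      simp only [Submodule.coe_sum, map_sum, Submodule.coe_smul, map_smul] at h2
      exact h2.symm
    rw [h1]
    refine Submodule.sum_mem _ fun i _ ↦ ?_
    rw [Algebra.smul_def]
    exact Ideal.mul_mem_left _ _ (Ideal.subset_span ⟨i, trivial, rfl⟩)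
  · rw [Ideal.span_le]
    rintro _ ⟨i, -, rfl⟩
    exact Ideal.subset_span ⟨b i, (b i).2, rfl⟩

/-- Three independent vectors of a three-dimensional space. -/
lemma exists_basis {N : Submodule ℂ V} (hN : finrank ℂ N = 3) (u : Fin 3 → V) (hu : ∀ i, u i ∈ N)
    (hli : LinearIndependent ℂ u) : ∃ b : Basis (Fin 3) ℂ N, ∀ i, (b i : V) = u i := by
  have h1 : LinearIndependent ℂ (fun i ↦ (⟨u i, hu i⟩ : N)) :=
    LinearIndependent.of_comp N.subtype hli
  refine ⟨basisOfLinearIndependentOfCardEqFinrank h1 (by simp [hN]), fun i ↦ ?_⟩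
  rw [coe_basisOfLinearIndependentOfCardEqFinrank]

/-- The blow-up of a point, in the chart where the form `b₀` generates the exceptional divisor and
the quotients of the forms in `N₁` by `b₀` vanish. -/
lemma exists_chart (Λ : V →ₗ[ℂ] R) (φ : R →ₐ[ℂ] R') (hφ : Function.Injective φ) (ρ : R' →ₐ[ℂ] κ)
    {N₀ : Submodule ℂ V} (h3 : finrank ℂ N₀ = 3)
    (hcoord : ∀ b : Basis (Fin 3) ℂ N₀, IsCoord fun i ↦ Λ (b i))
    (hbl : IsLocalBlowup φ.toRingHom (Ideal.span (Λ '' N₀))) {N₁ : Submodule ℂ V} (h1 : N₁ ≤ N₀)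
    {b₀ : V} (hb₀ : b₀ ∈ N₀) (hb₀' : b₀ ∉ N₁)
    (hspan : (Ideal.span (Λ '' N₀)).map φ.toRingHom = Ideal.span {φ (Λ b₀)})
    (hρ : ∀ a ∈ N₁, ∀ y, φ (Λ a) = y * φ (Λ b₀) → ρ y = 0) (b : Basis (Fin 2) ℂ N₁) :
    ∃ y : Fin 2 → R', IsCoord (Fin.cons (φ (Λ b₀)) y : Fin 3 → R') ∧
      (∀ j, φ (Λ (b j)) = y j * φ (Λ b₀)) ∧ ∀ j, ρ (y j) = 0 := by
  have hli : LinearIndependent ℂ (Fin.cons b₀ fun j ↦ (b j : V) : Fin 3 → V) := by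
    refine LinearIndependent.finCons (b.linearIndependent.map' N₁.subtype N₁.ker_subtype) ?_
    intro hmem
    refine hb₀' ((Submodule.span_le.mpr ?_ : Submodule.span ℂ _ ≤ N₁) hmem)
    rintro _ ⟨j, rfl⟩
    exact (b j).2
  obtain ⟨b', hb'⟩ := exists_basis h3 _ (by
    intro i
    refine Fin.cases hb₀ (fun j ↦ ?_) i
    exact h1 (b j).2) hli
  have hc := hcoord b'
  rw [span_image_eq Λ b'] at hbl hspan
  have hb0 : (b' 0 : V) = b₀ := by rw [hb']; rfl
  have hbj (j : Fin 2) : (b' j.succ : V) = b j := by rw [hb']; rfl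
  obtain ⟨c', hc', hc0, hcj, -⟩ := hc.blowup φ hφ hbl (k := 0) (by rw [hb0]; exact hspan)
  rw [hb0] at hc0 hcj
  have hj (j : Fin 2) : φ (Λ (b j)) = c' j.succ * φ (Λ b₀) := by
    rw [← hbj]
    exact hcj j.succ trivial (Fin.succ_ne_zero j)
  refine ⟨fun j ↦ c' j.succ, ?_, hj, fun j ↦ hρ _ (b j).2 _ (hj j)⟩
  have : (Fin.cons (φ (Λ b₀)) fun j ↦ c' j.succ : Fin 3 → R') = c' := by
    ext i
    refine Fin.cases ?_ (fun j ↦ ?_) i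
    · exact hc0.symm
    · rfl
  rw [this]
  exact hc'

/-- The blow-up of a point at a fixed point of an involution: either the coordinates can be chosen
to vanish, or there is one coordinate `y` which is not constant. -/
lemma pointBlowup (h : IsSymmetric f B) (Λ : V →ₗ[ℂ] R) (φ : R →ₐ[ℂ] R')
    (hφ : Function.Injective φ) (ρ : R' →ₐ[ℂ] κ) (hΛ : Function.Injective Λ)
    {N₀ : Submodule ℂ V} (h3 : finrank ℂ N₀ = 3)
    (hneg : eigenspace B (-1) ≤ N₀) (hstab : ∀ a ∈ N₀, B a ∈ N₀)
    (hcoord : ∀ b : Basis (Fin 3) ℂ N₀, IsCoord fun i ↦ Λ (b i))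
    (hbl : IsLocalBlowup φ.toRingHom (Ideal.span (Λ '' N₀)))
    (hodd : ∀ a b y, b ≠ 0 → φ (Λ a) = y * φ (Λ b) →
      (a ∈ eigenspace B 1 ∧ b ∈ eigenspace B (-1) ∨ a ∈ eigenspace B (-1) ∧ b ∈ eigenspace B 1) →
      ρ y = 0) :
    (∃ N₁ ≤ N₀, finrank ℂ N₁ = 2 ∧ (∀ a ∈ N₁, B a ∈ N₁) ∧ ∃ b₀ ∈ N₀, b₀ ∉ N₁ ∧
      ∀ b : Basis (Fin 2) ℂ N₁, ∃ y : Fin 2 → R', IsCoord (Fin.cons (φ (Λ b₀)) y : Fin 3 → R') ∧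
        (∀ j, φ (Λ (b j)) = y j * φ (Λ b₀)) ∧ ∀ j, ρ (y j) = 0) ∨
    ∃ b : Basis (Fin 3) ℂ N₀, (b 0 : V) ∈ eigenspace B (-1) ∧ (b 1 : V) ∈ eigenspace B (-1) ∧
      (b 2 : V) ∈ eigenspace B 1 ∧ ∃ y z : R', IsCoord ![φ (Λ (b 0)), y, z] ∧
        φ (Λ (b 1)) = y * φ (Λ (b 0)) ∧ φ (Λ (b 2)) = z * φ (Λ (b 0)) ∧ ρ z = 0 ∧
        ∀ a : ℂ, ρ y ≠ algebraMap ℂ κ a := by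
  have hΛ0 {a : V} (ha : a ≠ 0) : φ (Λ a) ≠ 0 := by
    rwa [Ne, map_eq_zero_iff _ hφ, map_eq_zero_iff _ hΛ]
  have hfr := h.finrank_eigenspace (-1) (.inr rfl)
  obtain ⟨s, hsN, hs, hs0⟩ : ∃ s ∈ N₀, s ∈ eigenspace B 1 ∧ s ≠ 0 := by
    by_contra! hcon
    have hle : N₀ ≤ eigenspace B (-1) := by
      intro a ha
      rw [mem_eigenspace_iff, neg_smul]
      exact eq_neg_of_add_eq_zero_left (hcon _ (N₀.add_mem (hstab a ha) (N₀.smul_mem _ ha))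
        (h.add_smul_mem 1 (.inl rfl) a))
    have := Submodule.finrank_mono hle
    omega
  have hsn : s ∉ eigenspace B (-1) := by
    intro hs'
    have h1 : s ∈ eigenspace B 1 ⊓ eigenspace B (-1) := ⟨hs, hs'⟩
    rw [h.inf_eigenspace] at h1
    exact hs0 h1
  -- a basis of eigenvectors with given vectors in the odd part
  have hbasis (u v : V) (hu : u ∈ eigenspace B (-1)) (hv : v ∈ eigenspace B (-1))
      (huv : LinearIndependent ℂ ![u, v]) : ∃ b : Basis (Fin 3) ℂ N₀, (b 0 : V) = u ∧
        (b 1 : V) = v ∧ (b 2 : V) = s := by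
    have hli : LinearIndependent ℂ (Fin.cons s ![u, v] : Fin 3 → V) := by
      refine LinearIndependent.finCons huv fun hmem ↦ hsn ?_
      refine (Submodule.span_le.mpr ?_ : Submodule.span ℂ _ ≤ eigenspace B (-1)) hmem
      rintro _ ⟨j, rfl⟩
      fin_cases j
      exacts [hu, hv]
    have hli' : LinearIndependent ℂ ![u, v, s] := by
      have h1 := hli.comp ![1, 2, 0] (by decide)
      convert h1 using 1
      ext j
      fin_cases j <;> rfl
    obtain ⟨b, hb⟩ := exists_basis h3 ![u, v, s] (by
      intro i
      fin_cases i
      exacts [hneg hu, hneg hv, hsN]) hli'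
    exact ⟨b, hb 0, hb 1, hb 2⟩
  -- one of the basis vectors generates the exceptional divisor
  have hgen : (∃ u v : V, u ∈ eigenspace B (-1) ∧ v ∈ eigenspace B (-1) ∧
      LinearIndependent ℂ ![u, v] ∧
      (Ideal.span (Λ '' N₀)).map φ.toRingHom = Ideal.span {φ (Λ u)}) ∨
      (Ideal.span (Λ '' N₀)).map φ.toRingHom = Ideal.span {φ (Λ s)} := by
    let e := finBasisOfFinrankEq ℂ (eigenspace B (-1)) hfr
    have hli : LinearIndependent ℂ ![(e 0 : V), e 1] := by
      have h5 := e.linearIndependent.map' (eigenspace B (-1)).subtype (Submodule.ker_subtype _)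
      have heq : ![(e 0 : V), e 1] = (eigenspace B (-1)).subtype ∘ e := by
        funext j
        fin_cases j <;> rfl
      rw [heq]
      exact h5
    obtain ⟨b, hb0, hb1, hb2⟩ := hbasis _ _ (e 0).2 (e 1).2 hli
    have hspanb := span_image_eq Λ b
    obtain ⟨γ₀, ⟨k, -, rfl⟩, -, hspan⟩ := (hspanb ▸ hbl).exists_generator
    rw [← hspanb] at hspan
    have hk : k = 0 ∨ k = 1 ∨ k = 2 := by fin_cases k <;> simp
    rcases hk with rfl | rfl | rfl
    · simp only [hb0] at hspan
      exact .inl ⟨_, _, (e 0).2, (e 1).2, hli, hspan⟩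
    · simp only [hb1] at hspan
      exact .inl ⟨_, _, (e 1).2, (e 0).2, LinearIndependent.pair_symm_iff.mp hli, hspan⟩
    · simp only [hb2] at hspan
      exact .inr hspan
  rcases hgen with ⟨u, v, hu, hv, huv, hspan⟩ | hspan
  · obtain ⟨b, hb0, hb1, hb2⟩ := hbasis u v hu hv huv
    have hbl' := hbl
    have hspan' := hspan
    rw [span_image_eq Λ b] at hbl' hspan'
    obtain ⟨c', hc', hc0, hcj, -⟩ := (hcoord b).blowup φ hφ hbl' (k := 0)
      (by rw [hb0]; exact hspan')
    have h1 := hcj 1 trivial (by simp)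
    have h2 := hcj 2 trivial (by simp)
    have hu0 : u ≠ 0 := huv.ne_zero 0
    have hz : ρ (c' 2) = 0 := by
      rw [hb2, hb0] at h2
      exact hodd s u _ hu0 h2 (.inl ⟨hs, hu⟩)
    by_cases hconst : ∃ a : ℂ, ρ (c' 1) = algebraMap ℂ κ a
    · obtain ⟨a, ha⟩ := hconst
      left
      let v' := v - a • u
      have hv' : v' ∈ eigenspace B (-1) := Submodule.sub_mem _ hv (Submodule.smul_mem _ _ hu)
      have huv' : LinearIndependent ℂ ![u, v'] := by
        rw [LinearIndependent.pair_iff] at huv ⊢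
        intro p q hpq
        have h5 := huv (p - q * a) q (by rw [← hpq]; simp only [v']; module)
        refine ⟨?_, h5.2⟩
        have := h5.1
        rw [h5.2] at this
        simpa using this
      obtain ⟨b', hb0', hb1', hb2'⟩ := hbasis u v' hu hv' huv'
      have hli : LinearIndependent ℂ ![v', s] := by
        have h5 := b'.linearIndependent.map' N₀.subtype N₀.ker_subtype
        have h6 := h5.comp ![1, 2] (by decide)
        have heq : ![v', s] = (N₀.subtype ∘ b') ∘ ![1, 2] := by
          funext j
          fin_cases j
          · exact hb1'.symm
          · exact hb2'.symm
        rw [heq]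
        exact h6
      have hfin : finrank ℂ (Submodule.span ℂ {v', s}) = 2 := by
        have := finrank_span_eq_card hli
        rwa [Matrix.range_cons_cons_empty] at this
      have hunot : u ∉ Submodule.span ℂ {v', s} := by
        intro hmem
        obtain ⟨p, q, hpq⟩ := Submodule.mem_span_pair.mp hmem
        have h5 := b'.linearIndependent.map' N₀.subtype N₀.ker_subtype
        rw [Fintype.linearIndependent_iff] at h5
        have h6 := h5 ![-1, p, q] (by
          simp [Fin.sum_univ_three, hb0', hb1', hb2', ← hpq]) 0
        simp at h6
      refine ⟨Submodule.span ℂ {v', s}, ?_, hfin, ?_, u, hneg hu, hunot, ?_⟩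
      · rw [Submodule.span_le]
        rintro _ (rfl | rfl)
        exacts [hneg hv', hsN]
      · intro x hx
        obtain ⟨p, q, rfl⟩ := Submodule.mem_span_pair.mp hx
        rw [map_add, map_smul, map_smul, mem_eigenspace_iff.mp hv', mem_eigenspace_iff.mp hs,
          Submodule.mem_span_pair]
        exact ⟨-p, q, by module⟩
      · refine exists_chart Λ φ hφ ρ h3 hcoord hbl ?_ (hneg hu) hunot hspan ?_
        · rw [Submodule.span_le]
          rintro _ (rfl | rfl)
          exacts [hneg hv', hsN]
        · intro x hx y hy
          obtain ⟨p, q, rfl⟩ := Submodule.mem_span_pair.mp hx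
          have h5 : y = p • (c' 1 - algebraMap ℂ R' a) + q • c' 2 := by
            apply mul_right_cancel₀ (hΛ0 hu0)
            rw [← hy]
            rw [hb1, hb0] at h1
            rw [hb2, hb0] at h2
            simp only [v', map_add, map_smul, map_sub, h1, h2]
            simp only [Algebra.smul_def]
            ring
          rw [h5, map_add, map_smul, map_smul, map_sub, hz, ha, AlgHom.commutes, sub_self]
          simp
    · right
      push Not at hconst
      refine ⟨b, by rw [hb0]; exact hu, by rw [hb1]; exact hv, by rw [hb2]; exact hs, c' 1, c' 2,
        ?_, h1, h2, hz, hconst⟩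
      convert hc' using 1
      ext j
      fin_cases j
      · exact hc0.symm
      · rfl
      · rfl
  · left
    refine ⟨eigenspace B (-1), hneg, hfr, h.stable_eigenspace (-1), s, hsN, hsn, ?_⟩
    exact exists_chart Λ φ hφ ρ h3 hcoord hbl hneg hsN hsn hspan
      fun a ha y hy ↦ hodd a s y hs0 hy (.inr ⟨ha, hs⟩)

/-- The blow-up of a line at a point where both quotients of its equations vanish. -/
lemma lineBlowup [IsLocalRing R] {x y₁ y₂ : R} (hc : IsCoord ![x, y₁, y₂]) (φ : R →ₐ[ℂ] R')
    (hφ : Function.Injective φ) (ρ : R' →ₐ[ℂ] κ) (hunit : ∀ z, ρ z ≠ 0 → IsUnit z)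
    (hx : ρ (φ x) = 0) (hy₁ : ρ (φ y₁) = 0) (hy₂ : ρ (φ y₂) = 0)
    (hbl : IsLocalBlowup φ.toRingHom (Ideal.span {y₁, y₂}))
    (h1 : ∀ z, φ y₁ = z * φ y₂ → ρ z = 0) (h2 : ∀ z, φ y₂ = z * φ y₁ → ρ z = 0) :
    ∃ c : Fin 3 → R', IsCoord c ∧ (∀ i, ρ (c i) = 0) ∧ c 0 = φ x ∧
      ∀ α β : ℂ, ¬ (α = 0 ∧ β = 0) → IsMonomial c (φ (α • y₁ + β • y₂)) := by
  have himg : (![x, y₁, y₂] : Fin 3 → R) '' {1, 2} = {y₁, y₂} := by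
    rw [Set.image_pair]; rfl
  rw [← himg] at hbl
  obtain ⟨γ₀, hγ₀, -, hspan⟩ := hbl.exists_generator
  have hadd {z : R'} (hz : ρ z = 0) {α : ℂ} (hα : α ≠ 0) (β : ℂ) :
      IsUnit (algebraMap ℂ R' α + β • z) := by
    refine hunit _ ?_
    rw [map_add, AlgHom.commutes, map_smul, hz, smul_zero, add_zero]
    exact (map_ne_zero _).mpr hα
  rw [himg] at hγ₀
  rcases hγ₀ with rfl | rfl
  · obtain ⟨c, hc', hc1, hc2, hc0⟩ := hc.blowup φ hφ hbl (k := 1) hspan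
    have h0 : c 0 = φ x := hc0 0 (by simp)
    have h3 : φ y₂ = c 2 * φ γ₀ := hc2 2 (by simp) (by simp)
    have h4 : c 1 = φ γ₀ := hc1
    have hr := h2 _ h3
    refine ⟨c, hc', ?_, h0, fun α β hαβ ↦ ?_⟩
    · intro i
      fin_cases i
      · exact (congrArg ρ h0).trans hx
      · exact (congrArg ρ h4).trans hy₁
      · exact hr
    · have h5 : φ (α • γ₀ + β • y₂) = (algebraMap ℂ R' α + β • c 2) * c 1 := by
        rw [map_add, map_smul, map_smul, h3, h4]
        simp only [Algebra.smul_def]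
        ring
      rw [h5]
      by_cases hα : α = 0
      · have hβ : β ≠ 0 := fun hβ ↦ hαβ ⟨hα, hβ⟩
        rw [hα, map_zero, zero_add]
        exact ((IsMonomial.coord 2).smul hβ).mul (IsMonomial.coord 1)
      · exact (IsMonomial.of_isUnit (hadd hr hα β)).mul (IsMonomial.coord 1)
  · obtain ⟨c, hc', hc1, hc2, hc0⟩ := hc.blowup φ hφ hbl (k := 2) hspan
    have h0 : c 0 = φ x := hc0 0 (by simp)
    have h3 : φ y₁ = c 1 * φ γ₀ := hc2 1 (by simp) (by simp)
    have h4 : c 2 = φ γ₀ := hc1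
    have hr := h1 _ h3
    refine ⟨c, hc', ?_, h0, fun α β hαβ ↦ ?_⟩
    · intro i
      fin_cases i
      · exact (congrArg ρ h0).trans hx
      · exact hr
      · exact (congrArg ρ h4).trans hy₂
    · have h5 : φ (α • y₁ + β • γ₀) = (algebraMap ℂ R' β + α • c 1) * c 2 := by
        rw [map_add, map_smul, map_smul, h3, h4]
        simp only [Algebra.smul_def]
        ring
      rw [h5]
      by_cases hβ : β = 0
      · have hα : α ≠ 0 := fun hα ↦ hαβ ⟨hα, hβ⟩
        rw [hβ, map_zero, zero_add]
        exact ((IsMonomial.coord 1).smul hα).mul (IsMonomial.coord 2)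
      · exact (IsMonomial.of_isUnit (hadd hr hβ α)).mul (IsMonomial.coord 2)

end Charts

/-! ### The tower of local rings at a fixed point -/

section LocalTower
open Module Module.End IsLocalRing IntermediateField
set_option linter.unusedSectionVars false
set_option linter.overlappingInstances false

variable {V : Type} [AddCommGroup V] [Module ℂ V]

/-- The local rings of the double octic at a point fixed by an involution: `R₀`, `R₁`, `R₂`, `R₃`
are the local rings of `ℙ³` and of its blow-ups, `S` and `O` those of the double cover and of its
resolution, and `κ` is the residue field. The forms `a` of degree one give functions `Λ a = a / h`
in `R₀`, where the form `h` does not vanish at the point. The residue field of the fixed point is that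
of the generic point of a curve on which the involution is trivial. The ideals of the centres of the
blow-ups are given through the primes that contain them; a prime `𝔮` in `le₂` is a point of the triple
lines outside of the fivefold points, which specializes to `𝔭` in the closure. -/
structure LocalTower (f : Fin 8 → V) (B : End ℂ V) (R₀ R₁ R₂ R₃ S O κ : Type)
    [CommRing R₀] [CommRing R₁] [CommRing R₂] [CommRing R₃] [CommRing S] [CommRing O] [Field κ]
    [Algebra ℂ R₀] [Algebra ℂ R₁] [Algebra ℂ R₂] [Algebra ℂ R₃] [Algebra ℂ S] [Algebra ℂ O]
    [Algebra ℂ κ] where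
  /-- The function `a / h`. -/
  Λ : V →ₗ[ℂ] R₀
  /-- The denominator. -/
  h : V
  Λ_h : Λ h = 1
  isCoord : ∀ a : Fin 3 → V, LinearIndependent ℂ (Fin.cons h a : Fin 4 → V) →
    IsCoord fun i ↦ Λ (a i)
  φ₁ : R₀ →ₐ[ℂ] R₁
  φ₂ : R₁ →ₐ[ℂ] R₂
  φ₃ : R₂ →ₐ[ℂ] R₃
  φ₄ : R₃ →ₐ[ℂ] S
  φ₅ : S →ₐ[ℂ] O
  θ : O →ₐ[ℂ] κ
  local₁ : IsLocalHom φ₁.toRingHom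
  local₂ : IsLocalHom φ₂.toRingHom
  local₃ : IsLocalHom φ₃.toRingHom
  local₄ : IsLocalHom φ₄.toRingHom
  local₅ : IsLocalHom φ₅.toRingHom
  inj₁ : Function.Injective φ₁
  inj₂ : Function.Injective φ₂
  inj₃ : Function.Injective φ₃
  inj₄ : Function.Injective φ₄
  inj₅ : Function.Injective φ₅
  surj : Function.Surjective θ
  /-- The ideal of the fivefold points. -/
  I₁ : Ideal R₀
  /-- The ideal of the strict transform of the triple lines. -/
  I₂ : Ideal R₁
  /-- The ideal of the fourfold points. -/
  I₃ : Ideal R₂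
  /-- The ideal of the singular locus of the double cover. -/
  J : Ideal S
  radical₁ : I₁.IsRadical
  radical₂ : I₂.IsRadical
  radical₃ : I₃.IsRadical
  radical₄ : J.IsRadical
  le₁ : ∀ 𝔭 : Ideal R₀, 𝔭.IsPrime → (I₁ ≤ 𝔭 ↔ ∃ N : Submodule ℂ V, finrank ℂ N = 3 ∧
    formMult f N = 5 ∧ ∀ a ∈ N, Λ a ∈ 𝔭)
  le₂ : ∀ 𝔭 : Ideal R₁, 𝔭.IsPrime → (I₂ ≤ 𝔭 ↔ ∃ 𝔮 ≤ 𝔭, 𝔮.IsPrime ∧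
    ¬ I₁ ≤ 𝔮.comap φ₁.toRingHom ∧ ∃ N : Submodule ℂ V, finrank ℂ N = 2 ∧
    formMult f N = 3 ∧ ∀ a ∈ N, φ₁ (Λ a) ∈ 𝔮)
  le₃ : ∀ 𝔭 : Ideal R₂, 𝔭.IsPrime → (I₃ ≤ 𝔭 ↔ ∃ N : Submodule ℂ V, finrank ℂ N = 3 ∧
    formMult f N = 4 ∧ (∀ N' ≤ N, finrank ℂ N' = 2 → formMult f N' ≠ 3) ∧
    ∀ a ∈ N, φ₂ (φ₁ (Λ a)) ∈ 𝔭)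
  le₄ : ∀ 𝔭 : Ideal S, ∀ _ : 𝔭.IsPrime,
    (J ≤ 𝔭 ↔ ¬ Algebra.FormallySmooth ℂ (Localization.AtPrime 𝔭))
  blowup₁ : IsLocalBlowup φ₁.toRingHom I₁
  blowup₂ : IsLocalBlowup φ₂.toRingHom I₂
  blowup₃ : IsLocalBlowup φ₃.toRingHom I₃
  blowup₄ : IsLocalBlowup φ₅.toRingHom J
  /-- The action of the involution. -/
  Φ : O →+* O
  Φ_Λ : ∀ a, Φ (φ₅ (φ₄ (φ₃ (φ₂ (φ₁ (Λ a)))))) = φ₅ (φ₄ (φ₃ (φ₂ (φ₁ (Λ (B a))))))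
  θ_Φ : ∀ z, θ (Φ z) = θ z
  /-- The square root of the octic form. -/
  w : S
  w_sq : w ^ 2 = φ₄ (φ₃ (φ₂ (φ₁ (∏ i, Λ (f i)))))
  frac : ∀ z : S, ∃ α β γ : R₀, γ ≠ 0 ∧ z * φ₄ (φ₃ (φ₂ (φ₁ γ))) =
    φ₄ (φ₃ (φ₂ (φ₁ α))) + φ₄ (φ₃ (φ₂ (φ₁ β))) * w
  int : ∀ z : S, ∃ b s : S, φ₄.toRingHom.IsIntegralElem b ∧ φ₄.toRingHom.IsIntegralElem s ∧
    IsUnit s ∧ z * s = b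

namespace LocalTower

variable [FiniteDimensional ℂ V] {f : Fin 8 → V} {B : End ℂ V} {R₀ R₁ R₂ R₃ S O κ : Type}
  [CommRing R₀] [CommRing R₁] [CommRing R₂] [CommRing R₃] [CommRing S] [CommRing O] [Field κ]
  [Algebra ℂ R₀] [Algebra ℂ R₁] [Algebra ℂ R₂] [Algebra ℂ R₃] [Algebra ℂ S] [Algebra ℂ O]
  [Algebra ℂ κ] [IsDomain R₀] [IsDomain R₁] [IsDomain R₂] [IsDomain R₃] [IsDomain S] [IsDomain O]
  [IsLocalRing R₀] [IsLocalRing R₁] [IsLocalRing R₂] [IsLocalRing R₃] [IsLocalRing S]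
  [IsLocalRing O] [IsIntegrallyClosed S] (T : LocalTower f B R₀ R₁ R₂ R₃ S O κ)

/-- The functions given by the forms, in `R₁`. -/
def Λ₁ : V →ₗ[ℂ] R₁ := T.φ₁.toLinearMap ∘ₗ T.Λ
/-- The functions given by the forms, in `R₂`. -/
def Λ₂ : V →ₗ[ℂ] R₂ := T.φ₂.toLinearMap ∘ₗ T.Λ₁
/-- The functions given by the forms, in `R₃`. -/
def Λ₃ : V →ₗ[ℂ] R₃ := T.φ₃.toLinearMap ∘ₗ T.Λ₂
/-- The inclusion of `R₃` in `O`. -/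
def ψ₃ : R₃ →ₐ[ℂ] O := T.φ₅.comp T.φ₄
/-- The inclusion of `R₂` in `O`. -/
def ψ₂ : R₂ →ₐ[ℂ] O := T.ψ₃.comp T.φ₃
/-- The inclusion of `R₁` in `O`. -/
def ψ₁ : R₁ →ₐ[ℂ] O := T.ψ₂.comp T.φ₂
/-- The inclusion of `R₀` in `O`. -/
def ψ₀ : R₀ →ₐ[ℂ] O := T.ψ₁.comp T.φ₁

/-- The residues of the functions given by the forms. -/
def ev : V →ₗ[ℂ] κ := T.θ.toLinearMap ∘ₗ T.ψ₀.toLinearMap ∘ₗ T.Λ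
/-- The forms that vanish at the point. -/
def vanishing : Submodule ℂ V := LinearMap.ker T.ev

lemma mem_vanishing {a : V} : a ∈ T.vanishing ↔ T.ev a = 0 := Iff.rfl

lemma isUnit_O {z : O} (h : T.θ z ≠ 0) : IsUnit z := isUnit_of_map_ne_zero T.surj h

lemma isUnit₃ {z : R₃} (h : T.θ (T.ψ₃ z) ≠ 0) : IsUnit z :=
  T.local₄.map_nonunit _ (T.local₅.map_nonunit _ (T.isUnit_O h))

lemma isUnit₂ {z : R₂} (h : T.θ (T.ψ₂ z) ≠ 0) : IsUnit z :=
  T.local₃.map_nonunit _ (T.isUnit₃ h)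

lemma isUnit₁ {z : R₁} (h : T.θ (T.ψ₁ z) ≠ 0) : IsUnit z :=
  T.local₂.map_nonunit _ (T.isUnit₂ h)

lemma isUnit₀ {z : R₀} (h : T.θ (T.ψ₀ z) ≠ 0) : IsUnit z :=
  T.local₁.map_nonunit _ (T.isUnit₁ h)

lemma ψ₃_injective : Function.Injective T.ψ₃ := T.inj₅.comp T.inj₄
lemma ψ₂_injective : Function.Injective T.ψ₂ := T.ψ₃_injective.comp T.inj₃
lemma ψ₁_injective : Function.Injective T.ψ₁ := T.ψ₂_injective.comp T.inj₂
lemma ψ₀_injective : Function.Injective T.ψ₀ := T.ψ₁_injective.comp T.inj₁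

lemma ev_eq₃ (a : V) : T.θ (T.ψ₃ (T.Λ₃ a)) = T.ev a := rfl
lemma ev_eq₀ (a : V) : T.θ (T.ψ₀ (T.Λ a)) = T.ev a := rfl

lemma ev_h : T.ev T.h = 1 := by rw [← T.ev_eq₀, T.Λ_h, map_one, map_one]

lemma ev_B (a : V) : T.ev (B a) = T.ev a := by
  have h1 := congrArg T.θ (T.Φ_Λ a)
  rw [T.θ_Φ] at h1
  exact h1.symm

lemma h_notMem : T.h ∉ T.vanishing := by
  rw [mem_vanishing, T.ev_h]; exact one_ne_zero

lemma stable : ∀ a ∈ T.vanishing, B a ∈ T.vanishing := by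
  intro a ha
  rw [mem_vanishing, T.ev_B]
  exact ha

lemma eq_zero_of_neg {x : κ} (h : x = -x) : x = 0 := by
  have h1 : (2 : κ) * x = 0 := by linear_combination h
  have h2 : (2 : κ) ≠ 0 := by
    rw [← map_ofNat (algebraMap ℂ κ) 2]
    exact (map_ne_zero _).mpr two_ne_zero
  exact (mul_eq_zero.mp h1).resolve_left h2

/-- The involution acts trivially on the residue field, so the odd forms vanish at the point. -/
lemma eigenspace_le : eigenspace B (-1) ≤ T.vanishing := by
  intro a ha
  rw [mem_eigenspace_iff] at ha
  rw [mem_vanishing]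
  apply eq_zero_of_neg
  conv_lhs => rw [← T.ev_B, ha, neg_one_smul, map_neg]

lemma Λ_injective (h : IsSymmetric f B) : Function.Injective T.Λ := by
  rw [injective_iff_map_eq_zero]
  intro a ha
  by_contra ha0
  -- complete `h, a` to a basis
  have h2 : LinearIndependent ℂ ![a, T.h] := by
    rw [LinearIndependent.pair_iff' ha0]
    intro c hc
    have h3 := T.Λ_h
    rw [← hc, map_smul, ha, smul_zero] at h3
    exact zero_ne_one h3
  obtain ⟨b, hb⟩ := exists_linearIndependent_cons_of_lt_finrank h2 (by rw [h.finrank_eq]; norm_num)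
  obtain ⟨c, hc⟩ := exists_linearIndependent_cons_of_lt_finrank hb (by rw [h.finrank_eq]; norm_num)
  have h4 := hc.comp ![3, 2, 1, 0] (by decide)
  have h5 : (Fin.cons c (Fin.cons b ![a, T.h]) : Fin 4 → V) ∘ ![3, 2, 1, 0] =
      Fin.cons T.h ![a, b, c] := by
    funext j
    fin_cases j <;> rfl
  rw [h5] at h4
  refine X_ne_zero (R := ℂ) (0 : Fin 3) ((T.isCoord _ h4).injective ?_)
  rw [aeval_X, map_zero]
  exact ha

lemma Λ₁_injective (h : IsSymmetric f B) : Function.Injective T.Λ₁ := T.inj₁.comp (T.Λ_injective h)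
lemma Λ₂_injective (h : IsSymmetric f B) : Function.Injective T.Λ₂ := T.inj₂.comp (T.Λ₁_injective h)

/-- A quotient of forms of different parity vanishes at the fixed point, because the involution
changes its sign and preserves its residue. -/
lemma odd (h : IsSymmetric f B) {a b : V} {y : O} (hb : b ≠ 0)
    (hy : T.ψ₀ (T.Λ a) = y * T.ψ₀ (T.Λ b))
    (hab : a ∈ eigenspace B 1 ∧ b ∈ eigenspace B (-1) ∨
      a ∈ eigenspace B (-1) ∧ b ∈ eigenspace B 1) : T.θ y = 0 := by
  have hb0 : T.ψ₀ (T.Λ b) ≠ 0 := by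
    rwa [Ne, map_eq_zero_iff _ T.ψ₀_injective, map_eq_zero_iff _ (T.Λ_injective h)]
  have hΦ (a : V) : T.Φ (T.ψ₀ (T.Λ a)) = T.ψ₀ (T.Λ (B a)) := T.Φ_Λ a
  have h1 := congrArg T.Φ hy
  rw [map_mul, hΦ, hΦ] at h1
  have h2 : T.Φ y = -y := by
    apply mul_right_cancel₀ hb0
    rcases hab with ⟨h3, h4⟩ | ⟨h3, h4⟩
    · rw [mem_eigenspace_iff] at h3 h4
      rw [h3, h4] at h1
      simp only [one_smul, neg_smul, map_neg] at h1
      linear_combination h1 - hy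
    · rw [mem_eigenspace_iff] at h3 h4
      rw [h3, h4] at h1
      simp only [one_smul, neg_smul, map_neg] at h1
      linear_combination -h1 - hy
  have h3 := T.θ_Φ y
  rw [h2, map_neg] at h3
  exact eq_zero_of_neg h3.symm

/-- The image of the point in `ℙ³` is the generic point of a line of fixed points, or it is a closed
point. -/
lemma finrank_vanishing (h : IsSymmetric f B) :
    T.vanishing = eigenspace B (-1) ∨ finrank ℂ T.vanishing = 3 := by
  have h1 := h.finrank_eigenspace (-1) (.inr rfl)
  have h2 := Submodule.finrank_mono T.eigenspace_le
  have h3 : finrank ℂ T.vanishing < 4 := by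
    rw [← h.finrank_eq]
    refine Submodule.finrank_lt fun htop ↦ T.h_notMem ?_
    rw [htop]; trivial
  by_cases h4 : finrank ℂ T.vanishing = 3
  · exact .inr h4
  · exact .inl (Submodule.eq_of_le_of_finrank_le T.eigenspace_le (by omega)).symm

/-- The residue field is generated by one element, if the planes are given by monomials in
suitable coordinates. -/
lemma exists_generator_of_monomial {c : Fin 3 → R₃} (hc : IsCoord c) {g : Fin 8 → R₃} {n : Fin 8 → Fin 3 → ℕ}
    (hg : ∀ i, IsUnit (g i)) (hf : ∀ i, T.Λ₃ (f i) = g i * ∏ j, c j ^ n i j)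
    (hn : ∀ i j, n i j ≠ 0 → T.θ (T.ψ₃ (c j)) = 0)
    (hend : (∀ j, T.θ (T.ψ₃ (c j)) = 0) ∨ ∃ τ : κ, (∀ j, T.θ (T.ψ₃ (c j)) ∈ ℂ⟮τ⟯) ∧
      (∀ j j', Odd (∑ i, n i j) → Odd (∑ i, n i j') → j = j') ∧
      ((∀ j, Even (∑ i, n i j)) → ∀ ω, ω ^ 2 = ∏ i, T.θ (T.ψ₃ (g i)) →
        ∃ τ' : κ, τ ∈ ℂ⟮τ'⟯ ∧ ω ∈ ℂ⟮τ'⟯)) :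
    ∃ τ : κ, ∀ z, z ∈ ℂ⟮τ⟯ := by
  let : Algebra R₃ S := T.φ₄.toRingHom.toAlgebra
  let : Algebra S O := T.φ₅.toRingHom.toAlgebra
  have : IsScalarTower ℂ R₃ S := .of_algebraMap_eq' T.φ₄.comp_algebraMap.symm
  have : IsScalarTower ℂ S O := .of_algebraMap_eq' T.φ₅.comp_algebraMap.symm
  have : IsLocalHom (algebraMap R₃ S) := T.local₄
  have : IsLocalHom (algebraMap S O) := T.local₅
  have hinj : Function.Injective (algebraMap R₃ S) := T.inj₄
  refine exists_forall_mem_adjoin (R := R₃) (S := S) T.θ T.surj hinj (w₀ := T.w) ?_ T.int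
    T.radical₄ T.le₄ T.blowup₄ hc (m := fun j ↦ ∑ i, n i j) (g := ∏ i, g i)
    (IsUnit.prod_univ_iff.mpr hg) ?_ (T.θ.comp T.ψ₃) (fun _ ↦ rfl) ?_ ?_
  · intro z
    obtain ⟨α, β, γ, hγ, hz⟩ := T.frac z
    refine ⟨_, _, _, ?_, hz⟩
    rwa [Ne, map_eq_zero_iff _ T.inj₃, map_eq_zero_iff _ T.inj₂, map_eq_zero_iff _ T.inj₁]
  · rw [T.w_sq, map_prod, map_prod, map_prod]
    change T.φ₄ _ = T.φ₄ _
    congr 1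
    have h1 : ∏ i, T.φ₃ (T.φ₂ (T.φ₁ (T.Λ (f i)))) = ∏ i, (g i * ∏ j, c j ^ n i j) :=
      Finset.prod_congr rfl fun i _ ↦ hf i
    rw [h1, Finset.prod_mul_distrib, Finset.prod_comm]
    congr 1
    exact Finset.prod_congr rfl fun j _ ↦ Finset.prod_pow_eq_pow_sum _ _ _
  · intro j hj
    obtain ⟨i, -, hi⟩ := Finset.exists_ne_zero_of_sum_ne_zero hj
    exact hn i j hi
  · rcases hend with h1 | ⟨τ, h1, h2, h3⟩
    · exact .inl h1
    · refine .inr ⟨τ, h1, h2, fun h4 ω hω ↦ h3 h4 ω ?_⟩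
      rw [hω, map_prod]
      rfl

/-- At a closed point in suitable coordinates, no condition on the parities is needed. -/
lemma exists_generator_of_closed {c : Fin 3 → R₃} (hc : IsCoord c) (h0 : ∀ j, T.θ (T.ψ₃ (c j)) = 0)
    (hf : ∀ i, IsMonomial c (T.Λ₃ (f i))) : ∃ τ : κ, ∀ z, z ∈ ℂ⟮τ⟯ := by
  choose g n hg hf using hf
  exact T.exists_generator_of_monomial hc hg hf (fun _ j _ ↦ h0 j) (.inl h0)

/-! ### The centres of the blow-ups in the tower -/

lemma eq_top_of_forall {R : Type} [CommRing R] {I : Ideal R}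
    (h : ∀ 𝔭 : Ideal R, 𝔭.IsPrime → ¬ I ≤ 𝔭) : I = ⊤ := by
  by_contra hne
  obtain ⟨𝔭, h𝔭, hle⟩ := Ideal.exists_le_maximal I hne
  exact h 𝔭 h𝔭.isPrime hle

lemma res_eq_zero₀ {𝔭 : Ideal R₀} (h : 𝔭.IsPrime) {z : R₀} (hz : z ∈ 𝔭) : T.θ (T.ψ₀ z) = 0 := by
  by_contra h0
  exact h.ne_top (𝔭.eq_top_of_isUnit_mem hz (T.isUnit₀ h0))

lemma res_eq_zero₁ {𝔭 : Ideal R₁} (h : 𝔭.IsPrime) {z : R₁} (hz : z ∈ 𝔭) : T.θ (T.ψ₁ z) = 0 := by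
  by_contra h0
  exact h.ne_top (𝔭.eq_top_of_isUnit_mem hz (T.isUnit₁ h0))

lemma res_eq_zero₂ {𝔭 : Ideal R₂} (h : 𝔭.IsPrime) {z : R₂} (hz : z ∈ 𝔭) : T.θ (T.ψ₂ z) = 0 := by
  by_contra h0
  exact h.ne_top (𝔭.eq_top_of_isUnit_mem hz (T.isUnit₂ h0))

/-- The first blow-up is an isomorphism at a point that is not over a fivefold point. -/
lemma bijective₁ (h : ∀ N ≤ T.vanishing, finrank ℂ N = 3 → formMult f N ≠ 5) :
    T.I₁ = ⊤ ∧ Function.Bijective T.φ₁ := by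
  have h1 : T.I₁ = ⊤ := eq_top_of_forall fun 𝔭 h𝔭 hle ↦ by
    obtain ⟨N, h3, h5, hN⟩ := (T.le₁ 𝔭 h𝔭).mp hle
    exact h N (fun a ha ↦ T.res_eq_zero₀ h𝔭 (hN a ha)) h3 h5
  have := T.local₁
  exact ⟨h1, T.inj₁, T.blowup₁.surjective_of_eq_top h1⟩

/-- The second blow-up is an isomorphism outside of the strict transforms of the triple lines. -/
lemma bijective₂ (h : ∀ N ≤ T.vanishing, finrank ℂ N = 2 → formMult f N = 3 →
    ∀ 𝔮 : Ideal R₁, 𝔮.IsPrime → ¬ T.I₁ ≤ 𝔮.comap T.φ₁.toRingHom →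
    (∀ a ∈ N, T.Λ₁ a ∈ 𝔮) → False) :
    Function.Bijective T.φ₂ := by
  have h1 : T.I₂ = ⊤ := eq_top_of_forall fun 𝔭 h𝔭 hle ↦ by
    obtain ⟨𝔮, -, h𝔮, hI, N, h2, h3, hN⟩ := (T.le₂ 𝔭 h𝔭).mp hle
    exact h N (fun a ha ↦ T.res_eq_zero₁ h𝔮 (hN a ha)) h2 h3 𝔮 h𝔮 hI hN
  have := T.local₂
  exact ⟨T.inj₂, T.blowup₂.surjective_of_eq_top h1⟩

/-- The third blow-up is an isomorphism outside of the remaining fourfold points. -/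
lemma bijective₃ (h : ∀ N ≤ T.vanishing, finrank ℂ N = 3 → formMult f N = 4 →
    (∀ N' ≤ N, finrank ℂ N' = 2 → formMult f N' ≠ 3) → False) :
    Function.Bijective T.φ₃ := by
  have h1 : T.I₃ = ⊤ := eq_top_of_forall fun 𝔭 h𝔭 hle ↦ by
    obtain ⟨N, h3, h4, h2, hN⟩ := (T.le₃ 𝔭 h𝔭).mp hle
    exact h N (fun a ha ↦ T.res_eq_zero₂ h𝔭 (hN a ha)) h3 h4 h2
  have := T.local₃
  exact ⟨T.inj₃, T.blowup₃.surjective_of_eq_top h1⟩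

end LocalTower
end LocalTower

/-! ### Curves over a fixed line -/

section LocalTower
open Module Module.End IsLocalRing IntermediateField
set_option linter.unusedSectionVars false
set_option linter.overlappingInstances false

namespace LocalTower

variable {V : Type} [AddCommGroup V] [Module ℂ V] [FiniteDimensional ℂ V]
  {f : Fin 8 → V} {B : End ℂ V} {R₀ R₁ R₂ R₃ S O κ : Type}
  [CommRing R₀] [CommRing R₁] [CommRing R₂] [CommRing R₃] [CommRing S] [CommRing O] [Field κ]
  [Algebra ℂ R₀] [Algebra ℂ R₁] [Algebra ℂ R₂] [Algebra ℂ R₃] [Algebra ℂ S] [Algebra ℂ O]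
  [Algebra ℂ κ] [IsDomain R₀] [IsDomain R₁] [IsDomain R₂] [IsDomain R₃] [IsDomain S] [IsDomain O]
  [IsLocalRing R₀] [IsLocalRing R₁] [IsLocalRing R₂] [IsLocalRing R₃] [IsLocalRing S]
  [IsLocalRing O] [IsIntegrallyClosed S] (T : LocalTower f B R₀ R₁ R₂ R₃ S O κ)

/-- The case of the generic point of a fixed line. The blow-ups are isomorphisms there. If the line
lies on a plane of the arrangement, it is in the branch locus; otherwise the double cover of the line
is branched at the points that lie on an odd number of planes, which are at most two, so that it is
rational. -/
lemma exists_generator_line (h : IsSymmetric f B) (hv : T.vanishing = eigenspace B (-1)) :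
    ∃ τ : κ, ∀ z, z ∈ ℂ⟮τ⟯ := by
  have hfr := h.finrank_eigenspace (-1) (.inr rfl)
  have hm := h.formMult_eigenspace (-1) (.inr rfl)
  have hN3 (N : Submodule ℂ V) (hN : N ≤ T.vanishing) : finrank ℂ N ≠ 3 := by
    have := Submodule.finrank_mono hN
    rw [hv] at this
    omega
  have hb1 := (T.bijective₁ fun N hN h3 ↦ (hN3 N hN h3).elim).2
  have hb2 := T.bijective₂ fun N hN _ h3 _ _ _ _ ↦ by
    have := formMult_mono (f := f) hN
    rw [hv] at this
    omega
  have hb3 := T.bijective₃ fun N hN h3 _ _ ↦ hN3 N hN h3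
  obtain ⟨b, hb⟩ := h.exists_adapted_basis (N := eigenspace B (-1)) (by omega)
    (fun N hN _ h3 ↦ by have := formMult_mono (f := f) hN; omega) hfr
  have hbi : LinearIndependent ℂ fun j ↦ (b j : V) :=
    b.linearIndependent.map' (eigenspace B (-1)).subtype (Submodule.ker_subtype _)
  have hli : LinearIndependent ℂ (Fin.cons T.h fun j ↦ (b j : V) : Fin 3 → V) := by
    refine hbi.finCons fun hmem ↦ T.h_notMem ?_
    rw [hv]
    refine (Submodule.span_le.mpr ?_ : Submodule.span ℂ _ ≤ eigenspace B (-1)) hmem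
    rintro _ ⟨j, rfl⟩
    exact (b j).2
  obtain ⟨t, ht⟩ := exists_linearIndependent_cons_of_lt_finrank hli (by
    rw [h.finrank_eq]; norm_num)
  have hli4 : LinearIndependent ℂ (Fin.cons T.h (Fin.cons t fun j ↦ (b j : V)) : Fin 4 → V) := by
    have h4 := ht.comp ![1, 0, 2, 3] (by decide)
    have h5 : (Fin.cons t (Fin.cons T.h fun j ↦ (b j : V)) : Fin 4 → V) ∘ ![1, 0, 2, 3] =
        Fin.cons T.h (Fin.cons t fun j ↦ (b j : V)) := by
      funext j
      fin_cases j <;> rfl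
    rwa [h5] at h4
  have hc : IsCoord fun i ↦ T.Λ₃ ((Fin.cons t fun j ↦ (b j : V) : Fin 3 → V) i) :=
    (((T.isCoord _ hli4).map_bijective _ hb1).map_bijective _ hb2).map_bijective _ hb3
  set u : Fin 3 → V := Fin.cons t fun j ↦ (b j : V)
  have hu0 : u 0 = t := rfl
  have hus (j : Fin 2) : u j.succ = b j := rfl
  have hevb (j : Fin 2) : T.ev (b j) = 0 := by
    have : (b j : V) ∈ T.vanishing := by rw [hv]; exact (b j).2
    exact this
  obtain ⟨τ, hτ⟩ : ∃ τ, τ = T.ev t := ⟨_, rfl⟩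
  -- values of the forms
  have hval (a : V) : ∃ x y : ℂ, T.ev a = algebraMap ℂ κ x + algebraMap ℂ κ y * τ := by
    have hspan : a ∈ Submodule.span ℂ (Set.range (Fin.cons T.h u : Fin 4 → V)) := by
      rw [hli4.span_eq_top_of_card_eq_finrank' (by rw [h.finrank_eq]; rfl)]
      trivial
    obtain ⟨x, rfl⟩ := (Submodule.mem_span_range_iff_exists_fun ℂ).mp hspan
    refine ⟨x 0, x 1, ?_⟩
    rw [Fin.sum_univ_four, map_add, map_add, map_add, map_smul, map_smul, map_smul, map_smul]
    have h1 : T.ev ((Fin.cons T.h u : Fin 4 → V) 0) = 1 := T.ev_h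
    have h2 : T.ev ((Fin.cons T.h u : Fin 4 → V) 1) = τ := hτ.symm
    have h3 : T.ev ((Fin.cons T.h u : Fin 4 → V) 2) = 0 := hevb 0
    have h4 : T.ev ((Fin.cons T.h u : Fin 4 → V) 3) = 0 := hevb 1
    rw [h1, h2, h3, h4]
    simp only [Algebra.smul_def]
    ring
  have key (i : Fin 8) : ∃ (g : R₃) (n : Fin 3 → ℕ), IsUnit g ∧
      T.Λ₃ (f i) = g * ∏ j, T.Λ₃ (u j) ^ n j ∧
      (f i ∉ T.vanishing → n = 0 ∧ T.θ (T.ψ₃ g) = T.ev (f i)) ∧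
      (f i ∈ T.vanishing → ∃ j : Fin 2, n = Pi.single j.succ 1) := by
    by_cases hi : f i ∈ T.vanishing
    · obtain ⟨j, hj⟩ := hb i (hv ▸ hi)
      refine ⟨1, Pi.single j.succ 1, isUnit_one, ?_, fun h ↦ (h hi).elim, fun _ ↦ ⟨j, rfl⟩⟩
      simp [Pi.single_apply, pow_ite, hus, hj]
    · exact ⟨T.Λ₃ (f i), 0, T.isUnit₃ hi, by simp, fun _ ↦ ⟨rfl, rfl⟩, fun h ↦ (hi h).elim⟩
  choose g n hg hf hn1 hn2 using key
  have hn0 (i : Fin 8) (j : Fin 3) (hij : n i j ≠ 0) : f i ∈ T.vanishing := by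
    by_contra hi
    rw [(hn1 i hi).1] at hij
    exact hij rfl
  have huniq (i i' : Fin 8) (hi : f i ∈ T.vanishing) (hi' : f i' ∈ T.vanishing) : i = i' :=
    eq_of_formMult_le_one hm (hv ▸ hi) (hv ▸ hi')
  refine T.exists_generator_of_monomial hc hg hf (fun i j hij ↦ ?_) (.inr ⟨τ, fun j ↦ ?_, fun j j' hj hj' ↦ ?_,
    fun hev ω hω ↦ ?_⟩)
  · obtain ⟨k, hk⟩ := hn2 i (hn0 i j hij)
    rw [hk] at hij
    have hjk : j = k.succ := by
      by_contra hne
      exact hij (Pi.single_eq_of_ne hne 1)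
    rw [hjk, T.ev_eq₃, hus]
    exact hevb k
  · refine Fin.cases ?_ (fun k ↦ ?_) j
    · change T.ev t ∈ _
      rw [← hτ]
      exact mem_adjoin_simple_self ℂ τ
    · change T.ev (b k) ∈ _
      rw [hevb]
      exact zero_mem _
  · obtain ⟨i, -, hi⟩ := Finset.exists_ne_zero_of_sum_ne_zero hj.pos.ne'
    obtain ⟨i', -, hi'⟩ := Finset.exists_ne_zero_of_sum_ne_zero hj'.pos.ne'
    obtain rfl := huniq i i' (hn0 i j hi) (hn0 i' j' hi')
    obtain ⟨k, hk⟩ := hn2 i (hn0 i j hi)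
    rw [hk] at hi hi'
    have h1 : j = k.succ := by
      by_contra hne
      exact hi (Pi.single_eq_of_ne hne 1)
    have h2 : j' = k.succ := by
      by_contra hne
      exact hi' (Pi.single_eq_of_ne hne 1)
    rw [h1, h2]
  · have hnone (i : Fin 8) : f i ∉ T.vanishing := by
      intro hi
      obtain ⟨k, hk⟩ := hn2 i hi
      have h1 := hev k.succ
      rw [Finset.sum_eq_single i (fun i' _ hi' ↦ ?_) (by simp), hk, Pi.single_eq_same] at h1
      · exact absurd h1 (by decide)
      · by_contra h0
        exact hi' (huniq i' i (hn0 i' _ h0) hi)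
    have hω' : ω ^ 2 = ∏ i, T.ev (f i) := by
      rw [hω]
      exact Finset.prod_congr rfl fun i _ ↦ (hn1 i (hnone i)).2
    have hmemτ (i : Fin 8) : T.ev (f i) ∈ ℂ⟮τ⟯ := by
      obtain ⟨x, y, hxy⟩ := hval (f i)
      rw [hxy]
      exact add_mem (IntermediateField.algebraMap_mem _ x)
        (mul_mem (IntermediateField.algebraMap_mem _ y) (mem_adjoin_simple_self ℂ τ))
    obtain ⟨W, -, hW1, hW2, ⟨k, hk⟩, d, q, hq, hprod⟩ := exists_prod_eq ℂ⟮τ⟯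
      (fun i ↦ T.ev (f i)) Finset.univ (fun i _ ↦ hnone i) (fun i _ ↦ hmemτ i)
    -- a class of proportional factors is the set of planes through a point of the fixed line
    have hclass (i : Fin 8) (a : V) : a ∈ eigenspace B (-1) ⊔ ℂ ∙ f i ↔
        ∃ c : ℂ, T.ev a = c • T.ev (f i) := by
      rw [Submodule.mem_sup]
      constructor
      · rintro ⟨y, hy, z, hz, rfl⟩
        obtain ⟨c, rfl⟩ := Submodule.mem_span_singleton.mp hz
        refine ⟨c, ?_⟩
        have hy' : T.ev y = 0 := by rw [← hv] at hy; exact hy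
        rw [map_add, map_smul, hy', zero_add]
      · rintro ⟨c, hc⟩
        refine ⟨a - c • f i, ?_, c • f i, Submodule.mem_span_singleton.mpr ⟨c, rfl⟩, by simp⟩
        rw [← hv, mem_vanishing, map_sub, map_smul, hc, sub_self]
    have hWcard : W.card ≤ 2 := by
      have hsub : (fun i ↦ eigenspace B (-1) ⊔ ℂ ∙ f i) '' (W : Set (Fin 8)) ⊆
          {N : Submodule ℂ V | finrank ℂ N = 3 ∧ eigenspace B (-1) ≤ N ∧
            Odd (formMult f N)} := by
        rintro _ ⟨i, hi, rfl⟩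
        refine ⟨?_, le_sup_left, ?_⟩
        · have h1 := Submodule.finrank_sup_add_finrank_inf_eq (eigenspace B (-1)) (ℂ ∙ f i)
          have h2 : eigenspace B (-1) ⊓ ℂ ∙ f i = ⊥ := by
            rw [Submodule.eq_bot_iff]
            rintro a ⟨h3, h4⟩
            obtain ⟨c, rfl⟩ := Submodule.mem_span_singleton.mp h4
            by_contra hne
            have hc0 : c ≠ 0 := by rintro rfl; simp at hne
            have h5 : f i ∈ eigenspace B (-1) := (Submodule.smul_mem_iff _ hc0).mp h3
            exact hnone i (hv ▸ h5)
          rw [h2, finrank_bot, finrank_span_singleton (h.ne_zero i), hfr] at h1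
          exact h1
        · have h1 := hW2 i hi
          have h2 : {j | j ∈ (Finset.univ : Finset (Fin 8)) ∧
              ∃ c : ℂ, T.ev (f j) = c • T.ev (f i)} =
              {j | f j ∈ eigenspace B (-1) ⊔ ℂ ∙ f i} := by
            ext j
            simp only [Finset.mem_univ, true_and, Set.mem_ofPred_eq]
            exact (hclass i (f j)).symm
          rw [h2] at h1
          exact h1
      have hinj : Set.InjOn (fun i ↦ eigenspace B (-1) ⊔ ℂ ∙ f i) (W : Set (Fin 8)) := by
        intro i hi j hj hij
        by_contra hne
        have h1 : f j ∈ eigenspace B (-1) ⊔ ℂ ∙ f i := by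
          change (fun i ↦ eigenspace B (-1) ⊔ ℂ ∙ f i) i = _ at hij
          rw [show eigenspace B (-1) ⊔ ℂ ∙ f i = eigenspace B (-1) ⊔ ℂ ∙ f j from hij]
          exact Submodule.mem_sup_right (Submodule.mem_span_singleton_self _)
        obtain ⟨c, hc⟩ := (hclass i (f j)).mp h1
        exact hW1 i hi j hj hne c hc
      have h1 := (Set.encard_le_encard hsub).trans
        (h.odd_points (h.finrank_eigenspace (-1) (.inr rfl)) fun i hi ↦ hnone i (hv ▸ hi))
      rw [hinj.encard_image, Set.encard_coe_eq_coe_finsetCard] at h1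
      exact_mod_cast h1
    rw [Finset.card_univ, Fintype.card_fin] at hk
    rw [← hω'] at hprod
    -- the number of odd points has the parity of the number of planes
    have hW : W.card = 0 ∨ W.card = 2 := by omega
    rcases hW with hW | hW
    · rw [Finset.card_eq_zero.mp hW, Finset.prod_empty, mul_one] at hprod
      obtain ⟨r, hr⟩ := IsAlgClosed.exists_pow_nat_eq d (n := 2) two_pos
      refine ⟨τ, mem_adjoin_simple_self ℂ τ, ?_⟩
      rw [← hr, Algebra.smul_def, map_pow, ← mul_pow, sq_eq_sq_iff_eq_or_eq_neg] at hprod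
      have hmem : algebraMap ℂ κ r * q ∈ ℂ⟮τ⟯ :=
        mul_mem (IntermediateField.algebraMap_mem _ r) hq
      rcases hprod with h1 | h1
      · rw [h1]; exact hmem
      · rw [h1]; exact neg_mem hmem
    · obtain ⟨i, j, hij, rfl⟩ := Finset.card_eq_two.mp hW
      rw [Finset.prod_pair hij] at hprod
      obtain ⟨x, y, hxy⟩ := hval (f i)
      obtain ⟨x', y', hxy'⟩ := hval (f j)
      exact exists_conic_parameter hxy hxy' (hnone i)
        (hW1 i (by simp) j (by simp) hij) hq hprod

end LocalTower
end LocalTower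

/-! ### Curves over a fixed line of an exceptional plane -/

section
open Module

lemma exists_eq_smul_add {V : Type} [AddCommGroup V] [Module ℂ V] [FiniteDimensional ℂ V]
    {N₀ N₁ : Submodule ℂ V} (h1 : N₁ ≤ N₀)
    (hd : finrank ℂ N₀ = finrank ℂ N₁ + 1) {b₀ : V} (hb₀ : b₀ ∈ N₀) (hb₀' : b₀ ∉ N₁) {a : V}
    (ha : a ∈ N₀) : ∃ r : ℂ, ∃ n ∈ N₁, a = r • b₀ + n := by
  have hle : N₁ ⊔ ℂ ∙ b₀ ≤ N₀ :=
    sup_le h1 ((Submodule.span_singleton_le_iff_mem _ _).mpr hb₀)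
  have hlt : N₁ < N₁ ⊔ ℂ ∙ b₀ := lt_of_le_of_ne le_sup_left fun h ↦ hb₀' <| by
    rw [h]; exact Submodule.mem_sup_right (Submodule.mem_span_singleton_self _)
  have := Submodule.finrank_lt_finrank_of_lt hlt
  rw [← Submodule.eq_of_le_of_finrank_le hle (by omega), Submodule.mem_sup] at ha
  obtain ⟨n, hn, y, hy, rfl⟩ := ha
  obtain ⟨r, rfl⟩ := Submodule.mem_span_singleton.mp hy
  exact ⟨r, n, hn, add_comm _ _⟩

/-- If the functions given by the forms in `N₁` are multiples of the function given by `b₀`, by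
functions which vanish at the point, then a form is `b₀` times a unit or it lies in `N₁`. -/
lemma exists_quotient {V R κ : Type} [AddCommGroup V] [Module ℂ V] [FiniteDimensional ℂ V]
    [CommRing R] [Algebra ℂ R] [Field κ] [Algebra ℂ κ] (Λ : V →ₗ[ℂ] R) (ρ : R →ₐ[ℂ] κ)
    {N₀ N₁ : Submodule ℂ V} (h1 : N₁ ≤ N₀)
    (hd : finrank ℂ N₀ = finrank ℂ N₁ + 1) {b₀ : V} (hb₀ : b₀ ∈ N₀) (hb₀' : b₀ ∉ N₁)
    (b : Basis (Fin 2) ℂ N₁) {y : Fin 2 → R} (hy : ∀ j, Λ (b j) = y j * Λ b₀)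
    (hy0 : ∀ j, ρ (y j) = 0) {a : V} (ha : a ∈ N₀) :
    ∃ g : R, (a ∉ N₁ → ρ g ≠ 0) ∧ Λ a = g * Λ b₀ := by
  obtain ⟨r, n, hn, hrn⟩ := exists_eq_smul_add h1 hd hb₀ hb₀' ha
  have hn2 : n = ∑ j, b.repr ⟨n, hn⟩ j • (b j : V) := by
    have h4 := congrArg (fun x : N₁ ↦ (x : V)) (b.sum_repr ⟨n, hn⟩)
    simp only [Submodule.coe_sum, Submodule.coe_smul] at h4
    exact h4.symm
  set x := b.repr ⟨n, hn⟩
  refine ⟨algebraMap ℂ R r + ∑ j, algebraMap ℂ R (x j) * y j, fun ha1 ↦ ?_, ?_⟩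
  · simp only [map_add, map_sum, map_mul, hy0, mul_zero, Finset.sum_const_zero, add_zero,
      AlgHom.commutes]
    refine (map_ne_zero _).mpr ?_
    rintro rfl
    rw [zero_smul, zero_add] at hrn
    exact ha1 (hrn ▸ hn)
  · rw [hrn, hn2, map_add, map_sum, map_smul, add_mul, Finset.sum_mul, Algebra.smul_def]
    congr 1
    refine Finset.sum_congr rfl fun j _ ↦ ?_
    rw [map_smul, hy, Algebra.smul_def, mul_assoc]

lemma IsMonomial.map {R R' : Type} [CommRing R] [CommRing R'] {c : Fin 3 → R} {z : R}
    (hz : IsMonomial c z) (φ : R →+* R') : IsMonomial (φ ∘ c) (φ z) := by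
  obtain ⟨g, n, hg, rfl⟩ := hz
  exact ⟨φ g, n, hg.map φ, by simp⟩

lemma IsMonomial.pow {R : Type} [CommRing R] {c : Fin 3 → R} {z : R}
    (hz : IsMonomial c z) (n : ℕ) : IsMonomial c (z ^ n) := by
  obtain ⟨g, m, hg, rfl⟩ := hz
  exact ⟨g ^ n, fun j ↦ m j * n, hg.pow n, by
    simp only [mul_pow, ← Finset.prod_pow, pow_mul]⟩

end

section LocalTower
open Module Module.End IsLocalRing IntermediateField
set_option linter.unusedSectionVars false
set_option linter.overlappingInstances false

namespace LocalTower

variable {V : Type} [AddCommGroup V] [Module ℂ V] [FiniteDimensional ℂ V]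
  {f : Fin 8 → V} {B : End ℂ V} {R₀ R₁ R₂ R₃ S O κ : Type}
  [CommRing R₀] [CommRing R₁] [CommRing R₂] [CommRing R₃] [CommRing S] [CommRing O] [Field κ]
  [Algebra ℂ R₀] [Algebra ℂ R₁] [Algebra ℂ R₂] [Algebra ℂ R₃] [Algebra ℂ S] [Algebra ℂ O]
  [Algebra ℂ κ] [IsDomain R₀] [IsDomain R₁] [IsDomain R₂] [IsDomain R₃] [IsDomain S] [IsDomain O]
  [IsLocalRing R₀] [IsLocalRing R₁] [IsLocalRing R₂] [IsLocalRing R₃] [IsLocalRing S]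
  [IsLocalRing O] [IsIntegrallyClosed S] (T : LocalTower f B R₀ R₁ R₂ R₃ S O κ)

lemma isCoord_basis (b : Basis (Fin 3) ℂ T.vanishing) : IsCoord fun i ↦ T.Λ (b i) := by
  refine T.isCoord _ ((b.linearIndependent.map' T.vanishing.subtype
    (Submodule.ker_subtype _)).finCons fun hmem ↦ T.h_notMem ?_)
  refine (Submodule.span_le.mpr ?_ : Submodule.span ℂ _ ≤ T.vanishing) hmem
  rintro _ ⟨j, rfl⟩
  exact (b j).2

/-- The case where the quotients of the forms by the equation `b₀` of an exceptional divisor are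
coordinates which vanish at the point. -/
lemma exists_generator_of_chart (h : IsSymmetric f B) (h3 : finrank ℂ T.vanishing = 3) {N₁ : Submodule ℂ V}
    (h1 : N₁ ≤ T.vanishing) (h2 : finrank ℂ N₁ = 2) (hm : formMult f N₁ ≤ 2) {b₀ : V}
    (hb₀ : b₀ ∈ T.vanishing) (hb₀' : b₀ ∉ N₁) (hy : ∀ b : Basis (Fin 2) ℂ N₁, ∃ y : Fin 2 → R₃,
      IsCoord (Fin.cons (T.Λ₃ b₀) y : Fin 3 → R₃) ∧ (∀ j, T.Λ₃ (b j) = y j * T.Λ₃ b₀) ∧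
        ∀ j, T.θ (T.ψ₃ (y j)) = 0) :
    ∃ τ : κ, ∀ z, z ∈ ℂ⟮τ⟯ := by
  obtain ⟨b, hb⟩ := h.exists_adapted_basis (N := N₁) (by omega)
    (fun N hN _ h3 ↦ by have := formMult_mono (f := f) hN; omega) h2
  obtain ⟨y, hc, hyb, hy0⟩ := hy b
  refine T.exists_generator_of_closed hc (fun j ↦ ?_) (fun i ↦ ?_)
  · refine Fin.cases ?_ (fun j ↦ ?_) j
    · exact hb₀
    · exact hy0 j
  · by_cases hi : f i ∈ T.vanishing
    · by_cases hi1 : f i ∈ N₁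
      · obtain ⟨k, hk⟩ := hb i hi1
        rw [hk, hyb]
        exact (IsMonomial.coord (c := (Fin.cons (T.Λ₃ b₀) y : Fin 3 → R₃)) k.succ).mul
          (IsMonomial.coord (c := (Fin.cons (T.Λ₃ b₀) y : Fin 3 → R₃)) 0)
      · obtain ⟨g, hg, hgi⟩ := exists_quotient T.Λ₃ (T.θ.comp T.ψ₃) h1 (by omega) hb₀ hb₀' b hyb
          hy0 hi
        rw [hgi]
        exact (IsMonomial.of_isUnit (T.isUnit₃ (hg hi1))).mul
          (IsMonomial.coord (c := (Fin.cons (T.Λ₃ b₀) y : Fin 3 → R₃)) 0)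
    · exact .of_isUnit (T.isUnit₃ hi)

lemma formMult_eq_sum (N : Submodule ℂ V) [DecidablePred (· ∈ N)] :
    formMult f N = ∑ i, if f i ∈ N then 1 else 0 := by
  rw [← Finset.card_filter, ← Set.ncard_coe_finset]
  simp [formMult]

/-- The case where, on the exceptional divisor over a point, the involution fixes a line pointwise.
The exceptional plane has multiplicity `formMult f T.vanishing` in the branch divisor, and the even
plane through the point, if there is one, cuts out the fixed line. If one of these two has an odd
multiplicity, the curve lies in the branch locus; they cannot both have. Otherwise no plane through
the point is invariant, the planes are exchanged in pairs, and both planes of a pair meet the fixed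
line in the same point: the octic form, divided by the equation of the exceptional plane, restricts
to a square on the fixed line, and the double cover splits. -/
lemma exists_generator_of_exceptional (h : IsSymmetric f B) (h3 : finrank ℂ T.vanishing = 3)
    (b : Basis (Fin 3) ℂ T.vanishing) (hb0 : (b 0 : V) ∈ eigenspace B (-1))
    (hb1 : (b 1 : V) ∈ eigenspace B (-1)) (hb2 : (b 2 : V) ∈ eigenspace B 1) {y z : R₃}
    (hc : IsCoord ![T.Λ₃ (b 0), y, z]) (hy : T.Λ₃ (b 1) = y * T.Λ₃ (b 0))
    (hz : T.Λ₃ (b 2) = z * T.Λ₃ (b 0)) (hz0 : T.θ (T.ψ₃ z) = 0)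
    (hy0 : ∀ a : ℂ, T.θ (T.ψ₃ y) ≠ algebraMap ℂ κ a) : ∃ τ : κ, ∀ z, z ∈ ℂ⟮τ⟯ := by
  obtain ⟨τ, hτ⟩ : ∃ τ, τ = T.θ (T.ψ₃ y) := ⟨_, rfl⟩
  rw [← hτ] at hy0
  -- the coordinates of a form
  have hx (a : V) : ∃ x : Fin 3 → ℂ, a ∈ T.vanishing →
      a = x 0 • (b 0 : V) + x 1 • (b 1 : V) + x 2 • (b 2 : V) := by
    by_cases ha : a ∈ T.vanishing
    · refine ⟨b.repr ⟨a, ha⟩, fun _ ↦ ?_⟩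
      have h4 := congrArg (fun x : T.vanishing ↦ (x : V)) (b.sum_repr ⟨a, ha⟩)
      simp only [Fin.sum_univ_three] at h4
      exact h4.symm
    · exact ⟨0, fun h ↦ (ha h).elim⟩
  choose x hx using hx
  have hneg (a : V) (ha : a ∈ T.vanishing) : x a 0 • (b 0 : V) + x a 1 • (b 1 : V) ∈
    eigenspace B (-1) := add_mem (Submodule.smul_mem _ _ hb0) (Submodule.smul_mem _ _ hb1)
  have hbi : LinearIndependent ℂ fun j ↦ (b j : V) :=
    b.linearIndependent.map' T.vanishing.subtype (Submodule.ker_subtype _)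
  have huniq {x0 x1 x2 x0' x1' x2' : ℂ} (h : x0 • (b 0 : V) + x1 • (b 1 : V) + x2 • (b 2 : V) =
      x0' • (b 0 : V) + x1' • (b 1 : V) + x2' • (b 2 : V)) : x0 = x0' ∧ x1 = x1' := by
    have h4 := Fintype.linearIndependent_iff.mp hbi ![x0 - x0', x1 - x1', x2 - x2'] (by
      rw [Fin.sum_univ_three]
      simp only [Matrix.cons_val]
      rw [← sub_eq_zero] at h
      rw [← h]
      module)
    exact ⟨sub_eq_zero.mp (h4 0), sub_eq_zero.mp (h4 1)⟩
  have hpos (a : V) (ha : a ∈ T.vanishing) :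
      a ∈ eigenspace B 1 ↔ x a 0 = 0 ∧ x a 1 = 0 := by
    constructor
    · intro h1
      have h4 : x a 0 • (b 0 : V) + x a 1 • (b 1 : V) ∈ eigenspace B 1 ⊓ eigenspace B (-1) := by
        refine ⟨?_, hneg a ha⟩
        have h5 := sub_mem h1 (Submodule.smul_mem _ (x a 2) hb2)
        have h6 := hx a ha
        rwa [sub_eq_iff_eq_add.mpr h6] at h5
      rw [h.inf_eigenspace, Submodule.mem_bot] at h4
      have := huniq (x0' := 0) (x1' := 0) (x2 := 0) (x2' := 0) (by simpa using h4)
      exact this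
    · rintro ⟨h1, h2⟩
      rw [hx a ha, h1, h2, zero_smul, zero_smul, zero_add, zero_add]
      exact Submodule.smul_mem _ _ hb2
  obtain ⟨l, hl⟩ : ∃ l : V → κ, ∀ a, l a = algebraMap ℂ κ (x a 0) + algebraMap ℂ κ (x a 1) * τ :=
    ⟨_, fun _ ↦ rfl⟩
  have hl0 (a : V) (ha : a ∈ T.vanishing) (ha1 : a ∉ eigenspace B 1) : l a ≠ 0 := by
    intro h0
    rw [hl] at h0
    rw [hpos a ha] at ha1
    by_cases h1 : x a 1 = 0
    · rw [h1, map_zero, zero_mul, add_zero, map_eq_zero] at h0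
      exact ha1 ⟨h0, h1⟩
    · refine hy0 (-(x a 0 / x a 1)) ?_
      have h1' : algebraMap ℂ κ (x a 1) ≠ 0 := (map_ne_zero _).mpr h1
      rw [map_neg, map_div₀]
      field_simp
      linear_combination h0
  have key (i : Fin 8) : ∃ (g : R₃) (n : Fin 3 → ℕ), IsUnit g ∧
      T.Λ₃ (f i) = g * ∏ j, (![T.Λ₃ (b 0), y, z] : Fin 3 → R₃) j ^ n j ∧
      (f i ∉ T.vanishing → n = 0 ∧ ∃ a : ℂ, T.θ (T.ψ₃ g) = algebraMap ℂ κ a) ∧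
      (f i ∈ T.vanishing → f i ∈ eigenspace B 1 → n = ![1, 0, 1]) ∧
      (f i ∈ T.vanishing → f i ∉ eigenspace B 1 → n = ![1, 0, 0] ∧
        T.θ (T.ψ₃ g) = l (f i)) := by
    by_cases hi : f i ∈ T.vanishing
    · have h4 := hx _ hi
      by_cases hi1 : f i ∈ eigenspace B 1
      · obtain ⟨h5, h6⟩ := (hpos _ hi).mp hi1
        rw [h5, h6, zero_smul, zero_smul, zero_add, zero_add] at h4
        have h7 : x (f i) 2 ≠ 0 := by
          intro h0
          rw [h0, zero_smul] at h4
          exact h.ne_zero i h4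
        refine ⟨algebraMap ℂ R₃ (x (f i) 2), ![1, 0, 1], (isUnit_iff_ne_zero.mpr h7).map _, ?_,
          fun h ↦ (h hi).elim, fun _ _ ↦ rfl, fun _ h ↦ (h hi1).elim⟩
        conv_lhs => rw [h4, map_smul, hz, Algebra.smul_def]
        rw [Fin.prod_univ_three]
        change _ = _ * (T.Λ₃ (b 0) ^ 1 * y ^ 0 * z ^ 1)
        ring
      · obtain ⟨g, hg⟩ : ∃ g, g = algebraMap ℂ R₃ (x (f i) 0) + algebraMap ℂ R₃ (x (f i) 1) * y +
          algebraMap ℂ R₃ (x (f i) 2) * z := ⟨_, rfl⟩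
        have h5 : T.θ (T.ψ₃ g) = l (f i) := by
          rw [hg, hl, map_add, map_add, map_add, map_add, map_mul, map_mul, map_mul, map_mul, hz0,
            mul_zero, add_zero, hτ, AlgHom.commutes, AlgHom.commutes, AlgHom.commutes,
            AlgHom.commutes]
        refine ⟨g, ![1, 0, 0], T.isUnit₃ (by rw [h5]; exact hl0 _ hi hi1), ?_,
          fun h ↦ (h hi).elim, fun _ h ↦ (hi1 h).elim, fun _ _ ↦ ⟨rfl, h5⟩⟩
        conv_lhs => rw [h4, map_add, map_add, map_smul, map_smul, map_smul, hz, hy,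
          Algebra.smul_def, Algebra.smul_def, Algebra.smul_def]
        simp [Fin.prod_univ_three, hg]
        ring
    · refine ⟨T.Λ₃ (f i), 0, T.isUnit₃ hi, by simp, fun _ ↦ ⟨rfl, ?_⟩, fun h ↦ (hi h).elim,
        fun h ↦ (hi h).elim⟩
      obtain ⟨r, n, hn, hr⟩ := exists_eq_smul_add (N₀ := ⊤) (N₁ := T.vanishing) le_top
        (by rw [finrank_top, h.finrank_eq, h3]) trivial T.h_notMem (a := f i) trivial
      refine ⟨r, ?_⟩
      have hn' : T.ev n = 0 := hn
      rw [T.ev_eq₃, hr, map_add, map_smul, T.ev_h, hn', add_zero, Algebra.smul_def, mul_one]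
  choose g n hg hf hn0 hn1 hn2 using key
  -- the multiplicities of the two divisors through the point are not both odd
  have hle := T.eigenspace_le
  obtain ⟨k, hk, hpar⟩ := h.exists_even _ T.stable
  rw [inf_eq_right.mpr hle, ← h.formMult_eigenspace_eq] at hpar
  have hq1 := h.formMult_eigenspace 1 (.inl rfl)
  have hpq : formMult f (T.vanishing ⊓ eigenspace B 1) ≤ formMult f (eigenspace B 1) :=
    formMult_mono inf_le_right
  classical
  have hs0 : ∑ i, n i 0 = formMult f T.vanishing := by
    rw [formMult_eq_sum]
    refine Finset.sum_congr rfl fun i _ ↦ ?_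
    split_ifs with hi
    · by_cases hi1 : f i ∈ eigenspace B 1
      · rw [hn1 i hi hi1]; rfl
      · rw [(hn2 i hi hi1).1]; rfl
    · rw [(hn0 i hi).1]; rfl
  have hs1 : ∑ i, n i 1 = 0 := by
    refine Finset.sum_eq_zero fun i _ ↦ ?_
    by_cases hi : f i ∈ T.vanishing
    · by_cases hi1 : f i ∈ eigenspace B 1
      · rw [hn1 i hi hi1]; rfl
      · rw [(hn2 i hi hi1).1]; rfl
    · rw [(hn0 i hi).1]; rfl
  have hs2 : ∑ i, n i 2 = formMult f (T.vanishing ⊓ eigenspace B 1) := by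
    rw [formMult_eq_sum]
    refine Finset.sum_congr rfl fun i _ ↦ ?_
    by_cases hi : f i ∈ T.vanishing
    · by_cases hi1 : f i ∈ eigenspace B 1
      · rw [hn1 i hi hi1, if_pos ⟨hi, hi1⟩]; rfl
      · rw [(hn2 i hi hi1).1, if_neg fun h ↦ hi1 h.2]; rfl
    · rw [(hn0 i hi).1, if_neg fun h ↦ hi h.1]; rfl
  refine T.exists_generator_of_monomial hc hg hf (fun i j hij ↦ ?_) (.inr ⟨τ, fun j ↦ ?_, fun j j' hj hj' ↦ ?_,
    fun hev ω hω ↦ ⟨τ, mem_adjoin_simple_self ℂ τ, ?_⟩⟩)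
  · fin_cases j
    · exact (b 0).2
    · exact ((Finset.sum_eq_zero_iff.mp hs1 i (Finset.mem_univ i)).symm ▸ hij : (0 : ℕ) ≠ 0).irrefl.elim
    · exact hz0
  · fin_cases j
    · change T.θ (T.ψ₃ (T.Λ₃ (b 0))) ∈ _
      rw [T.ev_eq₃, T.mem_vanishing.mp (b 0).2]
      exact zero_mem _
    · change T.θ (T.ψ₃ y) ∈ _
      rw [← hτ]
      exact mem_adjoin_simple_self ℂ τ
    · change T.θ (T.ψ₃ z) ∈ _
      rw [hz0]
      exact zero_mem _
  · have hpm : ¬ (Odd (formMult f T.vanishing) ∧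
        Odd (formMult f (T.vanishing ⊓ eigenspace B 1))) := by
      rintro ⟨⟨a, ha⟩, ⟨b, hb⟩⟩
      obtain ⟨d, hd⟩ := hk
      omega
    have hcase (j : Fin 3) (hj : Odd (∑ i, n i j)) :
        j = 0 ∧ Odd (formMult f T.vanishing) ∨
          j = 2 ∧ Odd (formMult f (T.vanishing ⊓ eigenspace B 1)) := by
      fin_cases j
      · exact .inl ⟨rfl, hs0 ▸ hj⟩
      · have hj' : Odd (∑ i, n i 1) := hj
        rw [hs1] at hj'
        exact absurd hj' (by decide)
      · exact .inr ⟨rfl, hs2 ▸ hj⟩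
    rcases hcase j hj with ⟨rfl, h1⟩ | ⟨rfl, h1⟩ <;>
      rcases hcase j' hj' with ⟨rfl, h2⟩ | ⟨rfl, h2⟩
    · rfl
    · exact (hpm ⟨h1, h2⟩).elim
    · exact (hpm ⟨h2, h1⟩).elim
    · rfl
  · have hm4 := hev 0
    have hp0 := hev 2
    rw [hs0] at hm4
    rw [hs2] at hp0
    obtain ⟨hp, hq⟩ : formMult f (T.vanishing ⊓ eigenspace B 1) = 0 ∧
        formMult f (eigenspace B (-1)) = 0 := by
      obtain ⟨a, ha⟩ := hm4
      obtain ⟨b, hb⟩ := hp0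
      obtain ⟨d, hd⟩ := hk
      rw [← h.formMult_eigenspace_eq]
      omega
    rw [formMult, Set.ncard_eq_zero] at hp hq
    have hnp (i : Fin 8) (hi : f i ∈ T.vanishing) : f i ∉ eigenspace B 1 := fun h1 ↦
      (Set.eq_empty_iff_forall_notMem.mp hp i) ⟨hi, h1⟩
    have hnq (i : Fin 8) : f i ∉ eigenspace B (-1) := Set.eq_empty_iff_forall_notMem.mp hq i
    obtain ⟨W, hWs, -, hW2, -, d, q, hq, hprod⟩ := exists_prod_eq ℂ⟮τ⟯
      (fun i ↦ T.θ (T.ψ₃ (g i))) {i | f i ∈ T.vanishing} (fun i hi ↦ by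
        have hi := (Finset.mem_filter.mp hi).2
        rw [(hn2 i hi (hnp i hi)).2]
        exact hl0 _ hi (hnp i hi)) (fun i hi ↦ by
        have hi := (Finset.mem_filter.mp hi).2
        rw [(hn2 i hi (hnp i hi)).2, hl]
        exact add_mem (IntermediateField.algebraMap_mem _ _)
          (mul_mem (IntermediateField.algebraMap_mem _ _) (mem_adjoin_simple_self ℂ τ)))
    -- the involution permutes the forms with proportional values without fixed points
    obtain ⟨σ, hσ, hσσ⟩ := h.exists_perm
    have hlB (a : V) (ha : a ∈ T.vanishing) : l (B a) = -l a := by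
      have h1 := congrArg B (hx a ha)
      rw [mem_eigenspace_iff] at hb0 hb1 hb2
      rw [map_add, map_add, map_smul, map_smul, map_smul, hb0, hb1, hb2] at h1
      obtain ⟨h5, h6⟩ := huniq (x0 := x (B a) 0) (x1 := x (B a) 1) (x2 := x (B a) 2)
        (x0' := -x a 0) (x1' := -x a 1) (x2' := x a 2) (by
          rw [← hx (B a) (T.stable a ha), h1]; module)
      rw [hl, hl, h5, h6, map_neg, map_neg]
      ring
    have hlsmul (c : ℂ) (a : V) (ha : a ∈ T.vanishing) : l (c • a) = c • l a := by
      obtain ⟨h5, h6⟩ := huniq (x0 := x (c • a) 0) (x1 := x (c • a) 1) (x2 := x (c • a) 2)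
        (x0' := c * x a 0) (x1' := c * x a 1) (x2' := c * x a 2) (by
          rw [← hx (c • a) (Submodule.smul_mem _ c ha)]
          conv_lhs => rw [hx a ha]
          module)
      rw [hl, hl, h5, h6, map_mul, map_mul, Algebra.smul_def]
      ring
    have hW : W = ∅ := by
      rw [Finset.eq_empty_iff_forall_notMem]
      intro i hi
      have h1 := hW2 i hi
      have h2 : {j | j ∈ (Finset.univ.filter fun i ↦ f i ∈ T.vanishing) ∧
          ∃ c : ℂ, T.θ (T.ψ₃ (g j)) = c • T.θ (T.ψ₃ (g i))} =
          ((Finset.univ.filter fun j ↦ f j ∈ T.vanishing ∧ ∃ c : ℂ, l (f j) = c • l (f i) :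
            Finset (Fin 8)) : Set (Fin 8)) := by
        have hi := (Finset.mem_filter.mp (hWs hi)).2
        ext j
        simp only [Finset.mem_filter, Finset.mem_univ, true_and, Set.mem_ofPred_eq,
          Finset.coe_filter]
        refine and_congr_right fun hj ↦ ?_
        rw [(hn2 i hi (hnp i hi)).2, (hn2 j hj (hnp j hj)).2]
      rw [h2, Set.ncard_coe_finset, ← ZMod.natCast_eq_one_iff_odd] at h1
      rw [Finset.card_eq_sum_ones, Nat.cast_sum,
        Finset.sum_involution (fun j _ ↦ σ j) (fun _ _ ↦ by decide)
          (fun j hj _ ↦ h.perm_ne hσ (hnp j (Finset.mem_filter.mp hj).2.1) (hnq j))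
          (fun j hj ↦ ?_) (fun j _ ↦ hσσ j)] at h1
      · exact zero_ne_one h1
      · obtain ⟨hj, c, hc⟩ := (Finset.mem_filter.mp hj).2
        refine Finset.mem_filter.mpr ⟨Finset.mem_univ _, h.mem_of_perm hσ T.stable hj, ?_⟩
        obtain ⟨c', hc'⟩ := hσ j
        have hc0 : c' ≠ 0 := by
          rintro rfl
          have h1 := h.sq (f j)
          rw [hc', zero_smul, map_zero] at h1
          exact h.ne_zero j h1.symm
        refine ⟨-(c'⁻¹ * c), ?_⟩
        have h1 := hlB _ hj
        rw [hc', hlsmul _ _ (h.mem_of_perm hσ T.stable hj), hc] at h1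
        rw [neg_smul, mul_smul, ← smul_neg, ← h1, smul_smul, inv_mul_cancel₀ hc0, one_smul]
    rw [hW, Finset.prod_empty, mul_one] at hprod
    have hrest : ∃ e : ℂ, ∏ i with f i ∉ T.vanishing, T.θ (T.ψ₃ (g i)) = algebraMap ℂ κ e := by
      refine Finset.prod_induction _ (fun x ↦ ∃ e : ℂ, x = algebraMap ℂ κ e) ?_ ⟨1, by simp⟩ ?_
      · rintro _ _ ⟨a, rfl⟩ ⟨b, rfl⟩
        exact ⟨a * b, by simp⟩
      · intro i hi
        exact (hn0 i (Finset.mem_filter.mp hi).2).2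
    obtain ⟨e, he⟩ := hrest
    rw [← Finset.prod_filter_mul_prod_filter_not _ (fun i ↦ f i ∈ T.vanishing), hprod, he] at hω
    obtain ⟨r, hr⟩ := IsAlgClosed.exists_pow_nat_eq (d * e) (n := 2) two_pos
    have hω2 : ω ^ 2 = (algebraMap ℂ κ r * q) ^ 2 := by
      rw [hω, mul_pow, ← map_pow, hr, map_mul, Algebra.smul_def]
      ring
    have hmem : algebraMap ℂ κ r * q ∈ ℂ⟮τ⟯ :=
      mul_mem (IntermediateField.algebraMap_mem _ r) hq
    rcases sq_eq_sq_iff_eq_or_eq_neg.mp hω2 with h1 | h1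
    · rw [h1]; exact hmem
    · rw [h1]; exact neg_mem hmem

end LocalTower
end LocalTower

/-! ### Curves over triple lines and fivefold points -/

section
open Module Module.End

lemma IsSymmetric.linearIndependent_pair {V : Type} [AddCommGroup V] [Module ℂ V]
    [FiniteDimensional ℂ V] {f : Fin 8 → V} {B : End ℂ V} (h : IsSymmetric f B) {v s : V}
    (hv : v ∈ eigenspace B (-1)) (hv0 : v ≠ 0) (hs : s ∈ eigenspace B 1) (hs0 : s ≠ 0) :
    LinearIndependent ℂ ![v, s] := by
  rw [LinearIndependent.pair_iff' hv0]
  intro a ha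
  have h4 : s ∈ eigenspace B 1 ⊓ eigenspace B (-1) := ⟨hs, ha ▸ Submodule.smul_mem _ a hv⟩
  rw [h.inf_eigenspace] at h4
  exact hs0 h4

lemma IsSymmetric.exists_eigenbasis {V : Type} [AddCommGroup V] [Module ℂ V]
    [FiniteDimensional ℂ V] {f : Fin 8 → V} {B : End ℂ V} (h : IsSymmetric f B)
    {N : Submodule ℂ V} (hN : finrank ℂ N = 2) {v s : V} (hvN : v ∈ N)
    (hv : v ∈ eigenspace B (-1)) (hv0 : v ≠ 0) (hsN : s ∈ N) (hs : s ∈ eigenspace B 1)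
    (hs0 : s ≠ 0) : ∃ b : Basis (Fin 2) ℂ N, (b 0 : V) = v ∧ (b 1 : V) = s := by
  have hli := h.linearIndependent_pair hv hv0 hs hs0
  have h1 : LinearIndependent ℂ (![⟨v, hvN⟩, ⟨s, hsN⟩] : Fin 2 → N) := by
    refine LinearIndependent.of_comp N.subtype ?_
    have h2 : N.subtype ∘ (![⟨v, hvN⟩, ⟨s, hsN⟩] : Fin 2 → N) = ![v, s] := by
      funext j
      fin_cases j <;> rfl
    rwa [h2]
  refine ⟨basisOfLinearIndependentOfCardEqFinrank h1 (by simp [hN]), ?_, ?_⟩ <;>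
    rw [coe_basisOfLinearIndependentOfCardEqFinrank] <;> rfl

end

section LocalTower
open Module Module.End IsLocalRing IntermediateField
set_option linter.unusedSectionVars false
set_option linter.overlappingInstances false

namespace LocalTower

variable {V : Type} [AddCommGroup V] [Module ℂ V] [FiniteDimensional ℂ V]
  {f : Fin 8 → V} {B : End ℂ V} {R₀ R₁ R₂ R₃ S O κ : Type}
  [CommRing R₀] [CommRing R₁] [CommRing R₂] [CommRing R₃] [CommRing S] [CommRing O] [Field κ]
  [Algebra ℂ R₀] [Algebra ℂ R₁] [Algebra ℂ R₂] [Algebra ℂ R₃] [Algebra ℂ S] [Algebra ℂ O]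
  [Algebra ℂ κ] [IsDomain R₀] [IsDomain R₁] [IsDomain R₂] [IsDomain R₃] [IsDomain S] [IsDomain O]
  [IsLocalRing R₀] [IsLocalRing R₁] [IsLocalRing R₂] [IsLocalRing R₃] [IsLocalRing S]
  [IsLocalRing O] [IsIntegrallyClosed S] (T : LocalTower f B R₀ R₁ R₂ R₃ S O κ)

lemma ψ₀_Λ (a : V) : T.ψ₀ (T.Λ a) = T.ψ₁ (T.Λ₁ a) := rfl

/-- The case of a triple line, given by two forms `v` and `s` of different parity. Their quotient is
odd, so the fixed points on the fibre of the exceptional divisor are its zero and its pole. Near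
these closed points the planes are given by monomials. -/
lemma exists_generator_of_triple_line (h : IsSymmetric f B) {N : Submodule ℂ V} {v s : V} (hv : v ∈ eigenspace B (-1))
    (hs : s ∈ eigenspace B 1) (hv0 : v ≠ 0) (hs0 : s ≠ 0) (hvN : v ∈ N) (hsN : s ∈ N)
    (hN : finrank ℂ N = 2) {x y₁ y₂ : R₁} (hc : IsCoord ![x, y₁, y₂]) (hx : T.θ (T.ψ₁ x) = 0)
    (hy₁ : T.θ (T.ψ₁ y₁) = 0) (hy₂ : T.θ (T.ψ₁ y₂) = 0) {k : ℕ}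
    (h1 : T.Λ₁ v = x ^ k * y₁) (h2 : T.Λ₁ s = x ^ k * y₂) (hI : T.I₂ = Ideal.span {y₁, y₂})
    (hf : ∀ i, f i ∉ N → ∃ g : R₁, ∃ k : ℕ, IsUnit g ∧ T.Λ₁ (f i) = g * x ^ k)
    (h3 : Function.Bijective T.φ₃) : ∃ τ : κ, ∀ z, z ∈ ℂ⟮τ⟯ := by
  have hxk : x ^ k ≠ 0 := by
    intro h0
    rw [h0, zero_mul] at h1
    exact hv0 ((injective_iff_map_eq_zero _).mp (T.Λ₁_injective h) v h1)
  have hxk' : T.ψ₁ (x ^ k) ≠ 0 := by rwa [Ne, map_eq_zero_iff _ T.ψ₁_injective]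
  have hψ (z : R₁) : T.ψ₂ (T.φ₂ z) = T.ψ₁ z := rfl
  obtain ⟨c, hc, hc0, hcx, hmon⟩ := lineBlowup hc T.φ₂ T.inj₂ (T.θ.comp T.ψ₂)
    (fun z hz ↦ T.isUnit₂ hz) hx hy₁ hy₂ (by rw [← hI]; exact T.blowup₂)
    (fun z hz ↦ T.odd h hs0 (y := T.ψ₂ z) (a := v) (by
      rw [ψ₀_Λ, ψ₀_Λ, h1, h2, map_mul, map_mul, ← hψ y₁, hz, map_mul, hψ, mul_left_comm]) (.inr ⟨hv, hs⟩))
    (fun z hz ↦ T.odd h hv0 (y := T.ψ₂ z) (a := s) (by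
      rw [ψ₀_Λ, ψ₀_Λ, h1, h2, map_mul, map_mul, ← hψ y₂, hz, map_mul, hψ, mul_left_comm]) (.inl ⟨hs, hv⟩))
  · refine T.exists_generator_of_closed (hc.map_bijective T.φ₃ h3) hc0 fun i ↦ ?_
    by_cases hi : f i ∈ N
    · have hli := h.linearIndependent_pair hv hv0 hs hs0
      have hle : Submodule.span ℂ {v, s} ≤ N := by
        rw [Submodule.span_le]
        rintro _ (rfl | rfl)
        exacts [hvN, hsN]
      have hfr : finrank ℂ (Submodule.span ℂ {v, s}) = 2 := by
        have := finrank_span_eq_card hli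
        rwa [Matrix.range_cons_cons_empty] at this
      rw [← Submodule.eq_of_le_of_finrank_le hle (by omega), Submodule.mem_span_pair] at hi
      obtain ⟨α, β, hαβ⟩ := hi
      have h5 : T.Λ₁ (f i) = x ^ k * (α • y₁ + β • y₂) := by
        rw [← hαβ, map_add, map_smul, map_smul, h1, h2, mul_add, mul_smul_comm, mul_smul_comm]
      have h6 : T.Λ₃ (f i) = T.φ₃ (c 0 ^ k * T.φ₂ (α • y₁ + β • y₂)) := by
        change T.φ₃ (T.φ₂ (T.Λ₁ (f i))) = _
        rw [h5, hcx, map_mul, map_pow]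
      rw [h6]
      refine (((IsMonomial.coord 0).pow k).mul (hmon α β ?_)).map T.φ₃.toRingHom
      rintro ⟨rfl, rfl⟩
      refine h.ne_zero i ?_
      rw [← hαβ, zero_smul, zero_smul, zero_add]
    · obtain ⟨g, k, hg, hgk⟩ := hf i hi
      have h6 : T.Λ₃ (f i) = T.φ₃ (T.φ₂ g * c 0 ^ k) := by
        change T.φ₃ (T.φ₂ (T.Λ₁ (f i))) = _
        rw [hgk, hcx, map_mul, map_pow]
      rw [h6]
      exact ((IsMonomial.of_isUnit (hg.map T.φ₂)).mul
        ((IsMonomial.coord 0).pow k)).map T.φ₃.toRingHom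

lemma isCoord_map {c : Fin 3 → R₁} (hc : IsCoord c) (h4 : Function.Bijective T.φ₂)
    (h5 : Function.Bijective T.φ₃) : IsCoord fun j ↦ T.φ₃ (T.φ₂ (c j)) :=
  (hc.map_bijective _ h4).map_bijective _ h5

/-- A version of `exists_generator_of_chart` with coordinates in `R₁`: they are transported
to `R₃` if the later blow-ups are isomorphisms. -/
lemma exists_generator_of_chart₁ (h : IsSymmetric f B) (h3 : finrank ℂ T.vanishing = 3) {N₁ : Submodule ℂ V}
    (h1 : N₁ ≤ T.vanishing) (h2 : finrank ℂ N₁ = 2) (hm : formMult f N₁ ≤ 2) {b₀ : V}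
    (hb₀ : b₀ ∈ T.vanishing) (hb₀' : b₀ ∉ N₁) (hy : ∀ b : Basis (Fin 2) ℂ N₁, ∃ y : Fin 2 → R₁,
      IsCoord (Fin.cons (T.Λ₁ b₀) y : Fin 3 → R₁) ∧ (∀ j, T.Λ₁ (b j) = y j * T.Λ₁ b₀) ∧
        ∀ j, T.θ (T.ψ₁ (y j)) = 0) (h4 : Function.Bijective T.φ₂) (h5 : Function.Bijective T.φ₃) :
    ∃ τ : κ, ∀ z, z ∈ ℂ⟮τ⟯ := by
  refine T.exists_generator_of_chart h h3 h1 h2 hm hb₀ hb₀' fun b ↦ ?_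
  obtain ⟨y, hc, hyb, hy0⟩ := hy b
  refine ⟨fun j ↦ T.φ₃ (T.φ₂ (y j)), ?_, fun j ↦ ?_, hy0⟩
  · have h6 := T.isCoord_map hc h4 h5
    have h7 : (Fin.cons (T.Λ₃ b₀) fun j ↦ T.φ₃ (T.φ₂ (y j)) : Fin 3 → R₃) =
        fun j ↦ T.φ₃ (T.φ₂ ((Fin.cons (T.Λ₁ b₀) y : Fin 3 → R₁) j)) := by
      funext j
      refine Fin.cases rfl (fun j ↦ rfl) j
    rw [h7]
    exact h6
  · change T.φ₃ (T.φ₂ (T.Λ₁ (b j))) = _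
    rw [hyb, map_mul, map_mul]
    rfl

/-- The case of a fivefold point. On the exceptional plane the involution fixes a point, which may lie
on the strict transform of a triple line, and a line, which does not meet these strict transforms at
its generic point. -/
lemma exists_generator_fivefold (h : IsSymmetric f B) (h3 : finrank ℂ T.vanishing = 3)
    (h5 : formMult f T.vanishing = 5) : ∃ τ : κ, ∀ z, z ∈ ℂ⟮τ⟯ := by
  have hb3 : Function.Bijective T.φ₃ := T.bijective₃ fun N hN hN3 hN4 _ ↦ by
    rw [Submodule.eq_of_le_of_finrank_le hN (by omega)] at hN4
    omega
  have hI (𝔭 : Ideal R₀) (h𝔭 : 𝔭.IsPrime) : T.I₁ ≤ 𝔭 ↔ ∀ a ∈ T.vanishing, T.Λ a ∈ 𝔭 := by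
    rw [T.le₁ 𝔭 h𝔭]
    constructor
    · rintro ⟨N, hN3, -, hN⟩
      have hle : N ≤ T.vanishing := fun a ha ↦ T.res_eq_zero₀ h𝔭 (hN a ha)
      rw [← Submodule.eq_of_le_of_finrank_le hle (by omega)]
      exact hN
    · exact fun hN ↦ ⟨_, h3, h5, hN⟩
  have hnu (a : V) (ha : a ∈ T.vanishing) : ¬ IsUnit (T.Λ a) := fun hu ↦
    ((hu.map T.ψ₀).map T.θ).ne_zero ha
  let b₀ : Basis (Fin 3) ℂ T.vanishing := finBasisOfFinrankEq ℂ T.vanishing h3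
  have hI₁ : T.I₁ = Ideal.span (T.Λ '' T.vanishing) := by
    refine eq_of_forall_isPrime_le_iff T.radical₁ ?_ fun 𝔭 h𝔭 ↦ ?_
    · rw [span_image_eq T.Λ b₀]
      exact ((T.isCoord_basis b₀).isPrime_span _ fun i _ ↦ hnu _ (b₀ i).2).isRadical
    · rw [hI 𝔭 h𝔭, Ideal.span_le]
      exact ⟨fun h ↦ by rintro _ ⟨a, ha, rfl⟩; exact h a ha, fun h a ha ↦ h ⟨a, ha, rfl⟩⟩
  have hI' (𝔮 : Ideal R₁) (h𝔮 : 𝔮.IsPrime) : T.I₁ ≤ 𝔮.comap T.φ₁.toRingHom ↔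
      ∀ a ∈ T.vanishing, T.Λ₁ a ∈ 𝔮 := hI _ (h𝔮.comap _)
  rcases pointBlowup h T.Λ T.φ₁ T.inj₁ (T.θ.comp T.ψ₁) (T.Λ_injective h) h3 T.eigenspace_le
    T.stable T.isCoord_basis (hI₁ ▸ T.blowup₁) (fun a b y hb hy ↦ T.odd h hb (y := T.ψ₁ y) (by
      change T.ψ₁ (T.φ₁ (T.Λ a)) = _ * T.ψ₁ (T.φ₁ (T.Λ b))
      rw [hy, map_mul])) with
    ⟨N₁, hN₁, hN₁2, hst, b, hb, hb', hy⟩ | ⟨b, hb0, hb1, hb2, y, z, hc, hy, hz, hz0, hy0⟩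
  · replace hy : ∀ b' : Basis (Fin 2) ℂ N₁, ∃ y : Fin 2 → R₁,
        IsCoord (Fin.cons (T.Λ₁ b) y : Fin 3 → R₁) ∧ (∀ j, T.Λ₁ (b' j) = y j * T.Λ₁ b) ∧
          ∀ j, T.θ (T.ψ₁ (y j)) = 0 := hy
    have hgen (𝔮 : Ideal R₁) (h𝔮 : 𝔮.IsPrime) (hb𝔮 : T.Λ₁ b ∈ 𝔮) :
        T.I₁ ≤ 𝔮.comap T.φ₁.toRingHom := by
      rw [hI' 𝔮 h𝔮]
      intro a ha
      obtain ⟨y, hc, hyb, hy0⟩ := hy (finBasisOfFinrankEq ℂ N₁ hN₁2)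
      obtain ⟨g, -, hg⟩ := exists_quotient T.Λ₁ (T.θ.comp T.ψ₁) hN₁ (by omega) hb hb' _ hyb hy0 ha
      rw [hg]
      exact 𝔮.mul_mem_left _ hb𝔮
    have hsub (N : Submodule ℂ V) (hN : N ≤ T.vanishing) (hN2 : finrank ℂ N = 2) (𝔮 : Ideal R₁)
        (h𝔮 : 𝔮.IsPrime) (hI𝔮 : ¬ T.I₁ ≤ 𝔮.comap T.φ₁.toRingHom) (hN𝔮 : ∀ a ∈ N, T.Λ₁ a ∈ 𝔮) :
        N = N₁ := by
      refine Submodule.eq_of_le_of_finrank_le (fun a ha ↦ ?_) (by omega)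
      by_contra ha1
      obtain ⟨y, hc, hyb, hy0⟩ := hy (finBasisOfFinrankEq ℂ N₁ hN₁2)
      obtain ⟨g, hg, hga⟩ := exists_quotient T.Λ₁ (T.θ.comp T.ψ₁) hN₁ (by omega) hb hb' _ hyb hy0
        (hN ha)
      have h6 := hN𝔮 a ha
      rw [hga, Ideal.unit_mul_mem_iff_mem _ (T.isUnit₁ (hg ha1))] at h6
      exact hI𝔮 (hgen 𝔮 h𝔮 h6)
    by_cases hm : formMult f N₁ ≤ 2
    · refine T.exists_generator_of_chart₁ h h3 hN₁ hN₁2 hm hb hb' hy (T.bijective₂ ?_) hb3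
      intro N hN hN2 hN3 𝔮 h𝔮 hI𝔮 hN𝔮
      rw [hsub N hN hN2 𝔮 h𝔮 hI𝔮 hN𝔮] at hN3
      omega
    -- the strict transform of a triple line passes through the point
    · have hm3 : formMult f N₁ = 3 := by
        have := h.no_four N₁ hN₁2
        omega
      obtain ⟨s, hsN, hs, hs0, v, hvN, hv, hv0⟩ := h.exists_eigenvectors hst hm3
      obtain ⟨b', hb'0, hb'1⟩ := h.exists_eigenbasis hN₁2 hvN hv hv0 hsN hs hs0
      obtain ⟨y, hc, hyb, hy0⟩ := hy b'
      have hc' : IsCoord ![T.Λ₁ b, y 0, y 1] := by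
        have h6 : (Fin.cons (T.Λ₁ b) y : Fin 3 → R₁) = ![T.Λ₁ b, y 0, y 1] := by
          funext j
          fin_cases j <;> rfl
        rwa [h6] at hc
      have hnu1 : ∀ i ∈ ({1, 2} : Set (Fin 3)), ¬ IsUnit ((![T.Λ₁ b, y 0, y 1] : Fin 3 → R₁) i) := by
        rintro i (rfl | rfl) hu
        · exact ((hu.map T.ψ₁).map T.θ).ne_zero (hy0 0)
        · exact ((hu.map T.ψ₁).map T.θ).ne_zero (hy0 1)
      have himg : (![T.Λ₁ b, y 0, y 1] : Fin 3 → R₁) '' {1, 2} = {y 0, y 1} := by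
        rw [Set.image_pair]; rfl
      have hpr := hc'.isPrime_span _ hnu1
      have hnot := hc'.notMem_span _ hnu1 (j := 0) (by simp)
      rw [himg] at hpr hnot
      have hyv := hyb 0
      have hys := hyb 1
      rw [hb'0] at hyv
      rw [hb'1] at hys
      refine T.exists_generator_of_triple_line h hv hs hv0 hs0 hvN hsN hN₁2 hc' hb (hy0 0) (hy0 1) (k := 1)
        (by rw [hyv, pow_one, mul_comm]) (by rw [hys, pow_one, mul_comm])
        (eq_of_forall_isPrime_le_iff T.radical₂ hpr.isRadical fun 𝔭 h𝔭 ↦ ?_) (fun i hi ↦ ?_) hb3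
      · rw [T.le₂ 𝔭 h𝔭, Ideal.span_le]
        constructor
        · rintro ⟨𝔮, hle, h𝔮, hI𝔮, N, hN2, -, hN𝔮⟩
          have hNN := hsub N (fun a ha ↦ T.res_eq_zero₁ h𝔮 (hN𝔮 a ha)) hN2 𝔮 h𝔮 hI𝔮 hN𝔮
          have hb𝔮 : T.Λ₁ b ∉ 𝔮 := fun h6 ↦ hI𝔮 (hgen 𝔮 h𝔮 h6)
          have hv𝔮 : T.Λ₁ v ∈ 𝔮 := hN𝔮 v (hNN ▸ hvN)
          have hs𝔮 : T.Λ₁ s ∈ 𝔮 := hN𝔮 s (hNN ▸ hsN)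
          rw [hyv] at hv𝔮
          rw [hys] at hs𝔮
          rintro _ (rfl | rfl)
          · exact hle ((h𝔮.mem_or_mem hv𝔮).resolve_right hb𝔮)
          · exact hle ((h𝔮.mem_or_mem hs𝔮).resolve_right hb𝔮)
        · intro hle
          refine ⟨_, Ideal.span_le.mpr hle, hpr, fun h6 ↦ hnot ?_, N₁, hN₁2, hm3, fun a ha ↦ ?_⟩
          · exact (hI' _ hpr).mp h6 b hb
          · have h6 : T.Λ₁ a ∈ Ideal.span (T.Λ₁ '' N₁) := Ideal.subset_span ⟨a, ha, rfl⟩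
            rw [span_image_eq T.Λ₁ b'] at h6
            refine (Ideal.span_le.mpr ?_ : _ ≤ Ideal.span {y 0, y 1}) h6
            rintro _ ⟨j, -, rfl⟩
            change T.Λ₁ (b' j) ∈ Ideal.span {y 0, y 1}
            rw [hyb]
            refine Ideal.mul_mem_right _ _ (Ideal.subset_span ?_)
            fin_cases j
            exacts [.inl rfl, .inr rfl]
      · by_cases hi0 : f i ∈ T.vanishing
        · obtain ⟨g, hg, hga⟩ := exists_quotient T.Λ₁ (T.θ.comp T.ψ₁) hN₁ (by omega) hb hb' _ hyb
            hy0 hi0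
          exact ⟨g, 1, T.isUnit₁ (hg hi), by rw [hga, pow_one]⟩
        · exact ⟨T.Λ₁ (f i), 0, T.isUnit₁ hi0, by rw [pow_zero, mul_one]⟩
  · have hquot (a : V) (ha : a ∈ T.vanishing) : T.Λ₁ a =
        (algebraMap ℂ R₁ (b.repr ⟨a, ha⟩ 0) + algebraMap ℂ R₁ (b.repr ⟨a, ha⟩ 1) * y +
          algebraMap ℂ R₁ (b.repr ⟨a, ha⟩ 2) * z) * T.Λ₁ (b 0) := by
      have h4 : a = b.repr ⟨a, ha⟩ 0 • (b 0 : V) + b.repr ⟨a, ha⟩ 1 • (b 1 : V) +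
          b.repr ⟨a, ha⟩ 2 • (b 2 : V) := by
        have h5 := congrArg (fun x : T.vanishing ↦ (x : V)) (b.sum_repr ⟨a, ha⟩)
        simp only [Fin.sum_univ_three] at h5
        exact h5.symm
      have hy' : T.Λ₁ (b 1) = y * T.Λ₁ (b 0) := hy
      have hz' : T.Λ₁ (b 2) = z * T.Λ₁ (b 0) := hz
      conv_lhs => rw [h4, map_add, map_add, map_smul, map_smul, map_smul, hy', hz',
        Algebra.smul_def, Algebra.smul_def, Algebra.smul_def]
      ring
    have hb2' : Function.Bijective T.φ₂ := by
      refine T.bijective₂ fun N hN hN2 hN3 𝔮 h𝔮 hI𝔮 hN𝔮 ↦ ?_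
      have hinf : 0 < finrank ℂ (N ⊓ eigenspace B (-1) : Submodule ℂ V) := by
        have h6 := Submodule.finrank_sup_add_finrank_inf_eq N (eigenspace B (-1))
        have h7 := Submodule.finrank_mono (sup_le hN T.eigenspace_le)
        rw [h.finrank_eigenspace (-1) (.inr rfl)] at h6
        omega
      obtain ⟨⟨a, haN, ha⟩, ha0⟩ := finrank_pos_iff_exists_ne_zero.mp hinf
      have ha0 : a ≠ 0 := fun h0 ↦ ha0 (Subtype.ext h0)
      have h6 := hN𝔮 a haN
      rw [hquot a (hN haN), Ideal.unit_mul_mem_iff_mem _ (T.isUnit₁ ?_)] at h6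
      · refine hI𝔮 ((hI' 𝔮 h𝔮).mpr fun a' ha' ↦ ?_)
        rw [hquot a' ha']
        exact 𝔮.mul_mem_left _ h6
      have hz0' : T.θ (T.ψ₁ z) = 0 := hz0
      rw [map_add, map_add, map_add, map_add, map_mul, map_mul, map_mul, map_mul, hz0', mul_zero,
        add_zero, AlgHom.commutes, AlgHom.commutes, AlgHom.commutes, AlgHom.commutes]
      have h7 : a = b.repr ⟨a, hN haN⟩ 0 • (b 0 : V) + b.repr ⟨a, hN haN⟩ 1 • (b 1 : V) +
          b.repr ⟨a, hN haN⟩ 2 • (b 2 : V) := by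
        have h5 := congrArg (fun x : T.vanishing ↦ (x : V)) (b.sum_repr ⟨a, hN haN⟩)
        simp only [Fin.sum_univ_three] at h5
        exact h5.symm
      intro h0
      by_cases h8 : b.repr ⟨a, hN haN⟩ 1 = 0
      · rw [h8, (algebraMap ℂ κ).map_zero, zero_mul, add_zero, _root_.map_eq_zero] at h0
        rw [h8, h0, zero_smul, zero_smul, zero_add, zero_add] at h7
        have h9 : a ∈ eigenspace B 1 ⊓ eigenspace B (-1) :=
          ⟨h7 ▸ Submodule.smul_mem _ _ hb2, ha⟩
        rw [h.inf_eigenspace] at h9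
        exact ha0 h9
      · refine hy0 (-(b.repr ⟨a, hN haN⟩ 0 / b.repr ⟨a, hN haN⟩ 1)) ?_
        have h1' : algebraMap ℂ κ (b.repr ⟨a, hN haN⟩ 1) ≠ 0 := (map_ne_zero _).mpr h8
        rw [map_neg, map_div₀, ← neg_div, eq_div_iff h1']
        change T.θ (T.ψ₁ y) * _ = _
        linear_combination h0
    refine T.exists_generator_of_exceptional h h3 b hb0 hb1 hb2 (y := T.φ₃ (T.φ₂ y)) (z := T.φ₃ (T.φ₂ z)) ?_ ?_ ?_
      hz0 hy0
    · have h6 := T.isCoord_map hc hb2' hb3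
      have h7 : (fun j ↦ T.φ₃ (T.φ₂ ((![T.φ₁ (T.Λ (b 0)), y, z] : Fin 3 → R₁) j))) =
          ![T.Λ₃ (b 0), T.φ₃ (T.φ₂ y), T.φ₃ (T.φ₂ z)] := by
        funext j
        fin_cases j <;> rfl
      rwa [h7] at h6
    · change T.φ₃ (T.φ₂ (T.φ₁ (T.Λ (b 1)))) = _
      rw [hy, map_mul, map_mul]
      rfl
    · change T.φ₃ (T.φ₂ (T.φ₁ (T.Λ (b 2)))) = _
      rw [hz, map_mul, map_mul]
      rfl

end LocalTower
end LocalTower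

/-! ### Curves over the remaining points -/

section LocalTower
open Module Module.End IsLocalRing IntermediateField
set_option linter.unusedSectionVars false
set_option linter.overlappingInstances false

namespace LocalTower

variable {V : Type} [AddCommGroup V] [Module ℂ V] [FiniteDimensional ℂ V]
  {f : Fin 8 → V} {B : End ℂ V} {R₀ R₁ R₂ R₃ S O κ : Type}
  [CommRing R₀] [CommRing R₁] [CommRing R₂] [CommRing R₃] [CommRing S] [CommRing O] [Field κ]
  [Algebra ℂ R₀] [Algebra ℂ R₁] [Algebra ℂ R₂] [Algebra ℂ R₃] [Algebra ℂ S] [Algebra ℂ O]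
  [Algebra ℂ κ] [IsDomain R₀] [IsDomain R₁] [IsDomain R₂] [IsDomain R₃] [IsDomain S] [IsDomain O]
  [IsLocalRing R₀] [IsLocalRing R₁] [IsLocalRing R₂] [IsLocalRing R₃] [IsLocalRing S]
  [IsLocalRing O] [IsIntegrallyClosed S] (T : LocalTower f B R₀ R₁ R₂ R₃ S O κ)

/-- The case of a point of a triple line which is not a fivefold point. -/
lemma exists_generator_triple (h : IsSymmetric f B) (h3 : finrank ℂ T.vanishing = 3)
    (h5 : formMult f T.vanishing ≤ 4) {N : Submodule ℂ V} (hN : N ≤ T.vanishing)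
    (hN2 : finrank ℂ N = 2) (hN3 : formMult f N = 3) : ∃ τ : κ, ∀ z, z ∈ ℂ⟮τ⟯ := by
  obtain ⟨hI₁, hb1⟩ := T.bijective₁ fun N' hN' hN'3 hN'5 ↦ by
    have := formMult_mono (f := f) hN'
    omega
  have hb3 : Function.Bijective T.φ₃ := T.bijective₃ fun N' hN' hN'3 _ hN'4 ↦ by
    have h6 := Submodule.eq_of_le_of_finrank_le hN' (by omega)
    exact hN'4 N (h6 ▸ hN) hN2 hN3
  obtain ⟨s, hsN, hs, hs0, v, hvN, hv, hv0⟩ :=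
    h.exists_eigenvectors (h.triple_stable T.stable h5 hN hN2 hN3) hN3
  obtain ⟨b', hb'0, hb'1⟩ := h.exists_eigenbasis hN2 hvN hv hv0 hsN hs hs0
  -- the third coordinate is given by a fourth plane through the point, if there is one
  obtain ⟨u, hu, huN, hfu⟩ : ∃ u ∈ T.vanishing, u ∉ N ∧
      ∀ i, f i ∈ T.vanishing → f i ∉ N → f i = u := by
    by_cases hex : ∃ i, f i ∈ T.vanishing ∧ f i ∉ N
    · obtain ⟨i, hi, hiN⟩ := hex
      refine ⟨f i, hi, hiN, fun j hj hjN ↦ ?_⟩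
      by_contra hne
      have hij : i ≠ j := by rintro rfl; exact hne rfl
      have hsub : {k | f k ∈ N} ∪ {i, j} ⊆ {k | f k ∈ T.vanishing} := by
        rintro k (hk | rfl | rfl)
        exacts [hN hk, hi, hj]
      have h6 := Set.ncard_le_ncard hsub
      rw [Set.ncard_union_eq ?_, Set.ncard_pair hij] at h6
      · change formMult f N + 2 ≤ formMult f T.vanishing at h6
        omega
      · rw [Set.disjoint_left]
        rintro k hk (rfl | rfl)
        exacts [hiN hk, hjN hk]
    · obtain ⟨u, hu, huN⟩ := SetLike.exists_of_lt (lt_of_le_of_ne hN fun h6 ↦ by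
        rw [← h6] at h3; omega)
      exact ⟨u, hu, huN, fun i hi hiN ↦ (hex ⟨i, hi, hiN⟩).elim⟩
  have hli : LinearIndependent ℂ ![u, v, s] := by
    refine (h.linearIndependent_pair hv hv0 hs hs0).finCons fun hmem ↦ huN ?_
    refine (Submodule.span_le.mpr ?_ : Submodule.span ℂ _ ≤ N) hmem
    rintro _ ⟨j, rfl⟩
    fin_cases j
    exacts [hvN, hsN]
  obtain ⟨b, hb⟩ := exists_basis h3 ![u, v, s] (by
    intro j
    fin_cases j
    exacts [hu, hN hvN, hN hsN]) hli
  have hc : IsCoord ![T.Λ₁ u, T.Λ₁ v, T.Λ₁ s] := by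
    have h6 := (T.isCoord_basis b).map_bijective _ hb1
    have h7 : (T.φ₁ ∘ fun i ↦ T.Λ (b i)) = ![T.Λ₁ u, T.Λ₁ v, T.Λ₁ s] := by
      funext j
      change T.φ₁ (T.Λ (b j)) = _
      rw [hb]
      fin_cases j <;> rfl
    rwa [h7] at h6
  have hnu1 : ∀ i ∈ ({1, 2} : Set (Fin 3)),
      ¬ IsUnit ((![T.Λ₁ u, T.Λ₁ v, T.Λ₁ s] : Fin 3 → R₁) i) := by
    rintro i (rfl | rfl) hunit
    · exact ((hunit.map T.ψ₁).map T.θ).ne_zero (hN hvN)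
    · exact ((hunit.map T.ψ₁).map T.θ).ne_zero (hN hsN)
  have himg : (![T.Λ₁ u, T.Λ₁ v, T.Λ₁ s] : Fin 3 → R₁) '' {1, 2} = {T.Λ₁ v, T.Λ₁ s} := by
    rw [Set.image_pair]; rfl
  have hpr := hc.isPrime_span _ hnu1
  rw [himg] at hpr
  refine T.exists_generator_of_triple_line h hv hs hv0 hs0 hvN hsN hN2 hc hu (hN hvN) (hN hsN) (k := 0)
    (by rw [pow_zero, one_mul]) (by rw [pow_zero, one_mul])
    (eq_of_forall_isPrime_le_iff T.radical₂ hpr.isRadical fun 𝔭 h𝔭 ↦ ?_) (fun i hi ↦ ?_) hb3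
  · rw [T.le₂ 𝔭 h𝔭, Ideal.span_le]
    constructor
    · rintro ⟨𝔮, hle, h𝔮, -, N', hN'2, hN'3, hN𝔮⟩
      have hNN : N' = N := h.triple_unique h5 hN (fun a ha ↦ T.res_eq_zero₁ h𝔮 (hN𝔮 a ha)) hN2 hN'2
        hN3.ge hN'3.ge
      rintro _ (rfl | rfl)
      · exact hle (hN𝔮 v (hNN ▸ hvN))
      · exact hle (hN𝔮 s (hNN ▸ hsN))
    · intro hle
      refine ⟨_, Ideal.span_le.mpr hle, hpr, fun h6 ↦ ?_, N, hN2, hN3, fun a ha ↦ ?_⟩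
      · rw [hI₁, top_le_iff] at h6
        exact (hpr.comap T.φ₁.toRingHom).ne_top h6
      · have h6 : T.Λ₁ a ∈ Ideal.span (T.Λ₁ '' N) := Ideal.subset_span ⟨a, ha, rfl⟩
        rw [span_image_eq T.Λ₁ b'] at h6
        refine (Ideal.span_le.mpr ?_ : _ ≤ Ideal.span {T.Λ₁ v, T.Λ₁ s}) h6
        rintro _ ⟨j, -, rfl⟩
        change T.Λ₁ (b' j) ∈ Ideal.span {T.Λ₁ v, T.Λ₁ s}
        refine Ideal.subset_span ?_
        fin_cases j
        · exact .inl (congrArg _ hb'0)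
        · exact .inr (congrArg _ hb'1)
  · by_cases hi0 : f i ∈ T.vanishing
    · exact ⟨1, 1, isUnit_one, by rw [hfu i hi0 hi, one_mul, pow_one]⟩
    · exact ⟨T.Λ₁ (f i), 0, T.isUnit₁ hi0, by rw [pow_zero, mul_one]⟩

/-- The case of a point which lies neither on a triple line nor on five planes. If it lies on at most
three planes, these have normal crossings, and otherwise it is one of the fourfold points that are
blown up. -/
lemma exists_generator_ordinary (h : IsSymmetric f B) (h3 : finrank ℂ T.vanishing = 3)
    (h5 : formMult f T.vanishing ≤ 4)
    (hN : ∀ N ≤ T.vanishing, finrank ℂ N = 2 → formMult f N ≠ 3) :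
    ∃ τ : κ, ∀ z, z ∈ ℂ⟮τ⟯ := by
  obtain ⟨hI₁, hb1⟩ := T.bijective₁ fun N' hN' hN'3 hN'5 ↦ by
    have := formMult_mono (f := f) hN'
    omega
  have hb2 : Function.Bijective T.φ₂ := T.bijective₂ fun N' hN' hN'2 hN'3 _ _ _ _ ↦
    hN N' hN' hN'2 hN'3
  have hc₂ (b : Basis (Fin 3) ℂ T.vanishing) : IsCoord fun i ↦ T.Λ₂ (b i) :=
    ((T.isCoord_basis b).map_bijective _ hb1).map_bijective _ hb2
  by_cases hm : formMult f T.vanishing = 4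
  · have hnu (a : V) (ha : a ∈ T.vanishing) : ¬ IsUnit (T.Λ₂ a) := fun hu ↦
      ((hu.map T.ψ₂).map T.θ).ne_zero ha
    have hI₃ : T.I₃ = Ideal.span (T.Λ₂ '' T.vanishing) := by
      refine eq_of_forall_isPrime_le_iff T.radical₃ ?_ fun 𝔭 h𝔭 ↦ ?_
      · let b₀ : Basis (Fin 3) ℂ T.vanishing := finBasisOfFinrankEq ℂ T.vanishing h3
        rw [span_image_eq T.Λ₂ b₀]
        exact ((hc₂ b₀).isPrime_span _ fun i _ ↦ hnu _ (b₀ i).2).isRadical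
      · rw [T.le₃ 𝔭 h𝔭, Ideal.span_le]
        constructor
        · rintro ⟨N, hN3, -, -, hN⟩
          have hle : N ≤ T.vanishing := fun a ha ↦ T.res_eq_zero₂ h𝔭 (hN a ha)
          rw [← Submodule.eq_of_le_of_finrank_le hle (by omega)]
          rintro _ ⟨a, ha, rfl⟩
          exact hN a ha
        · exact fun hle ↦ ⟨_, h3, hm, hN, fun a ha ↦ hle ⟨a, ha, rfl⟩⟩
    rcases pointBlowup h T.Λ₂ T.φ₃ T.inj₃ (T.θ.comp T.ψ₃) (T.Λ₂_injective h) h3 T.eigenspace_le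
      T.stable hc₂ (hI₃ ▸ T.blowup₃) (fun a b y hb hy ↦ T.odd h hb (y := T.ψ₃ y) (by
        change T.ψ₃ (T.φ₃ (T.Λ₂ a)) = _ * T.ψ₃ (T.φ₃ (T.Λ₂ b))
        rw [hy, map_mul])) with
      ⟨N₁, hN₁, hN₁2, -, b, hb, hb', hy⟩ | ⟨b, hb0, hb1, hb2, y, z, hc, hy, hz, hz0, hy0⟩
    · refine T.exists_generator_of_chart h h3 hN₁ hN₁2 ?_ hb hb' hy
      have h6 := h.no_four N₁ hN₁2
      have h7 := hN N₁ hN₁ hN₁2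
      change formMult f N₁ < 4 at h6
      omega
    · exact T.exists_generator_of_exceptional h h3 b hb0 hb1 hb2 hc hy hz hz0 hy0
  · have hb3 : Function.Bijective T.φ₃ := T.bijective₃ fun N' hN' hN'3 hN'4 _ ↦ by
      rw [Submodule.eq_of_le_of_finrank_le hN' (by omega)] at hN'4
      exact hm hN'4
    obtain ⟨b, hb⟩ := h.exists_adapted_basis (N := T.vanishing) (by omega) hN h3
    refine T.exists_generator_of_closed ((hc₂ b).map_bijective _ hb3) (fun j ↦ (b j).2) fun i ↦ ?_
    by_cases hi : f i ∈ T.vanishing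
    · obtain ⟨k, hk⟩ := hb i hi
      rw [hk]
      exact IsMonomial.coord (c := T.φ₃ ∘ fun i ↦ T.Λ₂ (b i)) k
    · exact .of_isUnit (T.isUnit₃ hi)

/-- The residue field at a point fixed by the involution is generated by one element. -/
theorem exists_generator (T : LocalTower f B R₀ R₁ R₂ R₃ S O κ) (h : IsSymmetric f B) :
    ∃ τ : κ, ∀ z, z ∈ ℂ⟮τ⟯ := by
  rcases T.finrank_vanishing h with hv | h3
  · exact T.exists_generator_line h hv
  by_cases h5 : formMult f T.vanishing = 5
  · exact T.exists_generator_fivefold h h3 h5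
  have h4 : formMult f T.vanishing ≤ 4 := by
    have := h.no_six _ h3
    omega
  by_cases hN : ∃ N ≤ T.vanishing, finrank ℂ N = 2 ∧ formMult f N = 3
  · obtain ⟨N, hN, hN2, hN3⟩ := hN
    exact T.exists_generator_triple h h3 h4 hN hN2 hN3
  · push Not at hN
    exact T.exists_generator_ordinary h h3 h4 hN

end LocalTower
end LocalTower

/-! ### Rational function fields have genus zero -/

section Genus
open IntermediateField KaehlerDifferential IsDedekindDomain

variable {κ : Type} [Field κ] [Algebra ℂ κ]

/-- On a purely transcendental extension, the differential of the generator is a basis of the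
module of differentials, and a regular differential has a polynomial coefficient, because it is
regular at all finite places. -/
lemma exists_polynomial_of_regular {τ : κ} (hτ : Transcendental ℂ τ) (h : ∀ z, z ∈ ℂ⟮τ⟯) :
    (∀ g : κ, g • D ℂ κ τ = 0 → g = 0) ∧ ∀ ω ∈ regularDifferentials ℂ κ,
      ∃ p : Polynomial ℂ, ω = Polynomial.aeval τ p • D ℂ κ τ := by
  let : Algebra (Polynomial ℂ) κ := (Polynomial.aeval τ).toRingHom.toAlgebra
  have halg (p : Polynomial ℂ) : algebraMap (Polynomial ℂ) κ p = Polynomial.aeval τ p := rfl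
  have : IsScalarTower ℂ (Polynomial ℂ) κ := .of_algebraMap_eq' (Polynomial.aeval τ).comp_algebraMap.symm
  have hinj : Function.Injective (algebraMap (Polynomial ℂ) κ) :=
    transcendental_iff_injective.mp hτ
  have : FaithfulSMul (Polynomial ℂ) κ := (faithfulSMul_iff_algebraMap_injective _ _).mpr hinj
  have : IsFractionRing (Polynomial ℂ) κ := by
    refine IsFractionRing.of_field _ _ fun z ↦ ?_
    obtain ⟨r, s, hrs⟩ := (mem_adjoin_simple_iff ℂ z).mp (h z)
    exact ⟨r, s, hrs⟩
  have : Algebra.FormallyEtale (Polynomial ℂ) κ :=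
    Algebra.FormallyEtale.of_isLocalization (nonZeroDivisors (Polynomial ℂ))
  let e : Ω[κ⁄ℂ] ≃ₗ[κ] κ :=
    ((tensorKaehlerEquivOfFormallyEtale ℂ (Polynomial ℂ) κ).symm.trans
      (LinearEquiv.baseChange _ _ _ _ (polynomialEquiv ℂ))).trans
      (TensorProduct.AlgebraTensorModule.rid (Polynomial ℂ) κ κ)
  have heD (p : Polynomial ℂ) : e (D ℂ κ (algebraMap (Polynomial ℂ) κ p)) =
      algebraMap (Polynomial ℂ) κ (Polynomial.derivative p) := by
    simp [e, tensorKaehlerEquivOfFormallyEtale_symm_D_algebraMap, Algebra.smul_def]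
  have heτ : e (D ℂ κ τ) = 1 := by
    have := heD Polynomial.X
    rwa [Polynomial.derivative_X, map_one, halg, Polynomial.aeval_X] at this
  refine ⟨fun g hg ↦ ?_, fun ω hω ↦ ?_⟩
  · have := congrArg e hg
    rwa [map_smul, heτ, map_zero, smul_eq_mul, mul_one] at this
  · suffices hp : ∃ p : Polynomial ℂ, algebraMap (Polynomial ℂ) κ p = e ω by
      obtain ⟨p, hp⟩ := hp
      refine ⟨p, e.injective ?_⟩
      rw [map_smul, heτ, smul_eq_mul, mul_one, ← hp, halg]
    refine HeightOneSpectrum.mem_integers_of_valuation_le_one κ (e ω) fun v ↦ ?_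
    have hc (c : ℂ) : algebraMap ℂ κ c ∈ (v.valuation κ).valuationSubring := by
      rw [IsScalarTower.algebraMap_apply ℂ (Polynomial ℂ) κ]
      exact v.valuation_le_one _
    rw [regularDifferentials, Submodule.mem_iInf] at hω
    have h1 := (Submodule.mem_iInf _).mp (hω (v.valuation κ).valuationSubring) hc
    have h2 (p : Polynomial ℂ) : algebraMap _ κ p ∈ (v.valuation κ).valuationSubring :=
      v.valuation_le_one p
    have hD (b : κ) (hb : b ∈ (v.valuation κ).valuationSubring) :
        e (D ℂ κ b) ∈ (v.valuation κ).valuationSubring := by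
      obtain ⟨n, d, hdn⟩ := v.exists_primeCompl_mul_eq_of_integer b hb
      have hd : v.valuation κ (algebraMap _ κ d.1) = 1 := (v.valuation_eq_one_iff_notMem).mpr d.2
      have h3 : e (D ℂ κ (b * algebraMap (Polynomial ℂ) κ d.1)) =
          algebraMap (Polynomial ℂ) κ (Polynomial.derivative n) := by rw [hdn, heD]
      rw [Derivation.leibniz, map_add, map_smul, map_smul, heD, smul_eq_mul, smul_eq_mul] at h3
      have h4 : algebraMap (Polynomial ℂ) κ d.1 * e (D ℂ κ b) ∈
          (v.valuation κ).valuationSubring := by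
        rw [← eq_sub_iff_add_eq'] at h3
        rw [h3]
        exact sub_mem (h2 _) (mul_mem hb (h2 _))
      change v.valuation κ _ ≤ 1 at h4
      rwa [map_mul, hd, one_mul] at h4
    change e ω ∈ (v.valuation κ).valuationSubring
    clear hω
    induction h1 using Submodule.span_induction with
    | mem x hx =>
      obtain ⟨a, ha, b, hb, rfl⟩ := hx
      rw [map_smul]
      exact mul_mem ha (hD b hb)
    | zero => rw [map_zero]; exact zero_mem _
    | add x y _ _ hx hy => rw [map_add]; exact add_mem hx hy
    | smul c x _ hx =>
      rw [← algebraMap_smul κ c x, map_smul]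
      exact mul_mem (hc c) hx

/-- A rational function field has no regular differentials: a differential which is regular at all the
finite places is `p(τ) dτ` with a polynomial `p`, and at infinity it is `-τ² p(τ) d(τ⁻¹)`, which is not
regular unless `p = 0`. -/
theorem regularDifferentials_eq_bot (h : ∃ τ : κ, ∀ z, z ∈ ℂ⟮τ⟯) :
    regularDifferentials ℂ κ = ⊥ := by
  obtain ⟨τ, h⟩ := h
  rw [Submodule.eq_bot_iff]
  intro ω hω
  by_cases hτ : Transcendental ℂ τ
  · have hτ0 : τ ≠ 0 := by
      rintro rfl
      exact hτ (isAlgebraic_zero)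
    have hτ' : Transcendental ℂ τ⁻¹ := fun h1 ↦ hτ (by simpa using h1.inv)
    have h' (z : κ) : z ∈ ℂ⟮τ⁻¹⟯ := by
      have hle : ℂ⟮τ⟯ ≤ ℂ⟮τ⁻¹⟯ := by
        rw [adjoin_simple_le_iff]
        simpa using inv_mem (mem_adjoin_simple_self ℂ τ⁻¹)
      exact hle (h z)
    obtain ⟨hli, hp⟩ := exists_polynomial_of_regular hτ h
    obtain ⟨-, hq⟩ := exists_polynomial_of_regular hτ' h'
    obtain ⟨p, hp⟩ := hp ω hω
    obtain ⟨q, hq⟩ := hq ω hω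
    have hD : D ℂ κ τ⁻¹ = -(τ⁻¹ ^ 2) • D ℂ κ τ := by
      rw [Derivation.leibniz_inv]
    have h1 : Polynomial.aeval τ p + Polynomial.aeval τ⁻¹ q * τ⁻¹ ^ 2 = 0 := by
      apply hli
      rw [hD, smul_smul, hp] at hq
      rw [add_smul, hq, ← add_smul]
      convert zero_smul κ _ using 2
      ring
    -- clear denominators and compare degrees
    have h2 : Polynomial.aeval τ (p * Polynomial.X ^ (q.natDegree + 2) + q.reverse) = 0 := by
      have h3 : Polynomial.aeval τ q.reverse = Polynomial.aeval τ⁻¹ q * τ ^ q.natDegree := by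
        let := invertibleOfNonzero (inv_ne_zero hτ0)
        have h4 := Polynomial.eval₂_reverse_mul_pow (algebraMap ℂ κ) τ⁻¹ q
        rw [invOf_eq_inv, inv_inv] at h4
        rw [Polynomial.aeval_def, Polynomial.aeval_def, ← h4, mul_assoc, ← mul_pow,
          inv_mul_cancel₀ hτ0, one_pow, mul_one]
      rw [map_add, h3, map_mul, map_pow, Polynomial.aeval_X]
      have h4 : Polynomial.aeval τ p = -(Polynomial.aeval τ⁻¹ q * τ⁻¹ ^ 2) :=
        eq_neg_of_add_eq_zero_left h1
      rw [h4, pow_add]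
      field_simp
      ring
    have h3 := (transcendental_iff.mp hτ) _ h2
    have hp0 : p = 0 := by
      by_contra hp0
      have h4 : (p * Polynomial.X ^ (q.natDegree + 2)).natDegree = (q.reverse).natDegree := by
        rw [eq_neg_of_add_eq_zero_left h3, Polynomial.natDegree_neg]
      rw [Polynomial.natDegree_mul_X_pow _ hp0] at h4
      have := Polynomial.reverse_natDegree_le q
      omega
    rw [hp, hp0, map_zero, zero_smul]
  · -- an algebraic extension of the complex numbers is trivial
    have hτ' : τ ∈ (⊥ : IntermediateField ℂ κ) := by
      have : IsIntegral ℂ τ := (not_not.mp hτ).isIntegral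
      exact mem_bot.mpr (minpoly.mem_range_of_degree_eq_one ℂ τ
        (IsAlgClosed.degree_eq_one_of_irreducible ℂ (minpoly.irreducible this)))
    have hz (z : κ) : D ℂ κ z = 0 := by
      have h1 := h z
      rw [adjoin_simple_eq_bot_iff.mpr hτ', mem_bot] at h1
      obtain ⟨c, rfl⟩ := h1
      exact Derivation.map_algebraMap _ c
    have h1 : (⊤ : Submodule κ Ω[κ⁄ℂ]) = ⊥ := by
      rw [← span_range_derivation, Submodule.span_eq_bot]
      rintro _ ⟨z, rfl⟩
      exact hz z
    exact (Submodule.eq_bot_iff _).mp h1 ω trivial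

end Genus

/-! ### Points and generizations of integral schemes -/

section Points
open IsLocalRing
variable {X Y : Scheme.{0}}

lemma map_fromSpecStalk (f : X ⟶ Y) (x : X) (𝔭 : PrimeSpectrum (X.presheaf.stalk x)) :
    f (X.fromSpecStalk x 𝔭) =
      Y.fromSpecStalk (f x) (PrimeSpectrum.comap (f.stalkMap x).hom 𝔭) := by
  have h := congrArg (fun g : Spec (X.presheaf.stalk x) ⟶ Y ↦ g 𝔭)
    (Scheme.SpecMap_stalkMap_fromSpecStalk f (x := x))
  exact h.symm

lemma fromSpecStalk_specializes (x : X) (𝔭 : PrimeSpectrum (X.presheaf.stalk x)) :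
    X.fromSpecStalk x 𝔭 ⤳ x := by
  have h : X.fromSpecStalk x 𝔭 ∈ Set.range (X.fromSpecStalk x) := ⟨𝔭, rfl⟩
  rwa [Scheme.range_fromSpecStalk] at h

lemma fromSpecStalk_mem_basicOpen {x : X} {U : X.Opens} (hx : x ∈ U) (s : Γ(X, U))
    (𝔭 : PrimeSpectrum (X.presheaf.stalk x)) :
    X.fromSpecStalk x 𝔭 ∈ X.basicOpen s ↔ X.presheaf.germ U x hx s ∉ 𝔭.asIdeal := by
  have h1 : X.fromSpecStalk x 𝔭 ∈ X.basicOpen s ↔ 𝔭 ∈ X.fromSpecStalk x ⁻¹ᵁ X.basicOpen s := Iff.rfl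
  rw [h1, Scheme.preimage_basicOpen, Scheme.fromSpecStalk_app hx]
  simp only [CommRingCat.comp_apply]
  rw [Scheme.basicOpen_res, basicOpen_eq_of_affine']
  have h2 : (Scheme.ΓSpecIso (X.presheaf.stalk x)).hom
      ((Scheme.ΓSpecIso (X.presheaf.stalk x)).inv (X.presheaf.germ U x hx s)) =
      X.presheaf.germ U x hx s := by
    rw [← CommRingCat.comp_apply, Iso.inv_hom_id]
    rfl
  rw [h2]
  refine and_iff_right ?_
  exact (fromSpecStalk_specializes x 𝔭).mem_open U.2 hx

lemma fromSpecStalk_specializes_iff (x : X) (𝔭 𝔮 : PrimeSpectrum (X.presheaf.stalk x)) :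
    X.fromSpecStalk x 𝔮 ⤳ X.fromSpecStalk x 𝔭 ↔ 𝔮 ≤ 𝔭 := by
  exact (X.fromSpecStalk x).isEmbedding.specializes_iff.trans
    (PrimeSpectrum.le_iff_specializes 𝔮 𝔭).symm

lemma stalkSpecializes_injective [IsIntegral X] {x y : X} (h : y ⤳ x) :
    Function.Injective (X.presheaf.stalkSpecializes h).hom := by
  have h1 : Function.Injective (algebraMap (X.presheaf.stalk x) X.functionField) :=
    IsFractionRing.injective _ _
  have h2 : algebraMap (X.presheaf.stalk x) X.functionField =
      (X.presheaf.stalkSpecializes ((genericPoint_spec X).specializes trivial)).hom.comp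
        (X.presheaf.stalkSpecializes h).hom := by
    rw [← CommRingCat.hom_comp, TopCat.Presheaf.stalkSpecializes_comp]
    rfl
  rw [h2] at h1
  exact Function.Injective.of_comp h1

lemma isField_stalk_genericPoint [IsIntegral X] {x : X} (hx : x = genericPoint X) :
    IsField (X.presheaf.stalk x) := by
  subst hx
  exact Field.toIsField X.functionField

lemma eq_genericPoint_of_isField [IsIntegral X] {x : X} (hx : IsField (X.presheaf.stalk x)) :
    x = genericPoint X := by
  have h1 : genericPoint X ∈ Set.range (X.fromSpecStalk x) := by
    rw [Scheme.range_fromSpecStalk]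
    exact (genericPoint_spec X).specializes trivial
  obtain ⟨𝔭, h𝔭⟩ := h1
  let := hx.toField
  have h1 : 𝔭 = closedPoint (X.presheaf.stalk x) :=
    Subsingleton.elim (α := PrimeSpectrum (X.presheaf.stalk x)) _ _
  rw [← h𝔭, h1]
  exact Scheme.fromSpecStalk_closedPoint.symm

/-- A dominant morphism of integral schemes is injective on local rings. -/
lemma stalkMap_injective_of_genericPoint [IsIntegral X] [IsIntegral Y] (f : X ⟶ Y)
    (hf : f (genericPoint X) = genericPoint Y) (x : X) :
    Function.Injective (f.stalkMap x).hom := by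
  have hs : genericPoint X ⤳ x := (genericPoint_spec X).specializes trivial
  have h1 := Scheme.Hom.stalkSpecializes_stalkMap f (genericPoint X) x hs
  have h2 : Function.Injective
      (Y.presheaf.stalkSpecializes (hs.map f.continuous) ≫ f.stalkMap (genericPoint X)).hom := by
    rw [CommRingCat.hom_comp]
    let := (isField_stalk_genericPoint hf).toField
    exact (f.stalkMap (genericPoint X)).hom.injective.comp (stalkSpecializes_injective _)
  rw [h1, CommRingCat.hom_comp] at h2
  exact Function.Injective.of_comp h2

lemma fromSpecStalk_genericPoint [IsIntegral X] (x : X) :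
    X.fromSpecStalk x (genericPoint (Spec (X.presheaf.stalk x))) = genericPoint X := by
  have h1 : genericPoint X ∈ Set.range (X.fromSpecStalk x) := by
    rw [Scheme.range_fromSpecStalk]
    exact (genericPoint_spec X).specializes trivial
  obtain ⟨𝔭, h𝔭⟩ := h1
  have h2 := (genericPoint_specializes (α := Spec (X.presheaf.stalk x)) 𝔭).map (X.fromSpecStalk x).continuous
  rw [h𝔭] at h2
  exact (h2.antisymm ((genericPoint_spec X).specializes trivial)).eq

/-- The local ring at a generization is a localization. -/
lemma isLocalization_stalkSpecializes [IsIntegral X] (x : X)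
    (𝔭 : PrimeSpectrum (X.presheaf.stalk x)) :
    letI := (X.presheaf.stalkSpecializes (fromSpecStalk_specializes x 𝔭)).hom.toAlgebra
    IsLocalization.AtPrime (X.presheaf.stalk (X.fromSpecStalk x 𝔭)) 𝔭.asIdeal := by
  have h := fromSpecStalk_specializes x 𝔭
  let g := X.fromSpecStalk x
  have h1 : X.presheaf.stalkSpecializes h ≫ g.stalkMap 𝔭 =
      (Scheme.ΓSpecIso (X.presheaf.stalk x)).inv ≫
        (Spec (X.presheaf.stalk x)).presheaf.germ ⊤ 𝔭 trivial := by
    apply Spec.map_injective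
    rw [← cancel_mono (X.fromSpecStalk x), Spec.map_comp, Category.assoc,
      Scheme.SpecMap_stalkSpecializes_fromSpecStalk]
    exact (Scheme.SpecMap_stalkMap_fromSpecStalk g (x := 𝔭)).trans
      (congrArg (· ≫ g) (Spec.fromSpecStalk_eq (X.presheaf.stalk x) 𝔭))
  have hbij : Function.Bijective (g.stalkMap 𝔭).hom :=
    ⟨stalkMap_injective_of_genericPoint g (fromSpecStalk_genericPoint x) 𝔭,
      Scheme.Hom.stalkMap_surjective g 𝔭⟩
  let := (X.presheaf.stalkSpecializes h).hom.toAlgebra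
  let : Algebra (X.presheaf.stalk x) ((Spec (X.presheaf.stalk x)).presheaf.stalk 𝔭) :=
    inferInstanceAs (Algebra (X.presheaf.stalk x)
      ((Spec.structureSheaf (X.presheaf.stalk x)).presheaf.stalk 𝔭))
  have hloc : IsLocalization.AtPrime ((Spec (X.presheaf.stalk x)).presheaf.stalk 𝔭) 𝔭.asIdeal :=
    inferInstanceAs (IsLocalization.AtPrime
      ((Spec.structureSheaf (X.presheaf.stalk x)).presheaf.stalk 𝔭) 𝔭.asIdeal)
  let e : X.presheaf.stalk (X.fromSpecStalk x 𝔭) ≃ₐ[X.presheaf.stalk x]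
      (Spec (X.presheaf.stalk x)).presheaf.stalk 𝔭 :=
    AlgEquiv.ofBijective ⟨(g.stalkMap 𝔭).hom, fun r ↦ congrArg (fun φ ↦ φ.hom r) h1⟩ hbij
  exact IsLocalization.isLocalization_of_algEquiv 𝔭.asIdeal.primeCompl e.symm

lemma exists_fraction_of_genericPoint [IsIntegral X] {x y : X} (hy : y = genericPoint X)
    (h : y ⤳ x) (z : X.presheaf.stalk y) : ∃ α γ : X.presheaf.stalk x, γ ≠ 0 ∧
      z * (X.presheaf.stalkSpecializes h).hom γ = (X.presheaf.stalkSpecializes h).hom α := by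
  subst hy
  obtain ⟨⟨α, γ⟩, hz⟩ := IsLocalization.surj (nonZeroDivisors (X.presheaf.stalk x)) (S := X.functionField) z
  exact ⟨α, γ, nonZeroDivisors.coe_ne_zero γ, hz⟩

lemma IsBlowup.stalkIdeal_genericPoint [IsIntegral X] {π : X ⟶ Y} {I : Y.IdealSheafData}
    (h : IsBlowup π I) : stalkIdeal I (π (genericPoint X)) = ⊤ := by
  obtain ⟨a, ha, h1⟩ := h.isInvertibleIdeal.exists_stalk (genericPoint X)
  rw [stalkIdeal_comap] at h1
  by_contra hne
  have h2 : (stalkIdeal I (π (genericPoint X))).map (π.stalkMap (genericPoint X)).hom ≤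
      maximalIdeal _ := by
    exact (Ideal.map_mono (le_maximalIdeal hne)).trans
      (((local_hom_TFAE (π.stalkMap (genericPoint X)).hom).out 0 2 rfl rfl).mp inferInstance)
  rw [h1, Ideal.span_singleton_le_iff_mem, mem_maximalIdeal] at h2
  obtain ⟨b, hb⟩ := (isField_stalk_genericPoint rfl).mul_inv_cancel ha
  exact h2 (IsUnit.of_mul_eq_one b hb)

/-- A blow-up of an integral scheme is dominant. -/
lemma IsBlowup.map_genericPoint [IsIntegral X] [IsIntegral Y] {π : X ⟶ Y} {I : Y.IdealSheafData}
    (h : IsBlowup π I) : π (genericPoint X) = genericPoint Y := by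
  have h1 := h.bijective_stalkMap _ h.stalkIdeal_genericPoint
  refine eq_genericPoint_of_isField ?_
  exact (MulEquiv.isField (isField_stalk_genericPoint rfl)
    (RingEquiv.ofBijective _ h1).toMulEquiv)

/-- A blow-up of an integral scheme is birational. -/
lemma IsBlowup.eq_genericPoint [IsIntegral X] [IsIntegral Y] {π : X ⟶ Y} {I : Y.IdealSheafData}
    (h : IsBlowup π I) {x : X} (hx : π x = genericPoint Y) : x = genericPoint X := by
  have h1 := h.stalkIdeal_genericPoint
  rw [h.map_genericPoint, ← hx] at h1
  refine eq_genericPoint_of_isField ?_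
  exact (MulEquiv.isField (isField_stalk_genericPoint hx)
    (RingEquiv.ofBijective _ (h.bijective_stalkMap _ h1)).symm.toMulEquiv)

/-- The closure of a locally closed subset of a Noetherian space consists of specializations. -/
lemma exists_specializes_of_mem_closure {T : Type} [TopologicalSpace T] [NoetherianSpace T]
    [QuasiSober T] {F Z : Set T} (hF : IsClosed F) (hZ : IsClosed Z) {x : T}
    (hx : x ∈ closure (F \ Z)) : ∃ y ∈ F \ Z, y ⤳ x := by
  obtain ⟨s, hs, hFs⟩ := NoetherianSpace.exists_finset_irreducible (⟨F, hF⟩ : Closeds T)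
  have hF' : F = ⋃ k ∈ s, (k : Set T) := by
    have := congrArg (fun k : Closeds T ↦ (k : Set T)) hFs
    simpa using this
  have h1 : F \ Z = ⋃ k ∈ s, ((k : Set T) \ Z) := by
    rw [hF']
    ext y
    simp only [Set.mem_sdiff, Set.mem_iUnion]
    tauto
  rw [h1, Finset.closure_biUnion] at hx
  obtain ⟨k, hk, hx⟩ := Set.mem_iUnion₂.mp hx
  obtain ⟨y, hy⟩ := QuasiSober.sober (hs ⟨k, hk⟩) k.isClosed
  have hxk : x ∈ (k : Set T) := closure_minimal Set.sdiff_subset k.isClosed hx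
  refine ⟨y, ⟨?_, fun hyZ ↦ ?_⟩, hy.specializes hxk⟩
  · rw [hF']
    exact Set.mem_iUnion₂.mpr ⟨k, hk, hy.mem⟩
  · have h2 : (k : Set T) ⊆ Z := hy.def ▸ closure_minimal (by simpa using hyZ) hZ
    rw [Set.sdiff_eq_empty.mpr h2, closure_empty] at hx
    exact hx

end Points

/-! ### The constants in local rings -/

section Constants
variable {X Y : Scheme.{0}}

/-- The constants in the local ring of a scheme over `ℂ`. -/
def stalkConstants (s : X ⟶ SpecC) (x : X) : ℂ →+* X.presheaf.stalk x :=
  (X.presheaf.germ ⊤ x trivial).hom.comp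
    (s.appTop.hom.comp (Scheme.ΓSpecIso (CommRingCat.of ℂ)).inv.hom)

lemma fromSpecStalk_comp (s : X ⟶ SpecC) (x : X) :
    X.fromSpecStalk x ≫ s = Spec.map (CommRingCat.ofHom (stalkConstants s x)) := by
  have h1 : s = X.toSpecΓ ≫ Spec.map s.appTop ≫
      Spec.map (Scheme.ΓSpecIso (CommRingCat.of ℂ)).inv := by
    have h2 := Scheme.toSpecΓ_naturality s
    rw [← Category.assoc, ← h2, Category.assoc, ← SpecMap_ΓSpecIso_hom, ← Spec.map_comp]
    simp
  conv_lhs => rw [h1]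
  rw [← Category.assoc, Scheme.fromSpecStalk_toSpecΓ, ← Spec.map_comp, ← Spec.map_comp]
  rfl

lemma stalkConstants_unique (s : X ⟶ SpecC) (x : X) (c : ℂ →+* X.presheaf.stalk x)
    (h : X.fromSpecStalk x ≫ s = Spec.map (CommRingCat.ofHom c)) : stalkConstants s x = c := by
  rw [fromSpecStalk_comp] at h
  exact congrArg CommRingCat.Hom.hom (Spec.map_injective h)

lemma stalkConstants_comp (f : X ⟶ Y) (s : Y ⟶ SpecC) (x : X) :
    stalkConstants (f ≫ s) x = (f.stalkMap x).hom.comp (stalkConstants s (f x)) := by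
  apply stalkConstants_unique
  rw [← Category.assoc, ← Scheme.SpecMap_stalkMap_fromSpecStalk, Category.assoc,
    fromSpecStalk_comp, ← Spec.map_comp]
  rfl

lemma stalkSpecializes_stalkConstants (s : X ⟶ SpecC) {x y : X} (h : y ⤳ x) (c : ℂ) :
    (X.presheaf.stalkSpecializes h).hom (stalkConstants s x c) = stalkConstants s y c := by
  exact congrArg (fun φ ↦ φ.hom (s.appTop.hom ((Scheme.ΓSpecIso (CommRingCat.of ℂ)).inv.hom c)))
    (TopCat.Presheaf.germ_stalkSpecializes X.presheaf (U := ⊤) (y := x) trivial h)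

end Constants

/-! ### The local rings of projective space -/

section ProjStalk

/-- A point of `ℙ³` has a homogeneous prime ideal. -/
abbrev pointIdeal (x : P3) : Ideal (MvPolynomial (Fin 4) ℂ) := x.asHomogeneousIdeal.toIdeal

instance (x : P3) : (pointIdeal x).IsPrime := x.isPrime

/-- The polynomial ring maps to its localization at the ideal of a point. -/
abbrev polyVal (x : P3) : MvPolynomial (Fin 4) ℂ →+* Localization.AtPrime (pointIdeal x) :=
  algebraMap _ _

/-- The inclusion of the local ring of `ℙ³` in the localization of the polynomial ring. -/
def stalkVal (x : P3) : P3.presheaf.stalk x →+* Localization.AtPrime (pointIdeal x) :=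
  (algebraMap (HomogeneousLocalization.AtPrime grading (pointIdeal x)) _).comp
    (Proj.stalkIso grading x).hom.hom

lemma stalkIso_bijective (x : P3) :
    Function.Bijective (Proj.stalkIso grading x).hom.hom :=
  ConcreteCategory.bijective_of_isIso (Proj.stalkIso grading x).hom

lemma stalkVal_injective (x : P3) : Function.Injective (stalkVal x) :=
  (HomogeneousLocalization.val_injective _).comp (stalkIso_bijective x).injective

lemma isUnit_stalkVal (x : P3) (z : P3.presheaf.stalk x) :
    IsUnit (stalkVal x z) ↔ IsUnit z := by
  refine (HomogeneousLocalization.isUnit_iff_isUnit_val _ _ _).trans ?_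
  exact isUnit_map_iff ((Proj.stalkIso grading x).commRingCatIsoToRingEquiv) z

lemma exists_stalkVal_eq (x : P3) (z : P3.presheaf.stalk x) : ∃ (n : ℕ) (p q : MvPolynomial (Fin 4) ℂ),
    p ∈ grading n ∧ q ∈ grading n ∧ q ∉ pointIdeal x ∧
      stalkVal x z * polyVal x q = polyVal x p := by
  obtain ⟨⟨n, p, q, hq⟩, h⟩ := HomogeneousLocalization.mk_surjective
    ((Proj.stalkIso grading x).hom.hom z)
  refine ⟨n, p, q, p.2, q.2, hq, ?_⟩
  have h1 : stalkVal x z = Localization.mk (p : MvPolynomial (Fin 4) ℂ) ⟨q, hq⟩ :=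
    (congrArg HomogeneousLocalization.val h).symm
  rw [h1, Localization.mk_eq_mk']
  exact IsLocalization.mk'_spec _ _ _

lemma isUnit_algebraMap_iff (x : P3) (q : MvPolynomial (Fin 4) ℂ) :
    IsUnit (polyVal x q) ↔ q ∉ pointIdeal x :=
  IsLocalization.AtPrime.isUnit_to_map_iff _ _ _

lemma stalkVal_germ (x : P3) (f : MvPolynomial (Fin 4) ℂ) (hf : x ∈ Proj.basicOpen grading f)
    (y : HomogeneousLocalization.Away grading f) :
    stalkVal x (P3.presheaf.germ _ x hf (Proj.awayToSection grading f y)) =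
      IsLocalization.map (M := Submonoid.powers f) (T := (pointIdeal x).primeCompl) _
        (RingHom.id _) (Submonoid.powers_le.mpr hf) y.val := by
  refine Eq.trans ?_ (ProjectiveSpectrum.Proj.awayToSection_apply grading f y ⟨x, hf⟩)
  exact congrArg HomogeneousLocalization.val
    (Proj.stalkIso'_germ grading _ x hf _)

lemma stalkVal_germ_mk (x : P3) {d : ℕ} (f : MvPolynomial (Fin 4) ℂ) (hfd : f ∈ grading d)
    (hf : x ∈ Proj.basicOpen grading f) (n : ℕ) (p : MvPolynomial (Fin 4) ℂ)
    (hp : p ∈ grading (n • d)) :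
    stalkVal x (P3.presheaf.germ _ x hf (Proj.awayToSection grading f
      (HomogeneousLocalization.Away.mk grading hfd n p hp))) * polyVal x f ^ n =
        polyVal x p := by
  rw [stalkVal_germ, HomogeneousLocalization.Away.val_mk, Localization.mk_eq_mk',
    IsLocalization.map_mk', ← map_pow]
  exact IsLocalization.mk'_spec _ _ _

lemma exists_mem_basicOpen (x : P3) : ∃ j : Fin 4, x ∈ Proj.basicOpen grading (X j) := by
  have h := Proj.iSup_basicOpen_eq_top' grading (fun j : Fin 4 ↦ (X j : MvPolynomial (Fin 4) ℂ))
    (fun j ↦ ⟨1, isHomogeneous_X ℂ j⟩) (by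
      refine eq_top_iff.mpr fun p _ ↦ ?_
      induction p using MvPolynomial.induction_on with
      | C a => exact Subalgebra.algebraMap_mem _ (⟨C a, isHomogeneous_C _ _⟩ : grading 0)
      | add p q hp hq => exact add_mem (hp trivial) (hq trivial)
      | mul_X p j hp => exact mul_mem (hp trivial) (Algebra.subset_adjoin ⟨j, rfl⟩))
  have h1 : x ∈ ⨆ j : Fin 4, Proj.basicOpen grading (X j) := h ▸ trivial
  simpa using h1

lemma stalkVal_stalkConstants (x : P3) (c : ℂ) :
    stalkVal x (stalkConstants P3.toSpecC x c) = polyVal x (C c) := by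
  obtain ⟨j, hj⟩ := exists_mem_basicOpen x
  let U := Proj.basicOpen grading (X j : MvPolynomial (Fin 4) ℂ)
  have hX : (X j : MvPolynomial (Fin 4) ℂ) ∈ grading 1 := isHomogeneous_X ℂ j
  have h1 : P3.fromSpecStalk x ≫ P3.toSpecC = Spec.map (CommRingCat.ofHom
      ((P3.presheaf.germ U x hj).hom.comp ((Proj.awayToSection grading (X j)).hom.comp
        ((HomogeneousLocalization.fromZeroRingHom grading _).comp
          (algebraMap ℂ (grading 0)))))) := by
    have h2 : U.ι = U.toSpecΓ ≫ Spec.map (Proj.awayToSection grading (X j)) ≫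
        Proj.awayι grading (X j) hX one_pos := by
      rw [← Proj.basicOpenIsoSpec_inv_ι, ← Category.assoc, ← Category.assoc, ← Proj.basicOpenToSpec,
        ← Proj.basicOpenIsoSpec_hom grading _ hX one_pos, Iso.hom_inv_id, Category.id_comp]
    rw [P3.toSpecC, ← Scheme.Opens.fromSpecStalkOfMem_ι U x hj, h2]
    simp only [Category.assoc]
    rw [Proj.awayι_toSpecZero_assoc, ← Category.assoc, Scheme.Opens.fromSpecStalkOfMem_toSpecΓ]
    simp only [← Spec.map_comp]
    rfl
  rw [stalkConstants_unique _ _ _ h1]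
  have h2 := stalkVal_germ_mk x (X j) hX hj 0 (C c) (isHomogeneous_C _ _)
  rw [pow_zero, mul_one] at h2
  exact h2

end ProjStalk

/-! ### Linear forms as local functions on projective space -/

section FormFun

/-- The local rings of `ℙ³` are algebras over the constants. -/
abbrev projStalkAlgebra (x : P3) : Algebra ℂ (P3.presheaf.stalk x) :=
  (stalkConstants P3.toSpecC x).toAlgebra

attribute [local instance] projStalkAlgebra

lemma polyVal_injective (x : P3) : Function.Injective (polyVal x) :=
  IsLocalization.injective _ (Ideal.primeCompl_le_nonZeroDivisors (pointIdeal x))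

instance isIntegral_P3 : IsIntegral P3 := by
  have : ∀ x : P3, _root_.IsReduced (P3.presheaf.stalk x) := fun x ↦
    isReduced_of_injective (stalkVal x) (stalkVal_injective x)
  have : IsReduced P3 := isReduced_of_isReduced_stalk P3
  have : IrreducibleSpace P3 := by
    let η : P3 := ⟨⊥, Ideal.isPrime_bot, fun h ↦ by
      have h1 := h (HomogeneousIdeal.mem_irrelevant_of_mem grading one_pos
        (isHomogeneous_X ℂ (0 : Fin 4)))
      exact X_ne_zero (R := ℂ) (0 : Fin 4) h1⟩
    have h : closure {η} = Set.univ := by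
      refine Set.eq_univ_of_forall fun x ↦ ?_
      exact (ProjectiveSpectrum.le_iff_mem_closure grading η x).mp (bot_le (a := x.asHomogeneousIdeal))
    have : PreirreducibleSpace P3 := ⟨h ▸ isIrreducible_singleton.closure.isPreirreducible⟩
    exact ⟨⟨η⟩⟩
  exact isIntegral_of_irreducibleSpace_of_isReduced P3

variable (x : P3) (h : Fin 4 → ℂ) (hx : x ∈ Proj.basicOpen grading (linearForm h))

lemma linearForm_add (a b : Fin 4 → ℂ) : linearForm (a + b) = linearForm a + linearForm b := by
  simp [linearForm, add_mul, Finset.sum_add_distrib]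

lemma linearForm_smul (c : ℂ) (a : Fin 4 → ℂ) : linearForm (c • a) = C c * linearForm a := by
  simp [linearForm, mul_assoc, Finset.mul_sum]

lemma eval_linearForm (v a : Fin 4 → ℂ) : eval v (linearForm a) = a ⬝ᵥ v := by
  simp [linearForm, dotProduct]

lemma linearForm_mem' (a : Fin 4 → ℂ) : linearForm a ∈ grading (1 • 1) := linearForm_mem a

/-- The regular function `a / h` on the open set `h ≠ 0`. -/
def formSection (h a : Fin 4 → ℂ) : Γ(P3, Proj.basicOpen grading (linearForm h)) :=
  Proj.awayToSection grading (linearForm h)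
    (HomogeneousLocalization.Away.mk grading (linearForm_mem h) 1 (linearForm a) (linearForm_mem' a))

lemma stalkVal_formSection (a : Fin 4 → ℂ) :
    stalkVal x (P3.presheaf.germ _ x hx (formSection h a)) * polyVal x (linearForm h) =
      polyVal x (linearForm a) := by
  have := stalkVal_germ_mk x (linearForm h) (linearForm_mem h) hx 1 (linearForm a) (linearForm_mem' a)
  rwa [pow_one] at this

include hx in
lemma isUnit_polyVal : IsUnit (polyVal x (linearForm h)) :=
  (isUnit_algebraMap_iff x _).mpr hx

lemma algebraMap_stalk (c : ℂ) : stalkVal x (algebraMap ℂ (P3.presheaf.stalk x) c) =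
    polyVal x (C c) := stalkVal_stalkConstants x c

/-- The germ of the function `a / h`. -/
def formFun : (Fin 4 → ℂ) →ₗ[ℂ] P3.presheaf.stalk x where
  toFun a := P3.presheaf.germ _ x hx (formSection h a)
  map_add' a b := by
    apply stalkVal_injective
    apply (isUnit_polyVal x h hx).mul_right_cancel
    rw [map_add, add_mul]
    simp only [stalkVal_formSection, linearForm_add, map_add]
  map_smul' c a := by
    apply stalkVal_injective
    apply (isUnit_polyVal x h hx).mul_right_cancel
    have h1 (z : P3.presheaf.stalk x) : c • z = algebraMap ℂ (P3.presheaf.stalk x) c * z :=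
      Algebra.smul_def _ _
    rw [RingHom.id_apply, h1, map_mul, mul_assoc, algebraMap_stalk]
    simp only [stalkVal_formSection, linearForm_smul, map_mul]

lemma stalkVal_formFun (a : Fin 4 → ℂ) :
    stalkVal x (formFun x h hx a) * polyVal x (linearForm h) = polyVal x (linearForm a) :=
  stalkVal_formSection x h hx a

lemma eq_formFun {z : P3.presheaf.stalk x} {a : Fin 4 → ℂ}
    (hz : stalkVal x z * polyVal x (linearForm h) = polyVal x (linearForm a)) :
    z = formFun x h hx a := by
  apply stalkVal_injective
  apply (isUnit_polyVal x h hx).mul_right_cancel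
  rw [hz, stalkVal_formFun]

lemma formFun_self : formFun x h hx h = 1 := by
  refine (eq_formFun x h hx ?_).symm
  rw [map_one, one_mul]

lemma isUnit_formFun (a : Fin 4 → ℂ) :
    IsUnit (formFun x h hx a) ↔ linearForm a ∉ pointIdeal x := by
  rw [← isUnit_stalkVal, ← isUnit_algebraMap_iff x]
  have h1 := stalkVal_formFun x h hx a
  have h2 := isUnit_polyVal x h hx
  rw [← h1]
  exact ⟨fun h3 ↦ h3.mul h2, fun h3 ↦ isUnit_of_mul_isUnit_left h3⟩

lemma fromSpecStalk_mem_linearLocus (𝔭 : PrimeSpectrum (P3.presheaf.stalk x))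
    (W : Submodule ℂ (Fin 4 → ℂ)) :
    P3.fromSpecStalk x 𝔭 ∈ linearLocus W ↔
      ∀ a, (∀ v ∈ W, a ⬝ᵥ v = 0) → formFun x h hx a ∈ 𝔭.asIdeal := by
  set q := P3.fromSpecStalk x 𝔭
  have hq : q ∈ Proj.basicOpen grading (linearForm h) :=
    (fromSpecStalk_specializes x 𝔭).mem_open (Proj.basicOpen grading (linearForm h)).2 hx
  have key (a : Fin 4 → ℂ) : linearForm a ∈ pointIdeal q ↔ formFun x h hx a ∈ 𝔭.asIdeal := by
    have h1 := fromSpecStalk_mem_basicOpen hx (formSection h a) 𝔭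
    have h2 := (P3.mem_basicOpen (formSection h a) q hq).trans (isUnit_formFun q h hq a)
    exact not_iff_not.mp (h2.symm.trans h1)
  have h1 : q ∈ linearLocus W ↔ {g | ∃ a : Fin 4 → ℂ, (∀ v ∈ W, a ⬝ᵥ v = 0) ∧
      g = linearForm a} ⊆ (pointIdeal q : Set (MvPolynomial (Fin 4) ℂ)) := Iff.rfl
  rw [h1]
  constructor
  · exact fun h2 a ha ↦ (key a).mp (h2 ⟨a, ha, rfl⟩)
  · rintro h2 _ ⟨a, ha, rfl⟩
    exact (key a).mpr (h2 a ha)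

/-- The functions given by three forms which are independent of the denominator are local
coordinates. -/
lemma isCoord_formFun (a : Fin 3 → Fin 4 → ℂ)
    (hli : LinearIndependent ℂ (Fin.cons h a : Fin 4 → Fin 4 → ℂ)) :
    IsCoord fun i ↦ formFun x h hx (a i) := by
  let c : Fin 3 → P3.presheaf.stalk x := fun i ↦ formFun x h hx (a i)
  have hu := isUnit_polyVal x h hx
  have hC (t : ℂ) : stalkVal x (aeval c (C t)) = polyVal x (C t) := by
    rw [algHom_C]
    exact algebraMap_stalk x t
  constructor
  · refine (injective_iff_map_eq_zero _).mpr fun P hP ↦ ?_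
    -- a polynomial in the functions `aᵢ / h` becomes a form after multiplication by a power of `h`
    have hQ (P : MvPolynomial (Fin 3) ℂ) : ∃ (n : ℕ) (Q : MvPolynomial (Fin 4) ℂ),
        polyVal x Q = stalkVal x (aeval c P) * polyVal x (linearForm h) ^ n ∧
        ∀ v, h ⬝ᵥ v = 1 → eval v Q = eval (fun i ↦ a i ⬝ᵥ v) P := by
      induction P using MvPolynomial.induction_on with
      | C t => exact ⟨0, C t, by rw [hC, pow_zero, mul_one], fun v _ ↦ by simp⟩
      | add P₁ P₂ h₁ h₂ =>
        obtain ⟨n₁, Q₁, h₁, e₁⟩ := h₁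
        obtain ⟨n₂, Q₂, h₂, e₂⟩ := h₂
        refine ⟨n₁ + n₂, Q₁ * linearForm h ^ n₂ + Q₂ * linearForm h ^ n₁, ?_, fun v hv ↦ ?_⟩
        · simp only [map_add, map_mul, map_pow, h₁, h₂]
          ring
        · simp only [map_add, map_mul, map_pow, e₁ v hv, e₂ v hv, eval_linearForm, hv, one_pow,
            mul_one]
      | mul_X P i h₁ =>
        obtain ⟨n, Q, h₁, e₁⟩ := h₁
        refine ⟨n + 1, Q * linearForm (a i), ?_, fun v hv ↦ ?_⟩
        · rw [map_mul, h₁, map_mul, map_mul, aeval_X, pow_succ, ← stalkVal_formFun x h hx (a i)]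
          ring
        · simp only [map_mul, e₁ v hv, eval_linearForm, eval_X]
    obtain ⟨n, Q, hQ, e⟩ := hQ P
    have hP' : aeval c P = 0 := hP
    rw [hP', map_zero, zero_mul] at hQ
    have hQ0 : Q = 0 := polyVal_injective x (hQ.trans (map_zero _).symm)
    apply MvPolynomial.funext
    intro t
    let M : Matrix (Fin 4) (Fin 4) ℂ := Matrix.of (Fin.cons h a : Fin 4 → Fin 4 → ℂ)
    have hM : IsUnit M := Matrix.linearIndependent_rows_iff_isUnit.mp hli
    obtain ⟨v, hv⟩ := Matrix.mulVec_surjective_iff_isUnit.mpr hM (Fin.cons 1 t : Fin 4 → ℂ)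
    have h0 : h ⬝ᵥ v = 1 := congrFun hv 0
    have h1 (i : Fin 3) : a i ⬝ᵥ v = t i := congrFun hv i.succ
    have h2 := e v h0
    rw [hQ0, map_zero] at h2
    simp only [h1] at h2
    rw [← h2, map_zero]
  · have hspan : Submodule.span ℂ (Set.range (Fin.cons h a : Fin 4 → Fin 4 → ℂ)) = ⊤ :=
      hli.span_eq_top_of_card_eq_finrank (by simp)
    have hX (j : Fin 4) : ∃ P : MvPolynomial (Fin 3) ℂ,
        stalkVal x (aeval c P) * polyVal x (linearForm h) = polyVal x (X j) := by
      have h1 : (Pi.single j 1 : Fin 4 → ℂ) ∈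
        Submodule.span ℂ (Set.range (Fin.cons h a : Fin 4 → Fin 4 → ℂ)) := hspan ▸ trivial
      obtain ⟨α, hα⟩ := (Submodule.mem_span_range_iff_exists_fun ℂ).mp h1
      rw [Fin.sum_univ_succ] at hα
      simp only [Fin.cons_zero, Fin.cons_succ] at hα
      refine ⟨C (α 0) + ∑ i : Fin 3, C (α i.succ) * X i, ?_⟩
      have h2 (t : ℂ) (z : P3.presheaf.stalk x) :
          algebraMap ℂ (P3.presheaf.stalk x) t * z = t • z := (Algebra.smul_def _ _).symm
      have h3 : aeval c (C (α 0) + ∑ i : Fin 3, C (α i.succ) * X i) =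
          formFun x h hx (Pi.single j 1) := by
        rw [← hα]
        simp only [map_add, map_sum, map_mul, map_smul, aeval_X, algHom_C, formFun_self, h2]
        rw [← h2 (α 0), mul_one]
      rw [h3, stalkVal_formFun, linearForm_single]
    choose P hP using hX
    -- a form of degree `n` is `h ^ n` times a polynomial in the functions `aᵢ / h`
    have key {n : ℕ} {p : MvPolynomial (Fin 4) ℂ} (hp : p ∈ grading n) :
        stalkVal x (aeval c (aeval P p)) * polyVal x (linearForm h) ^ n = polyVal x p := by
      let g : ℂ →+* Localization.AtPrime (pointIdeal x) := (polyVal x).comp C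
      have h1 : polyVal x = eval₂Hom g (fun j ↦ polyVal x (X j)) := by
        apply MvPolynomial.ringHom_ext
        · intro r; simp [g]
        · intro j; simp
      have h2 : (stalkVal x).comp ((aeval c).toRingHom.comp (aeval P).toRingHom) =
          eval₂Hom g (fun j ↦ stalkVal x (aeval c (P j))) := by
        apply MvPolynomial.ringHom_ext
        · intro r
          rw [eval₂Hom_C]
          change stalkVal x (aeval c (aeval P (C r))) = _
          rw [algHom_C, algebraMap_eq, hC]
          rfl
        · intro j
          rw [eval₂Hom_X']
          change stalkVal x (aeval c (aeval P (X j))) = _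
          rw [aeval_X]
      have h3 : stalkVal x (aeval c (aeval P p)) =
          eval₂Hom g (fun j ↦ stalkVal x (aeval c (P j))) p := congrArg (fun φ ↦ φ p) h2
      have h4 := congrArg (fun φ ↦ φ p) h1
      simp only [coe_eval₂Hom, eval₂_eq'] at h3 h4
      rw [h3, h4, Finset.sum_mul]
      refine Finset.sum_congr rfl fun d hd ↦ ?_
      have h5 : ∑ i, d i = n := by
        have := hp (mem_support_iff.mp hd)
        rw [← this, Finsupp.weight_apply, Finsupp.sum_fintype]
        · simp
        · simp
      rw [← h5, ← Finset.prod_pow_eq_pow_sum, mul_assoc, ← Finset.prod_mul_distrib]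
      simp only [← mul_pow, hP]
    intro z
    obtain ⟨n, p, q, hp, hq, hqx, hz⟩ := exists_stalkVal_eq x z
    refine ⟨aeval P p, aeval P q, ?_, ?_⟩
    · refine (isUnit_stalkVal x _).mp ?_
      have h1 := (isUnit_algebraMap_iff x q).mpr hqx
      rw [← key hq] at h1
      exact isUnit_of_mul_isUnit_left h1
    · apply stalkVal_injective
      apply (hu.pow n).mul_right_cancel
      rw [map_mul, mul_assoc]
      exact (congrArg _ (key hq)).trans (hz.trans (key hp).symm)

end FormFun

/-! ### Duality between linear forms and subspaces -/

section Duality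
open Module Module.End

/-- The standard bilinear form of `ℂ⁴`, which pairs linear forms with points. -/
def stdForm : LinearMap.BilinForm ℂ (Fin 4 → ℂ) := Matrix.toBilin' (1 : Matrix (Fin 4) (Fin 4) ℂ)

lemma stdForm_apply (a v : Fin 4 → ℂ) : stdForm a v = a ⬝ᵥ v := by
  simp [stdForm, Matrix.toBilin'_apply']

lemma stdForm_nondegenerate : stdForm.Nondegenerate :=
  LinearMap.BilinForm.nondegenerate_toBilin'_of_det_ne_zero' _ (by simp)

lemma stdForm_isRefl : stdForm.IsRefl := by
  intro a v h
  rw [stdForm_apply] at h ⊢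
  rwa [dotProduct_comm]

/-- The linear forms which vanish on a linear subspace. As forms and points are both vectors of
`ℂ⁴`, this is also the space of common zeros of a space of linear forms. -/
def perp (W : Submodule ℂ (Fin 4 → ℂ)) : Submodule ℂ (Fin 4 → ℂ) := stdForm.orthogonal W

lemma mem_perp {W : Submodule ℂ (Fin 4 → ℂ)} {a : Fin 4 → ℂ} :
    a ∈ perp W ↔ ∀ v ∈ W, a ⬝ᵥ v = 0 := by
  refine LinearMap.BilinForm.mem_orthogonal_iff.trans (forall₂_congr fun v _ ↦ ?_)
  rw [stdForm_apply, dotProduct_comm]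

lemma perp_perp (W : Submodule ℂ (Fin 4 → ℂ)) : perp (perp W) = W :=
  LinearMap.BilinForm.orthogonal_orthogonal stdForm_nondegenerate stdForm_isRefl W

lemma finrank_perp (W : Submodule ℂ (Fin 4 → ℂ)) : finrank ℂ (perp W) = 4 - finrank ℂ W := by
  have := LinearMap.BilinForm.finrank_orthogonal stdForm_nondegenerate W
  rwa [finrank_fin_fun] at this

lemma perp_le {W W' : Submodule ℂ (Fin 4 → ℂ)} (h : W ≤ W') : perp W' ≤ perp W :=
  LinearMap.BilinForm.orthogonal_le h

lemma perp_le_perp {W W' : Submodule ℂ (Fin 4 → ℂ)} : perp W' ≤ perp W ↔ W ≤ W' :=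
  ⟨fun h ↦ by simpa only [perp_perp] using perp_le h, perp_le⟩

lemma perp_injective : Function.Injective perp := fun W W' h ↦ by
  rw [← perp_perp W, h, perp_perp]

lemma mem_plane {a v : Fin 4 → ℂ} : v ∈ plane a ↔ a ⬝ᵥ v = 0 := by
  simp [plane, dotProduct]

lemma le_plane {W : Submodule ℂ (Fin 4 → ℂ)} {a : Fin 4 → ℂ} : W ≤ plane a ↔ a ∈ perp W := by
  rw [mem_perp]
  exact forall₂_congr fun v _ ↦ mem_plane

lemma perp_plane (a : Fin 4 → ℂ) : perp (plane a) = ℂ ∙ a := by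
  have h : plane a = perp (ℂ ∙ a) := by
    ext v
    rw [mem_plane, mem_perp]
    constructor
    · intro h w hw
      obtain ⟨c, rfl⟩ := Submodule.mem_span_singleton.mp hw
      rw [dotProduct_smul, dotProduct_comm, h, smul_zero]
    · intro h
      rw [dotProduct_comm]
      exact h a (Submodule.mem_span_singleton_self a)
  rw [h, perp_perp]

variable (S : Arrangement)

lemma mult_eq_formMult (W : Submodule ℂ (Fin 4 → ℂ)) : S.mult W = formMult S.form (perp W) := by
  rw [Arrangement.mult, formMult]
  simp only [le_plane]

lemma mult_perp (N : Submodule ℂ (Fin 4 → ℂ)) : S.mult (perp N) = formMult S.form N := by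
  rw [mult_eq_formMult, perp_perp]

/-- The action of `[v] ↦ [A v]` on linear forms, divided by `μ`. It is an involution if
`A² = μ²`. -/
def formAction (A : Matrix (Fin 4) (Fin 4) ℂ) (μ : ℂ) : End ℂ (Fin 4 → ℂ) :=
  μ⁻¹ • Matrix.vecMulLinear A

lemma formAction_apply (A : Matrix (Fin 4) (Fin 4) ℂ) (μ : ℂ) (a : Fin 4 → ℂ) :
    formAction A μ a = μ⁻¹ • Matrix.vecMul a A := rfl

variable {S} {A : Matrix (Fin 4) (Fin 4) ℂ} {μ : ℂ}

/-- The common zeros of an eigenspace of the action on forms are fixed points. The sign changes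
because a form in one eigenspace vanishes on the eigenvectors that pair with the other one. -/
lemma mulVec_of_mem_perp_eigenspace (hμ : μ ≠ 0) (hA : A * A = (μ ^ 2) • 1) {ε : ℂ}
    (hε : ε = 1 ∨ ε = -1) {v : Fin 4 → ℂ} (hv : v ∈ perp (eigenspace (formAction A μ) ε)) :
    A.mulVec v = (-ε * μ) • v := by
  have h1 (a : Fin 4 → ℂ) : a ⬝ᵥ (μ⁻¹ • A.mulVec v + ε • v) = 0 := by
    have h2 : formAction A μ a + ε • a ∈ eigenspace (formAction A μ) ε := by
      have h3 : formAction A μ (formAction A μ a) = a := by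
        simp only [formAction_apply, Matrix.smul_vecMul, Matrix.vecMul_vecMul, hA, smul_smul,
          Matrix.vecMul_smul, Matrix.vecMul_one]
        rw [show μ⁻¹ * (μ⁻¹ * μ ^ 2) = 1 by field_simp, one_smul]
      rw [mem_eigenspace_iff, map_add, h3, map_smul, smul_add, smul_smul]
      have : ε * ε = 1 := by rcases hε with rfl | rfl <;> norm_num
      rw [this, one_smul, add_comm]
    have h4 := mem_perp.mp hv _ h2
    rw [dotProduct_comm, add_dotProduct, formAction_apply, smul_dotProduct, smul_dotProduct,
      ← Matrix.dotProduct_mulVec] at h4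
    rw [dotProduct_add, dotProduct_smul, dotProduct_smul, h4]
  have h2 : μ⁻¹ • A.mulVec v + ε • v = 0 := dotProduct_eq_zero _ fun a ↦ by
    rw [dotProduct_comm]; exact h1 a
  have h3 : A.mulVec v = μ • (μ⁻¹ • A.mulVec v) := by rw [smul_smul, mul_inv_cancel₀ hμ, one_smul]
  rw [h3, eq_neg_of_add_eq_zero_left h2]
  module

/-- The equations of the arrangement and the involution satisfy the linear algebra assumptions. -/
lemma Arrangement.isSymmetric (hμ : μ ≠ 0) (hA : A * A = (μ ^ 2) • 1)
    (hS : ∀ i, ∃ j, (plane (S.form i)).map (Matrix.toLin' A) = plane (S.form j))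
    (h₁ : ∀ l : Submodule ℂ (Fin 4 → ℂ), S.IsDoubleLine l ∨ S.IsTripleLine l →
      ¬ ∀ v ∈ l, ∃ c : ℂ, A.mulVec v = c • v)
    (h₃ : ∀ l : Submodule ℂ (Fin 4 → ℂ), finrank ℂ l = 2 →
      (∀ v ∈ l, ∃ c : ℂ, A.mulVec v = c • v) → (∀ i, ¬ l ≤ plane (S.form i)) →
      {p : Submodule ℂ (Fin 4 → ℂ) | finrank ℂ p = 1 ∧ p ≤ l ∧ Odd (S.mult p)}.encard ≤ 2) :
    IsSymmetric S.form (formAction A μ) where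
  finrank_eq := by simp
  sq a := by
    simp only [formAction_apply, Matrix.smul_vecMul, Matrix.vecMul_vecMul, hA, smul_smul,
      Matrix.vecMul_smul, Matrix.vecMul_one]
    rw [show μ⁻¹ * (μ⁻¹ * μ ^ 2) = 1 by field_simp, one_smul]
  ne_zero := S.form_ne_zero
  not_proportional i j hij c h := by
    have hc : c ≠ 0 := by
      rintro rfl
      exact S.form_ne_zero i (by rw [h, zero_smul])
    refine S.distinct i j hij (perp_injective ?_)
    rw [perp_plane, perp_plane, h]
    exact Submodule.span_singleton_smul_eq (IsUnit.mk0 c hc) _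
  no_six N hN := by
    rw [← mult_perp]
    exact S.no_six _ (by rw [finrank_perp, hN])
  no_four N hN := by
    rw [← mult_perp]
    exact S.no_four _ (by rw [finrank_perp, hN])
  perm i := by
    obtain ⟨j, hj⟩ := hS i
    have h1 : plane (S.form j) ≤ plane (Matrix.vecMul (S.form i) A) := by
      rw [← hj]
      rintro _ ⟨v, hv, rfl⟩
      rw [SetLike.mem_coe, mem_plane] at hv
      rw [mem_plane, Matrix.toLin'_apply, Matrix.dotProduct_mulVec, Matrix.vecMul_vecMul, hA,
        Matrix.vecMul_smul, Matrix.vecMul_one, smul_dotProduct, hv, smul_zero]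
    have h2 := le_plane.mp h1
    rw [perp_plane] at h2
    obtain ⟨c, hc⟩ := Submodule.mem_span_singleton.mp h2
    exact ⟨j, μ⁻¹ * c, by rw [formAction_apply, ← hc, smul_smul]⟩
  no_fixed_line ε hε N hN hEN := by
    rw [← mult_perp]
    have h1 : ∀ v ∈ perp N, ∃ c : ℂ, A.mulVec v = c • v := fun v hv ↦
      ⟨_, mulVec_of_mem_perp_eigenspace hμ hA hε (perp_le hEN hv)⟩
    have h2 : finrank ℂ (perp N) = 2 := by rw [finrank_perp, hN]
    exact ⟨fun h ↦ h₁ _ (.inl ⟨h2, h⟩) h1, fun h ↦ h₁ _ (.inr ⟨h2, h⟩) h1⟩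
  odd_points h2 hE := by
    set E := eigenspace (formAction A μ) (-1)
    have h1 : ∀ v ∈ perp E, ∃ c : ℂ, A.mulVec v = c • v := fun v hv ↦
      ⟨_, mulVec_of_mem_perp_eigenspace hμ hA (.inr rfl) hv⟩
    refine (Set.encard_le_encard_of_injOn (f := perp) ?_ perp_injective.injOn).trans
      (h₃ (perp E) (by rw [finrank_perp, h2]) h1 fun i hi ↦ hE i ?_)
    · rintro N ⟨hN, hEN, hodd⟩
      exact ⟨by rw [finrank_perp, hN], perp_le hEN, by rwa [mult_perp]⟩
    · have := le_plane.mp hi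
      rwa [perp_perp] at this

/-- The scaling of the action of an involution on linear forms can be chosen such that an invariant
form does not vanish at a given point. -/
lemma exists_formAction (A : GL (Fin 4) ℂ) (hA : ∃ c : ℂ, A.val * A.val = c • 1) (x : P3) :
    ∃ μ : ℂ, μ ≠ 0 ∧ A.val * A.val = (μ ^ 2) • 1 ∧ ∃ h, formAction A.val μ h = h ∧
      x ∈ Proj.basicOpen grading (linearForm h) := by
  obtain ⟨c, hc⟩ := hA
  have hc0 : c ≠ 0 := by
    rintro rfl
    rw [zero_smul] at hc
    have h1 : IsUnit (A.val * A.val) := A.isUnit.mul A.isUnit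
    rw [hc] at h1
    exact not_isUnit_zero h1
  obtain ⟨μ, hμ⟩ := IsAlgClosed.exists_pow_nat_eq c two_pos
  have hμ0 : μ ≠ 0 := by rintro rfl; exact hc0 (by rw [← hμ]; simp)
  rw [← hμ] at hc
  have hsq (a : Fin 4 → ℂ) : formAction A.val μ (formAction A.val μ a) = a := by
    simp only [formAction_apply, Matrix.smul_vecMul, Matrix.vecMul_vecMul, hc, smul_smul,
      Matrix.vecMul_smul, Matrix.vecMul_one]
    rw [show μ⁻¹ * (μ⁻¹ * μ ^ 2) = 1 by field_simp, one_smul]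
  obtain ⟨a, ha⟩ : ∃ a, x ∈ Proj.basicOpen grading (linearForm a) := by
    obtain ⟨j, hj⟩ := exists_mem_basicOpen x
    exact ⟨Pi.single j 1, by rwa [linearForm_single]⟩
  by_cases h1 : x ∈ Proj.basicOpen grading (linearForm (a + formAction A.val μ a))
  · exact ⟨μ, hμ0, hc, _, by rw [map_add, hsq, add_comm], h1⟩
  · refine ⟨-μ, neg_ne_zero.mpr hμ0, by rwa [neg_sq], a - formAction A.val μ a, ?_, fun h2 ↦ ha ?_⟩
    · have h3 (b : Fin 4 → ℂ) : formAction A.val (-μ) b = - formAction A.val μ b := by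
        rw [formAction_apply, formAction_apply, inv_neg, neg_smul]
      rw [h3, map_sub, hsq, neg_sub]
    · have h3 : linearForm (a + formAction A.val μ a) ∈ pointIdeal x := not_not.mp h1
      have h4 := add_mem h3 h2
      rw [← linearForm_add, show a + formAction A.val μ a + (a - formAction A.val μ a) =
        (2 : ℂ) • a by module, linearForm_smul] at h4
      have h5 := (pointIdeal x).mul_mem_left (C (2⁻¹ : ℂ)) h4
      rwa [← mul_assoc, ← C_mul, inv_mul_cancel₀ two_ne_zero, C_1, one_mul] at h5

end Duality

/-! ### The action on local rings at fixed points -/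

section FixedPoints
variable {X Y : Scheme.{0}}

lemma stalkMap_germ_congr {f g : X ⟶ Y} (e : f = g) (x : X) {U : Y.Opens} (s : Γ(Y, U))
    (hf : f x ∈ U) (hg : g x ∈ U) :
    (f.stalkMap x).hom (Y.presheaf.germ U (f x) hf s) =
      (g.stalkMap x).hom (Y.presheaf.germ U (g x) hg s) := by
  subst e
  rfl

/-- The action of an endomorphism on the local ring at a fixed point. -/
def fixedStalkMap (φ : X ⟶ X) {x : X} (hx : φ x = x) : X.presheaf.stalk x →+* X.presheaf.stalk x :=
  (X.presheaf.stalkSpecializes (specializes_of_eq hx) ≫ φ.stalkMap x).hom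

lemma fixedStalkMap_germ (φ : X ⟶ X) {x : X} (hx : φ x = x) {U : X.Opens} (hU : x ∈ U)
    (hU' : φ x ∈ U) (s : Γ(X, U)) :
    fixedStalkMap φ hx (X.presheaf.germ U x hU s) =
      (φ.stalkMap x).hom (X.presheaf.germ U (φ x) hU' s) := by
  exact congrArg (φ.stalkMap x).hom (congrArg (fun φ ↦ φ.hom s)
    (TopCat.Presheaf.germ_stalkSpecializes X.presheaf hU (specializes_of_eq hx)))

lemma fixedStalkMap_stalkMap_germ (φ : X ⟶ X) {x : X} (hx : φ x = x) (f : X ⟶ Y) {U : Y.Opens}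
    (hU : f x ∈ U) (hU' : (φ ≫ f) x ∈ U) (s : Γ(Y, U)) :
    fixedStalkMap φ hx ((f.stalkMap x).hom (Y.presheaf.germ U (f x) hU s)) =
      ((φ ≫ f).stalkMap x).hom (Y.presheaf.germ U ((φ ≫ f) x) hU' s) := by
  have h1 := Scheme.Hom.germ_stalkMap_apply f U x hU s
  have h2 := Scheme.Hom.germ_stalkMap_apply f U (φ x) hU' s
  have h3 : ((φ ≫ f).stalkMap x).hom (Y.presheaf.germ U ((φ ≫ f) x) hU' s) =
      (φ.stalkMap x).hom ((f.stalkMap (φ x)).hom (Y.presheaf.germ U (f (φ x)) hU' s)) :=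
    congrArg (fun φ ↦ φ.hom (Y.presheaf.germ U (f (_ : X)) hU' s)) (Scheme.Hom.stalkMap_comp φ f x)
  rw [h3]
  refine (congrArg (fixedStalkMap φ hx) h1).trans ?_
  refine Eq.trans ?_ (congrArg (φ.stalkMap x).hom h2).symm
  exact fixedStalkMap_germ φ hx _ _ _

/-- An endomorphism acts trivially on the residue field of the generic point of a pointwise fixed
subscheme. -/
lemma stalkMap_fixedStalkMap (φ : X ⟶ X) {C : Scheme.{0}} (i : C ⟶ X) (hi : i ≫ φ = i) (η : C)
    (hx : φ (i η) = i η) (z : X.presheaf.stalk (i η)) :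
    (i.stalkMap η).hom (fixedStalkMap φ hx z) = (i.stalkMap η).hom z := by
  obtain ⟨U, hU, s, rfl⟩ := X.presheaf.exists_germ_eq z
  have hU' : φ (i η) ∈ U := by rwa [hx]
  refine (congrArg (i.stalkMap η).hom (fixedStalkMap_germ φ hx hU hU' s)).trans ?_
  have h3 : ((i ≫ φ).stalkMap η).hom (X.presheaf.germ U ((i ≫ φ) η) hU' s) =
      (i.stalkMap η).hom ((φ.stalkMap (i η)).hom (X.presheaf.germ U (φ (i η)) hU' s)) :=
    congrArg (fun φ ↦ φ.hom (X.presheaf.germ U _ hU' s)) (Scheme.Hom.stalkMap_comp i φ η)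
  exact h3.symm.trans (stalkMap_germ_congr hi η s hU' hU)

end FixedPoints

/-! ### The action on linear forms -/

section ProjMap

/-- An automorphism of `ℙ³` acts on the functions `a / h` through its action on linear forms. -/
lemma stalkMap_projMap_formSection (A : GL (Fin 4) ℂ) {μ : ℂ} (hμ : μ ≠ 0) {h : Fin 4 → ℂ}
    (hh : formAction A.val μ h = h) (x : P3) (hx : x ∈ Proj.basicOpen grading (linearForm h))
    (hx' : projMap A x ∈ Proj.basicOpen grading (linearForm h)) (a : Fin 4 → ℂ) :
    ((projMap A).stalkMap x).hom (P3.presheaf.germ _ (projMap A x) hx' (formSection h a)) =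
      P3.presheaf.germ _ x hx (formSection h (formAction A.val μ a)) := by
  have hvec (b : Fin 4 → ℂ) : Matrix.vecMul b A.val = μ • formAction A.val μ b := by
    rw [formAction_apply, smul_smul, mul_inv_cancel₀ hμ, one_smul]
  refine eq_formFun x h hx ?_
  have h1 := Scheme.Hom.germ_stalkMap_apply (projMap A) _ x hx' (formSection h a)
  have h2 : (projMap A).app (Proj.basicOpen grading (linearForm h)) (formSection h a) =
      Proj.awayToSection grading (substHom A.val (linearForm h))
        (HomogeneousLocalization.Away.mk grading ((substHom A.val).map_mem (linearForm_mem h)) 1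
          (substHom A.val (linearForm a)) ((substHom A.val).map_mem (linearForm_mem' a))) := by
    have h3 := Proj.awayToSection_comp_appLE (substHom A.val) (irrelevant_le_map A)
      (linearForm_mem h)
    have h4 := congrArg (fun φ ↦ φ.hom (HomogeneousLocalization.Away.mk grading (linearForm_mem h) 1
      (linearForm a) (linearForm_mem' a))) h3
    rw [Scheme.Hom.app_eq_appLE]
    refine h4.trans ?_
    exact congrArg (Proj.awayToSection grading (substHom A.val (linearForm h)))
      (HomogeneousLocalization.Away.map_mk _ _ _ _ _ _)
  have h3 := stalkVal_germ_mk x (substHom A.val (linearForm h))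
    ((substHom A.val).map_mem (linearForm_mem h)) hx' 1 (substHom A.val (linearForm a))
    ((substHom A.val).map_mem (linearForm_mem' a))
  rw [pow_one] at h3
  have h4 : stalkVal x (((projMap A).stalkMap x).hom
      (P3.presheaf.germ _ (projMap A x) hx' (formSection h a))) *
      polyVal x (substHom A.val (linearForm h)) =
        polyVal x (substHom A.val (linearForm a)) := by
    refine Eq.trans (congrArg (fun z ↦ stalkVal x z * polyVal x (substHom A.val (linearForm h)))
      ?_) h3
    refine h1.trans ?_
    exact congrArg (P3.presheaf.germ (projMap A ⁻¹ᵁ Proj.basicOpen grading (linearForm h)) x hx') h2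
  rw [substHom_linearForm, substHom_linearForm, hvec, hvec, hh, linearForm_smul, linearForm_smul,
    map_mul, map_mul, mul_left_comm] at h4
  have h5 : IsUnit (polyVal x (C μ)) := ((isUnit_iff_ne_zero.mpr hμ).map C).map (polyVal x)
  exact h5.mul_left_cancel h4

/-- An automorphism which lifts an automorphism of `ℙ³` acts on the functions `a / h` at a fixed
point. -/
lemma fixedStalkMap_formFun {X : Scheme.{0}} (p : X ⟶ P3) (φ : X ⟶ X) (A : GL (Fin 4) ℂ)
    (hφ : φ ≫ p = p ≫ projMap A) {x : X} (hx : φ x = x) {μ : ℂ} (hμ : μ ≠ 0) {h : Fin 4 → ℂ}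
    (hh : formAction A.val μ h = h) (hpx : p x ∈ Proj.basicOpen grading (linearForm h))
    (a : Fin 4 → ℂ) :
    letI := projStalkAlgebra (p x)
    fixedStalkMap φ hx ((p.stalkMap x).hom (formFun (p x) h hpx a)) =
      (p.stalkMap x).hom (formFun (p x) h hpx (formAction A.val μ a)) := by
  let U := Proj.basicOpen grading (linearForm h)
  have e : (φ ≫ p) x = p x := congrArg p hx
  have h1 : (φ ≫ p) x ∈ U := by rw [e]; exact hpx
  have h2 : (p ≫ projMap A) x ∈ U := by rw [← hφ]; exact h1
  refine (fixedStalkMap_stalkMap_germ φ hx p hpx h1 (formSection h a)).trans ?_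
  refine (stalkMap_germ_congr hφ x (formSection h a) h1 h2).trans ?_
  have h3 := congrArg (fun φ ↦ φ.hom (P3.presheaf.germ U _ h2 (formSection h a)))
    (Scheme.Hom.stalkMap_comp p (projMap A) x)
  refine h3.trans ?_
  exact congrArg (p.stalkMap x).hom (stalkMap_projMap_formSection A hμ hh (p x) hpx h2 a)

end ProjMap

/-! ### The centres of the blow-ups -/

section Centres
open Module

variable {f : Fin 8 → Fin 4 → ℂ} {B : End ℂ (Fin 4 → ℂ)}

/-- A fourfold or fivefold point or a multiple line is the intersection of the planes through it. -/
lemma IsSymmetric.eq_span (h : IsSymmetric f B) {N : Submodule ℂ (Fin 4 → ℂ)}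
    (hN : finrank ℂ N = 3 ∧ 4 ≤ formMult f N ∨ finrank ℂ N = 2 ∧ 2 ≤ formMult f N) :
    Submodule.span ℂ (f '' {i | f i ∈ N}) = N := by
  set W := Submodule.span ℂ (f '' {i | f i ∈ N})
  have hW : W ≤ N := Submodule.span_le.mpr (by rintro _ ⟨i, hi, rfl⟩; exact hi)
  have h1 : formMult f N ≤ formMult f W :=
    Set.ncard_le_ncard (fun i hi ↦ Submodule.subset_span ⟨i, hi, rfl⟩) (Set.toFinite _)
  refine Submodule.eq_of_le_of_finrank_le hW ?_
  by_contra hcon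
  have h2 : ¬ finrank ℂ W ≤ 1 := fun h2 ↦ by
    have := h.formMult_le_one h2
    omega
  have h3 : finrank ℂ W = 2 := by omega
  have := h.no_four W h3
  omega

/-- There are finitely many fourfold and fivefold points and multiple lines, so the centres of the
blow-ups are their finite unions. -/
lemma IsSymmetric.finite (h : IsSymmetric f B) : {N : Submodule ℂ (Fin 4 → ℂ) |
    finrank ℂ N = 3 ∧ 4 ≤ formMult f N ∨ finrank ℂ N = 2 ∧ 2 ≤ formMult f N}.Finite := by
  refine (Set.finite_range fun s : Set (Fin 8) ↦ Submodule.span ℂ (f '' s)).subset ?_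
  intro N hN
  exact ⟨_, h.eq_span hN⟩

/-- A finite supremum of closed sets is their union. -/
lemma mem_iSup_linearLocus {P : Submodule ℂ (Fin 4 → ℂ) → Prop} (hP : {p | P p}.Finite) (x : P3) :
    x ∈ (⨆ p : {p // P p}, linearLocus p.1) ↔ ∃ p, P p ∧ x ∈ linearLocus p := by
  have : Finite {p // P p} := hP
  have h1 : (⨆ p : {p // P p}, linearLocus p.1) =
      ⟨⋃ p : {p // P p}, linearLocus p.1, isClosed_iUnion_of_finite fun p ↦ (linearLocus p.1).isClosed⟩ := by
    apply le_antisymm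
    · exact iSup_le fun p ↦ Set.subset_iUnion (fun p : {p // P p} ↦ (linearLocus p.1 : Set P3)) p
    · exact Set.iUnion_subset fun p ↦ le_iSup (fun p : {p // P p} ↦ linearLocus p.1) p
  rw [h1]
  exact Set.mem_iUnion.trans ⟨fun ⟨p, hp⟩ ↦ ⟨p.1, p.2, hp⟩, fun ⟨p, hp, h⟩ ↦ ⟨⟨p, hp⟩, h⟩⟩

variable {S : Arrangement}

lemma finite_of_perp {P : Submodule ℂ (Fin 4 → ℂ) → Prop} (h : IsSymmetric S.form B)
    (hP : ∀ p, P p → finrank ℂ p = 1 ∧ 4 ≤ S.mult p ∨ finrank ℂ p = 2 ∧ 2 ≤ S.mult p) :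
    {p | P p}.Finite := by
  refine Set.Finite.of_finite_image (f := perp) (h.finite.subset ?_) perp_injective.injOn
  rintro _ ⟨p, hp, rfl⟩
  rcases hP p hp with ⟨h1, h2⟩ | ⟨h1, h2⟩
  · exact .inl ⟨by rw [finrank_perp, h1], by rwa [← mult_eq_formMult]⟩
  · exact .inr ⟨by rw [finrank_perp, h1], by rwa [← mult_eq_formMult]⟩

lemma mem_fivefoldLocus (h : IsSymmetric S.form B) (x : P3) :
    x ∈ S.fivefoldLocus ↔ ∃ p, S.IsFivefoldPoint p ∧ x ∈ linearLocus p :=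
  mem_iSup_linearLocus (finite_of_perp h fun p (hp : S.IsFivefoldPoint p) ↦ .inl ⟨hp.1, hp.2.symm ▸ by norm_num⟩) x

lemma mem_tripleLocus (h : IsSymmetric S.form B) (x : P3) :
    x ∈ S.tripleLocus ↔ ∃ p, S.IsTripleLine p ∧ x ∈ linearLocus p :=
  mem_iSup_linearLocus (finite_of_perp h fun p (hp : S.IsTripleLine p) ↦ .inr ⟨hp.1, hp.2.symm ▸ by norm_num⟩) x

lemma mem_fourfoldLocus (h : IsSymmetric S.form B) (x : P3) :
    x ∈ S.fourfoldLocus ↔ ∃ p, (S.IsFourfoldPoint p ∧ ∀ l, S.IsTripleLine l → ¬ p ≤ l) ∧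
      x ∈ linearLocus p :=
  mem_iSup_linearLocus (finite_of_perp h fun p
    (hp : S.IsFourfoldPoint p ∧ ∀ l, S.IsTripleLine l → ¬ p ≤ l) ↦ .inl ⟨hp.1.1, hp.1.2.symm ▸ le_rfl⟩) x

variable (x : P3) (h : Fin 4 → ℂ) (hx : x ∈ Proj.basicOpen grading (linearForm h))

attribute [local instance] projStalkAlgebra

lemma fromSpecStalk_mem_linearLocus_perp (𝔭 : PrimeSpectrum (P3.presheaf.stalk x))
    (W : Submodule ℂ (Fin 4 → ℂ)) :
    P3.fromSpecStalk x 𝔭 ∈ linearLocus W ↔ ∀ a ∈ perp W, formFun x h hx a ∈ 𝔭.asIdeal := by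
  rw [fromSpecStalk_mem_linearLocus x h hx]
  exact forall_congr' fun a ↦ imp_congr_left mem_perp.symm

lemma fromSpecStalk_mem_fivefoldLocus (hf : IsSymmetric S.form B)
    (𝔭 : PrimeSpectrum (P3.presheaf.stalk x)) :
    P3.fromSpecStalk x 𝔭 ∈ S.fivefoldLocus ↔ ∃ N : Submodule ℂ (Fin 4 → ℂ), finrank ℂ N = 3 ∧
      formMult S.form N = 5 ∧ ∀ a ∈ N, formFun x h hx a ∈ 𝔭.asIdeal := by
  rw [mem_fivefoldLocus hf]
  constructor
  · rintro ⟨p, ⟨h1, h2⟩, h3⟩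
    exact ⟨perp p, by rw [finrank_perp, h1], by rwa [← mult_eq_formMult],
      (fromSpecStalk_mem_linearLocus_perp x h hx 𝔭 p).mp h3⟩
  · rintro ⟨N, h1, h2, h3⟩
    refine ⟨perp N, ⟨by rw [finrank_perp, h1], by rwa [mult_perp]⟩, ?_⟩
    rw [fromSpecStalk_mem_linearLocus_perp x h hx 𝔭, perp_perp]
    exact h3

lemma fromSpecStalk_mem_tripleLocus (hf : IsSymmetric S.form B)
    (𝔭 : PrimeSpectrum (P3.presheaf.stalk x)) :
    P3.fromSpecStalk x 𝔭 ∈ S.tripleLocus ↔ ∃ N : Submodule ℂ (Fin 4 → ℂ), finrank ℂ N = 2 ∧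
      formMult S.form N = 3 ∧ ∀ a ∈ N, formFun x h hx a ∈ 𝔭.asIdeal := by
  rw [mem_tripleLocus hf]
  constructor
  · rintro ⟨p, ⟨h1, h2⟩, h3⟩
    exact ⟨perp p, by rw [finrank_perp, h1], by rwa [← mult_eq_formMult],
      (fromSpecStalk_mem_linearLocus_perp x h hx 𝔭 p).mp h3⟩
  · rintro ⟨N, h1, h2, h3⟩
    refine ⟨perp N, ⟨by rw [finrank_perp, h1], by rwa [mult_perp]⟩, ?_⟩
    rw [fromSpecStalk_mem_linearLocus_perp x h hx 𝔭, perp_perp]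
    exact h3

lemma fromSpecStalk_mem_fourfoldLocus (hf : IsSymmetric S.form B)
    (𝔭 : PrimeSpectrum (P3.presheaf.stalk x)) :
    P3.fromSpecStalk x 𝔭 ∈ S.fourfoldLocus ↔ ∃ N : Submodule ℂ (Fin 4 → ℂ), finrank ℂ N = 3 ∧
      formMult S.form N = 4 ∧ (∀ N' ≤ N, finrank ℂ N' = 2 → formMult S.form N' ≠ 3) ∧
      ∀ a ∈ N, formFun x h hx a ∈ 𝔭.asIdeal := by
  rw [mem_fourfoldLocus hf]
  constructor
  · rintro ⟨p, ⟨⟨h1, h2⟩, h4⟩, h3⟩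
    refine ⟨perp p, by rw [finrank_perp, h1], by rwa [← mult_eq_formMult], fun N' hN' h5 h6 ↦ ?_,
      (fromSpecStalk_mem_linearLocus_perp x h hx 𝔭 p).mp h3⟩
    refine h4 (perp N') ⟨by rw [finrank_perp, h5], by rwa [mult_perp]⟩ ?_
    rw [← perp_le_perp, perp_perp]
    exact hN'
  · rintro ⟨N, h1, h2, h4, h3⟩
    refine ⟨perp N, ⟨⟨by rw [finrank_perp, h1], by rwa [mult_perp]⟩, fun l hl hNl ↦ ?_⟩, ?_⟩
    · refine h4 (perp l) ?_ (by rw [finrank_perp, hl.1]) ((mult_eq_formMult S l).symm.trans hl.2)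
      rw [← perp_le_perp, perp_perp]
      exact hNl
    · rw [fromSpecStalk_mem_linearLocus_perp x h hx 𝔭, perp_perp]
      exact h3

/-- The points of the strict transform of a closed set are the specializations of points of its
preimage outside of the centre. -/
lemma fromSpecStalk_mem_strictTransform {X' X : Scheme.{0}} [NoetherianSpace X'] (π : X' ⟶ X)
    (Z T : Closeds X) (x : X') (𝔭 : PrimeSpectrum (X'.presheaf.stalk x)) :
    X'.fromSpecStalk x 𝔭 ∈ strictTransform π Z T ↔ ∃ 𝔮 ≤ 𝔭, π (X'.fromSpecStalk x 𝔮) ∈ T ∧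
      π (X'.fromSpecStalk x 𝔮) ∉ Z := by
  have h1 : X'.fromSpecStalk x 𝔭 ∈ strictTransform π Z T ↔
    X'.fromSpecStalk x 𝔭 ∈ closure ((π ⁻¹' T) \ (π ⁻¹' Z) : Set X') := Iff.rfl
  rw [h1]
  constructor
  · intro h2
    obtain ⟨y, ⟨hyT, hyZ⟩, hy⟩ := exists_specializes_of_mem_closure
      (T.isClosed.preimage π.continuous) (Z.isClosed.preimage π.continuous) h2
    have h3 : y ∈ Set.range (X'.fromSpecStalk x) := by
      rw [Scheme.range_fromSpecStalk]
      exact hy.trans (fromSpecStalk_specializes x 𝔭)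
    obtain ⟨𝔮, rfl⟩ := h3
    exact ⟨𝔮, (fromSpecStalk_specializes_iff x 𝔭 𝔮).mp hy, hyT, hyZ⟩
  · rintro ⟨𝔮, h𝔮, h2, h3⟩
    have h4 := (fromSpecStalk_specializes_iff x 𝔭 𝔮).mpr h𝔮
    have h5 : X'.fromSpecStalk x 𝔮 ∈ ((π ⁻¹' T) \ (π ⁻¹' Z) : Set X') := ⟨h2, h3⟩
    exact closure_mono (Set.singleton_subset_iff.mpr h5) h4.mem_closure

end Centres

/-! ### The singular locus in terms of local rings -/

section Smooth
variable {X : Scheme.{0}}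

lemma germ_bijective_of_isField (R : CommRingCat.{0}) (hR : IsField R) (q : PrimeSpectrum R) :
    Function.Bijective (((Spec R).presheaf.germ ⊤ q trivial).hom.comp
      (Scheme.ΓSpecIso R).inv.hom) := by
  let : Algebra R ((Spec R).presheaf.stalk q) :=
    inferInstanceAs (Algebra R ((Spec.structureSheaf R).presheaf.stalk q))
  have : IsLocalization.AtPrime ((Spec R).presheaf.stalk q) q.asIdeal :=
    inferInstanceAs (IsLocalization.AtPrime
      ((Spec.structureSheaf R).presheaf.stalk q) q.asIdeal)
  exact IsField.localization_map_bijective (Rₘ := (Spec R).presheaf.stalk q)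
    (M := q.asIdeal.primeCompl) (fun h ↦ h (Ideal.zero_mem _)) hR

lemma stalkConstants_id_bijective (q : SpecC) : Function.Bijective (stalkConstants (𝟙 SpecC) q) := by
  have h := germ_bijective_of_isField (CommRingCat.of ℂ) (Field.toIsField ℂ) q
  exact h

/-- The local ring of `Spec ℂ` is the field of constants. -/
lemma mem_smoothLocus_iff (s : X ⟶ SpecC) [LocallyOfFinitePresentation s] (q : X) :
    q ∈ s.smoothLocus ↔ (stalkConstants s q).FormallySmooth := by
  rw [Scheme.Hom.mem_smoothLocus]
  let e := RingEquiv.ofBijective _ (stalkConstants_id_bijective (s q))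
  have h1 : stalkConstants s q = (s.stalkMap q).hom.comp e.toRingHom := by
    have := stalkConstants_comp s (𝟙 SpecC) q
    rwa [Category.comp_id] at this
  rw [h1]
  refine ⟨fun h ↦ RingHom.FormallySmooth.respectsIso.2 _ e h, fun h ↦ ?_⟩
  have h2 := RingHom.FormallySmooth.respectsIso.2 _ e.symm h
  convert h2 using 1
  ext z
  exact congrArg _ (e.apply_symm_apply z).symm

/-- Smoothness at a generization is formal smoothness of the localization of the local ring. -/
lemma fromSpecStalk_mem_singularLocus [IsIntegral X] (s : X ⟶ SpecC)
    [LocallyOfFinitePresentation s] (x : X) (𝔭 : Ideal (X.presheaf.stalk x)) (h𝔭 : 𝔭.IsPrime) :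
    letI := (stalkConstants s x).toAlgebra
    X.fromSpecStalk x ⟨𝔭, h𝔭⟩ ∈ singularLocus s ↔
      ¬ Algebra.FormallySmooth ℂ (Localization.AtPrime 𝔭) := by
  let := (stalkConstants s x).toAlgebra
  refine not_congr ?_
  set q := X.fromSpecStalk x ⟨𝔭, h𝔭⟩ with hq
  refine (mem_smoothLocus_iff s q).trans ?_
  have hs := fromSpecStalk_specializes x ⟨𝔭, h𝔭⟩
  let : Algebra (X.presheaf.stalk x) (X.presheaf.stalk q) :=
    (X.presheaf.stalkSpecializes hs).hom.toAlgebra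
  have : IsLocalization.AtPrime (X.presheaf.stalk q) 𝔭 := isLocalization_stalkSpecializes x ⟨𝔭, h𝔭⟩
  let : Algebra ℂ (X.presheaf.stalk q) := (stalkConstants s q).toAlgebra
  have : IsScalarTower ℂ (X.presheaf.stalk x) (X.presheaf.stalk q) :=
    .of_algebraMap_eq fun c ↦ (stalkSpecializes_stalkConstants s hs c).symm
  let e : X.presheaf.stalk q ≃ₐ[ℂ] Localization.AtPrime 𝔭 :=
    (IsLocalization.algEquiv 𝔭.primeCompl (X.presheaf.stalk q)
      (Localization.AtPrime 𝔭)).restrictScalars ℂ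
  constructor
  · intro h
    have : Algebra.FormallySmooth ℂ (X.presheaf.stalk q) := h
    exact Algebra.FormallySmooth.of_equiv e
  · intro h
    exact Algebra.FormallySmooth.of_equiv e.symm

end Smooth

/-! ### The square root of the octic form -/

section DoubleCover
variable {Z Y P : Scheme.{0}}

lemma map_genericPoint_of_isDominant [IsIntegral Z] [IsIntegral Y] (f : Z ⟶ Y) [IsDominant f] :
    f (genericPoint Z) = genericPoint Y := by
  have h1 := (genericPoint_spec Z).image f.continuous
  rw [Set.image_univ, f.denseRange.closure_eq] at h1
  exact h1.eq (genericPoint_spec Y)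

lemma stalkMap_stalkSpecializes_apply (f : Z ⟶ Y) {x x' : Z} (h : x ⤳ x')
    (z : Y.presheaf.stalk (f x')) :
    (Z.presheaf.stalkSpecializes h).hom ((f.stalkMap x').hom z) =
      (f.stalkMap x).hom ((Y.presheaf.stalkSpecializes (h.map f.continuous)).hom z) :=
  (congrArg (fun φ ↦ φ.hom z) (Scheme.Hom.stalkSpecializes_stalkMap f x x' h)).symm

lemma stalkSpecializes_formFun {x x' : P3} (hs : x ⤳ x') {h : Fin 4 → ℂ}
    (hx : x ∈ Proj.basicOpen grading (linearForm h))
    (hx' : x' ∈ Proj.basicOpen grading (linearForm h)) (a : Fin 4 → ℂ) :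
    (P3.presheaf.stalkSpecializes hs).hom (formFun x' h hx' a) = formFun x h hx a :=
  congrArg (fun φ ↦ φ.hom (formSection h a))
    (TopCat.Presheaf.germ_stalkSpecializes P3.presheaf hx' hs)

attribute [local instance] projStalkAlgebra

/-- The comparison of the two dehomogenizations of the octic form. -/
lemma germ_dehomogenizedOctic (S : Arrangement) {x : P3} (h0 : x ∈ Proj.basicOpen grading (X 0))
    {h : Fin 4 → ℂ} (hx : x ∈ Proj.basicOpen grading (linearForm h)) :
    P3.presheaf.germ _ x h0 S.dehomogenizedOctic * formFun x h hx (Pi.single 0 1) ^ 8 =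
      ∏ i, formFun x h hx (S.form i) := by
  have hu := isUnit_polyVal x h hx
  apply stalkVal_injective
  apply (hu.pow 8).mul_right_cancel
  have h1 := stalkVal_germ_mk x (X 0) (isHomogeneous_X ℂ 0) h0 8 S.octic S.octic_mem
  have h2 := stalkVal_formFun x h hx (Pi.single 0 1)
  rw [linearForm_single] at h2
  rw [map_mul, map_pow, map_prod, mul_assoc, ← mul_pow, h2]
  refine h1.trans ?_
  rw [Arrangement.octic, map_prod, show polyVal x (linearForm h) ^ 8 =
    ∏ i : Fin 8, polyVal x (linearForm h) by simp, ← Finset.prod_mul_distrib]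
  exact Finset.prod_congr rfl fun i _ ↦ (stalkVal_formFun x h hx _).symm

/-- The local ring of the double cover contains the square root of the octic form, which
generates its field of fractions. It is `w` times the fourth power of `x₀ / h`, where `w` is the square
root of the octic form divided by `x₀⁸`, and it is in the local ring by normality. -/
lemma IsDoubleCover.exists_sqrt {S : Arrangement} [IsIntegral Y] {π : P ⟶ P3} {ρ : Y ⟶ P}
    (hD : IsDoubleCover S π ρ) (y : Y) {h : Fin 4 → ℂ}
    (hy : (ρ ≫ π) y ∈ Proj.basicOpen grading (linearForm h)) :
    ∃ w : Y.presheaf.stalk y,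
      w ^ 2 = ((ρ ≫ π).stalkMap y).hom (∏ i, formFun ((ρ ≫ π) y) h hy (S.form i)) ∧
      ∀ z, ∃ α β γ : P3.presheaf.stalk ((ρ ≫ π) y), γ ≠ 0 ∧
        z * ((ρ ≫ π).stalkMap y).hom γ =
          ((ρ ≫ π).stalkMap y).hom α + ((ρ ≫ π).stalkMap y).hom β * w := by
  have := hD.isDominant
  have hgen := map_genericPoint_of_isDominant (ρ ≫ π)
  set f := ρ ≫ π
  obtain ⟨h0, w, hw, hfrac⟩ := hD.function_field
  have hs : genericPoint Y ⤳ y := (genericPoint_spec Y).specializes trivial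
  have hfs : f (genericPoint Y) ⤳ f y := hs.map f.continuous
  set g := f (genericPoint Y)
  have hg : g ∈ Proj.basicOpen grading (linearForm h) := hfs.mem_open (Proj.basicOpen _ _).2 hy
  let ι := (Y.presheaf.stalkSpecializes hs).hom
  have hι : Function.Injective ι := stalkSpecializes_injective hs
  let F := (f.stalkMap (genericPoint Y)).hom
  let σ := (P3.presheaf.stalkSpecializes hfs).hom
  have hιF (z) : ι ((f.stalkMap y).hom z) = F (σ z) := stalkMap_stalkSpecializes_apply f hs z
  let u : P3.presheaf.stalk g := formFun g h hg (Pi.single 0 1)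
  have hu : u ≠ 0 := by
    have : IsUnit u := by
      rw [isUnit_formFun, linearForm_single]
      exact h0
    exact this.ne_zero
  obtain ⟨v, hv⟩ := (isField_stalk_genericPoint hgen).mul_inv_cancel (pow_ne_zero 4 hu)
  have hw2 : (F (u ^ 4) * w) ^ 2 = ι ((f.stalkMap y).hom (∏ i, formFun (f y) h hy (S.form i))) := by
    rw [hιF, map_prod]
    have h1 : ∏ i, σ (formFun (f y) h hy (S.form i)) = ∏ i, formFun g h hg (S.form i) :=
      Finset.prod_congr rfl fun i _ ↦ stalkSpecializes_formFun hfs hg hy _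
    have h2 : w ^ 2 = F (P3.presheaf.germ _ g h0 S.dehomogenizedOctic) :=
      hw.trans (Scheme.Hom.germ_stalkMap_apply f _ _ h0 _).symm
    rw [h1, ← germ_dehomogenizedOctic S h0 hg, mul_pow, h2, map_mul, ← map_pow, ← pow_mul, mul_comm]
  have := hD.isIntegrallyClosed y
  obtain ⟨w', hw'⟩ : ∃ w', ι w' = F (u ^ 4) * w :=
    IsIntegrallyClosed.exists_algebraMap_eq_of_isIntegral_pow
      (R := Y.presheaf.stalk y) (K := Y.functionField) two_pos (hw2 ▸ isIntegral_algebraMap)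
  refine ⟨w', hι ?_, fun z ↦ ?_⟩
  · rw [map_pow, hw', hw2]
  · obtain ⟨a, b, hab⟩ := hfrac (ι z)
    obtain ⟨α, γ, hγ, hα⟩ := exists_fraction_of_genericPoint hgen hfs a
    obtain ⟨β, γ', hγ', hβ⟩ := exists_fraction_of_genericPoint hgen hfs (b * v)
    refine ⟨α * γ', β * γ, γ * γ', mul_ne_zero hγ hγ', hι ?_⟩
    have hab' : ι z = F a + F (b * v) * (F (u ^ 4) * w) := by
      rw [hab, ← mul_assoc, ← map_mul, mul_assoc b, mul_comm v, hv, mul_one]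
    have hα' := congrArg F hα
    have hβ' := congrArg F hβ
    rw [map_mul] at hα' hβ'
    have h1 : ι (z * (f.stalkMap y).hom (γ * γ')) = ι z * (F (σ γ) * F (σ γ')) := by
      rw [map_mul, hιF, map_mul, map_mul]
    have h2 : ι ((f.stalkMap y).hom (α * γ') + (f.stalkMap y).hom (β * γ) * w') =
        F (σ α) * F (σ γ') + F (σ β) * F (σ γ) * (F (u ^ 4) * w) := by
      rw [map_add, map_mul ι, hιF, hιF, hw', map_mul, map_mul, map_mul, map_mul]
    refine h1.trans (Eq.trans ?_ h2.symm)
    rw [hab']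
    change F a * F (σ γ) = F (σ α) at hα'
    change F (b * v) * F (σ γ') = F (σ β) at hβ'
    rw [← hα', ← hβ']
    ring

/-- The local ring of a finite cover is a localization of an integral extension. -/
lemma exists_integral_fraction (ρ : Y ⟶ P) [IsFinite ρ] (y : Y) (z : Y.presheaf.stalk y) :
    ∃ b s : Y.presheaf.stalk y, (ρ.stalkMap y).hom.IsIntegralElem b ∧
      (ρ.stalkMap y).hom.IsIntegralElem s ∧ IsUnit s ∧ z * s = b := by
  obtain ⟨V, hV, hyV, -⟩ := exists_isAffineOpen_mem_and_subset (x := ρ y) (U := ⊤) trivial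
  have hU : IsAffineOpen (ρ ⁻¹ᵁ V) := hV.preimage ρ
  have hint (b : Γ(Y, ρ ⁻¹ᵁ V)) :
      (ρ.stalkMap y).hom.IsIntegralElem (Y.presheaf.germ (ρ ⁻¹ᵁ V) y hyV b) := by
    have h1 : (ρ.app V).hom.IsIntegral := (IsFinite.finite_app ρ V hV).to_isIntegral
    obtain ⟨p, hp, hpb⟩ := h1 b
    refine ⟨p.map (P.presheaf.germ V (ρ y) hyV).hom, hp.map _, ?_⟩
    have h2 : (ρ.stalkMap y).hom.comp (P.presheaf.germ V (ρ y) hyV).hom =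
        (Y.presheaf.germ (ρ ⁻¹ᵁ V) y hyV).hom.comp (ρ.app V).hom :=
      congrArg CommRingCat.Hom.hom (Scheme.Hom.germ_stalkMap ρ V y hyV)
    rw [Polynomial.eval₂_map, h2, ← Polynomial.hom_eval₂, hpb, map_zero]
  let := (Y.presheaf.germ (ρ ⁻¹ᵁ V) y hyV).hom.toAlgebra
  have hloc := hU.isLocalization_stalk ⟨y, hyV⟩
  obtain ⟨⟨b, s⟩, hbs⟩ := IsLocalization.surj
    (hU.primeIdealOf ⟨y, hyV⟩).asIdeal.primeCompl (S := Y.presheaf.stalk y) z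
  exact ⟨_, _, hint b, hint s, IsLocalization.map_units _ s, hbs⟩

end DoubleCover

/-! ### The function field of a fixed curve -/

section Tower
open Module IntermediateField
set_option linter.overlappingInstances false

lemma stalkMap_comp_hom_apply {X Y Z : Scheme.{0}} (f : X ⟶ Y) (g : Y ⟶ Z) (x : X)
    (z : Z.presheaf.stalk (g (f x))) :
    ((f ≫ g).stalkMap x).hom z = (f.stalkMap x).hom ((g.stalkMap (f x)).hom z) :=
  congrArg (fun φ ↦ φ.hom z) (Scheme.Hom.stalkMap_comp f g x)

lemma stalkMap_comp₃_hom_apply {W X Y Z : Scheme.{0}} (f : W ⟶ X) (g : X ⟶ Y) (h : Y ⟶ Z) (x : W)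
    (z : Z.presheaf.stalk (h (g (f x)))) :
    ((f ≫ g ≫ h).stalkMap x).hom z =
      (f.stalkMap x).hom ((g.stalkMap (f x)).hom ((h.stalkMap (g (f x))).hom z)) :=
  (stalkMap_comp_hom_apply f (g ≫ h) x z).trans
    (congrArg (f.stalkMap x).hom (stalkMap_comp_hom_apply g h (f x) z))

lemma stalkMap_comp₄_hom_apply {V W X Y Z : Scheme.{0}} (e : V ⟶ W) (f : W ⟶ X) (g : X ⟶ Y)
    (h : Y ⟶ Z) (x : V) (z : Z.presheaf.stalk (h (g (f (e x))))) :
    ((e ≫ f ≫ g ≫ h).stalkMap x).hom z = (e.stalkMap x).hom ((f.stalkMap (e x)).hom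
      ((g.stalkMap (f (e x))).hom ((h.stalkMap (g (f (e x)))).hom z))) :=
  (stalkMap_comp_hom_apply e (f ≫ g ≫ h) x z).trans
    (congrArg (e.stalkMap x).hom (stalkMap_comp₃_hom_apply f g h (e x) z))

lemma stalkMap_comp₅_hom_apply {U V W X Y Z : Scheme.{0}} (d : U ⟶ V) (e : V ⟶ W) (f : W ⟶ X)
    (g : X ⟶ Y) (h : Y ⟶ Z) (x : U) (z : Z.presheaf.stalk (h (g (f (e (d x)))))) :
    ((d ≫ e ≫ f ≫ g ≫ h).stalkMap x).hom z = (d.stalkMap x).hom ((e.stalkMap (d x)).hom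
      ((f.stalkMap (e (d x))).hom ((g.stalkMap (f (e (d x)))).hom
        ((h.stalkMap (g (f (e (d x))))).hom z)))) :=
  (stalkMap_comp_hom_apply d (e ≫ f ≫ g ≫ h) x z).trans
    (congrArg (d.stalkMap x).hom (stalkMap_comp₄_hom_apply e f g h (d x) z))

/-- The local rings of a scheme over `ℂ` are algebras over the constants. -/
abbrev stalkAlgebra {X : Scheme.{0}} (s : X ⟶ SpecC) (x : X) : Algebra ℂ (X.presheaf.stalk x) :=
  (stalkConstants s x).toAlgebra

/-- The map of local rings, as a homomorphism of algebras over the constants. -/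
def stalkAlgHom {X Y : Scheme.{0}} (f : X ⟶ Y) (s : Y ⟶ SpecC) (x : X) :
    letI := stalkAlgebra s (f x)
    letI := stalkAlgebra (f ≫ s) x
    Y.presheaf.stalk (f x) →ₐ[ℂ] X.presheaf.stalk x :=
  letI := stalkAlgebra s (f x)
  letI := stalkAlgebra (f ≫ s) x
  { (f.stalkMap x).hom with
    commutes' := fun c ↦ (congrArg (fun φ ↦ φ c) (stalkConstants_comp f s x)).symm }

variable {S : Arrangement} (D : Resolution S)

lemma Resolution.noetherianSpace : NoetherianSpace D.P₁ := by
  have := D.variety_P₁.locallyOfFinitePresentation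
  have := D.variety_P₁.quasiCompact
  have h1 : IsLocallyNoetherian D.P₁ :=
    LocallyOfFiniteType.isLocallyNoetherian (D.π₁ ≫ P3.toSpecC)
  have h2 : CompactSpace D.P₁ := QuasiCompact.compactSpace_of_compactSpace (D.π₁ ≫ P3.toSpecC)
  have : IsNoetherian D.P₁ := {}
  infer_instance

/-- The function field of a curve in the fixed locus is generated by one element: the local rings at
the images of its generic point form a `LocalTower` with this residue field. -/
lemma Resolution.exists_generator (A : GL (Fin 4) ℂ) (hA : ∃ c : ℂ, A.val * A.val = c • 1)
    (hsym : ∀ μ : ℂ, μ ≠ 0 → A.val * A.val = (μ ^ 2) • 1 →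
      IsSymmetric S.form (formAction A.val μ))
    (φ : D.X ⟶ D.X) (hφ : φ ≫ D.toP3 = D.toP3 ≫ projMap A)
    (C : Scheme.{0}) [IsIntegral C] (i : C ⟶ D.X) [IsClosedImmersion i] (hi : i ≫ φ = i) :
    letI := (constants (i ≫ D.toP3 ≫ P3.toSpecC)).toAlgebra
    ∃ τ : C.functionField, ∀ z, z ∈ ℂ⟮τ⟯ := by
  have := D.variety_P₁.isIntegral
  have := D.variety_P₂.isIntegral
  have := D.variety_P₃.isIntegral
  have := D.variety_Y.isIntegral
  have := D.variety_X.isIntegral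
  have := D.variety_Y.locallyOfFinitePresentation
  have hN := D.noetherianSpace
  have hD := D.cover
  have := hD.isFinite
  have := hD.isDominant
  let s₀ := P3.toSpecC
  let s₁ := D.π₁ ≫ s₀
  let s₂ := D.π₂ ≫ s₁
  let s₃ := D.π₃ ≫ s₂
  let sY := D.ρ ≫ s₃
  let sX := D.σ ≫ sY
  have hs : i ≫ D.toP3 ≫ P3.toSpecC = i ≫ sX := by
    simp only [Resolution.toP3, sX, sY, s₃, s₂, s₁, s₀, Category.assoc]
  rw [hs]
  let η := genericPoint C
  let x := i η
  let y := D.σ x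
  let p₃ := D.ρ y
  let p₂ := D.π₃ p₃
  let p₁ := D.π₂ p₂
  let p₀ := D.π₁ p₁
  obtain ⟨μ, hμ, hAμ, h, hBh, hh⟩ := exists_formAction A hA p₀
  have hf := hsym μ hμ hAμ
  have hx : φ x = x := congrArg (fun g : C ⟶ D.X ↦ g η) hi
  let := stalkAlgebra s₀ p₀
  let := stalkAlgebra s₁ p₁
  let := stalkAlgebra s₂ p₂
  let := stalkAlgebra s₃ p₃
  let := stalkAlgebra sY y
  let := stalkAlgebra sX x
  let : Algebra ℂ C.functionField := (constants (i ≫ sX)).toAlgebra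
  have hg₁ := IsBlowup.map_genericPoint D.blowup₁
  have hg₂ := IsBlowup.map_genericPoint D.blowup₂
  have hg₃ := IsBlowup.map_genericPoint D.blowup₃
  have hgX := IsBlowup.map_genericPoint D.blowup₄
  have hgY : D.ρ (genericPoint D.Y) = genericPoint D.P₃ :=
    IsBlowup.eq_genericPoint D.blowup₃ (IsBlowup.eq_genericPoint D.blowup₂
      (IsBlowup.eq_genericPoint D.blowup₁
        (map_genericPoint_of_isDominant (D.ρ ≫ D.π₃ ≫ D.π₂ ≫ D.π₁))))
  have : IsIntegrallyClosed (D.Y.presheaf.stalk y) := hD.isIntegrallyClosed y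
  obtain ⟨w, hw, hfrac⟩ := hD.exists_sqrt y hh
  let φ₁ := stalkAlgHom D.π₁ s₀ p₁
  let φ₂ := stalkAlgHom D.π₂ s₁ p₂
  let φ₃ := stalkAlgHom D.π₃ s₂ p₃
  let φ₄ := stalkAlgHom D.ρ s₃ y
  let φ₅ := stalkAlgHom D.σ sY x
  let θ : D.X.presheaf.stalk x →ₐ[ℂ] C.functionField := stalkAlgHom i sX η
  let Λ := formFun p₀ h hh
  have hcomp (z : P3.presheaf.stalk p₀) :
      ((D.ρ ≫ D.π₃ ≫ D.π₂ ≫ D.π₁).stalkMap y).hom z = φ₄ (φ₃ (φ₂ (φ₁ z))) :=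
    stalkMap_comp₄_hom_apply D.ρ D.π₃ D.π₂ D.π₁ y z
  have hcompX (z : P3.presheaf.stalk p₀) :
      ((D.σ ≫ D.ρ ≫ D.π₃ ≫ D.π₂ ≫ D.π₁).stalkMap x).hom z = φ₅ (φ₄ (φ₃ (φ₂ (φ₁ z)))) :=
    stalkMap_comp₅_hom_apply D.σ D.ρ D.π₃ D.π₂ D.π₁ x z
  have hφ' : φ ≫ D.σ ≫ D.ρ ≫ D.π₃ ≫ D.π₂ ≫ D.π₁ =
    (D.σ ≫ D.ρ ≫ D.π₃ ≫ D.π₂ ≫ D.π₁) ≫ projMap A := hφ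
  let T : LocalTower S.form (formAction A.val μ) (P3.presheaf.stalk p₀) (D.P₁.presheaf.stalk p₁)
      (D.P₂.presheaf.stalk p₂) (D.P₃.presheaf.stalk p₃) (D.Y.presheaf.stalk y)
      (D.X.presheaf.stalk x) C.functionField :=
    { Λ := Λ
      h := h
      Λ_h := formFun_self p₀ h hh
      isCoord := isCoord_formFun p₀ h hh
      φ₁ := φ₁
      φ₂ := φ₂
      φ₃ := φ₃
      φ₄ := φ₄
      φ₅ := φ₅
      θ := θ
      local₁ := inferInstanceAs (IsLocalHom (D.π₁.stalkMap p₁).hom)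
      local₂ := inferInstanceAs (IsLocalHom (D.π₂.stalkMap p₂).hom)
      local₃ := inferInstanceAs (IsLocalHom (D.π₃.stalkMap p₃).hom)
      local₄ := inferInstanceAs (IsLocalHom (D.ρ.stalkMap y).hom)
      local₅ := inferInstanceAs (IsLocalHom (D.σ.stalkMap x).hom)
      inj₁ := stalkMap_injective_of_genericPoint D.π₁ hg₁ p₁
      inj₂ := stalkMap_injective_of_genericPoint D.π₂ hg₂ p₂
      inj₃ := stalkMap_injective_of_genericPoint D.π₃ hg₃ p₃
      inj₄ := stalkMap_injective_of_genericPoint D.ρ hgY y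
      inj₅ := stalkMap_injective_of_genericPoint D.σ hgX x
      surj := Scheme.Hom.stalkMap_surjective i η
      I₁ := stalkIdeal (Scheme.IdealSheafData.vanishingIdeal S.fivefoldLocus) p₀
      I₂ := stalkIdeal (Scheme.IdealSheafData.vanishingIdeal
        (strictTransform D.π₁ S.fivefoldLocus S.tripleLocus)) p₁
      I₃ := stalkIdeal (Scheme.IdealSheafData.vanishingIdeal
        (S.fourfoldLocus.preimage (D.π₂ ≫ D.π₁).continuous)) p₂
      J := stalkIdeal (Scheme.IdealSheafData.vanishingIdeal (singularLocus sY)) y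
      radical₁ := stalkIdeal_vanishingIdeal_isRadical _ _
      radical₂ := stalkIdeal_vanishingIdeal_isRadical _ _
      radical₃ := stalkIdeal_vanishingIdeal_isRadical _ _
      radical₄ := stalkIdeal_vanishingIdeal_isRadical _ _
      le₁ := fun 𝔭 h𝔭 ↦ (stalkIdeal_vanishingIdeal_le_iff _ p₀ ⟨𝔭, h𝔭⟩).trans
        (fromSpecStalk_mem_fivefoldLocus p₀ h hh hf ⟨𝔭, h𝔭⟩)
      le₂ := fun 𝔭 h𝔭 ↦ by
        refine (stalkIdeal_vanishingIdeal_le_iff _ p₁ ⟨𝔭, h𝔭⟩).trans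
          ((fromSpecStalk_mem_strictTransform D.π₁ _ _ p₁ ⟨𝔭, h𝔭⟩).trans ?_)
        have key (𝔮 : PrimeSpectrum (D.P₁.presheaf.stalk p₁)) :
            (D.π₁ (D.P₁.fromSpecStalk p₁ 𝔮) ∈ S.tripleLocus ∧
              D.π₁ (D.P₁.fromSpecStalk p₁ 𝔮) ∉ S.fivefoldLocus) ↔
            (¬ stalkIdeal (Scheme.IdealSheafData.vanishingIdeal S.fivefoldLocus) p₀ ≤
              𝔮.asIdeal.comap φ₁.toRingHom ∧ ∃ N : Submodule ℂ (Fin 4 → ℂ), finrank ℂ N = 2 ∧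
              formMult S.form N = 3 ∧ ∀ a ∈ N, φ₁ (Λ a) ∈ 𝔮.asIdeal) := by
          rw [map_fromSpecStalk, and_comm]
          exact and_congr (not_congr (stalkIdeal_vanishingIdeal_le_iff _ p₀ _).symm)
            (fromSpecStalk_mem_tripleLocus p₀ h hh hf _)
        exact ⟨fun ⟨𝔮, h1, h2⟩ ↦ ⟨𝔮.asIdeal, h1, 𝔮.2, (key 𝔮).mp h2⟩,
          fun ⟨𝔮, h1, h𝔮, h2⟩ ↦ ⟨⟨𝔮, h𝔮⟩, h1, (key ⟨𝔮, h𝔮⟩).mpr h2⟩⟩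
      le₃ := fun 𝔭 h𝔭 ↦ by
        refine (stalkIdeal_vanishingIdeal_le_iff _ p₂ ⟨𝔭, h𝔭⟩).trans ?_
        change D.π₁ (D.π₂ (D.P₂.fromSpecStalk p₂ ⟨𝔭, h𝔭⟩)) ∈ S.fourfoldLocus ↔ _
        rw [map_fromSpecStalk, map_fromSpecStalk]
        exact fromSpecStalk_mem_fourfoldLocus p₀ h hh hf _
      le₄ := fun 𝔭 h𝔭 ↦ (stalkIdeal_vanishingIdeal_le_iff _ y ⟨𝔭, h𝔭⟩).trans
        (fromSpecStalk_mem_singularLocus sY y 𝔭 h𝔭)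
      blowup₁ := IsBlowup.isLocalBlowup D.blowup₁ p₁
      blowup₂ := IsBlowup.isLocalBlowup D.blowup₂ p₂
      blowup₃ := IsBlowup.isLocalBlowup D.blowup₃ p₃
      blowup₄ := IsBlowup.isLocalBlowup D.blowup₄ x
      Φ := fixedStalkMap φ hx
      Φ_Λ := fun a ↦ by
        rw [← hcompX, ← hcompX]
        exact fixedStalkMap_formFun (D.σ ≫ D.ρ ≫ D.π₃ ≫ D.π₂ ≫ D.π₁) φ A hφ' hx hμ hBh hh a
      θ_Φ := stalkMap_fixedStalkMap φ i hi η hx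
      w := w
      w_sq := hw.trans (hcomp _)
      frac := fun z ↦ by
        obtain ⟨α, β, γ, hγ, hz⟩ := hfrac z
        exact ⟨α, β, γ, hγ, (congrArg (z * ·) (hcomp γ).symm).trans
          (hz.trans (congrArg₂ (fun a b ↦ a + b * w) (hcomp α) (hcomp β)))⟩
      int := exists_integral_fraction D.ρ y }
  exact T.exists_generator hf

end Tower

end DoubleOctic

end

theorem proposition1 (S : Arrangement) (D : Resolution S)
    (A : GL (Fin 4) ℂ) (hA : IsOrderTwo A)
    -- `φ = projMap A` maps the arrangement to itself
    (hS : ∀ i, ∃ j, (plane (S.form i)).map (Matrix.toLin' A.val) = plane (S.form j))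
    -- no double or triple line is fixed pointwise
    (h₁ : ∀ l : Submodule ℂ (Fin 4 → ℂ), S.IsDoubleLine l ∨ S.IsTripleLine l →
      ¬ IsFixedPointwise A l)
    (h₂ : ∀ p : Submodule ℂ (Fin 4 → ℂ), S.IsFourfoldPoint p →
      ¬ ∀ i, p ≤ plane (S.form i) →
        (plane (S.form i)).map (Matrix.toLin' A.val) = plane (S.form i))
    (h₃ : ∀ l : Submodule ℂ (Fin 4 → ℂ), Module.finrank ℂ l = 2 → IsFixedPointwise A l →
      (∀ i, ¬ l ≤ plane (S.form i)) →
      {p : Submodule ℂ (Fin 4 → ℂ) | Module.finrank ℂ p = 1 ∧ p ≤ l ∧ Odd (S.mult p)}.encard ≤ 2)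
    -- `φ'` is an involution of `X` induced by `φ`
    (φ' : D.X ⟶ D.X) (hφ : φ' ≫ D.toP3 = D.toP3 ≫ projMap A) (hφ' : φ' ≫ φ' = 𝟙 D.X)
    -- `C` is a curve in `X` on which `φ'` is the identity
    (C : Scheme.{0}) [IsIntegral C] (i : C ⟶ D.X) [IsClosedImmersion i]
    (hC : dimension (i ≫ D.toP3 ≫ P3.toSpecC) = 1) (hi : i ≫ φ' = i) :
    ¬ 0 < geometricGenus (i ≫ D.toP3 ≫ P3.toSpecC) := by
  have hgen := D.exists_generator A hA.1 (fun μ hμ hAμ ↦ S.isSymmetric hμ hAμ hS h₁ h₃)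
    φ' hφ C i hi
  let := (constants (i ≫ D.toP3 ≫ P3.toSpecC)).toAlgebra
  have h : geometricGenus (i ≫ D.toP3 ≫ P3.toSpecC) =
      Module.rank ℂ (regularDifferentials ℂ C.functionField) := rfl
  rw [h, regularDifferentials_eq_bot hgen, rank_bot]
  exact lt_irrefl 0
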